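/- **Theorem (Punctured Hybrid Speedup).** Logarithms are binary, $\mathrm H(x)=-x\log x-(1-x)\log(1-x)$ with $\mathrm H(0)=\mathrm H(1)=0$, and $0\cdot\mathrm H(0/0):=0$. Let $\tau,R,\rho,\delta$ be real constants with $0<R$, $0<\tau<1-R$ and $0\le\delta\le 1$, and put $\beta=(1-\delta)(1-R)$, $\sigma=(1-\beta)\,\mathrm H\!\big(\tfrac{\tau-\rho}{1-\beta}\big)-(1-\beta-R)$ and, for $c\in\{\tfrac12,1\}$, $$t_c(\delta)=\frac{\mathrm H(\tau)-\beta\,\mathrm H\!\big(\frac{\rho}{\beta}\big)-\frac{1-\beta}{2}\,\mathrm H\!\big(\frac{\tau-\rho}{1-\beta}\big)-\frac{1-\beta-R}{2}\,\mathrm H\!\big(\frac{\tau-\rho}{1-\beta-R}\big)+c\max(0,\sigma)}{\mathrm H(\tau)-(1-R)\,\mathrm H\!\big(\frac{\tau}{1-R}\big)} .$$ *The algorithm.* An instance of the syndrome decoding problem $\mathrm{SD}(n,k,\omega)$ is $(H,s)$ with $H\in\mathbb F_2^{(n-k)\times n}$ of full rank and $s\in\mathbb F_2^{n-k}$; a solution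 is $e\in\mathbb F_2^n$ of Hamming weight $\omega$ with $He=s$. Punctured-Hybrid, with $b$ omitted equations and weight parameter $p$, puts $a=n-k-b$ and $S=\binom{n-b}{\omega-p}2^{-a}$ and repeats the following round until it finds a solution. It draws a uniformly random column permutation $P$ and transforms $HP$ (together with $s$) to $\begin{pmatrix}I_a&0&H_1\\0&I_b&H_2\end{pmatrix}$ with syndrome $(s_1,s_2)$ by Gaussian elimination (if this is impossible, the round ends). Then, at most $n\lceil S\rceil$ times, it runs a quantum decoder on $((I_a\mid H_1),s_1,\omega-p)$; if this returns $(x,y)\in\mathbb F_2^a\times\mathbb F_2^k$ and $z=H_2y+s_2$ has weight $p$, then $P(x,z,y)$ is the result of the round. The quantum decoder is an explicit circuit: it stores $H_1$ in its register, prepares the uniform superposition of all $a$-subsets $I$ of the $a+k$ columns, performs $j$ iterations of amplitude amplification towards those $I$ whose columns are linearly independent and whose linear system has a solution of weight $\omega-p$, and measures; $(x,y)$ is then computed classically from $I$. Here $j$ is uniform in $\{0,\dots,\lceil\pi/(4g)\rceil\}$ with $g^2=\max(1,S)\binom{a}{\omega-p}/\binom{n-b}{\omega-p}$. Time counts elementary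 quantum gates (at most two controls), initialised and measured qubits, classical bit operations and random bits. *Claim.* There are $C\in\mathbb R$ and $d\in\mathbb N$, depending only on $\tau,R,\rho,\delta$, such that the following holds for all integers $n\ge1$ and $k,\omega,p,b\ge0$ with $|k-Rn|\le1$, $|\omega-\tau n|\le1$, $|p-\rho n|\le1$ (for instance $k=Rn$, $\omega=\tau n$, $p=\rho n$), $b=\lceil(1-\delta)(n-k)\rceil$, $k+b\le n$, $p\le\min(\omega,b)$ and $\omega-p\le n-k-b$. Let $T_{\mathrm C}=\binom n\omega/\binom{n-k}\omega$ be the classical running time up to polynomial factors. 1. The number of qubits for the matrix representation differs from $\delta(1-R)Rn^2$ by at most $Cn$, and it is at most $\delta(1-R)Rn^2$ if $k=Rn$. All other qubits, including work qubits, are at most $Cn$ in number. 2. For every $e\in\mathbb F_2^n$ of weight $\omega$ and all but a fraction of at most $C/n$ of the full-rank matrices $H\in\mathbb F_2^{(n-k)\times n}$, Punctured-Hybrid on the instance $(H,He)$ terminates with probability one and returns a solution, and its expected running time (over its own randomness) is at most $C\,n^{d}\,T_{\mathrm C}^{\,t_1(\delta)}$, and even at most $C\,n^{d}\,T_{\mathrm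 C}^{\,t_{1/2}(\delta)}$. -/

import Mathlib

open scoped ENNReal

noncomputable section

namespace PuncturedISD

/-! ### Quantum circuits

A register is a finite type `W` of wires. A gate is a one-qubit operation on a target wire, applied
when all control wires carry the prescribed bits. -/

/-- One-qubit operations: NOT, sign flip, and rotation by a real angle. -/
inductive QOp where
  | X : QOp
  | Z : QOp
  | Ry : ℝ → QOp

/-- The `2 × 2` matrix of a one-qubit operation. -/
def QOp.mat : QOp → Bool → Bool → ℂ
  | .X, x, y => if x = y then 0 else 1
  | .Z, x, y => if x = y then (if x then -1 else 1) else 0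
  | .Ry θ, false, false => (Real.cos θ : ℂ)
  | .Ry θ, false, true => (-Real.sin θ : ℝ)
  | .Ry θ, true, false => (Real.sin θ : ℂ)
  | .Ry θ, true, true => (Real.cos θ : ℂ)

/-- The inverse operation. -/
def QOp.inv : QOp → QOp
  | .X => .X
  | .Z => .Z
  | .Ry θ => .Ry (-θ)

/-- A multi-controlled gate. -/
structure Gate (W : Type) where
  op : QOp
  target : W
  ctrl : List (W × Bool)

/-- A circuit, executed from the head of the list on. -/
abbrev Circuit (W : Type) := List (Gate W)

/-- The condition under which the gate acts on the basis state `x` (the target is never a control). -/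
def Gate.Fires {W : Type} (g : Gate W) (x : W → Bool) : Prop :=
  ∀ c ∈ g.ctrl, c.1 ≠ g.target → x c.1 = c.2

instance {W : Type} [DecidableEq W] (g : Gate W) (x : W → Bool) : Decidable (g.Fires x) :=
  inferInstanceAs (Decidable (∀ c ∈ g.ctrl, c.1 ≠ g.target → x c.1 = c.2))

/-- The linear action of a gate on amplitude vectors. -/
def Gate.apply {W : Type} [DecidableEq W] (g : Gate W) (ψ : (W → Bool) → ℂ) : (W → Bool) → ℂ := fun x =>
  if g.Fires x then
    g.op.mat (x g.target) false * ψ (Function.update x g.target false) +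
      g.op.mat (x g.target) true * ψ (Function.update x g.target true)
  else ψ x

theorem QOp.mat_unitary (o : QOp) (u v : ℂ) :
    ‖o.mat false false * u + o.mat false true * v‖ ^ 2 +
      ‖o.mat true false * u + o.mat true true * v‖ ^ 2 = ‖u‖ ^ 2 + ‖v‖ ^ 2 := by
  cases o with
  | X => simp [QOp.mat]; ring
  | Z => simp [QOp.mat]
  | Ry θ =>
    simp only [QOp.mat, ← Complex.normSq_eq_norm_sq, Complex.normSq_apply, Complex.add_re,
      Complex.add_im, Complex.mul_re, Complex.mul_im, Complex.ofReal_re, Complex.ofReal_im]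
    have h := Real.sin_sq_add_cos_sq θ
    linear_combination (u.re ^ 2 + u.im ^ 2 + v.re ^ 2 + v.im ^ 2) * h

theorem Gate.apply_norm {W : Type} [Fintype W] [DecidableEq W] (g : Gate W)
    (ψ : (W → Bool) → ℂ) : ∑ x, ‖g.apply ψ x‖ ^ 2 = ∑ x, ‖ψ x‖ ^ 2 := by
  let f : (W → Bool) → (W → Bool) := fun x => Function.update x g.target (!x g.target)
  have hf : Function.Involutive f := by
    intro x
    simp [f]
  have hsum : ∀ F : (W → Bool) → ℝ, ∑ x, F (f x) = ∑ x, F x := fun F =>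
    Equiv.sum_comp hf.toPerm F
  have hfire : ∀ x, g.Fires (f x) ↔ g.Fires x := by
    intro x
    simp only [Gate.Fires]
    refine forall₂_congr fun c _ => forall_congr' fun hc => ?_
    simp [f, Function.update_of_ne hc]
  have key : ∀ x, ‖g.apply ψ x‖ ^ 2 + ‖g.apply ψ (f x)‖ ^ 2 = ‖ψ x‖ ^ 2 + ‖ψ (f x)‖ ^ 2 := by
    intro x
    by_cases hx : g.Fires x
    · have hx' := (hfire x).2 hx
      simp only [Gate.apply, hx, hx', if_true]
      have hself : Function.update x g.target (x g.target) = x := Function.update_eq_self _ _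
      have h := QOp.mat_unitary g.op
      cases hb : x g.target
      · rw [hb] at hself
        simp only [f, hb, Bool.not_false, Function.update_self, Function.update_idem, hself]
        convert h _ _
      · rw [hb] at hself
        simp only [f, hb, Bool.not_true, Function.update_self, Function.update_idem, hself]
        rw [add_comm, h, add_comm]
    · have hx' : ¬ g.Fires (f x) := fun h => hx ((hfire x).1 h)
      simp only [Gate.apply, hx, hx', if_false]
  have h2 : ∑ x, (‖g.apply ψ x‖ ^ 2 + ‖g.apply ψ (f x)‖ ^ 2) =
      ∑ x, (‖ψ x‖ ^ 2 + ‖ψ (f x)‖ ^ 2) := Finset.sum_congr rfl fun x _ => key x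
  rw [Finset.sum_add_distrib, Finset.sum_add_distrib, hsum (fun x => ‖g.apply ψ x‖ ^ 2),
    hsum (fun x => ‖ψ x‖ ^ 2)] at h2
  linarith

/-- Unit vectors of the state space of the register `W`. -/
def QState (W : Type) [Fintype W] [DecidableEq W] : Type :=
  {ψ : (W → Bool) → ℂ // ∑ x, ‖ψ x‖ ^ 2 = 1}

/-- The computational basis state `|x⟩`. -/
def QState.basis {W : Type} [Fintype W] [DecidableEq W] (x : W → Bool) : QState W :=
  ⟨fun y => if y = x then 1 else 0, by
    rw [Finset.sum_eq_single x] <;> simp +contextual⟩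

/-- The state after running a circuit. -/
def QState.run {W : Type} [Fintype W] [DecidableEq W] (C : Circuit W) (ψ : QState W) : QState W :=
  C.foldl (fun φ g => ⟨g.apply φ.1, (g.apply_norm φ.1).trans φ.2⟩) ψ

/-- Measurement of the whole register in the computational basis (Born rule). -/
def QState.measure {W : Type} [Fintype W] [DecidableEq W] (ψ : QState W) : PMF (W → Bool) :=
  PMF.ofFintype (fun x => ENNReal.ofReal (‖ψ.1 x‖ ^ 2)) (by
    rw [← ENNReal.ofReal_sum_of_nonneg (fun _ _ => by positivity), ψ.2, ENNReal.ofReal_one])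

/-- The inverse circuit. -/
def Circuit.inverse {W : Type} (C : Circuit W) : Circuit W :=
  C.reverse.map fun g => { g with op := g.op.inv }

/-- Number of elementary gates (at most two controls each) of a circuit that is executed
sequentially: a gate with `c` controls is compiled by collecting the controls one after the other in
work qubits with Toffoli gates, and undoing this afterwards. -/
def Circuit.time {W : Type} (C : Circuit W) : ℕ :=
  (C.map fun g => 2 * g.ctrl.length + 1).sum

/-- Number of qubits of a circuit: its wires, and one reusable work qubit for each control of the
gate with most controls. -/
def Circuit.qubits {W : Type} [Fintype W] (C : Circuit W) : ℕ :=
  Fintype.card W + (C.map fun g => g.ctrl.length).foldr max 0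

/-- Multi-controlled NOT. -/
def mcx {W : Type} (ctrl : List (W × Bool)) (t : W) : Gate W := ⟨.X, t, ctrl⟩

/-- Controlled swap of two wires. -/
def cswap {W : Type} (ctrl : List (W × Bool)) (u v : W) : Circuit W :=
  [mcx ((u, true) :: ctrl) v, mcx ((v, true) :: ctrl) u, mcx ((u, true) :: ctrl) v]

/-- Controlled rotation of the wires `f 0, …, f i`: the content of `f i` moves to `f 0`, and the
content of `f j` moves to `f (j + 1)` for `j < i`. -/
def crotate {W : Type} (ctrl : List (W × Bool)) {m : ℕ} (f : Fin m → W) (i : Fin m) : Circuit W :=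
  ((List.finRange m).filter fun j => j < i).flatMap fun j => cswap ctrl (f j) (f i)

/-! ### The information set decoding circuit

The circuit decodes an instance with parity-check matrix `(I_a ∣ H₁)`, where `H₁` is `a × k`. The
identity part is not stored. -/

/-- The wires. -/
inductive Wire (a k : ℕ) : Type where
  /-- the selected subset of the `a + k` columns -/
  | sub : Fin a ⊕ Fin k → Wire a k
  /-- one-hot counter of the columns selected so far -/
  | cnt : Fin (a + 1) → Wire a k
  /-- the matrix `H₁` -/
  | mat : Fin a → Fin k → Wire a k
  /-- the syndrome -/
  | syn : Fin a → Wire a k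
  /-- unary encoding of the number of selected columns of `H₁` -/
  | act : Fin k → Wire a k
  /-- elimination steps without a pivot -/
  | sing : Fin k → Wire a k
  /-- one-hot counter of the weight of the solution -/
  | wgt : Fin (a + 1) → Wire a k
  deriving DecidableEq, Fintype

/-- The wires that represent the matrix. -/
def Wire.IsMatrix {a k : ℕ} : Wire a k → Prop
  | .mat _ _ => True
  | _ => False

/-- Number of qubits for the matrix representation. -/
def matrixQubits (a k : ℕ) : ℕ := Nat.card {v : Wire a k // v.IsMatrix}

/-- All columns in their order. -/
def columns (a k : ℕ) : List (Fin a ⊕ Fin k) :=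
  (List.finRange a).map Sum.inl ++ (List.finRange k).map Sum.inr

/-- Creation of the uniform superposition over all `a`-element subsets of the columns. The column
number `t` is selected with probability `(a - u) / (a + k - t)` if `u` columns have already been
selected. -/
def prepare (a k : ℕ) : Circuit (Wire a k) :=
  [mcx [] (Wire.cnt 0)] ++
  (columns a k).zipIdx.flatMap fun ct =>
    ((List.finRange (a + 1)).map fun u : Fin (a + 1) =>
      (⟨.Ry (Real.arcsin (Real.sqrt (((a : ℝ) - (u : ℕ)) / ((a : ℝ) + k - ct.2)))), .sub ct.1,
        [(.cnt u, true)]⟩ : Gate (Wire a k))) ++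
    crotate [(Wire.sub ct.1, true)] Wire.cnt (Fin.last a)

/-- Move the selected columns of `H₁` to the front, and count them in unary. -/
def moveColumns (a k : ℕ) : Circuit (Wire a k) :=
  ((List.finRange k).map fun j => mcx [(Wire.sub (.inr j), true)] (Wire.act j)) ++
  (List.finRange k).flatMap fun j =>
    ((List.finRange a).flatMap fun i => crotate [(Wire.sub (.inr j), true)] (Wire.mat i) j) ++
    crotate [(Wire.sub (.inr j), true)] Wire.act j

/-- Move the rows whose column of the identity part is not selected to the front. -/
def moveRows (a k : ℕ) : Circuit (Wire a k) :=
  (List.finRange a).flatMap fun i =>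
    ((List.finRange k).flatMap fun j =>
      crotate [(Wire.sub (.inl i), false)] (fun l => Wire.mat l j) i) ++
    crotate [(Wire.sub (.inl i), false)] Wire.syn i

/-- Controlled addition of row `l` to row `i`, on the columns after `j` and on the syndrome. -/
def addRow {a k : ℕ} (ctrl : List (Wire a k × Bool)) (j : Fin k) (l i : Fin a) :
    Circuit (Wire a k) :=
  (((List.finRange k).filter fun c => j < c).map fun c =>
    mcx ((Wire.mat l c, true) :: ctrl) (Wire.mat i c)) ++
  [mcx ((Wire.syn l, true) :: ctrl) (Wire.syn i)]

/-- Controls for: row `l` is the first row from row `i` on with a one in column `j`, and it is one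
of the rows that may be used as pivot. -/
def pivotCtrl {a k : ℕ} (j : Fin k) (i l : Fin a) (hl : (l : ℕ) < k) : List (Wire a k × Bool) :=
  [(Wire.act ⟨l, hl⟩, true), (Wire.mat l j, true)] ++
  (((List.finRange a).filter fun r => i ≤ r ∧ r < l).map fun r => (Wire.mat r j, false))

/-- One step of the Gaussian elimination: pivot search for the `j`-th column, whose pivot row is the
row with the same number, and elimination in all other rows. Column `j` itself stays unchanged,
since it controls the operations. -/
def eliminateColumn (a k : ℕ) (j : Fin k) : Circuit (Wire a k) :=
  if hj : (j : ℕ) < a then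
    let i : Fin a := ⟨j, hj⟩
    (((List.finRange a).filter fun l => i ≤ l).flatMap fun l : Fin a =>
      if hl : (l : ℕ) < k then
        [mcx (pivotCtrl j i l hl) (Wire.sing j)] ++
          (if l = i then [] else addRow (pivotCtrl j i l hl) j l i)
      else []) ++
    [mcx [(Wire.act j, true)] (Wire.sing j)] ++
    (((List.finRange a).filter fun l => l ≠ i).flatMap fun l =>
      addRow [(Wire.act j, true), (Wire.mat l j, true)] j i l)
  else []

/-- Accumulate the weight of the last column. -/
def accumulate (a k : ℕ) : Circuit (Wire a k) :=
  [mcx [] (Wire.wgt 0)] ++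
  (List.finRange a).flatMap fun i => crotate [(Wire.syn i, true)] Wire.wgt (Fin.last a)

/-- Solve the linear system of the selected columns and compute the weight of its solution. -/
def solveCircuit (a k : ℕ) : Circuit (Wire a k) :=
  moveColumns a k ++ moveRows a k ++ (List.finRange k).flatMap (eliminateColumn a k) ++
    accumulate a k

/-- The oracle: flip the sign of all subsets for which the linear system is invertible and its
solution has weight `w` (where `w ≤ a`). -/
def oracle (a k w : ℕ) : Circuit (Wire a k) :=
  solveCircuit a k ++
  [⟨.Z, Wire.wgt (Fin.ofNat (a + 1) w), (List.finRange k).map fun j => (Wire.sing j, false)⟩] ++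
  Circuit.inverse (solveCircuit a k)

/-- Flip the sign of the initial state of the registers on which `prepare` acts. -/
def reflectZero (a k : ℕ) : Circuit (Wire a k) :=
  [mcx [] (Wire.cnt 0),
    ⟨.Z, Wire.cnt 0, ((columns a k).map fun c => (Wire.sub c, false)) ++
      ((List.finRange (a + 1)).filter fun u => u ≠ 0).map fun u => (Wire.cnt u, false)⟩,
    mcx [] (Wire.cnt 0)]

/-- Amplitude amplification with `j` iterations (up to the global sign). -/
def searchCircuit (a k w j : ℕ) : Circuit (Wire a k) :=
  prepare a k ++
  (List.replicate j
    (oracle a k w ++ Circuit.inverse (prepare a k) ++ reflectZero a k ++ prepare a k)).flatten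

/-- The initial state of the register, which contains the matrix and the syndrome. -/
def loadInstance {a k : ℕ} (H₁ : Matrix (Fin a) (Fin k) (ZMod 2)) (s : Fin a → ZMod 2) :
    Wire a k → Bool
  | .mat i j => decide (H₁ i j = 1)
  | .syn i => decide (s i = 1)
  | _ => false

/-! ### Randomized computations with a step count -/

/-- Distributions of a result together with the number of steps. -/
def Timed (α : Type) : Type := PMF (α × ℕ)

/-- The steps of consecutive computations are added. -/
instance : Monad Timed where
  pure x := (PMF.pure (x, 0) : PMF _)
  bind T f := (PMF.bind T fun x => PMF.map (fun y => (y.1, x.2 + y.2)) (f x.1) : PMF _)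

/-- Spend `c` steps. -/
def tick (c : ℕ) : Timed Unit := (PMF.pure ((), c) : PMF _)

/-- Draw a uniformly random element, at the price of one step for each random bit. -/
def draw (α : Type) [Fintype α] [Nonempty α] : Timed α :=
  PMF.map (fun x => (x, Nat.log 2 (Fintype.card α) + 1)) (PMF.uniformOfFintype α)

/-- Load a register, run a circuit on it, and measure it. -/
def runQuantum {W : Type} [Fintype W] [DecidableEq W] (x : W → Bool) (C : Circuit W) :
    Timed (W → Bool) :=
  PMF.map (fun y => (y, Circuit.time C + 2 * Fintype.card W))
    (QState.measure (QState.run C (QState.basis x)))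

/-- Repeat a computation until it returns a result, but at most `m` times. -/
def repeatUntil {α : Type} (body : Timed (Option α)) : ℕ → Timed (Option α)
  | 0 => pure none
  | m + 1 => do
    match ← body with
    | some x => pure (some x)
    | none => repeatUntil body m

/-- Expected number of steps. -/
def Timed.expectedTime {α : Type} (T : Timed α) : ℝ≥0∞ :=
  ∑' x : α × ℕ, (show PMF (α × ℕ) from T) x * (x.2 : ℝ≥0∞)

/-- Probability that the result lies in `S`. -/
def Timed.prob {α : Type} (T : Timed α) (S : Set α) : ℝ≥0∞ :=
  (PMF.map Prod.fst (show PMF (α × ℕ) from T)).toOuterMeasure S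

/-- Expected number of steps of the unbounded loop "repeat `body` until it returns a result". -/
def loopExpectedTime {α : Type} (body : Timed (Option α)) : ℝ≥0∞ :=
  ⨆ m, (repeatUntil body m).expectedTime

/-- Probability that this loop terminates with a result in `S`. -/
def loopProb {α : Type} (body : Timed (Option α)) (S : Set α) : ℝ≥0∞ :=
  ⨆ m, (repeatUntil body m).prob (some '' S)

/-! ### The classical co-processor -/

/-- Gauss-Jordan elimination with steps counted in bit operations: row operations turn column
`pc i` into the unit vector of row `i`, for all `i` in the list of the rows still to be treated.
The result is `none` if there is no pivot in some step. -/
def gaussJordan {ι κ : Type} [DecidableEq ι] [Fintype ι] [Fintype κ] (pc : ι → κ) :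
    List ι → Matrix ι κ (ZMod 2) → Timed (Option (Matrix ι κ (ZMod 2)))
  | [], M => pure (some M)
  | i :: rest, M => do
    tick (Fintype.card ι)
    match (i :: rest).find? (fun r => M r (pc i) = 1) with
    | none => pure none
    | some r => do
      let M₁ := M.submatrix (Equiv.swap i r) id
      tick (2 * Fintype.card κ)
      let M₂ : Matrix ι κ (ZMod 2) := Matrix.of fun l c =>
        if l ≠ i ∧ M₁ l (pc i) = 1 then M₁ l c + M₁ i c else M₁ l c
      tick (Fintype.card ι * Fintype.card κ)
      gaussJordan pc rest M₂

/-- The expected number of solutions `S = C(a + k, w) / 2 ^ a` of a reduced instance. -/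
def expectedSolutions (a k w : ℕ) : ℝ := ((a + k).choose w : ℝ) / 2 ^ a

/-- The amplitude of the good subsets in the uniform superposition, for `max(1, S)` solutions. -/
def goodAmplitude (a k w : ℕ) : ℝ :=
  Real.sqrt (max 1 (expectedSolutions a k w) * ((a.choose w : ℝ) / ((a + k).choose w : ℝ)))

/-- The solution of `(I_a ∣ H₁) e = s` that is supported on `a` given columns, if these columns are
linearly independent. -/
def solveOn {a k : ℕ} (H₁ : Matrix (Fin a) (Fin k) (ZMod 2)) (s : Fin a → ZMod 2)
    (I : Fin a ⊕ Fin k → Bool) : Timed (Option (Fin a ⊕ Fin k → ZMod 2)) := do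
  let sel := (columns a k).filter fun c => I c
  tick (a + k)
  if h : sel.length = a then
    let pc : Fin a → Fin a ⊕ Fin k := fun i => sel.get (i.cast h.symm)
    let M : Matrix (Fin a) ((Fin a ⊕ Fin k) ⊕ Unit) (ZMod 2) := Matrix.of fun i =>
      Sum.elim (Sum.elim (fun l => if i = l then 1 else 0) (H₁ i)) (fun _ => s i)
    match ← gaussJordan (fun i => Sum.inl (pc i)) (List.finRange a) M with
    | none => pure none
    | some N => pure (some fun c => ∑ i, if pc i = c then N i (Sum.inr ()) else 0)
  else pure none

/-- The quantum algorithm for the instance `((I_a ∣ H₁), s, w)`: amplitude amplification with a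
random number of iterations of the right order of magnitude (the number of good subsets is not
known), a measurement, and the classical reconstruction of the error from the measured subset. -/
def quantumSolve {a k : ℕ} (H₁ : Matrix (Fin a) (Fin k) (ZMod 2)) (s : Fin a → ZMod 2) (w : ℕ) :
    Timed (Option (Fin a ⊕ Fin k → ZMod 2)) := do
  let j ← draw (Fin (⌈Real.pi / (4 * goodAmplitude a k w)⌉₊ + 1))
  let x ← runQuantum (loadInstance H₁ s) (searchCircuit a k w j)
  match ← solveOn H₁ s (fun c => x (Wire.sub c)) with
  | none => pure none
  | some e => do
    tick (a + k)
    if hammingNorm e = w then pure (some e) else pure none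

/-- The rows, split into the first `n - k - b` and the last `b` rows. -/
def rowBlocks (n k b : ℕ) (h : k + b ≤ n) : Fin (n - k - b) ⊕ Fin b ≃ Fin (n - k) :=
  finSumFinEquiv.trans (finCongr (by omega))

/-- The columns, split into the first `n - k - b`, the next `b` and the last `k` columns. -/
def colBlocks (n k b : ℕ) (h : k + b ≤ n) : (Fin (n - k - b) ⊕ Fin b) ⊕ Fin k ≃ Fin n :=
  ((rowBlocks n k b h).sumCongr (Equiv.refl _)).trans
    (finSumFinEquiv.trans (finCongr (by omega)))

/-- One iteration of the outer loop of Punctured-Hybrid, where `b` parity-check equations are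
omitted. The result is `none` if the iteration finds no solution. -/
def puncturedHybridRound (n k b ω p : ℕ) (h : k + b ≤ n)
    (H : Matrix (Fin (n - k)) (Fin n) (ZMod 2)) (s : Fin (n - k) → ZMod 2) :
    Timed (Option (Fin n → ZMod 2)) := do
  let P ← draw (Equiv.Perm (Fin n))
  tick (n * n)
  let M : Matrix (Fin (n - k - b) ⊕ Fin b) (((Fin (n - k - b) ⊕ Fin b) ⊕ Fin k) ⊕ Unit) (ZMod 2) :=
    Matrix.of fun i => Sum.elim (fun c => H (rowBlocks n k b h i) (P (colBlocks n k b h c)))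
      (fun _ => s (rowBlocks n k b h i))
  match ← gaussJordan (fun i => Sum.inl (Sum.inl i)) (columns (n - k - b) b) M with
  | none => pure none
  | some T => do
    let H₁ : Matrix (Fin (n - k - b)) (Fin k) (ZMod 2) :=
      Matrix.of fun i c => T (.inl i) (.inl (.inr c))
    let H₂ : Matrix (Fin b) (Fin k) (ZMod 2) := Matrix.of fun i c => T (.inr i) (.inl (.inr c))
    let s₁ : Fin (n - k - b) → ZMod 2 := fun i => T (.inl i) (.inr ())
    let s₂ : Fin b → ZMod 2 := fun i => T (.inr i) (.inr ())
    let attempt : Timed (Option (Fin n → ZMod 2)) := do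
      match ← quantumSolve H₁ s₁ (ω - p) with
      | none => pure none
      | some e₁ => do
        let e₂ : Fin b → ZMod 2 := H₂.mulVec (fun c => e₁ (.inr c)) + s₂
        tick (2 * n * n)
        if hammingNorm e₂ = p then
          pure (some fun i =>
            Sum.elim (Sum.elim (fun r => e₁ (.inl r)) e₂) (fun c => e₁ (.inr c))
              ((colBlocks n k b h).symm (P.symm i)))
        else pure none
    match ← repeatUntil attempt (n * ⌈expectedSolutions (n - k - b) k (ω - p)⌉₊) with
    | none => pure none
    | some e => do
      tick (2 * n * n)
      if H.mulVec e = s ∧ hammingNorm e = ω then pure (some e) else pure none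

/-- The solutions of the syndrome decoding instance `(H, s, ω)`. -/
def solutions {m n : ℕ} (H : Matrix (Fin m) (Fin n) (ZMod 2)) (s : Fin m → ZMod 2) (ω : ℕ) :
    Set (Fin n → ZMod 2) :=
  {e | H.mulVec e = s ∧ hammingNorm e = ω}

/-- Punctured-Hybrid terminates with probability one and then returns a solution. -/
def PuncturedHybridSolves (n k b ω p : ℕ) (h : k + b ≤ n)
    (H : Matrix (Fin (n - k)) (Fin n) (ZMod 2)) (s : Fin (n - k) → ZMod 2) : Prop :=
  loopProb (puncturedHybridRound n k b ω p h H s) (solutions H s ω) = 1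

/-- The expected number of steps of Punctured-Hybrid. -/
def puncturedHybridTime (n k b ω p : ℕ) (h : k + b ≤ n)
    (H : Matrix (Fin (n - k)) (Fin n) (ZMod 2)) (s : Fin (n - k) → ZMod 2) : ℝ≥0∞ :=
  loopExpectedTime (puncturedHybridRound n k b ω p h H s)

/-! ### The exponents -/

/-- The classical running time, up to polynomial factors. -/
def classicalTime (n k ω : ℕ) : ℝ := (n.choose ω : ℝ) / ((n - k).choose ω : ℝ)

/-- The binary entropy function, with binary logarithms. -/
def entropy (x : ℝ) : ℝ := Real.binEntropy x / Real.log 2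

def sigma (τ R ρ β : ℝ) : ℝ := (1 - β) * entropy ((τ - ρ) / (1 - β)) - (1 - β - R)

/-- The speedup exponent, in which multiple solutions enter through the summand `c * max 0 σ`. -/
def speedup (c τ R ρ δ : ℝ) : ℝ :=
  let β := (1 - δ) * (1 - R)
  (entropy τ - β * entropy (ρ / β) - (1 - β) / 2 * entropy ((τ - ρ) / (1 - β))
      - (1 - β - R) / 2 * entropy ((τ - ρ) / (1 - β - R)) + c * max 0 (sigma τ R ρ β)) /
    (entropy τ - (1 - R) * entropy (τ / (1 - R)))

end PuncturedISD

end

/-! Fix e and write a = n-k-b, w = ω-p. A permutation matters only through the set X of the b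
omitted columns and the set V ⊇ X of the n-k pivot columns. A round finds e with good probability if
four things hold: the support of e meets X in p elements; V is independent, so that the elimination
succeeds; at most Θ·max(1,S) vectors have the right syndrome and weight w outside X; and a
substantial fraction of the (n-k)-sets W containing X and the support of e are independent. Such a W
with X removed is a subset from which the decoder reconstructs the reduced part of e.

Quantum part. The circuit that solves the linear system consists of NOT gates, so it permutes basis
states, and its correctness is an invariant of Gaussian elimination (`cl_elimination`,
`solveCircuit_spec`). Hence the oracle is a sign flip on the good subsets, and amplification is a
rotation in the plane of states that are constant on the good and on the other subsets
(`act_prepare`, `act_searchCircuit`). Averaging over the random number of iterations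
(`average_sin_sq`), one run returns the wanted solution with probability at least F/(4·max(G,
N·g²)), where F, G, N count the subsets favourable to it, the good subsets and all subsets. Every
reduced solution lies in L = C(a+k-w, a-w) subsets, and N·g² = max(1,S)·L. So a run succeeds with
probability at least density/(4Θ·max(1,S)), and the n⌈S⌉ ≥ max(1,S) runs raise this to density/(8Θ)
(`roundWith_none_le`).

Random matrices. A set of n-k-s columns is dependent with probability at most 2^(-s), so failure
fraction O(1/n) is cheap only for s about log n. The last s columns are bridged by the distance of
the row space: for most matrices it is at least εn (`exists_dualDistance_bound`), so every
independent set with fewer than n-k columns has at least εn one-column extensions, and the density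
of independent sets loses at most a factor ε per column (`density_succ`). The total loss ε^s is
polynomial. The mean over all weight patterns X of the density above X ∪ supp e is the density above
supp e (`sum_density_patterns`), so polynomially many patterns are good; Markov's inequality removes
those with few pivot sets or too many solutions (`card_bad_matrices_le`). Outside a fraction C/n of
the full-rank matrices, a round therefore succeeds with the probability of the weight pattern, up to
a polynomial factor.

Exponents. The geometric series divides the worst-case time of a round by this probability. The time
is polynomial times max(1,S)/g, whose logarithm is half of max(0, log S) + log C(a+k,w) - log
C(a,w); that half is the constant c = 1/2. Entropy estimates of binomials with error O(1 + log n)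
(`log_choose_near`) and the symmetry `pattern_exponent` turn the quotient into T_C to the power
t_{1/2}, and t_1 is weaker because T_C ≥ 1. The finitely many small n are absorbed by the constant.
-/

noncomputable section

namespace PuncturedISD

/-! ### Randomized computations -/

/-- The joint distribution of the result and the number of steps. -/
def Timed.toPMF {α : Type} (T : Timed α) : PMF (α × ℕ) := T

/-- The distribution of the result of a randomized computation. -/
def Timed.res {α : Type} (T : Timed α) : PMF α := PMF.map Prod.fst T.toPMF

/-- The computation surely takes at most `B` steps. -/
def Timed.Within {α : Type} (T : Timed α) (B : ℕ) : Prop :=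
  ∀ x ∈ T.toPMF.support, x.2 ≤ B

theorem Timed.toPMF_bind {α β : Type} (T : Timed α) (f : α → Timed β) :
    (T >>= f).toPMF =
      T.toPMF.bind fun x => (f x.1).toPMF.map (fun y => (y.1, x.2 + y.2)) := rfl

theorem Timed.toPMF_pure {α : Type} (x : α) : (pure x : Timed α).toPMF = PMF.pure (x, 0) := rfl

theorem Timed.toPMF_tick (c : ℕ) : (tick c).toPMF = PMF.pure ((), c) := rfl

theorem Timed.toPMF_draw (α : Type) [Fintype α] [Nonempty α] : (draw α).toPMF =
    (PMF.uniformOfFintype α).map (fun x => (x, Nat.log 2 (Fintype.card α) + 1)) := rfl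

theorem Timed.toPMF_runQuantum {W : Type} [Fintype W] [DecidableEq W] (x : W → Bool)
    (C : Circuit W) : (runQuantum x C).toPMF =
      (QState.measure (QState.run C (QState.basis x))).map
        (fun y => (y, Circuit.time C + 2 * Fintype.card W)) := rfl

theorem Timed.res_pure {α : Type} (x : α) : (pure x : Timed α).res = PMF.pure x := by
  rw [Timed.res, Timed.toPMF_pure]
  exact PMF.pure_map _ _

theorem Timed.res_bind {α β : Type} (T : Timed α) (f : α → Timed β) :
    (T >>= f).res = T.res.bind fun a => (f a).res := by
  rw [Timed.res, Timed.toPMF_bind, Timed.res, PMF.map_bind, PMF.bind_map]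
  congr 1
  funext x
  rw [PMF.map_comp]
  rfl

theorem Timed.res_tick (c : ℕ) : (tick c).res = PMF.pure () := by
  rw [Timed.res, Timed.toPMF_tick]
  exact PMF.pure_map _ _

theorem Timed.res_tick_bind {β : Type} (c : ℕ) (f : Unit → Timed β) :
    (tick c >>= f).res = (f ()).res := by
  rw [Timed.res_bind, Timed.res_tick, PMF.pure_bind]

theorem Timed.res_draw (α : Type) [Fintype α] [Nonempty α] :
    (draw α).res = PMF.uniformOfFintype α := by
  rw [Timed.res, Timed.toPMF_draw]
  rw [PMF.map_comp]
  exact PMF.map_id _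

theorem Timed.res_runQuantum {W : Type} [Fintype W] [DecidableEq W] (x : W → Bool) (C : Circuit W) :
    (runQuantum x C).res = QState.measure (QState.run C (QState.basis x)) := by
  rw [Timed.res, Timed.toPMF_runQuantum]
  rw [PMF.map_comp]
  exact PMF.map_id _

theorem Timed.within_pure {α : Type} (x : α) (B : ℕ) : (pure x : Timed α).Within B := by
  intro y hy
  rw [Timed.toPMF_pure] at hy
  have : y = (x, 0) := by simpa using hy
  simp [this]

theorem Timed.within_tick (c : ℕ) : (tick c).Within c := by
  intro y hy
  have : y = ((), c) := by simpa [Timed.toPMF_tick] using hy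
  simp [this]

theorem Timed.Within.mono {α : Type} {T : Timed α} {B B' : ℕ} (h : T.Within B) (hB : B ≤ B') :
    T.Within B' := fun x hx => (h x hx).trans hB

theorem Timed.Within.bind {α β : Type} {T : Timed α} {f : α → Timed β} {B B' : ℕ}
    (hT : T.Within B) (hf : ∀ a, (f a).Within B') : (T >>= f).Within (B + B') := by
  intro y hy
  rw [Timed.toPMF_bind, PMF.mem_support_bind_iff] at hy
  obtain ⟨x, hx, hy⟩ := hy
  rw [PMF.mem_support_map_iff] at hy
  obtain ⟨z, hz, rfl⟩ := hy
  exact Nat.add_le_add (hT x hx) (hf _ z hz)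

theorem Timed.within_draw (α : Type) [Fintype α] [Nonempty α] :
    (draw α).Within (Nat.log 2 (Fintype.card α) + 1) := by
  intro y hy
  rw [Timed.toPMF_draw, PMF.mem_support_map_iff] at hy
  obtain ⟨z, _, rfl⟩ := hy
  exact le_rfl

theorem Timed.within_runQuantum {W : Type} [Fintype W] [DecidableEq W] (x : W → Bool)
    (C : Circuit W) : (runQuantum x C).Within (Circuit.time C + 2 * Fintype.card W) := by
  intro y hy
  rw [Timed.toPMF_runQuantum, PMF.mem_support_map_iff] at hy
  obtain ⟨z, _, rfl⟩ := hy
  exact le_rfl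

theorem Timed.within_repeatUntil {α : Type} {body : Timed (Option α)} {B : ℕ}
    (h : body.Within B) (m : ℕ) : (repeatUntil body m).Within (m * B) := by
  induction m with
  | zero => exact Timed.within_pure _ _
  | succ m ih =>
    rw [repeatUntil]
    refine (h.bind (B' := m * B) ?_).mono (by ring_nf; rfl)
    rintro (_ | a)
    · exact ih
    · exact Timed.within_pure _ _

/-! ### Loops: failure probability, termination and expected time. -/

theorem res_repeatUntil_succ {α : Type} (body : Timed (Option α)) (m : ℕ) :
    (repeatUntil body (m + 1)).res =
      body.res.bind fun o => o.elim (repeatUntil body m).res (fun a => PMF.pure (some a)) := by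
  rw [repeatUntil, Timed.res_bind]
  congr 1
  funext o
  cases o with
  | none => rfl
  | some a => exact Timed.res_pure _

/-- The repetitions are independent and a result stops the loop, so only the run in which every body
fails contributes. -/
theorem res_repeatUntil_none {α : Type} (body : Timed (Option α)) (m : ℕ) :
    (repeatUntil body m).res none = body.res none ^ m := by
  induction m with
  | zero => rw [repeatUntil, Timed.res_pure]; simp
  | succ m ih =>
    rw [res_repeatUntil_succ, PMF.bind_apply, tsum_eq_single none]
    · simp [ih, pow_succ']
    · rintro (_ | a) h
      · exact absurd rfl h
      · simp

theorem res_repeatUntil_some {α : Type} (body : Timed (Option α)) (m : ℕ) (a : α)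
    (h : (repeatUntil body m).res (some a) ≠ 0) : body.res (some a) ≠ 0 := by
  induction m with
  | zero => rw [repeatUntil, Timed.res_pure] at h; simp at h
  | succ m ih =>
    rw [res_repeatUntil_succ, ← PMF.mem_support_iff, PMF.mem_support_bind_iff] at h
    obtain ⟨o, ho, h⟩ := h
    cases o with
    | none => exact ih h
    | some b =>
      have : a = b := by simpa using h
      rw [this]; exact ho

/-- The unbounded loop terminates with a result in `S` if every round has a chance of success. -/
theorem loopProb_eq_one {α : Type} (body : Timed (Option α)) (S : Set α)
    (hS : ∀ a, body.res (some a) ≠ 0 → a ∈ S) (hq : body.res none < 1) : loopProb body S = 1 := by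
  have h1 : ∀ m, (repeatUntil body m).prob (some '' S) = 1 - body.res none ^ m := by
    intro m
    have hp : (repeatUntil body m).prob (some '' S) =
        (repeatUntil body m).res.toOuterMeasure (some '' S) := rfl
    have hn : (repeatUntil body m).res.toOuterMeasure {none} = body.res none ^ m := by
      rw [PMF.toOuterMeasure_apply_singleton, res_repeatUntil_none]
    have hsum : (repeatUntil body m).res.toOuterMeasure (some '' S) +
        (repeatUntil body m).res.toOuterMeasure {none} = 1 := by
      rw [PMF.toOuterMeasure_apply, PMF.toOuterMeasure_apply, ← ENNReal.tsum_add,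
        ← (repeatUntil body m).res.tsum_coe]
      refine tsum_congr fun o => ?_
      cases o with
      | none => simp
      | some a =>
        by_cases ha : (repeatUntil body m).res (some a) = 0
        · simp [Set.indicator, ha]
        · have := hS a (res_repeatUntil_some body m a ha)
          simp [Set.indicator, this]
    -- The results in S and the failure exhaust the whole mass, hence the probability of success is
    -- the complement of the failure probability.
    rw [hp, ← hsum, hn, ENNReal.add_sub_cancel_right]
    exact ENNReal.pow_ne_top hq.ne_top
  unfold loopProb
  simp_rw [h1]
  refine le_antisymm (iSup_le fun m => tsub_le_self) ?_
  have ht : Filter.Tendsto (fun m : ℕ => 1 - body.res none ^ m) Filter.atTop (nhds (1 - 0)) :=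
    ENNReal.Tendsto.sub tendsto_const_nhds (ENNReal.tendsto_pow_atTop_nhds_zero_of_lt_one hq)
      (Or.inl ENNReal.one_ne_top)
  rw [tsub_zero] at ht
  exact le_of_tendsto' ht fun m => le_iSup (fun m => 1 - body.res none ^ m) m

theorem tsum_bind_mul {α β : Type} (p : PMF α) (f : α → PMF β) (g : β → ℝ≥0∞) :
    ∑' y, (p.bind f) y * g y = ∑' x, p x * ∑' y, f x y * g y := by
  simp_rw [PMF.bind_apply, ← ENNReal.tsum_mul_right, ← ENNReal.tsum_mul_left]
  rw [ENNReal.tsum_comm]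
  simp_rw [mul_assoc]

theorem tsum_map_mul {α β : Type} (p : PMF α) (f : α → β) (g : β → ℝ≥0∞) :
    ∑' y, (p.map f) y * g y = ∑' x, p x * g (f x) := by
  rw [← PMF.bind_pure_comp, tsum_bind_mul]
  refine tsum_congr fun x => ?_
  congr 1
  rw [tsum_eq_single (f x)]
  · simp
  · intro y hy
    simp [hy]

theorem expectedTime_bind {α β : Type} (T : Timed α) (f : α → Timed β) :
    (T >>= f).expectedTime = T.expectedTime + ∑' a, T.res a * (f a).expectedTime := by
  have h : (T >>= f).expectedTime =
      ∑' x, T.toPMF x * ((x.2 : ℝ≥0∞) + (f x.1).expectedTime) := by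
    refine (tsum_bind_mul _ _ _).trans (tsum_congr fun x => ?_)
    congr 1
    refine (tsum_map_mul (f x.1).toPMF _ _).trans ?_
    change _ = (x.2 : ℝ≥0∞) + ∑' y, (f x.1).toPMF y * (y.2 : ℝ≥0∞)
    push_cast
    simp_rw [mul_add]
    rw [ENNReal.tsum_add, ENNReal.tsum_mul_right, PMF.tsum_coe, one_mul]
  rw [h]
  simp_rw [mul_add]
  rw [ENNReal.tsum_add]
  congr 1
  exact (tsum_map_mul T.toPMF Prod.fst fun a => (f a).expectedTime).symm

theorem Timed.Within.expectedTime_le {α : Type} {T : Timed α} {B : ℕ} (h : T.Within B) :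
    T.expectedTime ≤ B := by
  change ∑' x, T.toPMF x * (x.2 : ℝ≥0∞) ≤ _
  calc _ ≤ ∑' x, T.toPMF x * (B : ℝ≥0∞) := by
        refine ENNReal.tsum_le_tsum fun x => ?_
        by_cases hx : T.toPMF x = 0
        · exact (by simp [hx] : T.toPMF x * (x.2 : ℝ≥0∞) = 0) ▸ zero_le
        · gcongr
          exact h x hx
    _ = B := by rw [ENNReal.tsum_mul_right, PMF.tsum_coe, one_mul]

theorem expectedTime_pure {α : Type} (x : α) : (pure x : Timed α).expectedTime = 0 := by
  have := (Timed.within_pure x 0).expectedTime_le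
  simpa using this

/-- Round i is reached with probability q^i, where q is the failure probability of one round, and
costs at most B; the geometric series gives B/(1-q). With values in `ℝ≥0∞` the case q = 1 needs no
exception. -/
theorem loopExpectedTime_le {α : Type} (body : Timed (Option α)) (B : ℕ) (h : body.Within B) :
    loopExpectedTime body ≤ B * (1 - body.res none)⁻¹ := by
  refine iSup_le fun m => ?_
  rw [← ENNReal.tsum_geometric]
  suffices hs : (repeatUntil body m).expectedTime ≤
      B * ∑ i ∈ Finset.range m, body.res none ^ i from
    hs.trans (by gcongr; exact ENNReal.sum_le_tsum _)
  induction m with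
  | zero => rw [repeatUntil, expectedTime_pure]; exact zero_le
  | succ m ih =>
    rw [repeatUntil, expectedTime_bind]
    calc _ ≤ (B : ℝ≥0∞) + body.res none * (repeatUntil body m).expectedTime := by
          refine add_le_add h.expectedTime_le (le_of_eq ?_)
          rw [tsum_eq_single none]
          rintro (_ | a) ha
          · exact absurd rfl ha
          · simp [expectedTime_pure]
      _ ≤ (B : ℝ≥0∞) + body.res none * (B * ∑ i ∈ Finset.range m, body.res none ^ i) := by gcongr
      _ = _ := by
          rw [Finset.sum_range_succ', mul_add, mul_left_comm, Finset.mul_sum]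
          simp_rw [← pow_succ']
          simp [add_comm]


/-! ### Gauss-Jordan elimination -/

theorem ZMod.two_eq_zero_of_ne_one {x : ZMod 2} (h : x ≠ 1) : x = 0 := by
  revert h; revert x; decide

theorem ZMod.two_add_eq_zero_iff {x y : ZMod 2} : x + y = 0 ↔ x = y := by
  revert x y; decide

/-- The matrix after one step of the elimination, with pivot in row `r`. -/
def eliminationStep {ι κ : Type} [DecidableEq ι] (i r : ι) (c₀ : κ) (M : Matrix ι κ (ZMod 2)) :
    Matrix ι κ (ZMod 2) :=
  Matrix.of fun l c =>
    if l ≠ i ∧ (M.submatrix (Equiv.swap i r) id) l c₀ = 1 then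
      (M.submatrix (Equiv.swap i r) id) l c + (M.submatrix (Equiv.swap i r) id) i c
    else (M.submatrix (Equiv.swap i r) id) l c

/-- The result of the elimination, without step count. -/
def gaussJordanResult {ι κ : Type} [DecidableEq ι] (pc : ι → κ) :
    List ι → Matrix ι κ (ZMod 2) → Option (Matrix ι κ (ZMod 2))
  | [], M => some M
  | i :: rest, M =>
    match (i :: rest).find? (fun r => M r (pc i) = 1) with
    | none => none
    | some r => gaussJordanResult pc rest (eliminationStep i r (pc i) M)

theorem res_gaussJordan {ι κ : Type} [DecidableEq ι] [Fintype ι] [Fintype κ] (pc : ι → κ)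
    (l : List ι) (M : Matrix ι κ (ZMod 2)) :
    (gaussJordan pc l M).res = PMF.pure (gaussJordanResult pc l M) := by
  induction l generalizing M with
  | nil => rw [gaussJordan, gaussJordanResult, Timed.res_pure]
  | cons i rest ih =>
    rw [gaussJordan, gaussJordanResult, Timed.res_tick_bind]
    cases (i :: rest).find? (fun r => M r (pc i) = 1) with
    | none => exact Timed.res_pure _
    | some r =>
      refine (Timed.res_tick_bind _ _).trans ?_
      refine (Timed.res_tick_bind _ _).trans ?_
      exact ih _

theorem within_gaussJordan {ι κ : Type} [DecidableEq ι] [Fintype ι] [Fintype κ] (pc : ι → κ)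
    (l : List ι) (M : Matrix ι κ (ZMod 2)) :
    (gaussJordan pc l M).Within (l.length *
      (Fintype.card ι + 2 * Fintype.card κ + Fintype.card ι * Fintype.card κ)) := by
  induction l generalizing M with
  | nil => exact Timed.within_pure _ _
  | cons i rest ih =>
    rw [gaussJordan]
    refine ((Timed.within_tick _).bind (B' := 2 * Fintype.card κ + (Fintype.card ι * Fintype.card κ
      + rest.length * (Fintype.card ι + 2 * Fintype.card κ + Fintype.card ι * Fintype.card κ)))
      ?_).mono (by rw [List.length_cons]; ring_nf; rfl)
    intro _
    cases (i :: rest).find? (fun r => M r (pc i) = 1) with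
    | none => exact Timed.within_pure _ _
    | some r => exact (Timed.within_tick _).bind fun _ => (Timed.within_tick _).bind fun _ => ih _

/-- Row operations are invertible. Row i of the new matrix is the pivot row without any addition, so
its equation can be recovered first; then the added multiples of it vanish in all other rows. -/
theorem eliminationStep_mulVec {ι κ : Type} [DecidableEq ι] [Fintype κ] (i r : ι)
    (c₀ : κ) (M : Matrix ι κ (ZMod 2)) (v : κ → ZMod 2) :
    (eliminationStep i r c₀ M).mulVec v = 0 ↔ M.mulVec v = 0 := by
  have h1 : ∀ l, (M.submatrix (Equiv.swap i r) id).mulVec v l = M.mulVec v (Equiv.swap i r l) :=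
    fun l => rfl
  have h2 : ∀ l, (eliminationStep i r c₀ M).mulVec v l =
      if l ≠ i ∧ (M.submatrix (Equiv.swap i r) id) l c₀ = 1 then
        M.mulVec v (Equiv.swap i r l) + M.mulVec v (Equiv.swap i r i)
      else M.mulVec v (Equiv.swap i r l) := by
    intro l
    split_ifs with h
    · rw [← h1, ← h1]
      simp only [Matrix.mulVec, dotProduct, ← Finset.sum_add_distrib, ← add_mul]
      refine Finset.sum_congr rfl fun c _ => ?_
      simp only [eliminationStep, Matrix.of_apply, if_pos h]
    · rw [← h1]
      simp only [Matrix.mulVec, dotProduct]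
      refine Finset.sum_congr rfl fun c _ => ?_
      simp only [eliminationStep, Matrix.of_apply, if_neg h]
  constructor
  · intro h
    have hi : M.mulVec v (Equiv.swap i r i) = 0 := by
      have := congrFun h i
      rw [h2, if_neg (by simp)] at this
      exact this
    have hl : ∀ l, M.mulVec v (Equiv.swap i r l) = 0 := by
      intro l
      have := congrFun h l
      rw [h2, hi, add_zero, ite_self] at this
      exact this
    funext l
    have := hl (Equiv.swap i r l)
    rwa [Equiv.swap_apply_self] at this
  · intro h
    funext l
    rw [h2, h]
    simp

/-- The pivot row r is still untreated, so a finished unit column has a zero there. Neither the swap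
of i and r nor adding the pivot row can spoil it. -/
theorem eliminationStep_columns {ι κ : Type} [DecidableEq ι] (pc : ι → κ) {i r : ι} {rest : List ι}
    {M : Matrix ι κ (ZMod 2)} (hM : ∀ c ∉ i :: rest, ∀ j, M j (pc c) = if j = c then 1 else 0)
    (hr1 : M r (pc i) = 1) (hrm : r ∈ i :: rest) (c : ι) (hc : c ∉ rest) (j : ι) :
    eliminationStep i r (pc i) M j (pc c) = if j = c then 1 else 0 := by
  by_cases hci : c = i
  · subst hci
    by_cases hj : j = c
    · simp [eliminationStep, hj, hr1]
    · simp only [eliminationStep, Matrix.of_apply, Matrix.submatrix_apply, id, hj, ne_eq,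
        not_false_eq_true, true_and, if_false, Equiv.swap_apply_left, hr1]
      split_ifs with h
      · rw [h]; decide
      · exact ZMod.two_eq_zero_of_ne_one h
  · have hc' : c ∉ i :: rest := by simp [hci, hc]
    have hcr : c ≠ r := fun h => hc' (h ▸ hrm)
    have hz : M r (pc c) = 0 := by rw [hM c hc', if_neg hcr.symm]
    have hsw : M (Equiv.swap i r j) (pc c) = if j = c then 1 else 0 := by
      rw [hM c hc']
      congr 1
      rw [Equiv.swap_apply_eq_iff, Equiv.swap_apply_of_ne_of_ne hci hcr]
    simp only [eliminationStep, Matrix.of_apply, Matrix.submatrix_apply, id,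
      Equiv.swap_apply_left, hz, add_zero, ite_self, hsw]

theorem gaussJordanResult_spec {ι κ : Type} [DecidableEq ι] [Fintype κ] (pc : ι → κ) (l : List ι)
    (M N : Matrix ι κ (ZMod 2))
    (hM : ∀ i ∉ l, ∀ j, M j (pc i) = if j = i then 1 else 0)
    (h : gaussJordanResult pc l M = some N) :
    (∀ v, N.mulVec v = 0 ↔ M.mulVec v = 0) ∧ ∀ i j, N j (pc i) = if j = i then 1 else 0 := by
  induction l generalizing M with
  | nil =>
    rw [gaussJordanResult, Option.some_inj] at h
    subst h
    exact ⟨fun v => Iff.rfl, fun i j => hM i (by simp) j⟩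
  | cons i rest ih =>
    rw [gaussJordanResult] at h
    cases hr : (i :: rest).find? (fun r => M r (pc i) = 1) with
    | none => rw [hr] at h; simp at h
    | some r =>
      rw [hr] at h
      have hr1 : M r (pc i) = 1 := by simpa using List.find?_some hr
      have hrm : r ∈ i :: rest := List.mem_of_find?_eq_some hr
      obtain ⟨h1, h2⟩ := ih (eliminationStep i r (pc i) M) (eliminationStep_columns pc hM hr1 hrm) h
      exact ⟨fun v => (h1 v).trans (eliminationStep_mulVec i r (pc i) M v), h2⟩

/-- If the search fails, column `pc i` has ones only in treated rows. It is then a sum of the unit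
columns already produced, which is a nontrivial relation among the columns in the range of `pc`. -/
theorem gaussJordanResult_ne_none {ι κ : Type} [DecidableEq ι] [Fintype ι] [Fintype κ]
    (pc : ι → κ) (hpc : Function.Injective pc) (l : List ι) (M : Matrix ι κ (ZMod 2))
    (hM : ∀ i ∉ l, ∀ j, M j (pc i) = if j = i then 1 else 0)
    (hk : ∀ v : κ → ZMod 2, (∀ c ∉ Set.range pc, v c = 0) → M.mulVec v = 0 → v = 0) :
    gaussJordanResult pc l M ≠ none := by
  classical
  induction l generalizing M with
  | nil => simp [gaussJordanResult]
  | cons i rest ih =>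
    rw [gaussJordanResult]
    cases hr : (i :: rest).find? (fun r => M r (pc i) = 1) with
    | none =>
      exfalso
      rw [List.find?_eq_none] at hr
      -- The relation: column `pc i` plus, for each treated row j in which it has a one, the unit
      -- column `pc j`.
      let v : κ → ZMod 2 := Pi.single (pc i) 1 +
        ∑ j, if j ∈ i :: rest then 0 else Pi.single (pc j) (M j (pc i))
      have hv := hk v (fun c hc => by
        have h1 : ∀ j, c ≠ pc j := fun j hj => hc ⟨j, hj.symm⟩
        simp only [v, Pi.add_apply, Finset.sum_apply, Pi.single_eq_of_ne (h1 i), zero_add]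
        refine Finset.sum_eq_zero fun j _ => ?_
        split_ifs
        · rfl
        · exact Pi.single_eq_of_ne (h1 j) _) (by
        funext r
        simp only [v, Matrix.mulVec_add, Matrix.mulVec_sum, Pi.add_apply, Finset.sum_apply]
        have h2 : ∀ j, (M.mulVec (if j ∈ i :: rest then 0 else Pi.single (pc j) (M j (pc i)))) r =
            if j = r then (if r ∈ i :: rest then 0 else M r (pc i)) else 0 := by
          intro j
          by_cases hj : j ∈ i :: rest
          · rw [if_pos hj, Matrix.mulVec_zero]
            split_ifs with h h' <;> first | rfl | exact absurd (h ▸ hj) h'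
          · rw [if_neg hj]
            simp only [Matrix.mulVec_single, Matrix.col_apply, Pi.smul_apply, hM j hj r]
            by_cases hjr : j = r
            · subst hjr; simp [hj]
            · simp [hjr, Ne.symm hjr]
        rw [Finset.sum_congr rfl fun j _ => h2 j, Finset.sum_ite_eq' Finset.univ r]
        simp only [Matrix.mulVec_single_one, Matrix.col_apply, Finset.mem_univ, if_true,
          Pi.zero_apply]
        split_ifs with h
        · rw [add_zero]
          have := hr r h
          exact ZMod.two_eq_zero_of_ne_one (by simpa using this)
        · exact CharTwo.add_self_eq_zero _)
      have h3 := congrFun hv (pc i)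
      simp only [v, Pi.add_apply, Finset.sum_apply, Pi.single_eq_same, Pi.zero_apply] at h3
      rw [Finset.sum_eq_zero, add_zero] at h3
      · exact one_ne_zero h3
      · intro j _
        split_ifs with h
        · rfl
        · refine Pi.single_eq_of_ne (fun h' => h ?_) _
          rw [← hpc h']
          exact List.mem_cons_self
    | some r =>
      have hr1 : M r (pc i) = 1 := by simpa using List.find?_some hr
      have hrm : r ∈ i :: rest := List.mem_of_find?_eq_some hr
      refine ih (eliminationStep i r (pc i) M) (eliminationStep_columns pc hM hr1 hrm) ?_
      intro v hv hv0
      exact hk v hv ((eliminationStep_mulVec i r (pc i) M v).1 hv0)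

/-! ### Reconstruction of a solution from a given set of columns. -/

/-- The product of `(I ∣ H₁)` with a vector. -/
def reducedMul {α κ : Type} [Fintype κ] (H₁ : Matrix α κ (ZMod 2)) (e : α ⊕ κ → ZMod 2) :
    α → ZMod 2 := fun i => e (.inl i) + ∑ c, H₁ i c * e (.inr c)

/-- The matrix on which `solveOn` performs the elimination. -/
def augmentedMatrix {a k : ℕ} (H₁ : Matrix (Fin a) (Fin k) (ZMod 2)) (s : Fin a → ZMod 2) :
    Matrix (Fin a) ((Fin a ⊕ Fin k) ⊕ Unit) (ZMod 2) := Matrix.of fun i =>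
  Sum.elim (Sum.elim (fun l => if i = l then 1 else 0) (H₁ i)) (fun _ => s i)

theorem augmentedMatrix_mulVec {a k : ℕ} (H₁ : Matrix (Fin a) (Fin k) (ZMod 2))
    (s : Fin a → ZMod 2) (v : (Fin a ⊕ Fin k) ⊕ Unit → ZMod 2) (i : Fin a) :
    (augmentedMatrix H₁ s).mulVec v i =
      reducedMul H₁ (fun c => v (.inl c)) i + s i * v (.inr ()) := by
  simp [augmentedMatrix, Matrix.mulVec, dotProduct, reducedMul]

/-- Off the pivot columns `e` vanishes and on them the matrix is the identity, so each row reads off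
one coordinate of `e` and the last column. -/
theorem mulVec_of_unit_columns {ι κ : Type} [Fintype ι] [DecidableEq ι] [Fintype κ]
    (N : Matrix ι (κ ⊕ Unit) (ZMod 2)) (pc : ι → κ) (hpc : Function.Injective pc)
    (hN : ∀ i j, N j (.inl (pc i)) = if j = i then 1 else 0) (e : κ → ZMod 2) (t : ZMod 2)
    (he : ∀ c ∉ Set.range pc, e c = 0) (i : ι) :
    N.mulVec (Sum.elim e fun _ => t) i = e (pc i) + N i (.inr ()) * t := by
  classical
  simp only [Matrix.mulVec, dotProduct, Fintype.sum_sum_type, Sum.elim_inl, Sum.elim_inr,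
    Finset.univ_unique, Finset.sum_singleton]
  congr 1
  rw [Finset.sum_eq_single (pc i)]
  · simp [hN]
  · intro c _ hc
    by_cases hr : c ∈ Set.range pc
    · obtain ⟨j, rfl⟩ := hr
      rw [hN, if_neg (fun h => hc (by rw [h])), zero_mul]
    · rw [he c hr, mul_zero]
  · simp

theorem mem_columns (a k : ℕ) (c : Fin a ⊕ Fin k) : c ∈ columns a k := by
  cases c <;> simp [columns]

theorem nodup_columns (a k : ℕ) : (columns a k).Nodup := by
  unfold columns
  rw [List.nodup_append]
  refine ⟨(List.nodup_finRange a).map Sum.inl_injective,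
    (List.nodup_finRange k).map Sum.inr_injective, ?_⟩
  intro x hx y hy
  simp only [List.mem_map] at hx hy
  obtain ⟨i, _, rfl⟩ := hx
  obtain ⟨j, _, rfl⟩ := hy
  simp

theorem length_columns (a k : ℕ) : (columns a k).length = a + k := by simp [columns]

theorem length_filter_columns (a k : ℕ) (I : Fin a ⊕ Fin k → Bool) :
    ((columns a k).filter fun c => I c).length = (Finset.univ.filter fun c => I c = true).card := by
  rw [← List.toFinset_card_of_nodup ((nodup_columns a k).filter _)]
  congr 1
  ext c
  simp [mem_columns]

/-- A vector supported on the selected columns. -/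
def SupportedOn {κ : Type} (I : κ → Bool) (e : κ → ZMod 2) : Prop := ∀ c, I c = false → e c = 0

/-- The subset `I` has `a` elements, the corresponding columns of `(I_a ∣ H₁)` are linearly
independent, and the solution of the linear system has weight `w`. -/
def GoodSubset {a k : ℕ} (H₁ : Matrix (Fin a) (Fin k) (ZMod 2)) (s : Fin a → ZMod 2) (w : ℕ)
    (I : Fin a ⊕ Fin k → Bool) : Prop :=
  (Finset.univ.filter fun c => I c = true).card = a ∧
    (∀ u, SupportedOn I u → reducedMul H₁ u = 0 → u = 0) ∧
    ∃ u, SupportedOn I u ∧ reducedMul H₁ u = s ∧ hammingNorm u = w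

/-- The syndrome is an extra column, so `e` solves the system exactly when `(e, 1)` lies in the
kernel of the augmented matrix. That kernel is the same before and after the elimination. -/
theorem solveOn_sound {a k : ℕ} (H₁ : Matrix (Fin a) (Fin k) (ZMod 2)) (s : Fin a → ZMod 2)
    (I : Fin a ⊕ Fin k → Bool) (e : Fin a ⊕ Fin k → ZMod 2)
    (h : (solveOn H₁ s I).res (some e) ≠ 0) : reducedMul H₁ e = s := by
  unfold solveOn at h
  rw [Timed.res_tick_bind] at h
  split_ifs at h with hl
  · rw [Timed.res_bind, res_gaussJordan, PMF.pure_bind] at h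
    set pc : Fin a → Fin a ⊕ Fin k :=
      fun i => ((columns a k).filter fun c => I c).get (i.cast hl.symm)
    have hinj : Function.Injective pc := fun i j hij => by
      have := ((nodup_columns a k).filter _).injective_get hij
      simpa using this
    change (match gaussJordanResult (fun i => Sum.inl (pc i)) (List.finRange a)
      (augmentedMatrix H₁ s) with
      | none => (pure none : Timed _)
      | some N => (pure (some fun c => ∑ i, if pc i = c then N i (Sum.inr ()) else 0))).res
        (some e) ≠ 0 at h
    cases hN : gaussJordanResult (fun i => Sum.inl (pc i)) (List.finRange a)
        (augmentedMatrix H₁ s) with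
    | none => rw [hN] at h; simp [Timed.res_pure] at h
    | some N =>
      rw [hN] at h
      simp only [Timed.res_pure, ne_eq, PMF.pure_apply, ite_eq_right_iff, one_ne_zero, imp_false,
        not_not, Option.some_inj] at h
      obtain ⟨h1, h2⟩ := gaussJordanResult_spec _ _ _ _ (fun i hi => absurd (by simp) hi) hN
      have hpe : ∀ i, e (pc i) = N i (.inr ()) := by
        intro i
        rw [show e (pc i) = ∑ j, if pc j = pc i then N j (.inr ()) else 0 from congrFun h _,
          Finset.sum_eq_single i]
        · simp
        · intro j _ hj
          rw [if_neg (fun h' => hj (hinj h'))]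
        · simp
      have he : N.mulVec (Sum.elim e fun _ => 1) = 0 := by
        funext i
        rw [mulVec_of_unit_columns N pc hinj h2 e 1, hpe, mul_one]
        · exact CharTwo.add_self_eq_zero _
        · intro c hc
          rw [h]
          exact Finset.sum_eq_zero fun i _ => if_neg fun h' => hc ⟨i, h'⟩
      rw [h1] at he
      funext i
      have := congrFun he i
      rw [augmentedMatrix_mulVec] at this
      simpa [ZMod.two_add_eq_zero_iff] using this
  · simp [Timed.res_pure] at h

/-- Independence guarantees a pivot in every step, and the unit columns of the final matrix force
the coordinates of the supported solution to be the entries of the transformed syndrome. -/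
theorem solveOn_complete {a k : ℕ} (H₁ : Matrix (Fin a) (Fin k) (ZMod 2)) (s : Fin a → ZMod 2)
    (I : Fin a ⊕ Fin k → Bool) (hI : (Finset.univ.filter fun c => I c = true).card = a)
    (hind : ∀ u, SupportedOn I u → reducedMul H₁ u = 0 → u = 0)
    (e : Fin a ⊕ Fin k → ZMod 2) (he : SupportedOn I e) (hs : reducedMul H₁ e = s) :
    (solveOn H₁ s I).res = PMF.pure (some e) := by
  unfold solveOn
  rw [Timed.res_tick_bind]
  have hl : ((columns a k).filter fun c => I c).length = a := by rw [length_filter_columns, hI]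
  rw [dif_pos hl]
  rw [Timed.res_bind, res_gaussJordan, PMF.pure_bind]
  set pc : Fin a → Fin a ⊕ Fin k :=
    fun i => ((columns a k).filter fun c => I c).get (i.cast hl.symm) with hpc
  have hinj : Function.Injective pc := fun i j hij => by
    have := ((nodup_columns a k).filter _).injective_get hij
    simpa using this
  have hrange : ∀ c, c ∉ Set.range pc → I c = false := by
    intro c hc
    by_contra hcI
    have hmem : c ∈ (columns a k).filter fun c => I c := by
      rw [List.mem_filter]
      exact ⟨mem_columns a k c, by simpa using hcI⟩
    obtain ⟨i, hi⟩ := List.get_of_mem hmem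
    exact hc ⟨i.cast hl, by simpa [hpc] using hi⟩
  change (match gaussJordanResult (fun i => Sum.inl (pc i)) (List.finRange a)
      (augmentedMatrix H₁ s) with
    | none => (pure none : Timed _)
    | some N => (pure (some fun c => ∑ i, if pc i = c then N i (Sum.inr ()) else 0))).res = _
  cases hN : gaussJordanResult (fun i => Sum.inl (pc i)) (List.finRange a)
      (augmentedMatrix H₁ s) with
  | none =>
    exfalso
    refine gaussJordanResult_ne_none (fun i => (Sum.inl (pc i) : (Fin a ⊕ Fin k) ⊕ Unit))
      (Sum.inl_injective.comp hinj) _ _ (fun i hi => absurd (by simp) hi) ?_ hN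
    intro v hv hv0
    -- The syndrome column is not a pivot column, so a kernel vector supported on the pivot columns
    -- is a relation among the selected columns alone.
    have hu : v (.inr ()) = 0 := hv _ (by simp)
    have h0 := hind (fun c => v (.inl c))
      (fun c hc => by
        by_contra hne
        have h' : (Sum.inl c : (Fin a ⊕ Fin k) ⊕ Unit) ∈ Set.range fun i => Sum.inl (pc i) := by
          by_contra h''
          exact hne (hv _ h'')
        obtain ⟨i, hi⟩ := h'
        have : pc i = c := by simpa using hi
        have hIc : I (pc i) = true := by
          have := List.get_mem ((columns a k).filter fun c => I c) (i.cast hl.symm)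
          rw [List.mem_filter] at this
          exact this.2
        rw [this, hc] at hIc
        exact Bool.false_ne_true hIc)
      (by
        funext i
        have := congrFun hv0 i
        rwa [augmentedMatrix_mulVec, hu, mul_zero, add_zero] at this)
    funext c
    rcases c with c | ⟨⟩
    · exact congrFun h0 c
    · exact hu
  | some N =>
    obtain ⟨h1, h2⟩ := gaussJordanResult_spec _ _ _ _ (fun i hi => absurd (by simp) hi) hN
    have h0 : N.mulVec (Sum.elim e fun _ => 1) = 0 := by
      rw [h1]
      funext i
      rw [augmentedMatrix_mulVec]
      simp only [Sum.elim_inl, Sum.elim_inr, mul_one, Pi.zero_apply, hs]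
      exact CharTwo.add_self_eq_zero _
    have hpe : ∀ i, e (pc i) = N i (.inr ()) := by
      intro i
      have := congrFun h0 i
      rw [mulVec_of_unit_columns N pc hinj h2 e 1 (fun c hc => he c (hrange c hc)), mul_one] at this
      exact ZMod.two_add_eq_zero_iff.1 this
    refine (Timed.res_pure _).trans ?_
    congr 2
    funext c
    by_cases hc : c ∈ Set.range pc
    · obtain ⟨i, rfl⟩ := hc
      rw [hpe, Finset.sum_eq_single i]
      · simp
      · intro j _ hj
        rw [if_neg (fun h' => hj (hinj h'))]
      · simp
    · rw [he c (hrange c hc)]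
      exact Finset.sum_eq_zero fun i _ => if_neg fun h' => hc ⟨i, h'⟩

theorem within_solveOn {a k : ℕ} (H₁ : Matrix (Fin a) (Fin k) (ZMod 2)) (s : Fin a → ZMod 2)
    (I : Fin a ⊕ Fin k → Bool) :
    (solveOn H₁ s I).Within (a + k + a * (a + 2 * (a + k + 1) + a * (a + k + 1))) := by
  unfold solveOn
  refine (Timed.within_tick _).bind fun _ => ?_
  split_ifs with hl
  · refine ((within_gaussJordan _ _ _).bind (B' := 0) ?_).mono (by simp)
    rintro (_ | N)
    · exact Timed.within_pure _ _
    · exact Timed.within_pure _ _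
  · exact Timed.within_pure _ _


/-! ### Action of circuits on amplitudes -/

/-- The linear action of a circuit. -/
def Circuit.act {W : Type} [DecidableEq W] (C : Circuit W) (ψ : (W → Bool) → ℂ) :
    (W → Bool) → ℂ := C.foldl (fun φ g => g.apply φ) ψ

theorem QState.run_val {W : Type} [Fintype W] [DecidableEq W] (C : Circuit W) (ψ : QState W) :
    (QState.run C ψ).1 = C.act ψ.1 := by
  induction C generalizing ψ with
  | nil => rfl
  | cons g C ih => exact ih _

section

variable {W : Type} [DecidableEq W]

theorem Circuit.act_append (C D : Circuit W) (ψ : (W → Bool) → ℂ) :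
    Circuit.act (C ++ D) ψ = Circuit.act D (Circuit.act C ψ) := List.foldl_append

theorem Circuit.act_cons (g : Gate W) (C : Circuit W) (ψ : (W → Bool) → ℂ) :
    Circuit.act (g :: C) ψ = Circuit.act C (g.apply ψ) := rfl

theorem Circuit.act_nil (ψ : (W → Bool) → ℂ) : Circuit.act [] ψ = ψ := rfl

/-- The effect of a NOT gate on a basis state. -/
def Gate.flip (g : Gate W) (x : W → Bool) : W → Bool :=
  if g.Fires x then Function.update x g.target (!x g.target) else x

theorem Gate.fires_update (g : Gate W) (x : W → Bool) (b : Bool) :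
    g.Fires (Function.update x g.target b) ↔ g.Fires x := by
  simp only [Gate.Fires]
  refine forall₂_congr fun c _ => forall_congr' fun hc => ?_
  simp [Function.update_of_ne hc]

theorem Gate.flip_flip (g : Gate W) (x : W → Bool) : g.flip (g.flip x) = x := by
  by_cases h : g.Fires x
  · have h' : g.flip x = Function.update x g.target (!x g.target) := if_pos h
    rw [h', Gate.flip, if_pos ((g.fires_update x _).2 h)]
    simp
  · have h' : g.flip x = x := if_neg h
    rw [h', h']

theorem Gate.apply_X (g : Gate W) (hg : g.op = .X) (ψ : (W → Bool) → ℂ) (x : W → Bool) :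
    g.apply ψ x = ψ (g.flip x) := by
  unfold Gate.apply Gate.flip
  split_ifs with h
  · rw [hg]
    cases hb : x g.target <;> simp [QOp.mat]
  · rfl

theorem Gate.apply_Z (g : Gate W) (hg : g.op = .Z) (ψ : (W → Bool) → ℂ) (x : W → Bool) :
    g.apply ψ x = if g.Fires x ∧ x g.target = true then -ψ x else ψ x := by
  unfold Gate.apply
  by_cases h : g.Fires x
  · rw [if_pos h, hg]
    have hself : Function.update x g.target (x g.target) = x := Function.update_eq_self _ _
    cases hb : x g.target <;> rw [hb] at hself <;> simp [QOp.mat, h, hself]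
  · simp [h]

/-- The effect of a circuit of NOT gates on a basis state. -/
def Circuit.cl (C : Circuit W) (x : W → Bool) : W → Bool := C.foldl (fun x g => g.flip x) x

theorem Circuit.cl_append (C D : Circuit W) (x : W → Bool) :
    Circuit.cl (C ++ D) x = Circuit.cl D (Circuit.cl C x) := List.foldl_append

theorem Circuit.cl_cons (g : Gate W) (C : Circuit W) (x : W → Bool) :
    Circuit.cl (g :: C) x = Circuit.cl C (g.flip x) := rfl

theorem Circuit.cl_nil (x : W → Bool) : Circuit.cl [] x = x := rfl

/-- All gates of the circuit are (controlled) NOT gates. -/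
def Circuit.IsClassical (C : Circuit W) : Prop := ∀ g ∈ C, g.op = .X

/-- NOT gates only permute basis states, hence amplitudes are transported along the permutation `cl`
without change. -/
theorem Circuit.act_cl {C : Circuit W} (hC : C.IsClassical) (ψ : (W → Bool) → ℂ) (x : W → Bool) :
    C.act ψ (C.cl x) = ψ x := by
  induction C generalizing ψ x with
  | nil => rfl
  | cons g C ih =>
    rw [Circuit.act_cons, Circuit.cl_cons, ih (fun h hh => hC h (List.mem_cons_of_mem _ hh)),
      Gate.apply_X _ (hC g List.mem_cons_self), Gate.flip_flip]

theorem Circuit.inverse_cons (g : Gate W) (C : Circuit W) :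
    Circuit.inverse (g :: C) = Circuit.inverse C ++ [{ g with op := g.op.inv }] := by
  simp [Circuit.inverse]

theorem Circuit.act_inverse_classical {C : Circuit W} (hC : C.IsClassical)
    (ψ : (W → Bool) → ℂ) (x : W → Bool) : (Circuit.inverse C).act ψ x = ψ (C.cl x) := by
  induction C generalizing ψ x with
  | nil => rfl
  | cons g C ih =>
    have hg := hC g List.mem_cons_self
    rw [Circuit.inverse_cons, Circuit.act_append, Circuit.act_cons, Circuit.act_nil,
      Gate.apply_X _ (by simp [hg, QOp.inv]), ih (fun h hh => hC h (List.mem_cons_of_mem _ hh)),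
      Circuit.cl_cons]
    rfl

open Classical in
/-- The amplitudes of a basis state. -/
def delta (y : W → Bool) : (W → Bool) → ℂ := fun x => if x = y then 1 else 0

theorem delta_self (y : W → Bool) : delta y y = 1 := by simp [delta]

theorem delta_of_ne {y x : W → Bool} (h : x ≠ y) : delta y x = 0 := by simp [delta, h]

theorem Circuit.act_delta {C : Circuit W} (hC : C.IsClassical) (y : W → Bool) :
    C.act (delta y) = delta (C.cl y) := by
  induction C generalizing y with
  | nil => rfl
  | cons g C ih =>
    rw [Circuit.act_cons, Circuit.cl_cons, ← ih (fun h hh => hC h (List.mem_cons_of_mem _ hh))]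
    congr 1
    funext x
    rw [Gate.apply_X _ (hC g List.mem_cons_self)]
    by_cases h : x = g.flip y
    · rw [h, Gate.flip_flip, delta_self, delta_self]
    · rw [delta_of_ne h, delta_of_ne]
      rintro rfl
      exact h (g.flip_flip x).symm

theorem Gate.apply_linear (g : Gate W) (φ ψ : (W → Bool) → ℂ) (c d : ℂ) :
    g.apply (c • φ + d • ψ) = c • g.apply φ + d • g.apply ψ := by
  funext x
  simp only [Gate.apply, Pi.add_apply, Pi.smul_apply, smul_eq_mul]
  split_ifs <;> ring

theorem Circuit.act_linear (C : Circuit W) (φ ψ : (W → Bool) → ℂ) (c d : ℂ) :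
    C.act (c • φ + d • ψ) = c • C.act φ + d • C.act ψ := by
  induction C generalizing φ ψ with
  | nil => rfl
  | cons g C ih => rw [Circuit.act_cons, Gate.apply_linear, ih]; rfl

theorem Gate.apply_inv (g : Gate W) (ψ : (W → Bool) → ℂ) :
    g.apply (Gate.apply { g with op := g.op.inv } ψ) = ψ := by
  have hf : ∀ x, Gate.Fires { g with op := g.op.inv } x ↔ g.Fires x := fun x => Iff.rfl
  funext x
  by_cases h : g.Fires x
  · have hu : ∀ b, Gate.Fires { g with op := g.op.inv } (Function.update x g.target b) :=
      fun b => (hf _).2 ((g.fires_update x b).2 h)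
    have hself : Function.update x g.target (x g.target) = x := Function.update_eq_self _ _
    rw [Gate.apply, if_pos h, Gate.apply, if_pos (hu _), Gate.apply, if_pos (hu _)]
    simp only [Function.update_self, Function.update_idem]
    cases ho : g.op with
    | X => cases hb : x g.target <;> rw [hb] at hself <;> simp [QOp.mat, QOp.inv, hself]
    | Z => cases hb : x g.target <;> rw [hb] at hself <;> simp [QOp.mat, QOp.inv, hself]
    | Ry θ =>
      have hcs : (Complex.sin θ) ^ 2 + (Complex.cos θ) ^ 2 = 1 := Complex.sin_sq_add_cos_sq _
      cases hb : x g.target <;> rw [hb] at hself <;> rw [hself] <;> simp [QOp.mat, QOp.inv]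
      · linear_combination (ψ x) * hcs
      · linear_combination (ψ x) * hcs
  · rw [Gate.apply, if_neg h, Gate.apply, if_neg (fun h' => h ((hf x).1 h'))]

theorem Circuit.act_inverse (C : Circuit W) (ψ : (W → Bool) → ℂ) :
    C.act ((Circuit.inverse C).act ψ) = ψ := by
  induction C generalizing ψ with
  | nil => rfl
  | cons g C ih =>
    rw [Circuit.inverse_cons, Circuit.act_append, Circuit.act_cons, Circuit.act_cons,
      Circuit.act_nil, Gate.apply_inv, ih]

/-- The real bilinear form of amplitude vectors. -/
def pairing [Fintype W] (φ ψ : (W → Bool) → ℂ) : ℂ := ∑ x, φ x * ψ x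

/-- All gates have real orthogonal matrices, so the transpose is the inverse and a bilinear pairing
without conjugation is enough. -/
theorem Gate.pairing_apply [Fintype W] (g : Gate W) (φ ψ : (W → Bool) → ℂ) :
    pairing (g.apply φ) ψ = pairing φ (Gate.apply { g with op := g.op.inv } ψ) := by
  let f : (W → Bool) → (W → Bool) := fun x => Function.update x g.target (!x g.target)
  have hinv : Function.Involutive f := by
    intro x
    simp [f]
  -- Each basis state is paired with the one that differs in the target bit, which reduces the claim
  -- to a single two by two block.
  have hsum : ∀ F : (W → Bool) → ℂ, 2 * ∑ x, F x = ∑ x, (F x + F (f x)) := fun F => by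
    rw [Finset.sum_add_distrib, two_mul]
    congr 1
    exact (Equiv.sum_comp hinv.toPerm F).symm
  have hfire : ∀ x, Gate.Fires { g with op := g.op.inv } x ↔ g.Fires x := fun x => Iff.rfl
  refine mul_left_cancel₀ (two_ne_zero (α := ℂ)) ?_
  unfold pairing
  rw [hsum, hsum]
  refine Finset.sum_congr rfl fun x _ => ?_
  by_cases hx : g.Fires x
  · have hx' : g.Fires (f x) := (g.fires_update x _).2 hx
    simp only [Gate.apply, hfire, hx, hx', if_true]
    have hself : Function.update x g.target (x g.target) = x := Function.update_eq_self _ _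
    cases hb : x g.target <;> rw [hb] at hself <;>
      simp only [f, hb, Bool.not_false, Bool.not_true, Function.update_self, Function.update_idem,
        hself] <;> cases g.op <;> simp [QOp.mat, QOp.inv] <;> ring
  · have hx' : ¬ g.Fires (f x) := fun h => hx ((g.fires_update x _).1 h)
    simp only [Gate.apply, hfire, hx, hx', if_false]

theorem Circuit.pairing_act [Fintype W] (C : Circuit W) (φ ψ : (W → Bool) → ℂ) :
    pairing (C.act φ) ψ = pairing φ ((Circuit.inverse C).act ψ) := by
  induction C generalizing φ ψ with
  | nil => rfl
  | cons g C ih =>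
    rw [Circuit.act_cons, ih, Gate.pairing_apply, Circuit.inverse_cons, Circuit.act_append]
    rfl

theorem pairing_delta [Fintype W] (y : W → Bool) (ψ : (W → Bool) → ℂ) :
    pairing (delta y) ψ = ψ y := by
  unfold pairing
  rw [Finset.sum_eq_single y]
  · rw [delta_self, one_mul]
  · intro x _ hx
    rw [delta_of_ne hx, zero_mul]
  · simp

/-- The amplitudes vanish except on basis states that agree with `x₀` outside of `D`. -/
def AgreesOff (D : W → Prop) (x₀ : W → Bool) (ψ : (W → Bool) → ℂ) : Prop :=
  ∀ x, ψ x ≠ 0 → ∀ w, ¬ D w → x w = x₀ w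

theorem AgreesOff.act {D : W → Prop} {x₀ : W → Bool} {C : Circuit W} (hC : ∀ g ∈ C, D g.target)
    {ψ : (W → Bool) → ℂ} (h : AgreesOff D x₀ ψ) : AgreesOff D x₀ (C.act ψ) := by
  induction C generalizing ψ with
  | nil => exact h
  | cons g C ih =>
    refine ih (fun g' hg' => hC g' (List.mem_cons_of_mem _ hg')) fun x hx w hw => ?_
    have hwt : w ≠ g.target := fun h' => hw (h' ▸ hC g List.mem_cons_self)
    change g.apply ψ x ≠ 0 at hx
    unfold Gate.apply at hx
    split_ifs at hx
    · by_cases h0 : ψ (Function.update x g.target false) = 0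
      · have h1 : ψ (Function.update x g.target true) ≠ 0 := by
          intro h1
          simp [h0, h1] at hx
        simpa [Function.update_of_ne hwt] using h _ h1 w hw
      · simpa [Function.update_of_ne hwt] using h _ h0 w hw
    · exact h x hx w hw

/-! ### Controlled permutations of wires -/

/-- The loop invariant rule behind all circuit computations: `P t` holds after the first t passes.
-/
theorem foldl_finRange_induction {σ : Type} (m : ℕ) (f : σ → Fin m → σ) (P : ℕ → σ → Prop)
    (x : σ) (h0 : P 0 x) (hs : ∀ (t : Fin m) (y : σ), P t y → P (t + 1) (f y t)) :
    P m ((List.finRange m).foldl f x) := by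
  induction m with
  | zero => exact h0
  | succ m ih =>
    rw [List.finRange_succ_last, List.foldl_append, List.foldl_map, List.foldl_cons, List.foldl_nil]
    have := ih (fun y j => f y j.castSucc) (fun t y h => hs t.castSucc y h)
    exact hs (Fin.last m) _ this

theorem Circuit.cl_flatMap {β : Type} (l : List β) (g : β → Circuit W) (x : W → Bool) :
    Circuit.cl (l.flatMap g) x = l.foldl (fun y b => Circuit.cl (g b) y) x := by
  induction l generalizing x with
  | nil => rfl
  | cons b l ih => rw [List.flatMap_cons, Circuit.cl_append, ih, List.foldl_cons]

/-- All controls are satisfied. -/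
def CtrlHolds (ctrl : List (W × Bool)) (x : W → Bool) : Prop := ∀ c ∈ ctrl, x c.1 = c.2

instance (ctrl : List (W × Bool)) (x : W → Bool) : Decidable (CtrlHolds ctrl x) :=
  inferInstanceAs (Decidable (∀ c ∈ ctrl, x c.1 = c.2))

theorem flip_mcx (ctrl : List (W × Bool)) (t : W) (ht : ∀ c ∈ ctrl, c.1 ≠ t) (x : W → Bool) :
    (mcx ctrl t).flip x = if CtrlHolds ctrl x then Function.update x t (!x t) else x := by
  unfold Gate.flip
  refine if_congr ?_ rfl rfl
  exact ⟨fun h c hc => h c hc (ht c hc), fun h c hc _ => h c hc⟩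

theorem ctrlHolds_cons (c : W × Bool) (ctrl : List (W × Bool)) (x : W → Bool) :
    CtrlHolds (c :: ctrl) x ↔ x c.1 = c.2 ∧ CtrlHolds ctrl x := by
  simp [CtrlHolds]

theorem ctrlHolds_nil (x : W → Bool) : CtrlHolds [] x := by simp [CtrlHolds]

theorem ctrlHolds_congr {ctrl : List (W × Bool)} {x y : W → Bool}
    (h : ∀ c ∈ ctrl, x c.1 = y c.1) : CtrlHolds ctrl x ↔ CtrlHolds ctrl y :=
  forall₂_congr fun c hc => by rw [h c hc]

/-- Three controlled NOTs swap two bits. The shared controls are never targets, so they keep their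
value between the three gates. -/
theorem cl_cswap (ctrl : List (W × Bool)) (u v : W) (huv : u ≠ v) (hu : ∀ c ∈ ctrl, c.1 ≠ u)
    (hv : ∀ c ∈ ctrl, c.1 ≠ v) (x : W → Bool) :
    Circuit.cl (cswap ctrl u v) x =
      if CtrlHolds ctrl x then fun w => x (Equiv.swap u v w) else x := by
  have h1 : ∀ (t s : W), t ≠ s → (∀ c ∈ ctrl, c.1 ≠ s) → ∀ y, (mcx ((t, true) :: ctrl) s).flip y =
      if y t = true ∧ CtrlHolds ctrl y then Function.update y s (!y s) else y := by
    intro t s hts hs y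
    rw [flip_mcx _ _ (by simpa [hts] using fun a b hab => hs (a, b) hab)]
    simp only [ctrlHolds_cons]
  have h2 : ∀ (s : W) (b : Bool) (y : W → Bool), (∀ c ∈ ctrl, c.1 ≠ s) →
      (CtrlHolds ctrl (Function.update y s b) ↔ CtrlHolds ctrl y) := fun s b y hs =>
    ctrlHolds_congr fun c hc => Function.update_of_ne (hs c hc) _ _
  simp only [cswap, Circuit.cl_cons, Circuit.cl_nil]
  rw [h1 u v huv hv x]
  by_cases hc : CtrlHolds ctrl x
  · simp only [hc, and_true, if_true]
    have e1 : (fun w => x (Equiv.swap u v w)) =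
        Function.update (Function.update x u (x v)) v (x u) := by
      funext w
      by_cases hw : w = v
      · subst hw; simp
      · by_cases hw' : w = u
        · subst hw'; simp [huv]
        · rw [Equiv.swap_apply_of_ne_of_ne hw' hw]; simp [hw, hw']
    rw [e1]
    cases hxu : x u <;> cases hxv : x v
    · simp only [Bool.false_eq_true, if_false]
      rw [h1 v u huv.symm hu, hxv]
      simp only [Bool.false_eq_true, false_and, if_false]
      rw [h1 u v huv hv, hxu]
      simp only [Bool.false_eq_true, false_and, if_false]
      funext w
      by_cases hw : w = v
      · subst hw; simp [hxv]
      · by_cases hw' : w = u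
        · subst hw'; simp [huv, hxu]
        · simp [hw, hw']
    · simp only [Bool.false_eq_true, if_false]
      rw [h1 v u huv.symm hu, hxv]
      simp only [hc, and_self, if_true]
      rw [h1 u v huv hv]
      simp only [h2 u _ x hu, hc, Function.update_self, hxu, Bool.not_false, and_self, if_true]
      funext w
      by_cases hw : w = v
      · subst hw; simp [huv.symm, hxv]
      · by_cases hw' : w = u
        · subst hw'; simp [huv]
        · simp [hw, hw']
    · simp only [if_true]
      rw [h1 v u huv.symm hu]
      simp only [h2 v _ x hv, hc, Function.update_self, hxv, Bool.not_false, and_self, if_true]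
      rw [h1 u v huv hv]
      simp only [Function.update_self, Function.update_of_ne huv, hxu, Bool.not_true,
        Bool.false_eq_true, false_and, if_false]
      funext w
      by_cases hw : w = v
      · subst hw; simp [huv.symm]
      · by_cases hw' : w = u
        · subst hw'; simp [huv]
        · simp [hw, hw']
    · simp only [if_true]
      rw [h1 v u huv.symm hu]
      simp only [Function.update_self, hxv, Bool.not_true, Bool.false_eq_true, false_and, if_false]
      rw [h1 u v huv hv]
      simp only [h2 v _ x hv, hc, Function.update_of_ne huv, hxu, and_self, if_true, Function.update_self,
        Bool.not_false, Function.update_idem]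
      funext w
      by_cases hw : w = v
      · subst hw; simp
      · by_cases hw' : w = u
        · subst hw'; simp [huv, hxu]
        · simp [hw, hw']
  · simp only [hc, and_false, if_false]
    rw [h1 v u huv.symm hu]
    simp only [hc, and_false, if_false]
    rw [h1 u v huv hv]
    simp only [hc, and_false, if_false]

/-- Where the content of position `j` comes from after rotating the positions `0, …, i`. -/
def rotIdx {m : ℕ} (i j : Fin m) : Fin m :=
  if (j : ℕ) = 0 then i else if j ≤ i then ⟨j - 1, by omega⟩ else j

theorem rotIdx_injective {m : ℕ} (i : Fin m) : Function.Injective (rotIdx i) := by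
  intro j j' h
  unfold rotIdx at h
  split_ifs at h <;> simp only [Fin.ext_iff, Fin.le_def] at * <;> omega

/-- The analogue of `rotIdx` after the first `t` swaps of the rotation. -/
def partialRotIdx {m : ℕ} (t : ℕ) (i j : Fin m) : Fin m :=
  -- After t swaps with position i, that position holds the former content of position t - 1. The
  -- minimum only keeps the index in range.
  if t = 0 then j else if j = i then ⟨min (t - 1) i, by omega⟩ else
    if (j : ℕ) < t then (if (j : ℕ) = 0 then i else ⟨j - 1, by omega⟩) else j

theorem partialRotIdx_self {m : ℕ} (i j : Fin m) : partialRotIdx i i j = rotIdx i j := by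
  unfold partialRotIdx rotIdx
  split_ifs <;> simp only [Fin.ext_iff, Fin.le_def] at * <;> omega

theorem partialRotIdx_swap {m : ℕ} (t i j : Fin m) (h : t < i) :
    partialRotIdx t i (Equiv.swap t i j) = partialRotIdx (t + 1) i j := by
  have hlt : (t : ℕ) < i := h
  by_cases hji : j = i
  · subst hji
    rw [Equiv.swap_apply_right]
    unfold partialRotIdx
    split_ifs <;> simp only [Fin.ext_iff, not_true_eq_false] at * <;> omega
  · by_cases hjt : j = t
    · subst hjt
      rw [Equiv.swap_apply_left]
      unfold partialRotIdx
      split_ifs <;> simp only [Fin.ext_iff, not_true_eq_false] at * <;> omega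
    · rw [Equiv.swap_apply_of_ne_of_ne hjt hji]
      unfold partialRotIdx
      split_ifs <;> simp only [Fin.ext_iff, not_true_eq_false] at * <;> omega

theorem cl_crotate (ctrl : List (W × Bool)) {m : ℕ} (f : Fin m → W) (hf : Function.Injective f)
    (hctrl : ∀ c ∈ ctrl, ∀ j, c.1 ≠ f j) (i : Fin m) (x : W → Bool) :
    (∀ w, (∀ j, w ≠ f j) → Circuit.cl (crotate ctrl f i) x w = x w) ∧
      ∀ j, Circuit.cl (crotate ctrl f i) x (f j) =
        if CtrlHolds ctrl x then x (f (rotIdx i j)) else x (f j) := by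
  unfold crotate
  rw [Circuit.cl_flatMap, List.foldl_filter]
  have key := foldl_finRange_induction m
    (fun (y : W → Bool) (j : Fin m) =>
      if (decide (j < i)) = true then Circuit.cl (cswap ctrl (f j) (f i)) y else y)
    (fun t y => (∀ w, (∀ j, w ≠ f j) → y w = x w) ∧ ∀ j, y (f j) =
      if CtrlHolds ctrl x then x (f (partialRotIdx (min t i) i j)) else x (f j)) x
    ⟨fun w _ => rfl, fun j => by simp [partialRotIdx]⟩ ?_
  · refine ⟨key.1, fun j => (key.2 j).trans ?_⟩
    rw [show min m (i : ℕ) = i by omega, partialRotIdx_self]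
  · intro t y ⟨hy1, hy2⟩
    simp only [decide_eq_true_eq]
    by_cases hti : t < i
    · have hlt : (t : ℕ) < i := hti
      rw [show min (t : ℕ) (i : ℕ) = t by omega] at hy2
      rw [if_pos hti, show min ((t : ℕ) + 1) (i : ℕ) = t + 1 by omega,
        cl_cswap ctrl _ _ (hf.ne hti.ne) (fun c hc => hctrl c hc _) (fun c hc => hctrl c hc _)]
      have hcx : CtrlHolds ctrl y ↔ CtrlHolds ctrl x :=
        ctrlHolds_congr fun c hc => hy1 _ (hctrl c hc)
      by_cases hc : CtrlHolds ctrl x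
      · rw [if_pos (hcx.2 hc)]
        simp only [hc, if_true] at hy2 ⊢
        refine ⟨fun w hw => ?_, fun j => ?_⟩
        · rw [Equiv.swap_apply_of_ne_of_ne (hw _) (hw _)]
          exact hy1 w hw
        · rw [← Function.Injective.map_swap hf, hy2, partialRotIdx_swap t i j hti]
      · rw [if_neg (fun h => hc (hcx.1 h))]
        simp only [hc, if_false] at hy2 ⊢
        exact ⟨hy1, hy2⟩
    · rw [if_neg hti]
      have hlt : (i : ℕ) ≤ t := not_lt.1 hti
      rw [show min ((t : ℕ) + 1) (i : ℕ) = i by omega]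
      rw [show min (t : ℕ) (i : ℕ) = i by omega] at hy2
      exact ⟨hy1, hy2⟩

theorem isClassical_crotate (ctrl : List (W × Bool)) {m : ℕ} (f : Fin m → W) (i : Fin m) :
    Circuit.IsClassical (crotate ctrl f i) := by
  intro g hg
  simp only [crotate, cswap, List.mem_flatMap, List.mem_cons, List.not_mem_nil, or_false] at hg
  obtain ⟨j, _, rfl | rfl | rfl⟩ := hg <;> rfl

end


/-! ### Preparation of the uniform superposition -/

/-- The basis state `x₀`, with the given content of the subset and the counter registers. -/
def setReg {a k : ℕ} (x₀ : Wire a k → Bool) (I : Fin a ⊕ Fin k → Bool) (c : Fin (a + 1) → Bool) :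
    Wire a k → Bool
  | .sub i => I i
  | .cnt j => c j
  | w => x₀ w

/-- One-hot encoding. -/
def oneHot (m u : ℕ) : Fin m → Bool := fun j => decide ((j : ℕ) = u)

/-- The wires on which `prepare` acts. -/
def Wire.InReg {a k : ℕ} : Wire a k → Prop
  | .sub _ => True
  | .cnt _ => True
  | _ => False

theorem setReg_of_not_inReg {a k : ℕ} (x₀ : Wire a k → Bool) (I : Fin a ⊕ Fin k → Bool)
    (c : Fin (a + 1) → Bool) (w : Wire a k) (hw : ¬ w.InReg) : setReg x₀ I c w = x₀ w := by
  cases w <;> simp [setReg, Wire.InReg] at *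

theorem setReg_injective {a k : ℕ} {x₀ : Wire a k → Bool} {I J : Fin a ⊕ Fin k → Bool}
    {c d : Fin (a + 1) → Bool} (h : setReg x₀ I c = setReg x₀ J d) : I = J ∧ c = d :=
  ⟨funext fun i => congrFun h (.sub i), funext fun j => congrFun h (.cnt j)⟩

theorem rotIdx_last {m : ℕ} (j : Fin (m + 1)) :
    rotIdx (Fin.last m) j = if (j : ℕ) = 0 then Fin.last m else ⟨j - 1, by omega⟩ := by
  unfold rotIdx
  split_ifs with h1 h2
  · rfl
  · rfl
  · exact absurd (Fin.le_last j) h2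

/-- Rotating the whole one-hot register adds one to the counter. For `u = m` the one would wrap
around to position 0, hence the strict bound. -/
theorem oneHot_rotIdx {m u : ℕ} (hu : u < m) :
    (fun j => oneHot (m + 1) u (rotIdx (Fin.last m) j)) = oneHot (m + 1) (u + 1) := by
  funext j
  rw [rotIdx_last]
  unfold oneHot
  split_ifs with h
  · simp only [Fin.val_last, decide_eq_decide]; omega
  · simp only [decide_eq_decide]; omega

/-- The rotation gates of `prepare` for one column. -/
def rotationGate (a k : ℕ) (c : Fin a ⊕ Fin k) (t : ℕ) (u : Fin (a + 1)) : Gate (Wire a k) :=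
  ⟨.Ry (Real.arcsin (Real.sqrt (((a : ℝ) - (u : ℕ)) / ((a : ℝ) + k - t)))), .sub c, [(.cnt u, true)]⟩

/-- The part of `prepare` for one column. -/
def prepareColumn (a k : ℕ) (ct : (Fin a ⊕ Fin k) × ℕ) : Circuit (Wire a k) :=
  ((List.finRange (a + 1)).map fun u => rotationGate a k ct.1 ct.2 u) ++
    crotate [(Wire.sub ct.1, true)] Wire.cnt (Fin.last a)

theorem prepare_eq (a k : ℕ) : prepare a k =
    [mcx [] (Wire.cnt 0)] ++ (columns a k).zipIdx.flatMap (prepareColumn a k) := rfl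

theorem Gate.apply_delta_of_not_fires {W : Type} [DecidableEq W] (g : Gate W) (y : W → Bool)
    (h : ¬ g.Fires y) : g.apply (delta y) = delta y := by
  funext x
  unfold Gate.apply
  split_ifs with hx
  · have hu : ∀ b, Function.update x g.target b ≠ y := fun b hb =>
      h (hb ▸ (g.fires_update x b).2 hx)
    have hxy : x ≠ y := fun hb => h (hb ▸ hx)
    rw [delta_of_ne (hu _), delta_of_ne (hu _), delta_of_ne hxy]
    simp
  · rfl

theorem Gate.apply_delta_Ry {W : Type} [DecidableEq W] (g : Gate W) (θ : ℝ) (hg : g.op = .Ry θ)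
    (y : W → Bool) (h : g.Fires y) (hy : y g.target = false) :
    g.apply (delta y) = (Real.cos θ : ℂ) • delta y +
      (Real.sin θ : ℂ) • delta (Function.update y g.target true) := by
  funext x
  have hself : Function.update y g.target false = y := by rw [← hy, Function.update_eq_self]
  simp only [Pi.add_apply, Pi.smul_apply, smul_eq_mul]
  by_cases h1 : x = y
  · subst h1
    have hne : x ≠ Function.update x g.target true := fun h' => by
      have := congrFun h' g.target
      simp [hy] at this
    rw [Gate.apply, if_pos h, hy, hself, delta_self, delta_of_ne hne, delta_of_ne hne.symm, hg]
    simp [QOp.mat]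
  · by_cases h2 : x = Function.update y g.target true
    · subst h2
      have hf : g.Fires (Function.update y g.target true) := (g.fires_update y _).2 h
      rw [Gate.apply, if_pos hf, delta_of_ne h1, delta_self]
      simp only [Function.update_self, Function.update_idem, hself, delta_self, delta_of_ne h1, hg]
      simp [QOp.mat]
    · rw [delta_of_ne h1, delta_of_ne h2]
      have hu : ∀ b, Function.update x g.target b ≠ y := by
        rintro b rfl
        cases hb : x g.target
        · apply h1
          rw [Function.update_self] at hy
          rw [hy, ← hb, Function.update_eq_self]
        · apply h2
          rw [Function.update_idem, ← hb, Function.update_eq_self]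
      unfold Gate.apply
      split_ifs
      · rw [delta_of_ne (hu _), delta_of_ne (hu _)]; simp
      · rw [delta_of_ne h1]; simp

theorem fires_rotationGate {a k : ℕ} (x₀ : Wire a k → Bool) (I : Fin a ⊕ Fin k → Bool) (u : ℕ)
    (c : Fin a ⊕ Fin k) (t : ℕ) (v : Fin (a + 1)) :
    (rotationGate a k c t v).Fires (setReg x₀ I (oneHot (a + 1) u)) ↔ (v : ℕ) = u := by
  simp [rotationGate, Gate.Fires, setReg, oneHot]

theorem act_rotationGates_of_notMem {a k : ℕ} (x₀ : Wire a k → Bool) (I : Fin a ⊕ Fin k → Bool)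
    (u : ℕ) (c : Fin a ⊕ Fin k) (t : ℕ) (l : List (Fin (a + 1))) (hl : ∀ v ∈ l, (v : ℕ) ≠ u) :
    Circuit.act (l.map fun v => rotationGate a k c t v) (delta (setReg x₀ I (oneHot (a + 1) u))) =
      delta (setReg x₀ I (oneHot (a + 1) u)) := by
  induction l with
  | nil => rfl
  | cons v l ih =>
    rw [List.map_cons, Circuit.act_cons, Gate.apply_delta_of_not_fires,
      ih (fun w hw => hl w (List.mem_cons_of_mem _ hw))]
    rw [fires_rotationGate]
    exact hl v List.mem_cons_self

theorem cl_crotate_cnt {a k : ℕ} (x₀ : Wire a k → Bool) (I : Fin a ⊕ Fin k → Bool)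
    (d : Fin (a + 1) → Bool) (c : Fin a ⊕ Fin k) :
    Circuit.cl (crotate [(Wire.sub c, true)] Wire.cnt (Fin.last a)) (setReg x₀ I d) =
      setReg x₀ I (if I c = true then fun j => d (rotIdx (Fin.last a) j) else d) := by
  obtain ⟨h1, h2⟩ := cl_crotate [(Wire.sub c, true)] (Wire.cnt : Fin (a + 1) → Wire a k)
    (fun i j h => by simpa using h) (by simp) (Fin.last a) (setReg x₀ I d)
  have hc : CtrlHolds [(Wire.sub c, true)] (setReg x₀ I d) ↔ I c = true := by
    simp [CtrlHolds, setReg]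
  funext w
  cases w with
  | cnt j =>
    rw [h2 j]
    by_cases hI : I c = true
    · rw [if_pos (hc.2 hI)]; simp [setReg, hI]
    · rw [if_neg (fun h => hI (hc.1 h))]; simp [setReg, hI]
  | _ => rw [h1 _ (by simp)]; rfl

/-- Of the rotation gates only the one belonging to the counter value u fires. The counter content
`d` of the second branch is described only for `u < a`: for `u = a` the counter would wrap around,
but then the rotation angle is 0 and the branch has amplitude 0. -/
theorem act_prepareColumn {a k : ℕ} (x₀ : Wire a k → Bool) (I : Fin a ⊕ Fin k → Bool) (u : ℕ)
    (hu : u ≤ a) (c : Fin a ⊕ Fin k) (hc : I c = false) (t : ℕ) (θ : ℝ)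
    (hθ : θ = Real.arcsin (Real.sqrt (((a : ℝ) - u) / ((a : ℝ) + k - t)))) :
    ∃ d, (u < a → d = oneHot (a + 1) (u + 1)) ∧
    Circuit.act (prepareColumn a k (c, t)) (delta (setReg x₀ I (oneHot (a + 1) u))) =
      (Real.cos θ : ℂ) • delta (setReg x₀ I (oneHot (a + 1) u)) +
      (Real.sin θ : ℂ) • delta (setReg x₀ (Function.update I c true) d) := by
  refine ⟨fun j => oneHot (a + 1) u (rotIdx (Fin.last a) j), fun h => oneHot_rotIdx h, ?_⟩
  let v : Fin (a + 1) := ⟨u, by omega⟩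
  obtain ⟨l₁, l₂, hl⟩ := List.append_of_mem (List.mem_finRange v)
  have hnd : (l₁ ++ v :: l₂).Nodup := hl ▸ List.nodup_finRange (a + 1)
  rw [List.nodup_middle, List.nodup_cons, List.mem_append, not_or] at hnd
  have h1 : ∀ w ∈ l₁, (w : ℕ) ≠ u := fun w hw h => hnd.1.1 (by
    rwa [show v = w from Fin.ext h.symm])
  have h2 : ∀ w ∈ l₂, (w : ℕ) ≠ u := fun w hw h => hnd.1.2 (by
    rwa [show v = w from Fin.ext h.symm])
  have hupd : Function.update (setReg x₀ I (oneHot (a + 1) u)) (Wire.sub c) true =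
      setReg x₀ (Function.update I c true) (oneHot (a + 1) u) := by
    funext w
    cases w with
    | sub i =>
      by_cases hi : i = c
      · subst hi; simp [setReg]
      · rw [Function.update_of_ne (by simpa using hi)]; simp [setReg, hi]
    | _ => rw [Function.update_of_ne (by simp)]; rfl
  unfold prepareColumn
  rw [hl, List.map_append, List.map_cons, Circuit.act_append, Circuit.act_append,
    act_rotationGates_of_notMem _ _ _ _ _ _ h1, Circuit.act_cons,
    Gate.apply_delta_Ry _ θ (by rw [hθ]; rfl) _ ((fires_rotationGate _ _ _ _ _ _).2 rfl) (by exact hc),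
    Circuit.act_linear, act_rotationGates_of_notMem _ _ _ _ _ _ h2]
  change Circuit.act _ (_ + _ • Circuit.act _ (delta (Function.update _ (Wire.sub c) true))) = _
  rw [hupd, act_rotationGates_of_notMem _ _ _ _ _ _ h2, Circuit.act_linear,
    Circuit.act_delta (isClassical_crotate _ _ _), Circuit.act_delta (isClassical_crotate _ _ _),
    cl_crotate_cnt, cl_crotate_cnt]
  simp [hc]

/-- The basis states that occur after treating the columns in `l`, starting from the subset `I`
with `u` elements. -/
def Reachable {a k : ℕ} (x₀ : Wire a k → Bool) (l : List (Fin a ⊕ Fin k))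
    (I : Fin a ⊕ Fin k → Bool) (u : ℕ) (x : Wire a k → Bool) : Prop :=
  ∃ J, x = setReg x₀ J (oneHot (a + 1) a) ∧ (∀ c ∉ l, J c = I c) ∧ l.countP (fun c => J c) + u = a

/-- Every final subset either avoids or contains the column c; the two alternatives are the two
branches of the rotation. -/
theorem reachable_cons {a k : ℕ} (x₀ : Wire a k → Bool) (l : List (Fin a ⊕ Fin k))
    (c : Fin a ⊕ Fin k) (hcl : c ∉ l) (I : Fin a ⊕ Fin k → Bool) (hc : I c = false) (u : ℕ)
    (x : Wire a k → Bool) : Reachable x₀ (c :: l) I u x ↔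
      Reachable x₀ l I u x ∨ Reachable x₀ l (Function.update I c true) (u + 1) x := by
  constructor
  · rintro ⟨J, rfl, hJ, hn⟩
    rw [List.countP_cons] at hn
    cases hJc : J c
    · refine Or.inl ⟨J, rfl, fun d hd => ?_, by simpa [hJc] using hn⟩
      by_cases hdc : d = c
      · rw [hdc, hJc, hc]
      · exact hJ d (by simp [hdc, hd])
    · refine Or.inr ⟨J, rfl, fun d hd => ?_, by simp [hJc] at hn; omega⟩
      by_cases hdc : d = c
      · rw [hdc, hJc, Function.update_self]
      · rw [Function.update_of_ne hdc]; exact hJ d (by simp [hdc, hd])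
  · rintro (⟨J, rfl, hJ, hn⟩ | ⟨J, rfl, hJ, hn⟩)
    · refine ⟨J, rfl, fun d hd => hJ d (fun h => hd (List.mem_cons_of_mem _ h)), ?_⟩
      rw [List.countP_cons, hJ c hcl, hc]
      simpa using hn
    · refine ⟨J, rfl, fun d hd => ?_, ?_⟩
      · rw [hJ d (fun h => hd (List.mem_cons_of_mem _ h)), Function.update_of_ne]
        exact fun h => hd (h ▸ List.mem_cons_self)
      · rw [List.countP_cons, hJ c hcl, Function.update_self]
        simp only [if_true]; omega

theorem not_reachable_both {a k : ℕ} (x₀ : Wire a k → Bool) (l : List (Fin a ⊕ Fin k))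
    (c : Fin a ⊕ Fin k) (hcl : c ∉ l) (I : Fin a ⊕ Fin k → Bool) (hc : I c = false) (u : ℕ)
    (x : Wire a k → Bool) (h1 : Reachable x₀ l I u x)
    (h2 : Reachable x₀ l (Function.update I c true) (u + 1) x) : False := by
  obtain ⟨J, rfl, hJ, -⟩ := h1
  obtain ⟨J', h, hJ', -⟩ := h2
  have := (setReg_injective h).1
  subst this
  have h3 := hJ c hcl
  rw [hJ' c hcl, Function.update_self, hc] at h3
  exact Bool.false_ne_true h3.symm

theorem sqrt_mul_inv_sqrt {p x y : ℝ} (hp : 0 ≤ p) (h : p * y = x) (hy : 0 < y) (hx : 0 < x) :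
    Real.sqrt p * (Real.sqrt x)⁻¹ = (Real.sqrt y)⁻¹ := by
  rw [← h, Real.sqrt_mul hp, mul_inv, ← mul_assoc, mul_inv_cancel₀, one_mul]
  have : 0 < p := by
    rcases hp.lt_or_eq with h' | h'
    · exact h'
    · rw [← h', zero_mul] at h; exact absurd h hx.ne
  exact (Real.sqrt_pos.2 this).ne'

-- Sequential sampling without replacement. With m columns left to select among l + 1, the branches
-- have squared amplitudes 1 - m/(l+1) and m/(l+1), and multiplying by 1/C(l,m) and 1/C(l,m-1) gives
-- 1/C(l+1,m) in both cases. The branches end in distinct basis states, so there is no interference.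
open Classical in
theorem act_prepareColumns {a k : ℕ} (x₀ : Wire a k → Bool) (l : List (Fin a ⊕ Fin k)) (t u : ℕ)
    (hl : l.Nodup) (ht : t + l.length = a + k) (hu : u ≤ a) (hul : a ≤ u + l.length)
    (I : Fin a ⊕ Fin k → Bool) (hI : ∀ c ∈ l, I c = false) (x : Wire a k → Bool) :
    Circuit.act ((l.zipIdx t).flatMap (prepareColumn a k))
        (delta (setReg x₀ I (oneHot (a + 1) u))) x =
      if Reachable x₀ l I u x then (((Real.sqrt (l.length.choose (a - u)))⁻¹ : ℝ) : ℂ) else 0 := by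
  induction l generalizing t u I with
  | nil =>
    have hua : u = a := by simp at hul; omega
    subst hua
    simp only [List.zipIdx_nil, List.flatMap_nil, Circuit.act_nil]
    by_cases hx : x = setReg x₀ I (oneHot (u + 1) u)
    · rw [if_pos ⟨I, hx, fun _ _ => rfl, by simp⟩, hx, delta_self]; simp
    · rw [if_neg, delta_of_ne hx]
      rintro ⟨J, rfl, hJ, -⟩
      exact hx (by rw [show J = I from funext fun c => hJ c (by simp)])
  | cons c l ih =>
    rw [List.nodup_cons] at hl
    have hc := hI c List.mem_cons_self
    have hI' : ∀ d ∈ l, I d = false := fun d hd => hI d (List.mem_cons_of_mem _ hd)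
    rw [List.length_cons] at ht hul
    obtain ⟨d, hd, hact⟩ := act_prepareColumn x₀ I u hu c hc t _ rfl
    have hden : (a : ℝ) + k - t = l.length + 1 := by
      have : ((t + (l.length + 1) : ℕ) : ℝ) = ((a + k : ℕ) : ℝ) := by rw [ht]
      push_cast at this; linarith
    rw [List.zipIdx_cons, List.flatMap_cons, Circuit.act_append, hact, Circuit.act_linear, hden]
    have hm0 : (0 : ℝ) ≤ (a : ℝ) - u := by
      rw [sub_nonneg]; exact_mod_cast hu
    have hm1 : (a : ℝ) - u ≤ l.length + 1 := by
      have : (a : ℝ) ≤ ((u + (l.length + 1) : ℕ) : ℝ) := by exact_mod_cast hul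
      push_cast at this; linarith
    have hL : (0 : ℝ) < l.length + 1 := by positivity
    set p : ℝ := ((a : ℝ) - u) / (l.length + 1) with hp
    have hp0 : 0 ≤ p := div_nonneg hm0 hL.le
    have hp1 : p ≤ 1 := (div_le_one hL).2 hm1
    have hs1 : Real.sqrt p ≤ 1 := Real.sqrt_le_one.2 hp1
    rw [Real.sin_arcsin (by linarith [Real.sqrt_nonneg p]) hs1, Real.cos_arcsin, Real.sq_sqrt hp0]
    simp only [Pi.add_apply, Pi.smul_apply, smul_eq_mul]
    have hcast : ((a - u : ℕ) : ℝ) = (a : ℝ) - u := by rw [Nat.cast_sub hu]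
    have T1 : ((Real.sqrt (1 - p) : ℝ) : ℂ) *
        Circuit.act ((l.zipIdx (t + 1)).flatMap (prepareColumn a k))
          (delta (setReg x₀ I (oneHot (a + 1) u))) x =
        if Reachable x₀ l I u x then
          (((Real.sqrt ((l.length + 1).choose (a - u)))⁻¹ : ℝ) : ℂ) else 0 := by
      by_cases hful : a ≤ u + l.length
      · rw [ih (t + 1) u hl.2 (by omega) hu hful I hI']
        split_ifs with hR
        · rw [← Complex.ofReal_mul]
          congr 1
          refine sqrt_mul_inv_sqrt (by linarith) ?_ ?_ ?_
          · have h3 := Nat.choose_mul_succ_eq l.length (a - u)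
            have h4 : ((l.length + 1 - (a - u) : ℕ) : ℝ) = l.length + 1 - ((a : ℝ) - u) := by
              rw [Nat.cast_sub (by omega), hcast]; push_cast; ring
            have h5 : ((l.length.choose (a - u) : ℕ) : ℝ) * (l.length + 1) =
                ((l.length + 1).choose (a - u) : ℕ) * (l.length + 1 - ((a : ℝ) - u)) := by
              rw [← h4]; exact_mod_cast h3
            have h6 : (1 - p) = (l.length + 1 - ((a : ℝ) - u)) / (l.length + 1) := by
              rw [hp]; field_simp
            rw [h6, div_mul_eq_mul_div, div_eq_iff hL.ne', mul_comm, ← h5]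
          · exact_mod_cast Nat.choose_pos (by omega)
          · exact_mod_cast Nat.choose_pos (by omega)
        · rw [mul_zero]
      -- All remaining columns are needed, so the branch that skips one has amplitude 0 and reaches
      -- no subset.
      · have hpe : p = 1 := by
          rw [hp, div_eq_one_iff_eq hL.ne']
          have : ((u + (l.length + 1) : ℕ) : ℝ) = a := by
            have : u + (l.length + 1) = a := by omega
            rw [this]
          push_cast at this; linarith
        rw [if_neg, hpe]
        · simp
        · rintro ⟨J, -, -, hn⟩
          have := List.countP_le_length (p := fun c => J c) (l := l)
          omega
    have T2 : ((Real.sqrt p : ℝ) : ℂ) *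
        Circuit.act ((l.zipIdx (t + 1)).flatMap (prepareColumn a k))
          (delta (setReg x₀ (Function.update I c true) d)) x =
        if Reachable x₀ l (Function.update I c true) (u + 1) x then
          (((Real.sqrt ((l.length + 1).choose (a - u)))⁻¹ : ℝ) : ℂ) else 0 := by
      by_cases hua : u < a
      · rw [hd hua, ih (t + 1) (u + 1) hl.2 (by omega) hua (by omega) _ (fun e he => by
          rw [Function.update_of_ne (fun h : e = c => hl.1 (h ▸ he)), hI' e he])]
        split_ifs with hR
        · rw [← Complex.ofReal_mul]
          congr 1
          obtain ⟨m, hm⟩ : ∃ m, a - u = m + 1 := ⟨a - u - 1, by omega⟩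
          rw [show a - (u + 1) = m by omega, hm]
          refine sqrt_mul_inv_sqrt hp0 ?_ ?_ ?_
          · have h3 := Nat.add_one_mul_choose_eq l.length m
            have h4 : (a : ℝ) - u = m + 1 := by rw [← hcast, hm]; push_cast; ring
            have h5 : ((l.length : ℝ) + 1) * (l.length.choose m : ℕ) =
                ((l.length + 1).choose (m + 1) : ℕ) * ((m : ℝ) + 1) := by exact_mod_cast h3
            rw [hp, h4, div_mul_eq_mul_div, div_eq_iff hL.ne', mul_comm, ← h5, mul_comm]
          · exact_mod_cast Nat.choose_pos (by omega)
          · exact_mod_cast Nat.choose_pos (by omega)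
        · rw [mul_zero]
      -- Already `a` columns are selected, so the branch that takes another one has amplitude 0.
      · have hpe : p = 0 := by
          rw [hp, show u = a by omega]; simp
        rw [if_neg, hpe]
        · simp
        · rintro ⟨J, -, -, hn⟩
          omega
    rw [T1, T2]
    have hr := reachable_cons x₀ l c hl.1 I hc u x
    have hb := not_reachable_both x₀ l c hl.1 I hc u x
    rw [List.length_cons]
    by_cases h1 : Reachable x₀ l I u x
    · rw [if_pos h1, if_neg (fun h2 => hb h1 h2), if_pos (hr.2 (Or.inl h1)), add_zero]
    · by_cases h2 : Reachable x₀ l (Function.update I c true) (u + 1) x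
      · rw [if_neg h1, if_pos h2, if_pos (hr.2 (Or.inr h2)), zero_add]
      · rw [if_neg h1, if_neg h2, if_neg (fun h => (hr.1 h).elim h1 h2), add_zero]

/-- The basis states in the uniform superposition. -/
def IsSubsetState {a k : ℕ} (x₀ : Wire a k → Bool) (x : Wire a k → Bool) : Prop :=
  ∃ J : Fin a ⊕ Fin k → Bool, x = setReg x₀ J (oneHot (a + 1) a) ∧
    (Finset.univ.filter fun c => J c = true).card = a

open Classical in
theorem act_prepare {a k : ℕ} (x₀ : Wire a k → Bool)
    (hx₀ : setReg x₀ (fun _ => false) (fun _ => false) = x₀) (x : Wire a k → Bool) :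
    Circuit.act (prepare a k) (delta x₀) x =
      if IsSubsetState x₀ x then (((Real.sqrt ((a + k).choose a))⁻¹ : ℝ) : ℂ) else 0 := by
  have h0 : Circuit.act [mcx [] (Wire.cnt 0)] (delta x₀) =
      delta (setReg x₀ (fun _ => false) (oneHot (a + 1) 0)) := by
    rw [Circuit.act_delta (by intro g hg; simp at hg; rw [hg]; rfl), Circuit.cl_cons, Circuit.cl_nil,
      flip_mcx _ _ (by simp), if_pos (ctrlHolds_nil _)]
    congr 1
    nth_rw 1 [← hx₀]
    funext w
    cases w with
    | cnt j =>
      by_cases hj : j = 0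
      · subst hj
        rw [← hx₀]; simp [setReg, oneHot]
      · rw [Function.update_of_ne (by simpa using hj)]
        have : (j : ℕ) ≠ 0 := fun h => hj (Fin.ext h)
        simp [setReg, oneHot, this]
    | _ => rw [Function.update_of_ne (by simp)]; rfl
  rw [prepare_eq, Circuit.act_append, h0, act_prepareColumns x₀ _ 0 0 (nodup_columns a k)
    (by rw [length_columns]; omega) (by omega) (by rw [length_columns]; omega) _ (by simp),
    length_columns, Nat.sub_zero]
  refine if_congr ?_ rfl rfl
  refine exists_congr fun J => and_congr_right fun _ => ?_
  rw [← length_filter_columns, List.countP_eq_length_filter]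
  simp [mem_columns]

theorem prepare_target (a k : ℕ) : ∀ g ∈ prepare a k, g.target.InReg := by
  intro g hg
  simp only [prepare, crotate, cswap, List.mem_append, List.mem_flatMap, List.mem_map,
    List.mem_cons, List.not_mem_nil, or_false] at hg
  rcases hg with rfl | ⟨ct, _, ⟨u, _, rfl⟩ | ⟨j, _, rfl | rfl | rfl⟩⟩ <;> trivial

theorem inverse_target {W : Type} (D : W → Prop) (C : Circuit W) (h : ∀ g ∈ C, D g.target) :
    ∀ g ∈ Circuit.inverse C, D g.target := by
  intro g hg
  simp only [Circuit.inverse, List.mem_map, List.mem_reverse] at hg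
  obtain ⟨g', hg', rfl⟩ := hg
  exact h g' hg'

/-- A sign flip needs a target bit that is one. The surrounding NOT gates on counter position 0
provide it, and the other bits are required to be zero by the controls. -/
theorem act_reflectZero {a k : ℕ} (v : (Wire a k → Bool) → ℂ) (x : Wire a k → Bool) :
    Circuit.act (reflectZero a k) v x =
      if (∀ c, x (.sub c) = false) ∧ ∀ u, x (.cnt u) = false then -v x else v x := by
  have hX : ∀ (φ : (Wire a k → Bool) → ℂ) (y : Wire a k → Bool),
      (mcx [] (Wire.cnt 0) : Gate (Wire a k)).apply φ y =
        φ (Function.update y (.cnt 0) (!y (.cnt 0))) := by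
    intro φ y
    rw [Gate.apply_X _ rfl, flip_mcx _ _ (by simp), if_pos (ctrlHolds_nil _)]
  unfold reflectZero
  rw [Circuit.act_cons, Circuit.act_cons, Circuit.act_cons, Circuit.act_nil, hX,
    Gate.apply_Z _ rfl, hX]
  simp only [Function.update_self, Function.update_idem, Bool.not_not, Function.update_eq_self]
  refine if_congr ?_ rfl rfl
  constructor
  · rintro ⟨hf, h0⟩
    constructor
    · intro c
      have := hf (.sub c, false) (by simp [mem_columns]) (by simp)
      simpa using this
    · intro u
      by_cases hu : u = 0
      · subst hu; simpa using h0
      · have := hf (.cnt u, false) (by simp [hu]) (by simpa using hu)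
        rwa [Function.update_of_ne (by simpa using hu)] at this
  · rintro ⟨h1, h2⟩
    refine ⟨fun c hc hct => ?_, by simpa using h2 0⟩
    rw [Function.update_of_ne hct]
    simp only [List.mem_append, List.mem_map, List.mem_filter] at hc
    rcases hc with ⟨d, _, rfl⟩ | ⟨u, _, rfl⟩
    · exact h1 d
    · exact h2 u

/-- Reflection about the uniform superposition. -/
theorem act_diffusion {a k : ℕ} (x₀ : Wire a k → Bool)
    (hx₀ : setReg x₀ (fun _ => false) (fun _ => false) = x₀) (v : (Wire a k → Bool) → ℂ)
    (hv : AgreesOff Wire.InReg x₀ v) :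
    Circuit.act (Circuit.inverse (prepare a k) ++ reflectZero a k ++ prepare a k) v =
      (1 : ℂ) • v + (-2 * pairing (Circuit.act (prepare a k) (delta x₀)) v) •
        Circuit.act (prepare a k) (delta x₀) := by
  rw [Circuit.act_append, Circuit.act_append, Circuit.pairing_act, pairing_delta]
  set y := Circuit.act (Circuit.inverse (prepare a k)) v with hy
  have hya : AgreesOff Wire.InReg x₀ y := hv.act (inverse_target _ _ (prepare_target a k))
  -- The reflection fixes only the subset and counter registers. Since `y` is supported on states
  -- that agree with `x₀` elsewhere, flipping the zero content of these registers flips `x₀` alone.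
  have hr : Circuit.act (reflectZero a k) y = (1 : ℂ) • y + (-2 * y x₀) • delta x₀ := by
    funext x
    rw [act_reflectZero]
    simp only [Pi.add_apply, Pi.smul_apply, smul_eq_mul, one_mul]
    by_cases hx : x = x₀
    · subst hx
      rw [delta_self, if_pos]
      · ring
      · rw [← hx₀]; exact ⟨fun _ => rfl, fun _ => rfl⟩
    · rw [delta_of_ne hx, mul_zero, add_zero]
      split_ifs with h
      · have : y x = 0 := by
          by_contra hne
          apply hx
          rw [← hx₀]
          funext w
          cases w with
          | sub c => exact h.1 c
          | cnt u => exact h.2 u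
          | _ => exact hya x hne _ (by simp [Wire.InReg])
        rw [this, neg_zero]
      · rfl
  rw [hr, Circuit.act_linear, hy, Circuit.act_inverse]


/-! ### Moving the selected columns and rows to the front -/

/-- The basis state with the given register contents. -/
def st {a k : ℕ} (sub : Fin a ⊕ Fin k → Bool) (cnt : Fin (a + 1) → Bool)
    (M : Fin a → Fin k → Bool) (S : Fin a → Bool) (A G : Fin k → Bool) (V : Fin (a + 1) → Bool) :
    Wire a k → Bool
  | .sub c => sub c
  | .cnt u => cnt u
  | .mat i j => M i j
  | .syn i => S i
  | .act j => A j
  | .sing j => G j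
  | .wgt u => V u

/-- The order of the positions after moving those selected by `b` to the front. -/
def frontIdx {m : ℕ} (b : Fin m → Bool) : Fin m → Fin m :=
  (List.finRange m).foldl (fun π t => if b t = true then fun j => π (rotIdx t j) else π) id

/-- Invariant after t passes: the arrangement is injective, positions from t on are untouched, and
among the first t the selected ones form an initial segment. Rotating a newly met selected position
to the front lengthens this segment by one. -/
theorem frontIdx_spec {m : ℕ} (b : Fin m → Bool) : Function.Injective (frontIdx b) ∧
    ∀ j j', j ≤ j' → b (frontIdx b j') = true → b (frontIdx b j) = true := by
  have key := foldl_finRange_induction m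
    (fun (π : Fin m → Fin m) t => if b t = true then fun j => π (rotIdx t j) else π)
    (fun t π => Function.Injective π ∧ (∀ j : Fin m, t ≤ (j : ℕ) → π j = j) ∧
      ∀ j j' : Fin m, j ≤ j' → (j' : ℕ) < t → b (π j') = true → b (π j) = true) id
    ⟨Function.injective_id, fun _ _ => rfl, fun _ _ _ h => absurd h (by omega)⟩ ?_
  · exact ⟨key.1, fun j j' h => key.2.2 j j' h j'.2⟩
  · rintro t π ⟨h1, h2, h3⟩
    by_cases hb : b t = true
    · simp only [hb, if_true]
      refine ⟨fun j j' h => rotIdx_injective t (h1 h), fun j hj => ?_, fun j j' hj hj' h => ?_⟩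
      · have : rotIdx t j = j := by
          unfold rotIdx
          rw [if_neg (by omega), if_neg (by rw [Fin.le_def]; omega)]
        rw [this, h2 j (by omega)]
      · by_cases h0 : (j : ℕ) = 0
        · have : rotIdx t j = t := by unfold rotIdx; rw [if_pos h0]
          rw [this, h2 t le_rfl, hb]
        · have hjj : (j : ℕ) ≤ j' := hj
          have e1 : rotIdx t j = ⟨j - 1, by omega⟩ := by
            unfold rotIdx
            rw [if_neg h0, if_pos (by rw [Fin.le_def]; omega)]
          have e2 : rotIdx t j' = ⟨j' - 1, by omega⟩ := by
            unfold rotIdx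
            rw [if_neg (by omega), if_pos (by rw [Fin.le_def]; omega)]
          rw [e1]
          rw [e2] at h
          refine h3 _ _ ?_ ?_ h
          · rw [Fin.le_def]; simp only []; omega
          · simp only []; omega
    · simp only [hb, Bool.false_eq_true, if_false]
      refine ⟨h1, fun j hj => h2 j (by omega), fun j j' hj hj' h => ?_⟩
      rcases Nat.lt_or_ge j' t with hlt | hge
      · exact h3 j j' hj hlt h
      · have : j' = t := Fin.ext (by omega)
        subst this
        rw [h2 j' le_rfl] at h
        exact absurd h hb

theorem downward_closed_iff {m : ℕ} (D : Fin m → Bool)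
    (hD : ∀ j j', j ≤ j' → D j' = true → D j = true) (j : Fin m) :
    D j = true ↔ (j : ℕ) < (Finset.univ.filter fun i => D i = true).card := by
  constructor
  · intro h
    have hsub : Finset.Iic j ⊆ Finset.univ.filter fun i => D i = true := fun i hi => by
      simpa using hD i j (by simpa using hi) h
    have := Finset.card_le_card hsub
    rw [Fin.card_Iic] at this
    omega
  · intro h
    by_contra hj
    have hsub : (Finset.univ.filter fun i => D i = true) ⊆ Finset.Iio j := fun i hi => by
      rw [Finset.mem_Iio]
      by_contra hij
      exact hj (hD j i (not_lt.1 hij) (by simpa using hi))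
    have := Finset.card_le_card hsub
    rw [Fin.card_Iio] at this
    omega

/-- An initial segment is determined by its length, which is the number of selected positions
because the arrangement is a bijection. -/
theorem frontIdx_iff {m : ℕ} (b : Fin m → Bool) (j : Fin m) : b (frontIdx b j) = true ↔
    (j : ℕ) < (Finset.univ.filter fun i => b i = true).card := by
  obtain ⟨h1, h2⟩ := frontIdx_spec b
  rw [downward_closed_iff (fun j => b (frontIdx b j)) h2 j]
  have hbij : Function.Bijective (frontIdx b) := Finite.injective_iff_bijective.1 h1
  have : (Finset.univ.filter fun i => b (frontIdx b i) = true).card =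
      (Finset.univ.filter fun i => b i = true).card := by
    refine Finset.card_bij (fun i _ => frontIdx b i) (by simp) (fun i _ j _ h => h1 h) ?_
    intro i hi
    obtain ⟨j, rfl⟩ := hbij.2 i
    exact ⟨j, by simpa using hi, rfl⟩
  rw [this]

section

variable {a k : ℕ} (sub : Fin a ⊕ Fin k → Bool) (cnt : Fin (a + 1) → Bool)
  (M : Fin a → Fin k → Bool) (S : Fin a → Bool) (A G : Fin k → Bool) (V : Fin (a + 1) → Bool)

theorem cl_rotate_matRow (ctrl : Fin a ⊕ Fin k) (b : Bool) (i : Fin a) (j : Fin k) :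
    Circuit.cl (crotate [(Wire.sub ctrl, b)] (Wire.mat i) j) (st sub cnt M S A G V) =
      st sub cnt (fun i' j' => if i' = i ∧ sub ctrl = b then M i' (rotIdx j j') else M i' j')
        S A G V := by
  obtain ⟨h1, h2⟩ := cl_crotate [(Wire.sub ctrl, b)] (Wire.mat i : Fin k → Wire a k)
    (fun i j h => by simpa using h) (by simp) j (st sub cnt M S A G V)
  have hc : CtrlHolds [(Wire.sub ctrl, b)] (st sub cnt M S A G V) ↔ sub ctrl = b := by
    simp [CtrlHolds, st]
  funext w
  cases w with
  | mat i' j' =>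
    by_cases hi : i' = i
    · subst hi
      rw [h2 j', if_congr hc rfl rfl]; simp [st]
    · rw [h1 _ (by simp [hi])]; simp [st, hi]
  | _ => rw [h1 _ (by simp)]; rfl

theorem cl_rotate_matCol (ctrl : Fin a ⊕ Fin k) (b : Bool) (i : Fin a) (j : Fin k) :
    Circuit.cl (crotate [(Wire.sub ctrl, b)] (fun l => Wire.mat l j) i) (st sub cnt M S A G V) =
      st sub cnt (fun i' j' => if j' = j ∧ sub ctrl = b then M (rotIdx i i') j' else M i' j')
        S A G V := by
  obtain ⟨h1, h2⟩ := cl_crotate [(Wire.sub ctrl, b)] (fun l => (Wire.mat l j : Wire a k))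
    (fun i j h => by simpa using h) (by simp) i (st sub cnt M S A G V)
  have hc : CtrlHolds [(Wire.sub ctrl, b)] (st sub cnt M S A G V) ↔ sub ctrl = b := by
    simp [CtrlHolds, st]
  funext w
  cases w with
  | mat i' j' =>
    by_cases hj : j' = j
    · subst hj
      rw [h2 i', if_congr hc rfl rfl]; simp [st]
    · rw [h1 _ (by simp [hj])]; simp [st, hj]
  | _ => rw [h1 _ (by simp)]; rfl

theorem cl_rotate_act (ctrl : Fin a ⊕ Fin k) (b : Bool) (j : Fin k) :
    Circuit.cl (crotate [(Wire.sub ctrl, b)] Wire.act j) (st sub cnt M S A G V) =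
      st sub cnt M S (fun j' => if sub ctrl = b then A (rotIdx j j') else A j') G V := by
  obtain ⟨h1, h2⟩ := cl_crotate [(Wire.sub ctrl, b)] (Wire.act : Fin k → Wire a k)
    (fun i j h => by simpa using h) (by simp) j (st sub cnt M S A G V)
  have hc : CtrlHolds [(Wire.sub ctrl, b)] (st sub cnt M S A G V) ↔ sub ctrl = b := by
    simp [CtrlHolds, st]
  funext w
  cases w with
  | act j' => rw [h2 j', if_congr hc rfl rfl]; simp [st]
  | _ => rw [h1 _ (by simp)]; rfl

theorem cl_rotate_syn (ctrl : Fin a ⊕ Fin k) (b : Bool) (i : Fin a) :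
    Circuit.cl (crotate [(Wire.sub ctrl, b)] Wire.syn i) (st sub cnt M S A G V) =
      st sub cnt M (fun i' => if sub ctrl = b then S (rotIdx i i') else S i') A G V := by
  obtain ⟨h1, h2⟩ := cl_crotate [(Wire.sub ctrl, b)] (Wire.syn : Fin a → Wire a k)
    (fun i j h => by simpa using h) (by simp) i (st sub cnt M S A G V)
  have hc : CtrlHolds [(Wire.sub ctrl, b)] (st sub cnt M S A G V) ↔ sub ctrl = b := by
    simp [CtrlHolds, st]
  funext w
  cases w with
  | syn j' => rw [h2 j', if_congr hc rfl rfl]; simp [st]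
  | _ => rw [h1 _ (by simp)]; rfl

theorem cl_loadAct :
    Circuit.cl ((List.finRange k).map fun j => mcx [(Wire.sub (.inr j), true)] (Wire.act j))
      (st sub cnt M S (fun _ => false) G V) = st sub cnt M S (fun j => sub (.inr j)) G V := by
  unfold Circuit.cl
  rw [List.foldl_map]
  have key := foldl_finRange_induction k
    (fun (y : Wire a k → Bool) j => (mcx [(Wire.sub (.inr j), true)] (Wire.act j)).flip y)
    (fun t y => y = st sub cnt M S (fun j => if (j : ℕ) < t then sub (.inr j) else false) G V)
    (st sub cnt M S (fun _ => false) G V) (by simp) ?_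
  · rw [key]; congr 1; funext j; simp
  · rintro t y rfl
    rw [flip_mcx _ _ (by simp)]
    have hc : CtrlHolds [(Wire.sub (.inr t), true)]
      (st sub cnt M S (fun j => if (j : ℕ) < t then sub (.inr j) else false) G V) ↔
        sub (.inr t) = true := by simp [CtrlHolds, st]
    rw [if_congr hc rfl rfl]
    funext w
    cases w with
    | act j =>
      by_cases hj : j = t
      · subst hj
        cases hs : sub (.inr j) <;> simp [st, hs]
      · have h1 : (j : ℕ) < t + 1 ↔ (j : ℕ) < t := by
          have : (j : ℕ) ≠ t := fun h => hj (Fin.ext h)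
          omega
        split_ifs with h
        · rw [Function.update_of_ne (by simpa using hj)]; simp [st, h1]
        · simp [st, h1]
    | _ => split_ifs <;> first | (rw [Function.update_of_ne (by simp)]; rfl) | rfl

/-- The `act` bits start as a copy of the selection and are rotated together with the columns, so
afterwards they encode in unary how many columns of H₁ are selected. The controls are the `sub`
bits, which never move. -/
theorem cl_moveColumns : Circuit.cl (moveColumns a k) (st sub cnt M S (fun _ => false) G V) =
    st sub cnt (fun i j => M i (frontIdx (fun j => sub (.inr j)) j)) S
      (fun j => sub (.inr (frontIdx (fun j => sub (.inr j)) j))) G V := by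
  unfold moveColumns
  rw [Circuit.cl_append, cl_loadAct, Circuit.cl_flatMap]
  unfold frontIdx
  refine List.foldl_hom (fun π : Fin k → Fin k => st sub cnt (fun i j => M i (π j)) S
    (fun j => sub (.inr (π j))) G V) (l := List.finRange k) (init := id) ?_
  intro π j
  simp only []
  rw [Circuit.cl_append, Circuit.cl_flatMap]
  have key := foldl_finRange_induction a
    (fun (y : Wire a k → Bool) i =>
      Circuit.cl (crotate [(Wire.sub (.inr j), true)] (Wire.mat i) j) y)
    (fun t y => y = st sub cnt (fun i j' => if (i : ℕ) < t ∧ sub (.inr j) = true then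
      M i (π (rotIdx j j')) else M i (π j')) S (fun j => sub (.inr (π j))) G V)
    (st sub cnt (fun i j => M i (π j)) S (fun j => sub (.inr (π j))) G V) (by simp) ?_
  · rw [key, cl_rotate_act]
    by_cases hs : sub (.inr j) = true <;> simp [hs]
  · rintro t y rfl
    rw [cl_rotate_matRow]
    congr 1
    funext i j'
    by_cases hs : sub (.inr j) = true
    · by_cases hi : i = t
      · subst hi; simp [hs]
      · have h1 : (i : ℕ) < t + 1 ↔ (i : ℕ) < t := by
          have : (i : ℕ) ≠ t := fun h => hi (Fin.ext h)
          omega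
        simp [hs, hi, h1]
    · simp [hs]

theorem cl_moveRows : Circuit.cl (moveRows a k) (st sub cnt M S A G V) =
    st sub cnt (fun i j => M (frontIdx (fun i => !sub (.inl i)) i) j)
      (fun i => S (frontIdx (fun i => !sub (.inl i)) i)) A G V := by
  unfold moveRows
  rw [Circuit.cl_flatMap]
  unfold frontIdx
  refine List.foldl_hom (fun π : Fin a → Fin a => st sub cnt (fun i j => M (π i) j)
    (fun i => S (π i)) A G V) (l := List.finRange a) (init := id) ?_
  intro π i
  simp only []
  rw [Circuit.cl_append, Circuit.cl_flatMap]
  have key := foldl_finRange_induction k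
    (fun (y : Wire a k → Bool) j =>
      Circuit.cl (crotate [(Wire.sub (.inl i), false)] (fun l => Wire.mat l j) i) y)
    (fun t y => y = st sub cnt (fun i' j => if (j : ℕ) < t ∧ sub (.inl i) = false then
      M (π (rotIdx i i')) j else M (π i') j) (fun i => S (π i)) A G V)
    (st sub cnt (fun i j => M (π i) j) (fun i => S (π i)) A G V) (by simp) ?_
  · rw [key, cl_rotate_syn]
    by_cases hs : sub (.inl i) = false <;> simp [hs]
  · rintro t y rfl
    rw [cl_rotate_matCol]
    congr 1
    funext i' j
    by_cases hs : sub (.inl i) = false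
    · by_cases hj : j = t
      · subst hj; simp [hs]
      · have h1 : (j : ℕ) < t + 1 ↔ (j : ℕ) < t := by
          have : (j : ℕ) ≠ t := fun h => hj (Fin.ext h)
          omega
        simp [hs, hj, h1]
    · simp [hs]

theorem cl_rotate_wgt (i : Fin a) :
    Circuit.cl (crotate [(Wire.syn i, true)] Wire.wgt (Fin.last a)) (st sub cnt M S A G V) =
      st sub cnt M S A G (if S i = true then fun u => V (rotIdx (Fin.last a) u) else V) := by
  obtain ⟨h1, h2⟩ := cl_crotate [(Wire.syn i, true)] (Wire.wgt : Fin (a + 1) → Wire a k)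
    (fun i j h => by simpa using h) (by simp) (Fin.last a) (st sub cnt M S A G V)
  have hc : CtrlHolds [(Wire.syn i, true)] (st sub cnt M S A G V) ↔ S i = true := by
    simp [CtrlHolds, st]
  funext w
  cases w with
  | wgt u =>
    rw [h2 u, if_congr hc rfl rfl]
    by_cases hs : S i = true <;> simp [st, hs]
  | _ => rw [h1 _ (by simp)]; rfl

theorem cl_accumulate : Circuit.cl (accumulate a k) (st sub cnt M S A G fun _ => false) =
    st sub cnt M S A G (oneHot (a + 1) (Finset.univ.filter fun i => S i = true).card) := by
  have h0 : Circuit.cl [mcx [] (Wire.wgt 0)] (st sub cnt M S A G fun _ => false) =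
      st sub cnt M S A G (oneHot (a + 1) 0) := by
    rw [Circuit.cl_cons, Circuit.cl_nil, flip_mcx _ _ (by simp), if_pos (ctrlHolds_nil _)]
    funext w
    cases w with
    | wgt u =>
      by_cases hu : u = 0
      · subst hu; simp [st, oneHot]
      · rw [Function.update_of_ne (by simpa using hu)]
        have : (u : ℕ) ≠ 0 := fun h => hu (Fin.ext h)
        simp [st, oneHot, this]
    | _ => rw [Function.update_of_ne (by simp)]; rfl
  unfold accumulate
  rw [Circuit.cl_append, h0, Circuit.cl_flatMap]
  have key := foldl_finRange_induction a
    (fun (y : Wire a k → Bool) i =>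
      Circuit.cl (crotate [(Wire.syn i, true)] Wire.wgt (Fin.last a)) y)
    (fun t y => y = st sub cnt M S A G (oneHot (a + 1)
      (Finset.univ.filter fun i : Fin a => (i : ℕ) < t ∧ S i = true).card))
    (st sub cnt M S A G (oneHot (a + 1) 0)) (by simp) ?_
  · rw [key]; simp
  · rintro t y rfl
    rw [cl_rotate_wgt]
    congr 1
    by_cases hs : S t = true
    · rw [if_pos hs, oneHot_rotIdx]
      · congr 1
        have : (Finset.univ.filter fun i : Fin a => (i : ℕ) < t + 1 ∧ S i = true) =
            insert t (Finset.univ.filter fun i : Fin a => (i : ℕ) < t ∧ S i = true) := by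
          ext i
          simp only [Finset.mem_filter, Finset.mem_univ, true_and, Finset.mem_insert]
          constructor
          · rintro ⟨h1, h2⟩
            rcases Nat.lt_or_ge i t with h | h
            · exact Or.inr ⟨h, h2⟩
            · exact Or.inl (Fin.ext (by omega))
          · rintro (rfl | ⟨h1, h2⟩)
            · exact ⟨by omega, hs⟩
            · exact ⟨by omega, h2⟩
        rw [this, Finset.card_insert_of_notMem (by simp)]
      -- At most t ones have been seen among the first t rows, so the counter has not yet reached
      -- its last position and the rotation does not wrap around.
      · have hsub : (Finset.univ.filter fun i : Fin a => (i : ℕ) < t ∧ S i = true) ⊆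
            Finset.Iio t := fun i hi => by
          simp only [Finset.mem_filter] at hi
          rw [Finset.mem_Iio]; exact hi.2.1
        have := Finset.card_le_card hsub
        rw [Fin.card_Iio] at this
        omega
    · rw [if_neg hs]
      congr 2
      ext i
      simp only [Finset.mem_filter, Finset.mem_univ, true_and]
      constructor
      · rintro ⟨h1, h2⟩; exact ⟨by omega, h2⟩
      · rintro ⟨h1, h2⟩
        refine ⟨?_, h2⟩
        rcases Nat.lt_or_ge i t with h | h
        · exact h
        · exact absurd ((show i = t from Fin.ext (by omega)) ▸ h2) hs

end


/-! ### Gaussian elimination on basis states -/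

section

variable {a k : ℕ} (sub : Fin a ⊕ Fin k → Bool) (cnt : Fin (a + 1) → Bool)
  (M : Fin a → Fin k → Bool) (S : Fin a → Bool) (A G : Fin k → Bool) (V : Fin (a + 1) → Bool)

/-- Addition of row `l` to row `i`, on the columns after `j`. -/
def rowAdd (j : Fin k) (l i : Fin a) (M : Fin a → Fin k → Bool) : Fin a → Fin k → Bool :=
  fun r c => if r = i ∧ j < c then M i c ^^ M l c else M r c

/-- Addition of entry `l` to entry `i`. -/
def synAdd (l i : Fin a) (S : Fin a → Bool) : Fin a → Bool :=
  fun r => if r = i then S i ^^ S l else S r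

theorem foldl_fixed {α β : Type} (f : α → β → α) (l : List β) (y : α) (h : ∀ b ∈ l, f y b = y) :
    l.foldl f y = y := by
  induction l with
  | nil => rfl
  | cons b l ih =>
    rw [List.foldl_cons, h b List.mem_cons_self, ih fun c hc => h c (List.mem_cons_of_mem _ hc)]

/-- None of the targets occurs among the controls, so a violated condition stays violated through
all gates of the row addition. -/
theorem cl_addRow_of_not (ctrl : List (Wire a k × Bool)) (j : Fin k) (l i : Fin a) (hli : l ≠ i)
    (hm : ∀ c ∈ ctrl, ∀ c', j < c' → c.1 ≠ .mat i c') (hs : ∀ c ∈ ctrl, c.1 ≠ .syn i)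
    (y : Wire a k → Bool) (h : ¬ CtrlHolds ctrl y) : Circuit.cl (addRow ctrl j l i) y = y := by
  unfold addRow Circuit.cl
  refine foldl_fixed _ _ _ fun g hg => ?_
  simp only [List.mem_append, List.mem_map, List.mem_filter, List.mem_finRange, true_and,
    decide_eq_true_eq, List.mem_singleton] at hg
  rcases hg with ⟨c, hc, rfl⟩ | rfl
  · rw [flip_mcx, if_neg (fun h' => h ((ctrlHolds_cons _ _ _).1 h').2)]
    intro d hd
    rcases List.mem_cons.1 hd with rfl | hd
    · simp [hli]
    · exact hm d hd c hc
  · rw [flip_mcx, if_neg (fun h' => h ((ctrlHolds_cons _ _ _).1 h').2)]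
    intro d hd
    rcases List.mem_cons.1 hd with rfl | hd
    · simp [hli]
    · exact hs d hd

theorem cl_addRow (ctrl : List (Wire a k × Bool)) (j : Fin k) (l i : Fin a) (hli : l ≠ i)
    (hm : ∀ c ∈ ctrl, ∀ c', j < c' → c.1 ≠ .mat i c') (hs : ∀ c ∈ ctrl, c.1 ≠ .syn i)
    (h : CtrlHolds ctrl (st sub cnt M S A G V)) :
    Circuit.cl (addRow ctrl j l i) (st sub cnt M S A G V) =
      st sub cnt (rowAdd j l i M) (synAdd l i S) A G V := by
  have hcongr : ∀ y : Wire a k → Bool,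
      (∀ w, (∀ c', j < c' → w ≠ .mat i c') → y w = st sub cnt M S A G V w) → CtrlHolds ctrl y :=
    fun y hy => (ctrlHolds_congr fun c hc => hy _ (hm c hc)).2 h
  unfold addRow
  rw [Circuit.cl_append]
  have key : Circuit.cl (((List.finRange k).filter fun c => j < c).map fun c =>
      mcx ((Wire.mat l c, true) :: ctrl) (Wire.mat i c)) (st sub cnt M S A G V) =
      st sub cnt (rowAdd j l i M) S A G V := by
    unfold Circuit.cl
    rw [List.foldl_map, List.foldl_filter]
    have key := foldl_finRange_induction k
      (fun (y : Wire a k → Bool) c => if decide (j < c) = true then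
        (mcx ((Wire.mat l c, true) :: ctrl) (Wire.mat i c)).flip y else y)
      (fun t y => y = st sub cnt
        (fun r c => if r = i ∧ j < c ∧ (c : ℕ) < t then M i c ^^ M l c else M r c) S A G V)
      (st sub cnt M S A G V) (by simp) ?_
    · rw [key]
      congr 1
      funext r c
      simp [rowAdd]
    · rintro t y rfl
      simp only [decide_eq_true_eq]
      by_cases hjt : j < t
      · rw [if_pos hjt, flip_mcx]
        · have hc : CtrlHolds ((Wire.mat l t, true) :: ctrl) (st sub cnt
              (fun r c => if r = i ∧ j < c ∧ (c : ℕ) < t then M i c ^^ M l c else M r c) S A G V) ↔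
              M l t = true := by
            rw [ctrlHolds_cons]
            constructor
            · rintro ⟨h1, -⟩
              simpa [st, hli] using h1
            · intro h1
              refine ⟨by simpa [st, hli] using h1, hcongr _ fun w hw => ?_⟩
              cases w with
              | mat r c =>
                simp only [st]
                rw [if_neg]
                rintro ⟨rfl, h2, -⟩
                exact hw c h2 rfl
              | _ => rfl
          rw [if_congr hc rfl rfl]
          funext w
          cases w with
          | mat r c =>
            by_cases hrc : r = i ∧ c = t
            · obtain ⟨rfl, rfl⟩ := hrc
              cases hM : M l c <;> simp [st, hM, hjt]
            · have hne : (Wire.mat r c : Wire a k) ≠ Wire.mat i t := by simpa using hrc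
              have h1 : r = i → ((c : ℕ) < t + 1 ↔ (c : ℕ) < t) := fun hr => by
                have : (c : ℕ) ≠ t := fun h => hrc ⟨hr, Fin.ext h⟩
                omega
              have h2 : (r = i ∧ j < c ∧ (c : ℕ) < t + 1) ↔ (r = i ∧ j < c ∧ (c : ℕ) < t) :=
                and_congr_right fun hr => and_congr_right fun _ => h1 hr
              split_ifs
              · rw [Function.update_of_ne hne]; simp only [st, h2]
              · simp only [st, h2]
          | _ => split_ifs <;> first | (rw [Function.update_of_ne (by simp)]; rfl) | rfl
        · intro d hd
          rcases List.mem_cons.1 hd with rfl | hd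
          · simp [hli]
          · exact hm d hd t hjt
      · rw [if_neg hjt]
        congr 1
        funext r c
        have h2 : (j < c ∧ (c : ℕ) < t + 1) ↔ (j < c ∧ (c : ℕ) < t) := by
          rw [Fin.lt_def] at *
          constructor <;> rintro ⟨h1, h2⟩ <;> exact ⟨h1, by omega⟩
        simp only [h2]
  rw [key, Circuit.cl_cons, Circuit.cl_nil, flip_mcx]
  · have hc : CtrlHolds ((Wire.syn l, true) :: ctrl) (st sub cnt (rowAdd j l i M) S A G V) ↔
        S l = true := by
      rw [ctrlHolds_cons]
      constructor
      · rintro ⟨h1, -⟩; exact h1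
      · intro h1
        refine ⟨h1, hcongr _ fun w hw => ?_⟩
        cases w with
        | mat r c =>
          simp only [st, rowAdd]
          rw [if_neg]
          rintro ⟨rfl, h2⟩
          exact hw c h2 rfl
        | _ => rfl
    rw [if_congr hc rfl rfl]
    funext w
    cases w with
    | syn r =>
      by_cases hr : r = i
      · subst hr
        cases hS : S l <;> simp [st, synAdd, hS]
      · split_ifs
        · rw [Function.update_of_ne (by simpa using hr)]; simp [st, synAdd, hr]
        · simp [st, synAdd, hr]
    | _ => split_ifs <;> first | (rw [Function.update_of_ne (by simp)]; rfl) | rfl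
  · intro d hd
    rcases List.mem_cons.1 hd with rfl | hd
    · simp [hli]
    · exact hs d hd

/-- Row `l` is chosen as the pivot row for column `j`, where the search starts in row `i`. -/
def IsPivot (M : Fin a → Fin k → Bool) (A : Fin k → Bool) (j : Fin k) (i l : Fin a) : Prop :=
  (∃ hl : (l : ℕ) < k, A ⟨l, hl⟩ = true) ∧ M l j = true ∧ ∀ r, i ≤ r → r < l → M r j = false

theorem ctrlHolds_pivotCtrl (j : Fin k) (i l : Fin a) (hl : (l : ℕ) < k) :
    CtrlHolds (pivotCtrl j i l hl) (st sub cnt M S A G V) ↔ IsPivot M A j i l := by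
  unfold CtrlHolds pivotCtrl IsPivot
  simp only [List.mem_append, List.mem_cons, List.not_mem_nil, or_false, List.mem_map,
    List.mem_filter, List.mem_finRange, true_and, decide_eq_true_eq]
  constructor
  · intro h
    refine ⟨⟨hl, h (.act ⟨l, hl⟩, true) (by simp)⟩, h (.mat l j, true) (by simp), fun r h1 h2 => ?_⟩
    exact h (.mat r j, false) (Or.inr ⟨r, ⟨h1, h2⟩, rfl⟩)
  · rintro ⟨⟨_, h1⟩, h2, h3⟩ c ((rfl | rfl) | ⟨r, ⟨hr1, hr2⟩, rfl⟩)
    · exact h1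
    · exact h2
    · exact h3 r hr1 hr2

/-- The part of `eliminateColumn` that checks whether row `l` is the pivot row. -/
def pivotBlock (j : Fin k) (i l : Fin a) : Circuit (Wire a k) :=
  if hl : (l : ℕ) < k then
    [mcx (pivotCtrl j i l hl) (Wire.sing j)] ++
      (if l = i then [] else addRow (pivotCtrl j i l hl) j l i)
  else []

theorem pivotCtrl_ne (j : Fin k) (i l : Fin a) (hl : (l : ℕ) < k) :
    ∀ c ∈ pivotCtrl j i l hl, c.1 ≠ .sing j ∧ (∀ i' c', j < c' → c.1 ≠ .mat i' c') ∧
      ∀ i', c.1 ≠ .syn i' := by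
  intro c hc
  simp only [pivotCtrl, List.mem_append, List.mem_cons, List.not_mem_nil, or_false, List.mem_map,
    List.mem_filter, List.mem_finRange, true_and, decide_eq_true_eq] at hc
  rcases hc with (rfl | rfl) | ⟨r, _, rfl⟩
  · simp
  · refine ⟨by simp, fun i' c' hc' h => ?_, by simp⟩
    simp only [Wire.mat.injEq] at h
    exact hc'.ne h.2
  · refine ⟨by simp, fun i' c' hc' h => ?_, by simp⟩
    simp only [Wire.mat.injEq] at h
    exact hc'.ne h.2

theorem cl_pivotBlock_of_not (j : Fin k) (i l : Fin a) (h : ¬ IsPivot M A j i l) :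
    Circuit.cl (pivotBlock j i l) (st sub cnt M S A G V) = st sub cnt M S A G V := by
  unfold pivotBlock
  split_ifs with hl h' <;> try rfl
  all_goals
    rw [Circuit.cl_append, Circuit.cl_cons, Circuit.cl_nil,
      flip_mcx _ _ (fun c hc => (pivotCtrl_ne j i l hl c hc).1),
      if_neg (fun h' => h ((ctrlHolds_pivotCtrl _ _ _ _ _ _ _ _ _ _ _).1 h'))]
  · rfl
  · exact cl_addRow_of_not _ _ _ _ h' (fun c hc => (pivotCtrl_ne j i l hl c hc).2.1 i)
      (fun c hc => (pivotCtrl_ne j i l hl c hc).2.2 i) _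
      (fun h' => h ((ctrlHolds_pivotCtrl _ _ _ _ _ _ _ _ _ _ _).1 h'))

theorem update_sing (j : Fin k) (b : Bool) :
    Function.update (st sub cnt M S A G V) (.sing j) b =
      st sub cnt M S A (Function.update G j b) V := by
  funext w
  cases w with
  | sing j' =>
    by_cases hj : j' = j
    · subst hj; simp [st]
    · rw [Function.update_of_ne (by simpa using hj)]; simp [st, hj]
  | _ => rw [Function.update_of_ne (by simp)]; rfl

theorem cl_pivotBlock (j : Fin k) (i l : Fin a) (h : IsPivot M A j i l) :
    Circuit.cl (pivotBlock j i l) (st sub cnt M S A G V) =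
      st sub cnt (if l = i then M else rowAdd j l i M) (if l = i then S else synAdd l i S) A
        (Function.update G j (!G j)) V := by
  obtain ⟨hl, -⟩ := h.1
  unfold pivotBlock
  rw [dif_pos hl, Circuit.cl_append, Circuit.cl_cons, Circuit.cl_nil,
    flip_mcx _ _ (fun c hc => (pivotCtrl_ne j i l hl c hc).1),
    if_pos ((ctrlHolds_pivotCtrl _ _ _ _ _ _ _ _ _ _ _).2 h), update_sing]
  split_ifs with h'
  · rfl
  · exact cl_addRow _ _ _ _ _ _ _ _ _ _ _ h' (fun c hc => (pivotCtrl_ne j i l hl c hc).2.1 i)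
      (fun c hc => (pivotCtrl_ne j i l hl c hc).2.2 i)
      ((ctrlHolds_pivotCtrl _ _ _ _ _ _ _ _ _ _ _).2 h)

theorem cl_clearColumn_of_not (j : Fin k) (i : Fin a) (hA : A j = false) :
    Circuit.cl ((((List.finRange a).filter fun l => l ≠ i).flatMap fun l =>
      addRow [(Wire.act j, true), (Wire.mat l j, true)] j i l)) (st sub cnt M S A G V) =
      st sub cnt M S A G V := by
  rw [Circuit.cl_flatMap]
  refine foldl_fixed _ _ _ fun l hl => ?_
  have hl' : l ≠ i := by simpa using hl
  refine cl_addRow_of_not _ _ _ _ hl'.symm ?_ (by simp) _ ?_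
  · intro c hc c' hc' h
    simp only [List.mem_cons, List.not_mem_nil, or_false] at hc
    rcases hc with rfl | rfl
    · simp at h
    · simp only [Wire.mat.injEq] at h
      exact hc'.ne h.2
  · rw [ctrlHolds_cons]
    rintro ⟨h, -⟩
    rw [show st sub cnt M S A G V (Wire.act j) = A j from rfl, hA] at h
    exact Bool.false_ne_true h

/-- Elimination of column `j` with pivot row `i`, in all other rows. -/
def clearM (j : Fin k) (i : Fin a) (M : Fin a → Fin k → Bool) : Fin a → Fin k → Bool :=
  fun r c => if r ≠ i ∧ j < c ∧ M r j = true then M r c ^^ M i c else M r c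

/-- The effect of the elimination on the syndrome. -/
def clearS (j : Fin k) (i : Fin a) (M : Fin a → Fin k → Bool) (S : Fin a → Bool) : Fin a → Bool :=
  fun r => if r ≠ i ∧ M r j = true then S r ^^ S i else S r

theorem cl_clearColumn (j : Fin k) (i : Fin a) (hA : A j = true) :
    Circuit.cl ((((List.finRange a).filter fun l => l ≠ i).flatMap fun l =>
      addRow [(Wire.act j, true), (Wire.mat l j, true)] j i l)) (st sub cnt M S A G V) =
      st sub cnt (clearM j i M) (clearS j i M S) A G V := by
  rw [Circuit.cl_flatMap, List.foldl_filter]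
  have key := foldl_finRange_induction a
    (fun (y : Wire a k → Bool) l => if decide (l ≠ i) = true then
      Circuit.cl (addRow [(Wire.act j, true), (Wire.mat l j, true)] j i l) y else y)
    (fun t y => y = st sub cnt
      (fun r c => if (r : ℕ) < t ∧ r ≠ i ∧ j < c ∧ M r j = true then M r c ^^ M i c else M r c)
      (fun r => if (r : ℕ) < t ∧ r ≠ i ∧ M r j = true then S r ^^ S i else S r) A G V)
    (st sub cnt M S A G V) (by simp) ?_
  · rw [key]; simp only [Fin.is_lt, true_and]; rfl
  · rintro t y rfl
    simp only [decide_eq_true_eq]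
    have hlt : ∀ r : Fin a, r ≠ t → ((r : ℕ) < t + 1 ↔ (r : ℕ) < t) := fun r hr => by
      have : (r : ℕ) ≠ t := fun h => hr (Fin.ext h)
      omega
    have hm : ∀ c ∈ [(Wire.act j, true), (Wire.mat t j, true)], ∀ c', j < c' →
        c.1 ≠ (Wire.mat t c' : Wire a k) := by
      intro c hc c' hc' h
      simp only [List.mem_cons, List.not_mem_nil, or_false] at hc
      rcases hc with rfl | rfl
      · simp at h
      · simp only [Wire.mat.injEq] at h
        exact hc'.ne h.2
    by_cases hti : t = i
    · rw [if_neg (by simpa using hti)]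
      congr 1
      · funext r c
        by_cases hr : r = t
        · simp [hr, hti]
        · simp only [hlt r hr]
      · funext r
        by_cases hr : r = t
        · simp [hr, hti]
        · simp only [hlt r hr]
    · rw [if_pos hti]
      by_cases hM : M t j = true
      · rw [cl_addRow _ _ _ _ _ _ _ _ _ _ _ (Ne.symm hti) hm (by simp)]
        · congr 1
          · funext r c
            unfold rowAdd
            by_cases hr : r = t
            · subst hr
              by_cases hc : j < c <;> simp [hti, hM, hc]
            · simp only [hr, false_and, if_false, hlt r hr]
          · funext r
            unfold synAdd
            by_cases hr : r = t
            · subst hr; simp [hti, hM]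
            · simp only [hr, if_false, hlt r hr]
        · rw [ctrlHolds_cons, ctrlHolds_cons]
          refine ⟨hA, ?_, ctrlHolds_nil _⟩
          simpa [st] using hM
      · rw [cl_addRow_of_not _ _ _ _ (Ne.symm hti) hm (by simp)]
        · congr 1
          · funext r c
            by_cases hr : r = t
            · subst hr; simp [hM]
            · simp only [hlt r hr]
          · funext r
            by_cases hr : r = t
            · subst hr; simp [hM]
            · simp only [hlt r hr]
        · rw [ctrlHolds_cons, ctrlHolds_cons]
          rintro ⟨-, h, -⟩
          apply hM
          simpa [st] using h

theorem eliminateColumn_eq (j : Fin k) (hj : (j : ℕ) < a) : eliminateColumn a k j =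
    (((List.finRange a).filter fun l => (⟨j, hj⟩ : Fin a) ≤ l).flatMap fun l =>
      pivotBlock j ⟨j, hj⟩ l) ++ [mcx [(Wire.act j, true)] (Wire.sing j)] ++
    (((List.finRange a).filter fun l => l ≠ ⟨j, hj⟩).flatMap fun l =>
      addRow [(Wire.act j, true), (Wire.mat l j, true)] j ⟨j, hj⟩ l) := by
  unfold eliminateColumn
  rw [dif_pos hj]
  rfl

theorem cl_checkSing (j : Fin k) :
    Circuit.cl [mcx [(Wire.act j, true)] (Wire.sing j)] (st sub cnt M S A G V) =
      st sub cnt M S A (Function.update G j (if A j = true then !G j else G j)) V := by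
  have hc : CtrlHolds [(Wire.act j, true)] (st sub cnt M S A G V) ↔ A j = true := by
    simp [CtrlHolds, st]
  rw [Circuit.cl_cons, Circuit.cl_nil, flip_mcx _ _ (by simp), if_congr hc rfl rfl]
  split_ifs with h
  · rw [update_sing]; rfl
  · rw [Function.update_eq_self]

theorem cl_pivotSearch_of_not (j : Fin k) (i : Fin a) (h : ∀ l, i ≤ l → ¬ IsPivot M A j i l) :
    Circuit.cl (((List.finRange a).filter fun l => i ≤ l).flatMap fun l => pivotBlock j i l)
      (st sub cnt M S A G V) = st sub cnt M S A G V := by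
  rw [Circuit.cl_flatMap]
  exact foldl_fixed _ _ _ fun l hl =>
    cl_pivotBlock_of_not _ _ _ _ _ _ _ _ _ _ (h l (by simpa using hl))

theorem isPivot_unique {j : Fin k} {i l l' : Fin a} (hl : i ≤ l) (hl' : i ≤ l')
    (h : IsPivot M A j i l) (h' : IsPivot M A j i l') : l = l' := by
  by_contra hne
  rcases lt_or_gt_of_ne hne with hlt | hlt
  · have := h'.2.2 l hl hlt
    rw [h.2.1] at this; exact Bool.false_ne_true this.symm
  · have := h.2.2 l' hl' hlt
    rw [h'.2.1] at this; exact Bool.false_ne_true this.symm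

/-- Exactly one block fires. Its row addition touches only columns after j, so the later blocks
still see the original column j, in which the pivot row is unique. This is why the circuit leaves
column j unchanged. -/
theorem cl_pivotSearch (j : Fin k) (i l : Fin a) (hil : i ≤ l) (h : IsPivot M A j i l) :
    Circuit.cl (((List.finRange a).filter fun l => i ≤ l).flatMap fun l => pivotBlock j i l)
      (st sub cnt M S A G V) =
      st sub cnt (if l = i then M else rowAdd j l i M) (if l = i then S else synAdd l i S) A
        (Function.update G j (!G j)) V := by
  rw [Circuit.cl_flatMap]
  have hmem : l ∈ (List.finRange a).filter fun l => i ≤ l := by simpa using hil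
  obtain ⟨l₁, l₂, hll⟩ := List.append_of_mem hmem
  have hnd : (l₁ ++ l :: l₂).Nodup := hll ▸ (List.nodup_finRange a).filter _
  rw [List.nodup_middle, List.nodup_cons, List.mem_append, not_or] at hnd
  have hge : ∀ r, r ∈ l₁ ∨ r ∈ l₂ → i ≤ r := fun r hr => by
    have : r ∈ (List.finRange a).filter fun l => i ≤ l := by
      rw [hll]; rcases hr with hr | hr <;> simp [hr]
    simpa using this
  rw [hll, List.foldl_append, List.foldl_cons, foldl_fixed _ l₁, cl_pivotBlock _ _ _ _ _ _ _ _ _ _ h,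
    foldl_fixed _ l₂]
  · intro r hr
    refine cl_pivotBlock_of_not _ _ _ _ _ _ _ _ _ _ fun h' => hnd.1.2 ?_
    have hcol : ∀ r, (if l = i then M else rowAdd j l i M) r j = M r j := by
      intro r; split_ifs <;> simp [rowAdd]
    have h'' : IsPivot M A j i r := ⟨h'.1, hcol r ▸ h'.2.1, fun r' h1 h2 => hcol r' ▸ h'.2.2 r' h1 h2⟩
    rwa [isPivot_unique M A hil (hge r (Or.inr hr)) h h'']
  · intro r hr
    refine cl_pivotBlock_of_not _ _ _ _ _ _ _ _ _ _ fun h' => hnd.1.1 ?_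
    rwa [isPivot_unique M A hil (hge r (Or.inl hr)) h h']

theorem cl_eliminateColumn_inactive (j : Fin k) (hA : ∀ l, j ≤ l → A l = false) :
    Circuit.cl (eliminateColumn a k j) (st sub cnt M S A G V) = st sub cnt M S A G V := by
  by_cases hj : (j : ℕ) < a
  · rw [eliminateColumn_eq j hj, Circuit.cl_append, Circuit.cl_append, cl_pivotSearch_of_not,
      cl_checkSing, hA j le_rfl]
    · simp only [Bool.false_eq_true, if_false, Function.update_eq_self]
      exact cl_clearColumn_of_not _ _ _ _ _ _ _ _ _ (hA j le_rfl)
    · rintro l hl ⟨⟨hlk, h1⟩, -⟩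
      rw [hA _ hl] at h1
      exact Bool.false_ne_true h1
  · unfold eliminateColumn
    rw [dif_neg hj]
    rfl

/-- No pivot block fires, so the final check alone toggles the flag and records the failure. The
clearing of the column still runs, but its effect is irrelevant from then on. -/
theorem cl_eliminateColumn_singular (j : Fin k) (hj : (j : ℕ) < a) (hA : A j = true)
    (hG : G j = false) (h : ∀ l, (⟨j, hj⟩ : Fin a) ≤ l → ¬ IsPivot M A j ⟨j, hj⟩ l) :
    Circuit.cl (eliminateColumn a k j) (st sub cnt M S A G V) =
      st sub cnt (clearM j ⟨j, hj⟩ M) (clearS j ⟨j, hj⟩ M S) A (Function.update G j true) V := by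
  rw [eliminateColumn_eq j hj, Circuit.cl_append, Circuit.cl_append,
    cl_pivotSearch_of_not _ _ _ _ _ _ _ _ _ h, cl_checkSing, cl_clearColumn _ _ _ _ _ _ _ _ _ hA]
  simp [hA, hG]

/-- The flag `sing j` is toggled once by the pivot block and once more by the check, so it returns
to its former value. -/
theorem cl_eliminateColumn_pivot (j : Fin k) (hj : (j : ℕ) < a) (hA : A j = true) (l : Fin a)
    (hl : (⟨j, hj⟩ : Fin a) ≤ l) (h : IsPivot M A j ⟨j, hj⟩ l) :
    Circuit.cl (eliminateColumn a k j) (st sub cnt M S A G V) =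
      st sub cnt (clearM j ⟨j, hj⟩ (if l = ⟨j, hj⟩ then M else rowAdd j l ⟨j, hj⟩ M))
        (clearS j ⟨j, hj⟩ (if l = ⟨j, hj⟩ then M else rowAdd j l ⟨j, hj⟩ M)
          (if l = ⟨j, hj⟩ then S else synAdd l ⟨j, hj⟩ S)) A G V := by
  rw [eliminateColumn_eq j hj, Circuit.cl_append, Circuit.cl_append,
    cl_pivotSearch _ _ _ _ _ _ _ _ _ _ hl h, cl_checkSing, cl_clearColumn _ _ _ _ _ _ _ _ _ hA]
  simp [hA]

/-- After a failure only one fact is needed: a step can change no flag but its own, so the recorded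
failure survives all later steps. -/
theorem cl_eliminateColumn_sing (j : Fin k) (hA : A j = true ∨
    ∀ l, j ≤ l → A l = false) :
    ∃ M' S' G', Circuit.cl (eliminateColumn a k j) (st sub cnt M S A G V) =
      st sub cnt M' S' A G' V ∧ ∀ j', j' ≠ j → G' j' = G j' := by
  rcases hA with hA | hA
  · by_cases hj : (j : ℕ) < a
    · by_cases h : ∃ l, (⟨j, hj⟩ : Fin a) ≤ l ∧ IsPivot M A j ⟨j, hj⟩ l
      · obtain ⟨l, hl, h⟩ := h
        exact ⟨_, _, _, cl_eliminateColumn_pivot _ _ _ _ _ _ _ j hj hA l hl h, fun _ _ => rfl⟩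
      · push Not at h
        rw [eliminateColumn_eq j hj, Circuit.cl_append, Circuit.cl_append,
          cl_pivotSearch_of_not _ _ _ _ _ _ _ _ _ h, cl_checkSing,
          cl_clearColumn _ _ _ _ _ _ _ _ _ hA]
        exact ⟨_, _, _, rfl, fun j' hj' => Function.update_of_ne hj' _ _⟩
    · refine ⟨M, S, G, ?_, fun _ _ => rfl⟩
      unfold eliminateColumn
      rw [dif_neg hj]
      rfl
  · exact ⟨M, S, G, cl_eliminateColumn_inactive _ _ _ _ _ _ _ j hA, fun _ _ => rfl⟩

end


/-! ### Correctness of the elimination circuit -/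

/-- Bits as elements of the field with two elements. -/
def bz (b : Bool) : ZMod 2 := if b = true then 1 else 0

theorem bz_xor (x y : Bool) : bz (x ^^ y) = bz x + bz y := by cases x <;> cases y <;> decide

/-- The square matrix represented after `j` of `q` elimination steps: columns before `j` and from
`q` on are unit vectors. -/
def squareEntry {a k : ℕ} (j q : ℕ) (M : Fin a → Fin k → Bool) (r c : Fin a) : ZMod 2 :=
  if h : (j ≤ (c : ℕ) ∧ (c : ℕ) < q) ∧ (c : ℕ) < k then bz (M r ⟨c, h.2⟩) else
    if r = c then 1 else 0

/-- The residual of the linear system, with the syndrome scaled by `t`. -/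
def residual {a k : ℕ} (j q : ℕ) (M : Fin a → Fin k → Bool) (S : Fin a → Bool)
    (u : Fin a → ZMod 2) (t : ZMod 2) (r : Fin a) : ZMod 2 :=
  ∑ c, squareEntry j q M r c * u c + bz (S r) * t

theorem isPivot_lt {a k q : ℕ} {M : Fin a → Fin k → Bool} {A : Fin k → Bool}
    (hA : ∀ l : Fin k, A l = true ↔ (l : ℕ) < q) {j : Fin k} {i l : Fin a}
    (h : IsPivot M A j i l) : (l : ℕ) < q := by
  obtain ⟨hl, hl'⟩ := h.1
  exact (hA ⟨l, hl⟩).1 hl'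

section

variable {a k q : ℕ} (M : Fin a → Fin k → Bool) (S : Fin a → Bool) (j : Fin k) (hj : (j : ℕ) < a)
  (l : Fin a)

/-- The new pivot row is the old row j, plus row l if the pivot was found there. The stored column j
is stale after the step and is represented by a unit vector; the conditions on the entries of column
j are what make the sum equal to 1 there. -/
theorem squareEntry_pivotRow (hqk : q ≤ k) (hjq : (j : ℕ) < q) (hlq : (l : ℕ) < q)
    (hl : (⟨j, hj⟩ : Fin a) ≤ l) (h1 : M l j = true) (h2 : l ≠ ⟨j, hj⟩ → M ⟨j, hj⟩ j = false)
    (c : Fin a) :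
    squareEntry (j + 1) q
        (clearM j ⟨j, hj⟩ (if l = ⟨j, hj⟩ then M else rowAdd j l ⟨j, hj⟩ M)) ⟨j, hj⟩ c =
      squareEntry j q M ⟨j, hj⟩ c + if l = ⟨j, hj⟩ then 0 else squareEntry j q M l c := by
  have hlj : (j : ℕ) ≤ l := hl
  unfold squareEntry clearM
  rcases Nat.lt_trichotomy (c : ℕ) j with hc | hc | hc
  · have hcj : (⟨j, hj⟩ : Fin a) ≠ c := fun h => by simp [Fin.ext_iff] at h; omega
    have hlc : l ≠ c := fun h => by simp [Fin.ext_iff] at h; omega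
    rw [dif_neg (by omega), dif_neg (by omega), dif_neg (by omega)]
    simp [hcj, hlc]
  · have hcj : c = ⟨j, hj⟩ := Fin.ext hc
    subst hcj
    have hk : (j : ℕ) < k := j.2
    rw [dif_neg (by simp), dif_pos (by simp [hjq]), dif_pos (by simp [hjq])]
    simp only [Fin.eta, if_true]
    by_cases hlj' : l = ⟨j, hj⟩
    · rw [if_pos hlj', ← hlj', h1]; rfl
    · rw [if_neg hlj', h1, h2 hlj']; decide
  · by_cases hcq : (c : ℕ) < q ∧ (c : ℕ) < k
    · rw [dif_pos (by omega), dif_pos (by omega), dif_pos (by omega)]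
      simp only [ne_eq, not_true_eq_false, false_and, if_false]
      split_ifs with hlj'
      · rw [add_zero]
      · have hlt : j < (⟨c, hcq.2⟩ : Fin k) := hc
        simp only [rowAdd, hlt, and_self, if_true, bz_xor]
    · rw [dif_neg (by omega), dif_neg (by omega), dif_neg (by omega)]
      have hlc : l ≠ c := fun h => by simp [Fin.ext_iff] at h; omega
      simp [hlc]

/-- Every other row receives the new pivot row once, according to its stored entry in column j. In
column j itself this cancels the entry, as the unit vector demands. -/
theorem squareEntry_otherRow (hqk : q ≤ k) (hjq : (j : ℕ) < q)
    (hl : (⟨j, hj⟩ : Fin a) ≤ l) (r : Fin a) (hr : r ≠ ⟨j, hj⟩) (c : Fin a) :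
    squareEntry (j + 1) q
        (clearM j ⟨j, hj⟩ (if l = ⟨j, hj⟩ then M else rowAdd j l ⟨j, hj⟩ M)) r c =
      squareEntry j q M r c + bz (M r j) * squareEntry (j + 1) q
        (clearM j ⟨j, hj⟩ (if l = ⟨j, hj⟩ then M else rowAdd j l ⟨j, hj⟩ M)) ⟨j, hj⟩ c := by
  set M₁ := (if l = ⟨j, hj⟩ then M else rowAdd j l ⟨j, hj⟩ M) with hM₁
  have hMr : ∀ c, M₁ r c = M r c := fun c => by
    rw [hM₁]; split_ifs <;> simp [rowAdd, hr]
  unfold squareEntry clearM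
  rcases Nat.lt_trichotomy (c : ℕ) j with hc | hc | hc
  · have hcj : (⟨j, hj⟩ : Fin a) ≠ c := fun h => by simp [Fin.ext_iff] at h; omega
    rw [dif_neg (by omega), dif_neg (by omega), dif_neg (by omega)]
    simp [hcj]
  · have hcj : c = ⟨j, hj⟩ := Fin.ext hc
    subst hcj
    rw [dif_neg (by simp), dif_pos (by simp [hjq]), dif_neg (by simp)]
    simp only [Fin.eta, if_true, hr, if_false, mul_one]
    exact (CharTwo.add_self_eq_zero _).symm
  · by_cases hcq : (c : ℕ) < q
    · rw [dif_pos (by omega), dif_pos (by omega), dif_pos (by omega)]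
      have hlt : j < (⟨c, by omega⟩ : Fin k) := hc
      simp only [ne_eq, not_true_eq_false, false_and, if_false, hr, not_false_eq_true, true_and,
        hlt, hMr]
      cases h : M r j
      · simp [bz]
      · simp [bz_xor, show bz true = 1 from rfl]
    · rw [dif_neg (by omega), dif_neg (by omega), dif_neg (by omega)]
      have hcj : (⟨j, hj⟩ : Fin a) ≠ c := fun h => by simp [Fin.ext_iff] at h; omega
      simp [hcj]

/-- The step is an invertible row operation on the represented system, so it preserves the common
zeros of the residuals. The scale t of the syndrome is kept general: t = 1 gives the solutions, t =
0 the kernel. -/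
theorem residual_step (hqk : q ≤ k) (hjq : (j : ℕ) < q) (hlq : (l : ℕ) < q)
    (hl : (⟨j, hj⟩ : Fin a) ≤ l) (h1 : M l j = true) (h2 : l ≠ ⟨j, hj⟩ → M ⟨j, hj⟩ j = false)
    (u : Fin a → ZMod 2) (t : ZMod 2) :
    (∀ r, residual (j + 1) q
      (clearM j ⟨j, hj⟩ (if l = ⟨j, hj⟩ then M else rowAdd j l ⟨j, hj⟩ M))
      (clearS j ⟨j, hj⟩ (if l = ⟨j, hj⟩ then M else rowAdd j l ⟨j, hj⟩ M)
          (if l = ⟨j, hj⟩ then S else synAdd l ⟨j, hj⟩ S)) u t r = 0) ↔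
      ∀ r, residual j q M S u t r = 0 := by
  set i : Fin a := ⟨j, hj⟩ with hi
  set M₂ := clearM j i (if l = i then M else rowAdd j l i M) with hM₂
  set S₂ := clearS j i (if l = i then M else rowAdd j l i M)
    (if l = i then S else synAdd l i S) with hS₂
  have e1 : residual (j + 1) q M₂ S₂ u t i =
      residual j q M S u t i + if l = i then 0 else residual j q M S u t l := by
    have hS : bz (S₂ i) = bz (S i) + if l = i then 0 else bz (S l) := by
      rw [hS₂]
      unfold clearS synAdd
      split_ifs <;> simp_all [bz_xor]
    unfold residual
    rw [hS, Finset.sum_congr rfl fun c _ => by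
      rw [squareEntry_pivotRow M j hj l hqk hjq hlq hl h1 h2 c]]
    split_ifs
    · simp only [add_zero]; rfl
    · simp only [add_mul, Finset.sum_add_distrib]; ring
  have e2 : ∀ r, r ≠ i → residual (j + 1) q M₂ S₂ u t r =
      residual j q M S u t r + bz (M r j) * residual (j + 1) q M₂ S₂ u t i := by
    intro r hr
    have hS : bz (S₂ r) = bz (S r) + bz (M r j) * bz (S₂ i) := by
      rw [hS₂]
      unfold clearS synAdd rowAdd
      have hb0 : bz false = 0 := rfl
      have hb1 : bz true = 1 := rfl
      cases h : M r j <;> split_ifs <;> simp_all [bz_xor]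
    unfold residual
    rw [hS, Finset.sum_congr rfl fun c _ => by
      rw [squareEntry_otherRow M j hj l hqk hjq hl r hr c]]
    simp only [add_mul, Finset.sum_add_distrib, mul_add, Finset.mul_sum]
    simp only [mul_assoc]
    ring
  constructor
  · intro h
    have h3 : ∀ r, r ≠ i → residual j q M S u t r = 0 := fun r hr => by
      have := e2 r hr
      rw [h r, h i, mul_zero, add_zero] at this
      exact this.symm
    intro r
    by_cases hr : r = i
    · rw [hr]
      rw [h i] at e1
      split_ifs at e1 with h4
      · rw [add_zero] at e1; exact e1.symm
      · rw [h3 l h4, add_zero] at e1; exact e1.symm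
    · exact h3 r hr
  · intro h
    have h3 : residual (j + 1) q M₂ S₂ u t i = 0 := by rw [e1, h i, h l]; simp
    intro r
    by_cases hr : r = i
    · rw [hr, h3]
    · rw [e2 r hr, h r, h3]; simp

/-- Without a pivot, column j vanishes in rows j to q - 1. The columns with index below j or from q
on are unit vectors, so column j is a combination of them. -/
theorem residual_singular (hqk : q ≤ k) (hqa : q ≤ a) (A : Fin k → Bool)
    (hA : ∀ l : Fin k, A l = true ↔ (l : ℕ) < q) (hjq : (j : ℕ) < q)
    (h : ∀ l, (⟨j, hj⟩ : Fin a) ≤ l → ¬ IsPivot M A j ⟨j, hj⟩ l) :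
    ∃ u : Fin a → ZMod 2, u ≠ 0 ∧ ∀ r, residual j q M S u 0 r = 0 := by
  -- `IsPivot` asks for the first one in the column, so strong induction on the row is needed to
  -- conclude that there is no one at all.
  have hz : ∀ n : ℕ, ∀ r : Fin a, (r : ℕ) = n → (j : ℕ) ≤ r → (r : ℕ) < q → M r j = false := by
    intro n
    induction n using Nat.strong_induction_on with
    | _ n ih =>
      intro r hrn h1 h2
      by_contra hM
      refine h r h1 ⟨⟨by omega, (hA _).2 h2⟩, by simpa using hM, fun r' h3 h4 => ?_⟩
      have h4' : (r' : ℕ) < r := h4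
      exact ih r' (by omega) r' rfl h3 (by omega)
  let u : Fin a → ZMod 2 := fun c => if c = ⟨j, hj⟩ then 1 else
    if (c : ℕ) < j ∨ q ≤ (c : ℕ) then bz (M c j) else 0
  refine ⟨u, fun hu => ?_, fun r => ?_⟩
  · have := congrFun hu ⟨j, hj⟩
    simp [u] at this
  · unfold residual
    have hterm : ∀ c, squareEntry j q M r c * u c =
        (if c = ⟨j, hj⟩ then bz (M r j) else 0) +
          if c = r then (if (r : ℕ) < j ∨ q ≤ (r : ℕ) then bz (M r j) else 0) else 0 := by
      intro c
      unfold squareEntry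
      by_cases hc : c = ⟨j, hj⟩
      · subst hc
        rw [dif_pos (by simp [hjq])]
        by_cases hr : (⟨j, hj⟩ : Fin a) = r
        · subst hr
          simp [u, hjq]
        · simp [u, hr]
      · simp only [u, hc, if_false, zero_add]
        by_cases hcq : (c : ℕ) < j ∨ q ≤ (c : ℕ)
        · rw [dif_neg (by omega), if_pos hcq]
          by_cases hcr : c = r
          · subst hcr; simp [hcq]
          · simp [hcr, Ne.symm hcr]
        · rw [if_neg hcq, mul_zero]
          by_cases hcr : c = r
          · subst hcr; simp [hcq]
          · simp [hcr]
    rw [Finset.sum_congr rfl fun c _ => hterm c, Finset.sum_add_distrib, Finset.sum_ite_eq',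
      Finset.sum_ite_eq']
    simp only [Finset.mem_univ, if_true, mul_zero, add_zero]
    split_ifs with hr
    · exact CharTwo.add_self_eq_zero _
    · rw [hz r r rfl (by omega) (by omega)]; simp [bz]

end

/-- The invariant is an alternative. Either no flag is set and the residuals have the same zeros as
at the start, or a flag is set and the original square matrix has a nonzero kernel vector. Steps
from q on are idle, whence `min n q`; at `min k q = q` the represented matrix is the identity and
the syndrome register holds the solution. -/
theorem cl_elimination {a k q : ℕ} (sub : Fin a ⊕ Fin k → Bool) (cnt : Fin (a + 1) → Bool)
    (M : Fin a → Fin k → Bool) (S : Fin a → Bool) (A : Fin k → Bool) (V : Fin (a + 1) → Bool)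
    (hqk : q ≤ k) (hqa : q ≤ a) (hA : ∀ l : Fin k, A l = true ↔ (l : ℕ) < q) :
    ∃ M' S' G', Circuit.cl ((List.finRange k).flatMap (eliminateColumn a k))
        (st sub cnt M S A (fun _ => false) V) = st sub cnt M' S' A G' V ∧
      (((∀ j, G' j = false) ∧ ∀ u t, (∀ r, u r + bz (S' r) * t = 0) ↔
          ∀ r, residual 0 q M S u t r = 0) ∨
        ((∃ j, G' j = true) ∧ ∃ u, u ≠ 0 ∧ ∀ r, residual 0 q M S u 0 r = 0)) := by
  rw [Circuit.cl_flatMap]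
  have key := foldl_finRange_induction k
    (fun (y : Wire a k → Bool) j => Circuit.cl (eliminateColumn a k j) y)
    (fun n y => ∃ M' S' G', y = st sub cnt M' S' A G' V ∧ (∀ j : Fin k, n ≤ (j : ℕ) → G' j = false) ∧
      (((∀ j, G' j = false) ∧ ∀ u t, (∀ r, residual (min n q) q M' S' u t r = 0) ↔
          ∀ r, residual 0 q M S u t r = 0) ∨
        ((∃ j : Fin k, (j : ℕ) < n ∧ G' j = true) ∧
          ∃ u, u ≠ 0 ∧ ∀ r, residual 0 q M S u 0 r = 0)))
    (st sub cnt M S A (fun _ => false) V)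
    ⟨M, S, _, rfl, fun _ _ => rfl, Or.inl ⟨fun _ => rfl, fun u t => by simp⟩⟩ ?_
  · obtain ⟨M', S', G', h1, -, h3⟩ := key
    refine ⟨M', S', G', h1, ?_⟩
    rcases h3 with ⟨h3, h4⟩ | ⟨⟨j, -, h3⟩, h4⟩
    · refine Or.inl ⟨h3, fun u t => ?_⟩
      rw [← h4 u t, min_eq_right hqk]
      refine forall_congr' fun r => ?_
      have : residual q q M' S' u t r = u r + bz (S' r) * t := by
        unfold residual
        congr 1
        rw [Finset.sum_eq_single r]
        · unfold squareEntry; rw [dif_neg (by omega)]; simp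
        · intro c _ hc
          unfold squareEntry; rw [dif_neg (by omega), if_neg hc.symm, zero_mul]
        · simp
      rw [this]
    · exact Or.inr ⟨⟨j, h3⟩, h4⟩
  · rintro j y ⟨M', S', G', rfl, hG, hcase⟩
    have hact : A j = true ∨ ∀ l, j ≤ l → A l = false := by
      by_cases hAj : A j = true
      · exact Or.inl hAj
      · right
        intro l hl
        have hl' : (j : ℕ) ≤ l := hl
        by_contra hAl
        have := (hA l).1 (by simpa using hAl)
        exact hAj ((hA j).2 (by omega))
    rcases hcase with ⟨hz, hinv⟩ | ⟨⟨j₀, hj₀, hG₀⟩, hker⟩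
    · by_cases hAj : A j = true
      · have hjq := (hA j).1 hAj
        have hj : (j : ℕ) < a := by omega
        rw [show min (j : ℕ) q = j by omega] at hinv
        by_cases h : ∃ l, (⟨j, hj⟩ : Fin a) ≤ l ∧ IsPivot M' A j ⟨j, hj⟩ l
        · obtain ⟨l, hl, h⟩ := h
          refine ⟨_, _, _, cl_eliminateColumn_pivot _ _ _ _ _ _ _ j hj hAj l hl h,
            fun j' hj' => hG j' (by omega), Or.inl ⟨hz, fun u t => ?_⟩⟩
          rw [show min ((j : ℕ) + 1) q = j + 1 by omega]
          refine (residual_step M' S' j hj l hqk hjq (isPivot_lt hA h) hl h.2.1 ?_ u t).trans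
            (hinv u t)
          intro hne
          exact h.2.2 _ le_rfl (lt_of_le_of_ne hl hne.symm)
        · push Not at h
          refine ⟨_, _, _, cl_eliminateColumn_singular _ _ _ _ _ _ _ j hj hAj (hz j) h,
            fun j' hj' => ?_, Or.inr ⟨⟨j, by omega, by simp⟩, ?_⟩⟩
          · rw [Function.update_of_ne (fun h => by rw [h] at hj'; omega)]
            exact hz j'
          · obtain ⟨u, hu, hu'⟩ := residual_singular M' S' j hj hqk hqa A hA hjq h
            exact ⟨u, hu, (hinv u 0).1 hu'⟩
      · have hjq : q ≤ j := by
          by_contra hlt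
          exact hAj ((hA j).2 (by omega))
        refine ⟨M', S', G', cl_eliminateColumn_inactive _ _ _ _ _ _ _ j (hact.resolve_left hAj),
          fun j' _ => hz j', Or.inl ⟨hz, fun u t => ?_⟩⟩
        rw [← hinv u t, show min ((j : ℕ) + 1) q = q by omega, show min (j : ℕ) q = q by omega]
    · obtain ⟨M₂, S₂, G₂, h1, h2⟩ := cl_eliminateColumn_sing sub cnt M' S' A G' V j hact
      refine ⟨M₂, S₂, G₂, h1, fun j' hj' => ?_, Or.inr ⟨⟨j₀, by omega, ?_⟩, hker⟩⟩
      · rw [h2 j' (fun h => by rw [h] at hj'; omega)]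
        exact hG j' (by omega)
      · rw [h2 j₀ (fun h => by rw [h] at hj₀; omega), hG₀]

/-! ### The oracle -/

/-- The columns of `(I_a ∣ H₁)`. -/
def blockColumn {a k : ℕ} (H₁ : Matrix (Fin a) (Fin k) (ZMod 2)) (i : Fin a) :
    Fin a ⊕ Fin k → ZMod 2 := Sum.elim (fun l => if i = l then 1 else 0) (H₁ i)

theorem reducedMul_eq_sum {a k : ℕ} (H₁ : Matrix (Fin a) (Fin k) (ZMod 2))
    (e : Fin a ⊕ Fin k → ZMod 2) (i : Fin a) :
    reducedMul H₁ e i = ∑ c, blockColumn H₁ i c * e c := by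
  simp [reducedMul, blockColumn]

/-- Numbering of the selected columns used by the circuit. -/
def selectedColumn {a k : ℕ} (I : Fin a ⊕ Fin k → Bool) (q : ℕ) (c : Fin a) : Fin a ⊕ Fin k :=
  if h : (c : ℕ) < q ∧ (c : ℕ) < k then
    .inr (frontIdx (fun j => I (.inr j)) ⟨c, h.2⟩) else .inl (frontIdx (fun i => !I (.inl i)) c)

section

variable {a k : ℕ} (H₁ : Matrix (Fin a) (Fin k) (ZMod 2)) (s : Fin a → ZMod 2)
  (I : Fin a ⊕ Fin k → Bool)

/-- The number of selected columns of `H₁`. -/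
def selectedCount : ℕ := (Finset.univ.filter fun j => I (.inr j) = true).card

theorem selectedCount_le : selectedCount I ≤ k :=
  (Finset.card_le_univ _).trans (by simp)

theorem card_selected : (Finset.univ.filter fun c => I c = true).card =
    (Finset.univ.filter fun i => I (.inl i) = true).card + selectedCount I := by
  unfold selectedCount
  simp only [Finset.card_filter, Fintype.sum_sum_type]

theorem selectedColumn_injective : Function.Injective (selectedColumn I (selectedCount I)) := by
  intro c c' h
  unfold selectedColumn at h
  split_ifs at h with h1 h2 h2
  · have := (frontIdx_spec _).1 (Sum.inr_injective h)
    simp only [Fin.mk.injEq] at this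
    exact Fin.ext this
  · exact (frontIdx_spec _).1 (Sum.inl_injective h)

variable (hI : (Finset.univ.filter fun c => I c = true).card = a)

include hI

/-- As many identity columns are missing as columns of H₁ are selected, because the selection has
`a` elements. So the system left after using the selected identity columns is square of size q. -/
theorem card_unselected : (Finset.univ.filter fun i => (!I (.inl i)) = true).card =
    selectedCount I := by
  have h1 := card_selected I
  have h2 := Finset.card_filter_add_card_filter_not (s := (Finset.univ : Finset (Fin a)))
    (fun i => I (.inl i) = true)
  simp only [Bool.not_eq_true, Finset.card_univ, Fintype.card_fin] at h2
  simp only [Bool.not_eq_true']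
  omega

theorem selectedCount_le' : selectedCount I ≤ a := by
  have := card_selected I
  omega

theorem selectedColumn_selected (c : Fin a) : I (selectedColumn I (selectedCount I) c) = true := by
  unfold selectedColumn
  split_ifs with h
  · exact (frontIdx_iff (fun j => I (.inr j)) ⟨c, h.2⟩).2 h.1
  · have hk := selectedCount_le I
    have := frontIdx_iff (fun i => !I (.inl i)) c
    rw [card_unselected I hI] at this
    have hnot : ¬ (!I (.inl (frontIdx (fun i => !I (.inl i)) c))) = true := fun h' => by
      have := this.1 h'
      omega
    simpa using hnot

theorem exists_selectedColumn (c : Fin a ⊕ Fin k) (hc : I c = true) :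
    ∃ i, selectedColumn I (selectedCount I) i = c := by
  have himg : Finset.univ.image (selectedColumn I (selectedCount I)) =
      Finset.univ.filter fun c => I c = true := by
    refine Finset.eq_of_subset_of_card_le ?_ ?_
    · intro d hd
      obtain ⟨i, -, rfl⟩ := Finset.mem_image.1 hd
      simpa using selectedColumn_selected I hI i
    · rw [hI, Finset.card_image_of_injective _ (selectedColumn_injective I)]
      simp
  have : c ∈ Finset.univ.image (selectedColumn I (selectedCount I)) := by
    rw [himg]; simpa using hc
  obtain ⟨i, -, hi⟩ := Finset.mem_image.1 this
  exact ⟨i, hi⟩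

theorem sum_selected {R : Type} [AddCommMonoid R] (f : Fin a ⊕ Fin k → R)
    (hf : ∀ c, I c = false → f c = 0) :
    ∑ c, f c = ∑ i, f (selectedColumn I (selectedCount I) i) := by
  symm
  rw [← Finset.sum_image (s := Finset.univ) (g := selectedColumn I (selectedCount I)) (f := f)
    (fun i _ j _ h => selectedColumn_injective I h)]
  refine Finset.sum_subset (Finset.subset_univ _) fun c _ hc => hf c ?_
  by_contra h
  obtain ⟨i, hi⟩ := exists_selectedColumn I hI c (by simpa using h)
  exact hc (Finset.mem_image.2 ⟨i, Finset.mem_univ _, hi⟩)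

/-- After the moves, position c stands for the c-th selected column of H₁ if c < q and for a
selected identity column otherwise. In permuted rows the latter is a unit vector, which is why it
need not be stored. -/
theorem residual_eq (e : Fin a ⊕ Fin k → ZMod 2) (he : SupportedOn I e) (t : ZMod 2) (r : Fin a) :
    residual 0 (selectedCount I)
      (fun i j => decide (H₁ (frontIdx (fun i => !I (.inl i)) i)
        (frontIdx (fun j => I (.inr j)) j) = 1))
      (fun i => decide (s (frontIdx (fun i => !I (.inl i)) i) = 1))
      (fun i => e (selectedColumn I (selectedCount I) i)) t r =
    reducedMul H₁ e (frontIdx (fun i => !I (.inl i)) r) +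
      s (frontIdx (fun i => !I (.inl i)) r) * t := by
  have hbz : ∀ x : ZMod 2, bz (decide (x = 1)) = x := by decide
  have hk := selectedCount_le I
  unfold residual
  rw [reducedMul_eq_sum, sum_selected I hI _ (fun c hc => by rw [he c hc, mul_zero]), hbz]
  congr 1
  refine Finset.sum_congr rfl fun c _ => ?_
  congr 1
  unfold squareEntry selectedColumn blockColumn
  by_cases h : (c : ℕ) < selectedCount I
  · rw [dif_pos (by omega), dif_pos (by omega), hbz]
    rfl
  · rw [dif_neg (by omega), dif_neg (by omega)]
    simp only [Sum.elim_inl, (frontIdx_spec (fun i => !I (.inl i))).1.eq_iff]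

/-- Vectors supported on the a-set I correspond to vectors indexed by its a positions. If no flag is
set, the final syndrome bits are the coordinates of the unique solution, so the counter holds its
weight. If a flag is set, the kernel vector is a relation among the selected columns, and neither
side holds. -/
theorem solveCircuit_spec (w : ℕ) (y : Wire a k → Bool)
    (hy : y = Circuit.cl (solveCircuit a k) (setReg (loadInstance H₁ s) I (oneHot (a + 1) a)))
    (v : Fin (a + 1)) (hv : (v : ℕ) = w) :
    ((∀ j, y (.sing j) = false) ∧ y (.wgt v) = true) ↔ GoodSubset H₁ s w I := by
  have hbz : ∀ x : ZMod 2, bz (decide (x = 1)) = x := by decide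
  set πr := frontIdx (fun i => !I (.inl i)) with hπr
  set πc := frontIdx (fun j => I (.inr j)) with hπc
  have hπr_bij : Function.Bijective πr := Finite.injective_iff_bijective.1 (frontIdx_spec _).1
  have hinit : setReg (loadInstance H₁ s) I (oneHot (a + 1) a) =
      st I (oneHot (a + 1) a) (fun i j => decide (H₁ i j = 1)) (fun i => decide (s i = 1))
        (fun _ => false) (fun _ => false) (fun _ => false) := by
    funext w; cases w <;> rfl
  obtain ⟨M', S', G', h1, h2⟩ := cl_elimination I (oneHot (a + 1) a)
    (fun i j => decide (H₁ (πr i) (πc j) = 1)) (fun i => decide (s (πr i) = 1))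
    (fun j => I (.inr (πc j))) (fun _ => false) (selectedCount_le I) (selectedCount_le' I hI)
    (fun l => frontIdx_iff (fun j => I (.inr j)) l)
  unfold solveCircuit at hy
  rw [hinit, Circuit.cl_append, Circuit.cl_append, Circuit.cl_append, cl_moveColumns, cl_moveRows,
    h1, cl_accumulate] at hy
  have hys : ∀ j, y (.sing j) = G' j := fun j => by rw [hy]; rfl
  have hyw : y (.wgt v) = true ↔ (Finset.univ.filter fun i => S' i = true).card = w := by
    rw [hy, ← hv]
    change decide ((v : ℕ) = _) = true ↔ _
    rw [decide_eq_true_iff, eq_comm]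
  have hcorr : ∀ u : Fin a → ZMod 2, ∃ e, SupportedOn I e ∧
      ∀ i, e (selectedColumn I (selectedCount I) i) = u i := by
    intro u
    classical
    refine ⟨fun c => if h : ∃ i, selectedColumn I (selectedCount I) i = c then u h.choose else 0,
      fun c hc => dif_neg ?_, fun i => ?_⟩
    · rintro ⟨i, rfl⟩
      rw [selectedColumn_selected I hI i] at hc
      exact Bool.false_ne_true hc.symm
    · have h : ∃ i', selectedColumn I (selectedCount I) i' = selectedColumn I (selectedCount I) i := ⟨i, rfl⟩
      simp only [dif_pos h]
      congr 1
      exact selectedColumn_injective I h.choose_spec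
  have hzero : ∀ e, SupportedOn I e → (∀ i, e (selectedColumn I (selectedCount I) i) = 0) → e = 0 := by
    intro e he h
    funext c
    by_cases hc : I c = true
    · obtain ⟨i, rfl⟩ := exists_selectedColumn I hI c hc
      exact h i
    · exact he c (by simpa using hc)
  have hres : ∀ e, SupportedOn I e → ∀ t r, residual 0 (selectedCount I)
      (fun i j => decide (H₁ (πr i) (πc j) = 1)) (fun i => decide (s (πr i) = 1))
      (fun i => e (selectedColumn I (selectedCount I) i)) t r = reducedMul H₁ e (πr r) + s (πr r) * t :=
    residual_eq H₁ s I hI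
  simp only [hys, hyw]
  rcases h2 with ⟨hG, hsol⟩ | ⟨⟨j, hG⟩, u, hu, hker⟩
  · have hind : ∀ e, SupportedOn I e → reducedMul H₁ e = 0 → e = 0 := by
      intro e he h
      refine hzero e he fun i => ?_
      have := (hsol (fun i => e (selectedColumn I (selectedCount I) i)) 0).2 (fun r => by
        rw [hres e he, h]; simp) i
      simpa using this
    have hS : ∀ e, SupportedOn I e →
        (reducedMul H₁ e = s ↔ ∀ i, e (selectedColumn I (selectedCount I) i) = bz (S' i)) := by
      intro e he
      have := hsol (fun i => e (selectedColumn I (selectedCount I) i)) 1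
      simp only [hres e he, mul_one, ZMod.two_add_eq_zero_iff] at this
      rw [this]
      constructor
      · intro h r; rw [h]
      · intro h
        funext i
        obtain ⟨r, rfl⟩ := hπr_bij.2 i
        exact h r
    have hwt : ∀ e, SupportedOn I e → reducedMul H₁ e = s →
        hammingNorm e = (Finset.univ.filter fun i => S' i = true).card := by
      intro e he h
      have h3 := (hS e he).1 h
      unfold hammingNorm
      rw [Finset.card_filter, sum_selected I hI _ (fun c hc => by simp [he c hc]),
        Finset.card_filter]
      refine Finset.sum_congr rfl fun i _ => ?_
      rw [h3 i]
      cases S' i <;> simp [bz]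
    constructor
    · rintro ⟨-, hw⟩
      obtain ⟨e, he, hei⟩ := hcorr fun i => bz (S' i)
      have h := (hS e he).2 hei
      exact ⟨hI, hind, e, he, h, (hwt e he h).trans hw⟩
    · rintro ⟨-, -, e, he, h, hw⟩
      exact ⟨hG, (hwt e he h).symm.trans hw⟩
  · constructor
    · rintro ⟨h, -⟩
      rw [h j] at hG
      exact absurd hG Bool.false_ne_true
    · rintro ⟨-, hind, -⟩
      exfalso
      obtain ⟨e, he, hei⟩ := hcorr u
      have he0 := hind e he (by
        funext i
        obtain ⟨r, rfl⟩ := hπr_bij.2 i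
        have := hker r
        rw [← show (fun i => e (selectedColumn I (selectedCount I) i)) = u from funext hei,
          hres e he] at this
        simpa using this)
      apply hu
      funext i
      rw [← hei i, he0]
      rfl

end


/-! ### Size of the circuits -/

/-- The circuit has at most `N` gates, each with at most `L` controls. -/
def Circuit.Size {W : Type} (C : Circuit W) (N L : ℕ) : Prop :=
  C.length ≤ N ∧ ∀ g ∈ C, g.ctrl.length ≤ L

theorem Circuit.Size.mono {W : Type} {C : Circuit W} {N L N' L' : ℕ} (h : C.Size N L)
    (hN : N ≤ N') (hL : L ≤ L') : C.Size N' L' :=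
  ⟨h.1.trans hN, fun g hg => (h.2 g hg).trans hL⟩

theorem Circuit.Size.append {W : Type} {C D : Circuit W} {N N' L : ℕ} (hC : C.Size N L)
    (hD : D.Size N' L) : Circuit.Size (C ++ D) (N + N') L := by
  refine ⟨by rw [List.length_append]; exact Nat.add_le_add hC.1 hD.1, fun g hg => ?_⟩
  rcases List.mem_append.1 hg with h | h
  · exact hC.2 g h
  · exact hD.2 g h

theorem Circuit.Size.flatMap {W β : Type} {l : List β} {f : β → Circuit W} {N L m : ℕ}
    (hm : l.length ≤ m) (h : ∀ x ∈ l, (f x).Size N L) : Circuit.Size (l.flatMap f) (m * N) L := by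
  constructor
  · refine le_trans ?_ (Nat.mul_le_mul_right N hm)
    clear hm
    induction l with
    | nil => simp
    | cons x l ih =>
      rw [List.flatMap_cons, List.length_append, List.length_cons, add_mul, one_mul, add_comm]
      exact Nat.add_le_add (ih fun y hy => h y (List.mem_cons_of_mem _ hy))
        (h x List.mem_cons_self).1
  · intro g hg
    obtain ⟨x, hx, hg⟩ := List.mem_flatMap.1 hg
    exact (h x hx).2 g hg

theorem Circuit.Size.inverse {W : Type} {C : Circuit W} {N L : ℕ} (h : C.Size N L) :
    (Circuit.inverse C).Size N L := by
  refine ⟨by simpa [Circuit.inverse] using h.1, fun g hg => ?_⟩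
  simp only [Circuit.inverse, List.mem_map, List.mem_reverse] at hg
  obtain ⟨g', hg', rfl⟩ := hg
  exact h.2 g' hg'

theorem Circuit.Size.time_le {W : Type} {C : Circuit W} {N L : ℕ} (h : C.Size N L) :
    Circuit.time C ≤ N * (2 * L + 1) := by
  unfold Circuit.time
  refine le_trans ?_ (Nat.mul_le_mul_right _ h.1)
  have h2 := h.2
  clear h
  induction C with
  | nil => simp
  | cons g C ih =>
    rw [List.map_cons, List.sum_cons, List.length_cons, add_mul, one_mul, add_comm]
    refine Nat.add_le_add (ih fun g' hg' => h2 g' (List.mem_cons_of_mem _ hg')) ?_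
    have := h2 g List.mem_cons_self
    omega

theorem Circuit.Size.qubits_le {W : Type} [Fintype W] {C : Circuit W} {N L : ℕ} (h : C.Size N L) :
    Circuit.qubits C ≤ Fintype.card W + L := by
  unfold Circuit.qubits
  refine Nat.add_le_add_left ?_ _
  have h2 := h.2
  clear h
  induction C with
  | nil => simp
  | cons g C ih =>
    rw [List.map_cons, List.foldr_cons]
    exact max_le (h2 g List.mem_cons_self) (ih fun g' hg' => h2 g' (List.mem_cons_of_mem _ hg'))

theorem size_singleton {W : Type} (g : Gate W) (L : ℕ) (h : g.ctrl.length ≤ L) :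
    Circuit.Size [g] 1 L := ⟨le_rfl, by simpa using h⟩

theorem size_nil {W : Type} (N L : ℕ) : Circuit.Size ([] : Circuit W) N L :=
  ⟨Nat.zero_le _, by simp⟩

theorem size_map {W β : Type} (l : List β) (f : β → Gate W) (m L : ℕ) (hm : l.length ≤ m)
    (h : ∀ x ∈ l, (f x).ctrl.length ≤ L) : Circuit.Size (l.map f) m L := by
  refine ⟨by simpa using hm, fun g hg => ?_⟩
  obtain ⟨x, hx, rfl⟩ := List.mem_map.1 hg
  exact h x hx

theorem length_filter_finRange_le {m : ℕ} (p : Fin m → Bool) :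
    ((List.finRange m).filter p).length ≤ m :=
  (List.length_filter_le _ _).trans (by simp)

theorem size_cswap {W : Type} (ctrl : List (W × Bool)) (u v : W) (L : ℕ) (h : ctrl.length + 1 ≤ L) :
    Circuit.Size (cswap ctrl u v) 3 L := by
  refine ⟨le_rfl, fun g hg => ?_⟩
  simp only [cswap, List.mem_cons, List.not_mem_nil, or_false] at hg
  rcases hg with rfl | rfl | rfl <;> exact h

theorem size_crotate {W : Type} (ctrl : List (W × Bool)) {m : ℕ} (f : Fin m → W) (i : Fin m)
    (L : ℕ) (h : ctrl.length + 1 ≤ L) : Circuit.Size (crotate ctrl f i) (m * 3) L :=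
  Circuit.Size.flatMap (length_filter_finRange_le _) fun _ _ => size_cswap _ _ _ _ h

theorem size_prepare (a k L : ℕ) (hL : 2 ≤ L) :
    Circuit.Size (prepare a k) (1 + (a + k) * ((a + 1) + (a + 1) * 3)) L := by
  refine (size_singleton _ _ (by simp [mcx])).append (Circuit.Size.flatMap ?_ fun ct _ => ?_)
  · rw [List.length_zipIdx, length_columns]
  · refine (size_map _ _ _ _ (by simp) fun u _ => ?_).append (size_crotate _ _ _ _ (by simpa using hL))
    simp only [List.length_cons, List.length_nil]
    omega

theorem size_addRow {a k : ℕ} (ctrl : List (Wire a k × Bool)) (j : Fin k) (l i : Fin a) (L : ℕ)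
    (h : ctrl.length + 1 ≤ L) : Circuit.Size (addRow ctrl j l i) (k + 1) L :=
  (size_map _ _ _ _ (length_filter_finRange_le _) fun _ _ => h).append (size_singleton _ _ h)

theorem size_eliminateColumn (a k : ℕ) (j : Fin k) (L : ℕ) (hL : a + 3 ≤ L) :
    Circuit.Size (eliminateColumn a k j) (a * (1 + (k + 1)) + 1 + a * (k + 1)) L := by
  by_cases hj : (j : ℕ) < a
  · rw [eliminateColumn_eq j hj]
    refine ((Circuit.Size.flatMap (length_filter_finRange_le _) fun l _ => ?_).append
      (size_singleton _ _ ?_)).append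
      (Circuit.Size.flatMap (length_filter_finRange_le _) fun l _ => size_addRow _ _ _ _ _ ?_)
    · have hp : ∀ hl : (l : ℕ) < k, (pivotCtrl j ⟨j, hj⟩ l hl).length ≤ a + 2 := by
        intro hl
        simp only [pivotCtrl, List.length_append, List.length_cons, List.length_nil,
          List.length_map]
        have := length_filter_finRange_le (m := a) (fun r => decide (⟨j, hj⟩ ≤ r ∧ r < l))
        omega
      unfold pivotBlock
      split_ifs with hl h'
      · exact (size_singleton _ _ ((hp hl).trans (by omega))).append (size_nil _ _)
      · exact (size_singleton _ _ ((hp hl).trans (by omega))).append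
          (size_addRow _ _ _ _ _ (by have := hp hl; omega))
      · exact size_nil _ _
    · simp only [mcx, List.length_cons, List.length_nil]; omega
    · simp only [List.length_cons, List.length_nil]; omega
  · unfold eliminateColumn
    rw [dif_neg hj]
    exact size_nil _ _

/-- The widest gate is a pivot test with an additional row-addition control, hence at most a + 3
controls. -/
theorem size_solveCircuit (a k L : ℕ) (hL : a + 3 ≤ L) : Circuit.Size (solveCircuit a k)
    ((k + k * (a * (k * 3) + k * 3)) + a * (k * (a * 3) + a * 3) +
      k * (a * (1 + (k + 1)) + 1 + a * (k + 1)) + (1 + a * ((a + 1) * 3))) L := by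
  have h1 : ∀ x : Wire a k × Bool, [x].length + 1 ≤ L := fun x => by
    simp only [List.length_cons, List.length_nil]; omega
  refine (((Circuit.Size.append (size_map _ _ _ _ (by simp) fun j _ => ?_)
    (Circuit.Size.flatMap (by simp) fun j _ =>
      (Circuit.Size.flatMap (by simp) fun i _ => size_crotate _ _ _ _ (h1 _)).append
        (size_crotate _ _ _ _ (h1 _)))).append
    (Circuit.Size.flatMap (by simp) fun j _ =>
      (Circuit.Size.flatMap (by simp) fun i _ => size_crotate _ _ _ _ (h1 _)).append
        (size_crotate _ _ _ _ (h1 _)))).append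
    (Circuit.Size.flatMap (by simp) fun j _ => size_eliminateColumn _ _ _ _ hL)).append
    ((size_singleton _ _ (by simp [mcx])).append
      (Circuit.Size.flatMap (by simp) fun j _ => size_crotate _ _ _ _ (h1 _)))
  simp only [mcx, List.length_cons, List.length_nil]
  omega

/-- The number of gates of the search circuit, and the number of their controls. -/
theorem size_searchCircuit (a k w j : ℕ) : Circuit.Size (searchCircuit a k w j)
    (46 * (j + 1) * (a + k + 1) ^ 3) (2 * (a + k) + 3) := by
  set m := a + k + 1 with hm
  have ha : a ≤ m := by omega
  have ha1 : a + 1 ≤ m := by omega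
  have hk : k ≤ m := by omega
  have hk1 : k + 1 ≤ m := by omega
  have hak : a + k ≤ m := by omega
  have hm1 : 1 ≤ m := by omega
  have h12 : m ≤ m ^ 3 := Nat.le_self_pow (by omega) m
  have h23 : m ^ 2 ≤ m ^ 3 := Nat.pow_le_pow_right hm1 (by omega)
  have h1 : 1 ≤ m ^ 3 := Nat.one_le_pow _ _ hm1
  have hp : Circuit.Size (prepare a k) (5 * m ^ 3) (2 * (a + k) + 3) := by
    refine (size_prepare a k _ (by omega)).mono ?_ le_rfl
    calc 1 + (a + k) * ((a + 1) + (a + 1) * 3) ≤ 1 + m * (m + m * 3) := by gcongr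
      _ = 1 + 4 * m ^ 2 := by ring
      _ ≤ 5 * m ^ 3 := by omega
  have hs : Circuit.Size (solveCircuit a k) (16 * m ^ 3) (2 * (a + k) + 3) := by
    refine (size_solveCircuit a k _ (by omega)).mono ?_ le_rfl
    calc _ ≤ (m + m * (m * (m * 3))) + m * (m * (m * 3)) +
          m * (m * (1 + m) + 1 + m * m) + (1 + m * (m * 3)) := by
          have e1 : a * (k * 3) + k * 3 = (a + 1) * (k * 3) := by ring
          have e2 : k * (a * 3) + a * 3 = (k + 1) * (a * 3) := by ring
          rw [e1, e2]
          gcongr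
      _ = 8 * m ^ 3 + 4 * m ^ 2 + 2 * m + 1 := by ring
      _ ≤ 16 * m ^ 3 := by omega
  have hr : Circuit.Size (reflectZero a k) (3 * m ^ 3) (2 * (a + k) + 3) := by
    refine ⟨by simp only [reflectZero, List.length_cons, List.length_nil]; omega, fun g hg => ?_⟩
    simp only [reflectZero, List.mem_cons, List.not_mem_nil, or_false] at hg
    rcases hg with rfl | rfl | rfl
    · simp [mcx]
    · simp only [List.length_append, List.length_map, length_columns]
      have := length_filter_finRange_le (m := a + 1) (fun u => decide (u ≠ 0))
      omega
    · simp [mcx]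
  have ho : Circuit.Size (oracle a k w) (33 * m ^ 3) (2 * (a + k) + 3) := by
    refine ((hs.append (size_singleton _ _ ?_)).append hs.inverse).mono ?_ le_rfl
    · simp only [List.length_map, List.length_finRange]; omega
    · omega
  -- One iteration: 33 for the oracle, 5 for each of the two preparations and 3 for the reflection.
  have hit : Circuit.Size (oracle a k w ++ Circuit.inverse (prepare a k) ++ reflectZero a k ++
      prepare a k) (46 * m ^ 3) (2 * (a + k) + 3) :=
    (((ho.append hp.inverse).append hr).append hp).mono (by omega) le_rfl
  unfold searchCircuit
  have hrep : Circuit.Size (List.replicate j (oracle a k w ++ Circuit.inverse (prepare a k) ++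
      reflectZero a k ++ prepare a k)).flatten (j * (46 * m ^ 3)) (2 * (a + k) + 3) := by
    have := Circuit.Size.flatMap (l := List.replicate j (oracle a k w ++
      Circuit.inverse (prepare a k) ++ reflectZero a k ++ prepare a k)) (f := id) (m := j) (by simp)
      (fun x hx => by rw [List.eq_of_mem_replicate hx]; exact hit)
    rwa [List.flatMap_id] at this
  refine (hp.append hrep).mono ?_ le_rfl
  calc 5 * m ^ 3 + j * (46 * m ^ 3) ≤ 46 * m ^ 3 + j * (46 * m ^ 3) := by omega
    _ = 46 * (j + 1) * m ^ 3 := by ring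

theorem time_searchCircuit_le (a k w j : ℕ) :
    Circuit.time (searchCircuit a k w j) ≤ 322 * (j + 1) * (a + k + 1) ^ 4 := by
  refine (size_searchCircuit a k w j).time_le.trans ?_
  calc _ ≤ 46 * (j + 1) * (a + k + 1) ^ 3 * (7 * (a + k + 1)) := by gcongr; omega
    _ = _ := by ring

/-- The wires as a disjoint union. -/
def wireEquiv (a k : ℕ) : Wire a k ≃
    (Fin a ⊕ Fin k) ⊕ Fin (a + 1) ⊕ (Fin a × Fin k) ⊕ Fin a ⊕ Fin k ⊕ Fin k ⊕ Fin (a + 1) where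
  toFun
    | .sub c => .inl c
    | .cnt u => .inr (.inl u)
    | .mat i j => .inr (.inr (.inl (i, j)))
    | .syn i => .inr (.inr (.inr (.inl i)))
    | .act j => .inr (.inr (.inr (.inr (.inl j))))
    | .sing j => .inr (.inr (.inr (.inr (.inr (.inl j)))))
    | .wgt u => .inr (.inr (.inr (.inr (.inr (.inr u)))))
  invFun
    | .inl c => .sub c
    | .inr (.inl u) => .cnt u
    | .inr (.inr (.inl (i, j))) => .mat i j
    | .inr (.inr (.inr (.inl i))) => .syn i
    | .inr (.inr (.inr (.inr (.inl j)))) => .act j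
    | .inr (.inr (.inr (.inr (.inr (.inl j))))) => .sing j
    | .inr (.inr (.inr (.inr (.inr (.inr u))))) => .wgt u
  left_inv w := by cases w <;> rfl
  right_inv w := by rcases w with c | u | ⟨i, j⟩ | i | j | j | u <;> rfl

theorem card_wire (a k : ℕ) : Fintype.card (Wire a k) = a * k + 4 * a + 3 * k + 2 := by
  rw [Fintype.card_congr (wireEquiv a k)]
  simp only [Fintype.card_sum, Fintype.card_fin, Fintype.card_prod]
  ring

theorem matrixQubits_eq (a k : ℕ) : matrixQubits a k = a * k := by
  unfold matrixQubits
  have e : {v : Wire a k // v.IsMatrix} ≃ Fin a × Fin k :=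
    { toFun := fun v => match v with
        | ⟨.mat i j, _⟩ => (i, j)
      invFun := fun x => ⟨.mat x.1 x.2, trivial⟩
      left_inv := by
        rintro ⟨v, hv⟩
        cases v <;> first | rfl | exact hv.elim
      right_inv := fun x => rfl }
  rw [Nat.card_congr e]
  simp

/-- The register has 4a + 3k + 2 wires besides the matrix, and 2(a+k) + 3 reusable work qubits
suffice for the gate with most controls. -/
theorem qubits_searchCircuit_le (a k w j : ℕ) :
    (searchCircuit a k w j).qubits ≤ matrixQubits a k + (6 * a + 5 * k + 5) := by
  refine (size_searchCircuit a k w j).qubits_le.trans ?_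
  rw [card_wire, matrixQubits_eq]
  omega


/-! ### Amplitude amplification -/

theorem setReg_loadInstance {a k : ℕ} (H₁ : Matrix (Fin a) (Fin k) (ZMod 2)) (s : Fin a → ZMod 2) :
    setReg (loadInstance H₁ s) (fun _ => false) (fun _ => false) = loadInstance H₁ s := by
  funext w; cases w <;> rfl

theorem isClassical_append {W : Type} {C D : Circuit W} (hC : C.IsClassical) (hD : D.IsClassical) :
    Circuit.IsClassical (C ++ D) := fun g hg => (List.mem_append.1 hg).elim (hC g) (hD g)

theorem isClassical_flatMap {W β : Type} (l : List β) (f : β → Circuit W)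
    (h : ∀ x ∈ l, (f x).IsClassical) : Circuit.IsClassical (l.flatMap f) := fun g hg => by
  obtain ⟨x, hx, hg⟩ := List.mem_flatMap.1 hg
  exact h x hx g hg

theorem isClassical_map_mcx {W β : Type} (l : List β) (f : β → List (W × Bool)) (t : β → W) :
    Circuit.IsClassical (l.map fun x => mcx (f x) (t x)) := fun g hg => by
  obtain ⟨x, _, rfl⟩ := List.mem_map.1 hg
  rfl

theorem isClassical_mcx {W : Type} (c : List (W × Bool)) (t : W) :
    Circuit.IsClassical [mcx c t] := fun g hg => by
  rw [List.mem_singleton.1 hg]; rfl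

theorem isClassical_nil {W : Type} : Circuit.IsClassical ([] : Circuit W) := fun g hg => by
  simp at hg

theorem isClassical_rotate {W : Type} (ctrl : List (W × Bool)) {m : ℕ} (f : Fin m → W) (i : Fin m) :
    Circuit.IsClassical (crotate ctrl f i) := by
  classical exact isClassical_crotate ctrl f i

theorem isClassical_addRow {a k : ℕ} (ctrl : List (Wire a k × Bool)) (j : Fin k) (l i : Fin a) :
    Circuit.IsClassical (addRow ctrl j l i) :=
  isClassical_append (isClassical_map_mcx _ _ _) (isClassical_mcx _ _)

theorem isClassical_eliminateColumn (a k : ℕ) (j : Fin k) :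
    Circuit.IsClassical (eliminateColumn a k j) := by
  by_cases hj : (j : ℕ) < a
  · rw [eliminateColumn_eq j hj]
    refine isClassical_append (isClassical_append (isClassical_flatMap _ _ fun l _ => ?_)
      (isClassical_mcx _ _)) (isClassical_flatMap _ _ fun l _ => isClassical_addRow _ _ _ _)
    unfold pivotBlock
    split_ifs
    · exact isClassical_append (isClassical_mcx _ _) isClassical_nil
    · exact isClassical_append (isClassical_mcx _ _) (isClassical_addRow _ _ _ _)
    · exact isClassical_nil
  · unfold eliminateColumn
    rw [dif_neg hj]
    exact isClassical_nil

theorem isClassical_solveCircuit (a k : ℕ) : Circuit.IsClassical (solveCircuit a k) := by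
  refine isClassical_append (isClassical_append (isClassical_append
    (isClassical_append (isClassical_map_mcx _ _ _) (isClassical_flatMap _ _ fun j _ =>
      isClassical_append (isClassical_flatMap _ _ fun i _ => isClassical_rotate _ _ _)
        (isClassical_rotate _ _ _)))
    (isClassical_flatMap _ _ fun j _ =>
      isClassical_append (isClassical_flatMap _ _ fun i _ => isClassical_rotate _ _ _)
        (isClassical_rotate _ _ _)))
    (isClassical_flatMap _ _ fun j _ => isClassical_eliminateColumn _ _ _))
    (isClassical_append (isClassical_mcx _ _)
      (isClassical_flatMap _ _ fun j _ => isClassical_rotate _ _ _))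

/-- Compute, flip the phase, uncompute: conjugating a diagonal sign by a permutation of basis states
gives the sign read off from the computed bits. -/
theorem act_oracle (a k w : ℕ) (ψ : (Wire a k → Bool) → ℂ) (x : Wire a k → Bool) :
    Circuit.act (oracle a k w) ψ x =
      if (∀ j, Circuit.cl (solveCircuit a k) x (.sing j) = false) ∧
        Circuit.cl (solveCircuit a k) x (.wgt (Fin.ofNat (a + 1) w)) = true then -ψ x else ψ x := by
  unfold oracle
  rw [Circuit.act_append, Circuit.act_append,
    Circuit.act_inverse_classical (isClassical_solveCircuit a k), Circuit.act_cons, Circuit.act_nil,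
    Gate.apply_Z _ rfl, Circuit.act_cl (isClassical_solveCircuit a k)]
  refine if_congr (and_congr_left fun _ => ?_) rfl rfl
  simp [Gate.Fires]

open Classical in
/-- Amplitude `α` on the good subsets and `β` on the other subsets. -/
def twoLevel {a k : ℕ} (H₁ : Matrix (Fin a) (Fin k) (ZMod 2)) (s : Fin a → ZMod 2) (w : ℕ)
    (α β : ℝ) : (Wire a k → Bool) → ℂ := fun x =>
  if IsSubsetState (loadInstance H₁ s) x then
    ((if GoodSubset H₁ s w (fun c => x (.sub c)) then α else β : ℝ) : ℂ) else 0

open Classical in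
/-- The `a`-element subsets of the columns. -/
def subsets (a k : ℕ) : Finset (Fin a ⊕ Fin k → Bool) :=
  Finset.univ.filter fun I => (Finset.univ.filter fun c => I c = true).card = a

open Classical in
/-- The good subsets. -/
def goodSubsets {a k : ℕ} (H₁ : Matrix (Fin a) (Fin k) (ZMod 2)) (s : Fin a → ZMod 2) (w : ℕ) :
    Finset (Fin a ⊕ Fin k → Bool) := Finset.univ.filter fun I => GoodSubset H₁ s w I

theorem mem_subsets {a k : ℕ} (I : Fin a ⊕ Fin k → Bool) : I ∈ subsets a k ↔
    (Finset.univ.filter fun c => I c = true).card = a := by simp [subsets]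

theorem mem_goodSubsets {a k : ℕ} (H₁ : Matrix (Fin a) (Fin k) (ZMod 2)) (s : Fin a → ZMod 2)
    (w : ℕ) (I : Fin a ⊕ Fin k → Bool) : I ∈ goodSubsets H₁ s w ↔ GoodSubset H₁ s w I := by
  simp [goodSubsets]

theorem goodSubsets_subset {a k : ℕ} (H₁ : Matrix (Fin a) (Fin k) (ZMod 2)) (s : Fin a → ZMod 2)
    (w : ℕ) : goodSubsets H₁ s w ⊆ subsets a k := fun I hI =>
  (mem_subsets I).2 ((mem_goodSubsets H₁ s w I).1 hI).1

/-- The characteristic function of a finite set. -/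
def boolEquivFinset (α : Type) [Fintype α] [DecidableEq α] : (α → Bool) ≃ Finset α where
  toFun I := Finset.univ.filter fun c => I c = true
  invFun A := fun c => decide (c ∈ A)
  left_inv I := by funext c; simp
  right_inv A := by ext c; simp

theorem card_subsets (a k : ℕ) : (subsets a k).card = (a + k).choose a := by
  have : (a + k).choose a = (Finset.powersetCard a (Finset.univ : Finset (Fin a ⊕ Fin k))).card := by
    simp [Finset.card_powersetCard]
  rw [this]
  refine Finset.card_bij (fun I _ => boolEquivFinset _ I) ?_ ?_ ?_
  · intro I hI
    rw [Finset.mem_powersetCard]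
    exact ⟨Finset.subset_univ _, (mem_subsets I).1 hI⟩
  · intro I _ J _ h
    exact (boolEquivFinset _).injective h
  · intro A hA
    refine ⟨(boolEquivFinset _).symm A, ?_, by simp⟩
    rw [mem_subsets]
    have : (Finset.univ.filter fun c => (boolEquivFinset _).symm A c = true) = A :=
      (boolEquivFinset _).apply_symm_apply A
    rw [this]
    exact (Finset.mem_powersetCard.1 hA).2

section

variable {a k : ℕ} (H₁ : Matrix (Fin a) (Fin k) (ZMod 2)) (s : Fin a → ZMod 2) (w : ℕ)

/-- The bound `w ≤ a` ensures that `Fin.ofNat` does not reduce w to another counter position. -/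
theorem act_oracle_twoLevel (hw : w ≤ a) (α β : ℝ) :
    Circuit.act (oracle a k w) (twoLevel H₁ s w α β) = twoLevel H₁ s w (-α) β := by
  funext x
  rw [act_oracle]
  unfold twoLevel
  by_cases hx : IsSubsetState (loadInstance H₁ s) x
  · obtain ⟨I, rfl, hI⟩ := hx
    have hspec := solveCircuit_spec H₁ s I hI w _ rfl (Fin.ofNat (a + 1) w)
      (by simp only [Fin.ofNat]; exact Nat.mod_eq_of_lt (by omega))
    have hx : IsSubsetState (loadInstance H₁ s)
      (setReg (loadInstance H₁ s) I (oneHot (a + 1) a)) := ⟨I, rfl, hI⟩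
    rw [if_pos hx, if_pos hx]
    have hsub : (fun c => setReg (loadInstance H₁ s) I (oneHot (a + 1) a) (.sub c)) = I := rfl
    rw [hsub]
    by_cases hg : GoodSubset H₁ s w I
    · rw [if_pos (hspec.2 hg), if_pos hg, if_pos hg]; simp
    · rw [if_neg (fun h => hg (hspec.1 h)), if_neg hg, if_neg hg]
  · simp [hx]

theorem agreesOff_twoLevel (α β : ℝ) :
    AgreesOff Wire.InReg (loadInstance H₁ s) (twoLevel H₁ s w α β) := by
  intro x hx wi hwi
  by_cases h : IsSubsetState (loadInstance H₁ s) x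
  · obtain ⟨I, rfl, -⟩ := h
    exact setReg_of_not_inReg _ _ _ _ hwi
  · exact absurd (by unfold twoLevel; rw [if_neg h]) hx

theorem sum_subsetState (F : (Wire a k → Bool) → ℂ)
    (hF : ∀ x, ¬ IsSubsetState (loadInstance H₁ s) x → F x = 0) :
    ∑ x, F x = ∑ I ∈ subsets a k, F (setReg (loadInstance H₁ s) I (oneHot (a + 1) a)) := by
  classical
  rw [← Finset.sum_image (s := subsets a k)
    (g := fun I => setReg (loadInstance H₁ s) I (oneHot (a + 1) a)) (f := F)
    (fun I _ J _ h => (setReg_injective h).1)]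
  symm
  refine Finset.sum_subset (Finset.subset_univ _) fun x _ hx => hF x fun ⟨I, h1, h2⟩ => hx ?_
  exact Finset.mem_image.2 ⟨I, (mem_subsets I).2 h2, h1.symm⟩

theorem twoLevel_setReg (α β : ℝ) (I : Fin a ⊕ Fin k → Bool) (hI : I ∈ subsets a k) :
    twoLevel H₁ s w α β (setReg (loadInstance H₁ s) I (oneHot (a + 1) a)) =
      ((if I ∈ goodSubsets H₁ s w then α else β : ℝ) : ℂ) := by
  unfold twoLevel
  rw [if_pos ⟨I, rfl, (mem_subsets I).1 hI⟩]
  have hsub : (fun c => setReg (loadInstance H₁ s) I (oneHot (a + 1) a) (.sub c)) = I := rfl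
  rw [hsub]
  by_cases h : GoodSubset H₁ s w I
  · rw [if_pos h, if_pos ((mem_goodSubsets H₁ s w I).2 h)]
  · rw [if_neg h, if_neg (mt (mem_goodSubsets H₁ s w I).1 h)]

theorem pairing_twoLevel (c α β : ℝ) :
    pairing (twoLevel H₁ s w c c) (twoLevel H₁ s w α β) =
      ((c * ((goodSubsets H₁ s w).card * α +
        (((a + k).choose a : ℝ) - (goodSubsets H₁ s w).card) * β) : ℝ) : ℂ) := by
  classical
  unfold pairing
  rw [sum_subsetState H₁ s _ (fun x hx => by unfold twoLevel; simp [hx])]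
  have h1 : ∀ I ∈ subsets a k,
      twoLevel H₁ s w c c (setReg (loadInstance H₁ s) I (oneHot (a + 1) a)) *
        twoLevel H₁ s w α β (setReg (loadInstance H₁ s) I (oneHot (a + 1) a)) =
      ((c * β + if I ∈ goodSubsets H₁ s w then c * (α - β) else 0 : ℝ) : ℂ) := by
    intro I hI
    rw [twoLevel_setReg _ _ _ _ _ _ hI, twoLevel_setReg _ _ _ _ _ _ hI, ite_self,
      ← Complex.ofReal_mul]
    congr 1
    split_ifs <;> ring
  rw [Finset.sum_congr rfl h1, ← Complex.ofReal_sum]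
  congr 1
  rw [Finset.sum_add_distrib, Finset.sum_const, card_subsets, ← Finset.sum_filter,
    Finset.filter_mem_eq_inter, Finset.inter_eq_right.2 (goodSubsets_subset H₁ s w),
    Finset.sum_const, nsmul_eq_mul, nsmul_eq_mul]
  ring

theorem act_prepare_twoLevel : Circuit.act (prepare a k) (delta (loadInstance H₁ s)) =
    twoLevel H₁ s w (Real.sqrt ((a + k).choose a))⁻¹ (Real.sqrt ((a + k).choose a))⁻¹ := by
  funext x
  rw [act_prepare _ (setReg_loadInstance H₁ s)]
  unfold twoLevel
  simp

theorem twoLevel_linear (α β γ δ c : ℝ) :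
    (1 : ℂ) • twoLevel H₁ s w α β + (c : ℂ) • twoLevel H₁ s w γ δ =
      twoLevel H₁ s w (α + c * γ) (β + c * δ) := by
  funext x
  unfold twoLevel
  simp only [Pi.add_apply, Pi.smul_apply, smul_eq_mul, one_mul]
  split_ifs <;> simp

/-- The angle of the amplitude amplification. -/
def searchAngle : ℝ := Real.arcsin (Real.sqrt ((goodSubsets H₁ s w).card / (a + k).choose a))

theorem sin_sq_searchAngle : Real.sin (searchAngle H₁ s w) ^ 2 =
    (goodSubsets H₁ s w).card / (a + k).choose a := by
  have hN : (0 : ℝ) < (a + k).choose a := by exact_mod_cast Nat.choose_pos (by omega)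
  have h0 : (0 : ℝ) ≤ (goodSubsets H₁ s w).card / (a + k).choose a := by positivity
  have h1 : ((goodSubsets H₁ s w).card : ℝ) / (a + k).choose a ≤ 1 := by
    rw [div_le_one hN, ← card_subsets]
    exact_mod_cast Finset.card_le_card (goodSubsets_subset H₁ s w)
  have hnn := Real.sqrt_nonneg (((goodSubsets H₁ s w).card : ℝ) / (a + k).choose a)
  unfold searchAngle
  rw [Real.sin_arcsin (by linarith) (Real.sqrt_le_one.2 h1), Real.sq_sqrt h0]

/-- In the two-dimensional space spanned by the good and the other subsets, each iteration is a
rotation by 2θ, up to sign. The sign (-1)^j appears because the circuit reflects by 1 - 2|s⟩⟨s|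
rather than by its negative. Multiplying the amplitudes by sin θ and cos θ instead of dividing
includes the cases in which one class of subsets is empty. -/
theorem act_searchCircuit (hw : w ≤ a) (j : ℕ) : ∃ α β : ℝ,
    Circuit.act (searchCircuit a k w j) (delta (loadInstance H₁ s)) = twoLevel H₁ s w α β ∧
      Real.sqrt ((a + k).choose a) * Real.sin (searchAngle H₁ s w) * α =
        (-1) ^ j * Real.sin ((2 * j + 1) * searchAngle H₁ s w) ∧
      Real.sqrt ((a + k).choose a) * Real.cos (searchAngle H₁ s w) * β =
        (-1) ^ j * Real.cos ((2 * j + 1) * searchAngle H₁ s w) := by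
  set θ := searchAngle H₁ s w with hθ
  set R := Real.sqrt ((a + k).choose a) with hR
  have hN : (0 : ℝ) < (a + k).choose a := by exact_mod_cast Nat.choose_pos (by omega)
  have hRpos : 0 < R := Real.sqrt_pos.2 hN
  have hR2 : R ^ 2 = (a + k).choose a := Real.sq_sqrt hN.le
  have hsin : ((goodSubsets H₁ s w).card : ℝ) = R ^ 2 * Real.sin θ ^ 2 := by
    rw [hR2, sin_sq_searchAngle]; field_simp
  induction j with
  | zero =>
    refine ⟨R⁻¹, R⁻¹, ?_, ?_, ?_⟩
    · unfold searchCircuit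
      rw [List.replicate_zero, List.flatten_nil, List.append_nil]
      exact act_prepare_twoLevel H₁ s w
    · simp only [Nat.cast_zero, mul_zero, zero_add, one_mul, pow_zero]; field_simp
    · simp only [Nat.cast_zero, mul_zero, zero_add, one_mul, pow_zero]; field_simp
  | succ j ih =>
    obtain ⟨α, β, h1, h2, h3⟩ := ih
    have hsplit : searchCircuit a k w (j + 1) = searchCircuit a k w j ++
        (oracle a k w ++ (Circuit.inverse (prepare a k) ++ reflectZero a k ++ prepare a k)) := by
      unfold searchCircuit
      rw [List.replicate_succ', List.flatten_append, List.flatten_singleton]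
      simp only [List.append_assoc]
    have hp : -2 * (((R⁻¹ * ((goodSubsets H₁ s w).card * (-α) +
        (((a + k).choose a : ℝ) - (goodSubsets H₁ s w).card) * β) : ℝ)) : ℂ) =
        ((2 * R * (Real.sin θ ^ 2 * α - Real.cos θ ^ 2 * β) : ℝ) : ℂ) := by
      rw [hsin, ← hR2, Real.cos_sq']
      push_cast
      have : (R : ℂ) ≠ 0 := by exact_mod_cast hRpos.ne'
      field_simp
      ring
    refine ⟨-α + 2 * R * (Real.sin θ ^ 2 * α - Real.cos θ ^ 2 * β) * R⁻¹,
      β + 2 * R * (Real.sin θ ^ 2 * α - Real.cos θ ^ 2 * β) * R⁻¹, ?_, ?_, ?_⟩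
    · rw [hsplit, Circuit.act_append, Circuit.act_append, h1, act_oracle_twoLevel _ _ _ hw,
        act_diffusion _ (setReg_loadInstance H₁ s) _ (agreesOff_twoLevel H₁ s w _ _),
        act_prepare_twoLevel H₁ s w, pairing_twoLevel, ← hR, hp, twoLevel_linear]
    · have e1 : (2 * ((j + 1 : ℕ) : ℝ) + 1) * θ = (2 * j + 1) * θ + 2 * θ := by push_cast; ring
      rw [e1, Real.sin_add, Real.sin_two_mul, Real.cos_two_mul', pow_succ (-1 : ℝ) j]
      have e2 : R * Real.sin θ * (-α + 2 * R * (Real.sin θ ^ 2 * α - Real.cos θ ^ 2 * β) * R⁻¹) =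
          (2 * Real.sin θ ^ 2 - 1) * (R * Real.sin θ * α) -
            2 * Real.sin θ * Real.cos θ * (R * Real.cos θ * β) := by
        field_simp; ring
      rw [e2, h2, h3]
      linear_combination (-1 : ℝ) ^ j * Real.sin ((2 * j + 1) * θ) * Real.sin_sq_add_cos_sq θ
    · have e1 : (2 * ((j + 1 : ℕ) : ℝ) + 1) * θ = (2 * j + 1) * θ + 2 * θ := by push_cast; ring
      rw [e1, Real.cos_add, Real.sin_two_mul, Real.cos_two_mul', pow_succ (-1 : ℝ) j]
      have e2 : R * Real.cos θ * (β + 2 * R * (Real.sin θ ^ 2 * α - Real.cos θ ^ 2 * β) * R⁻¹) =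
          (1 - 2 * Real.cos θ ^ 2) * (R * Real.cos θ * β) +
            2 * Real.sin θ * Real.cos θ * (R * Real.sin θ * α) := by
        field_simp; ring
      rw [e2, h2, h3]
      linear_combination (-1 : ℝ) ^ (j + 1) * Real.cos ((2 * j + 1) * θ) *
        Real.sin_sq_add_cos_sq θ

/-! ### Random number of iterations -/

/-- Multiplying by sin 2θ makes the sum telescope. The undivided form remains valid when sin 2θ = 0.
-/
theorem sum_sin_sq (θ : ℝ) (M : ℕ) :
    4 * Real.sin (2 * θ) * ∑ j ∈ Finset.range M, Real.sin ((2 * j + 1) * θ) ^ 2 =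
      2 * M * Real.sin (2 * θ) - Real.sin (4 * M * θ) := by
  induction M with
  | zero => simp
  | succ M ih =>
    rw [Finset.sum_range_succ, mul_add, ih]
    have e1 : 4 * ((M + 1 : ℕ) : ℝ) * θ = 2 * ((2 * M + 1) * θ) + 2 * θ := by push_cast; ring
    have e2 : 4 * (M : ℝ) * θ = 2 * ((2 * M + 1) * θ) - 2 * θ := by ring
    rw [e1, e2, Real.sin_add, Real.sin_sub, Real.cos_two_mul' ((2 * M + 1) * θ)]
    push_cast
    linear_combination (2 * Real.sin (2 * θ)) * Real.sin_sq_add_cos_sq ((2 * M + 1) * θ)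

/-- The sum is M(4M² - 1)/3, and this is at least M³ because M ≥ 1. -/
theorem sum_odd_sq_le (M : ℕ) (hM : 1 ≤ M) :
    (M : ℝ) ^ 3 ≤ ∑ j ∈ Finset.range M, (2 * (j : ℝ) + 1) ^ 2 := by
  have h : ∀ n : ℕ, 3 * ∑ j ∈ Finset.range n, (2 * (j : ℝ) + 1) ^ 2 =
      (n : ℝ) * (4 * (n : ℝ) ^ 2 - 1) := by
    intro n
    induction n with
    | zero => simp
    | succ n ih => rw [Finset.sum_range_succ, mul_add, ih]; push_cast; ring
  have h1 : (1 : ℝ) ≤ M := by exact_mod_cast hM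
  nlinarith [h M, mul_nonneg (sub_nonneg.2 h1) (sq_nonneg (M : ℝ))]

/-- Lower bound for the average success probability over a random number of iterations. -/
theorem average_sin_sq (θ g : ℝ) (hθ0 : 0 < θ) (hθ1 : θ ≤ Real.pi / 2) (hg : 0 < g) (M : ℕ)
    (hM1 : 1 ≤ M) (hM : Real.pi / (4 * g) ≤ M) :
    (M : ℝ) / 4 * min 1 (Real.sin θ ^ 2 / g ^ 2) ≤
      ∑ j ∈ Finset.range M, Real.sin ((2 * j + 1) * θ) ^ 2 := by
  have hπ := Real.pi_pos
  have hMr : (1 : ℝ) ≤ M := by exact_mod_cast hM1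
  have hid := sum_sin_sq θ M
  set T := ∑ j ∈ Finset.range M, Real.sin ((2 * j + 1) * θ) ^ 2 with hT
  have hs0 : 0 ≤ Real.sin (2 * θ) := Real.sin_nonneg_of_nonneg_of_le_pi (by linarith) (by linarith)
  have hmin : min 1 (Real.sin θ ^ 2 / g ^ 2) ≤ 1 := min_le_left _ _
  have hquarter : (M : ℝ) / 4 ≤ T → (M : ℝ) / 4 * min 1 (Real.sin θ ^ 2 / g ^ 2) ≤ T := fun h =>
    (mul_le_of_le_one_right (by positivity) hmin).trans h
  -- If M·sin 2θ ≥ 1, the oscillating term of the closed form is at most M·sin 2θ, and the average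
  -- is at least 1/4.
  by_cases hA : 1 ≤ M * Real.sin (2 * θ)
  · apply hquarter
    have hs : 0 < Real.sin (2 * θ) := by
      rcases hs0.lt_or_eq with h | h
      · exact h
      · rw [← h, mul_zero] at hA; linarith
    have h1 := Real.sin_le_one (4 * M * θ)
    have h2 : 4 * Real.sin (2 * θ) * (M / 4) ≤ 4 * Real.sin (2 * θ) * T := by
      rw [hid]; nlinarith
    exact le_of_mul_le_mul_left h2 (by linarith)
  · push Not at hA
    rcases le_or_gt θ (Real.pi / 4) with hB | hC
    · have hlin : 2 / Real.pi * (2 * θ) ≤ Real.sin (2 * θ) :=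
        Real.mul_le_sin (by linarith) (by linarith)
      -- Jordan's inequality turns a small M·sin 2θ into a small Mθ. All angles then lie below π/2,
      -- where the sine is bounded below linearly, and the sum of odd squares with M ≥ π/(4g) gives
      -- the bound.
      have hMθ : 2 * M * θ ≤ Real.pi / 2 := by
        have h1 : M * (2 / Real.pi * (2 * θ)) ≤ 1 :=
          (mul_le_mul_of_nonneg_left hlin (by linarith)).trans hA.le
        have h2 : M * (2 / Real.pi * (2 * θ)) = (4 * M * θ) / Real.pi := by ring
        rw [h2, div_le_one hπ] at h1
        linarith
      have hterm : ∀ j ∈ Finset.range M, (2 / Real.pi) ^ 2 * Real.sin θ ^ 2 * (2 * (j : ℝ) + 1) ^ 2 ≤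
          Real.sin ((2 * j + 1) * θ) ^ 2 := by
        intro j hj
        have hjM : (2 * (j : ℝ) + 1) ≤ 2 * M := by
          have : j + 1 ≤ M := Finset.mem_range.1 hj
          have : (j : ℝ) + 1 ≤ M := by exact_mod_cast this
          linarith
        have h1 : (2 * (j : ℝ) + 1) * θ ≤ Real.pi / 2 :=
          (mul_le_mul_of_nonneg_right hjM hθ0.le).trans hMθ
        have h2 := Real.mul_le_sin (by positivity : (0 : ℝ) ≤ (2 * (j : ℝ) + 1) * θ) h1
        have h3 : Real.sin θ ≤ θ := Real.sin_le hθ0.le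
        have h4 : 0 ≤ Real.sin θ :=
          Real.sin_nonneg_of_nonneg_of_le_pi hθ0.le (by linarith)
        rw [← mul_pow, ← mul_pow]
        refine pow_le_pow_left₀ (by positivity) (le_trans ?_ h2) 2
        have : 0 ≤ 2 / Real.pi * (2 * (j : ℝ) + 1) := by positivity
        nlinarith
      have hsum := Finset.sum_le_sum hterm
      rw [← Finset.mul_sum] at hsum
      refine le_trans ?_ hsum
      refine le_trans (mul_le_mul_of_nonneg_left (min_le_right _ _) (by positivity)) ?_
      refine le_trans ?_ (mul_le_mul_of_nonneg_left (sum_odd_sq_le M hM1) (by positivity))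
      have h5 : 1 / g ^ 2 ≤ 16 * M ^ 2 / Real.pi ^ 2 := by
        have h6 : (Real.pi / (4 * g)) ^ 2 ≤ M ^ 2 := pow_le_pow_left₀ (by positivity) hM 2
        rw [div_le_div_iff₀ (by positivity) (by positivity)]
        rw [div_pow, div_le_iff₀ (by positivity)] at h6
        nlinarith
      calc (M : ℝ) / 4 * (Real.sin θ ^ 2 / g ^ 2)
          = (M : ℝ) / 4 * Real.sin θ ^ 2 * (1 / g ^ 2) := by ring
        _ ≤ (M : ℝ) / 4 * Real.sin θ ^ 2 * (16 * M ^ 2 / Real.pi ^ 2) := by gcongr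
        _ = _ := by ring
    · rcases hs0.lt_or_eq with hs | hs
      · apply hquarter
        -- Near π/2 the angle is measured from π/2. Then sin(4Mθ) = -sin(4Mη) is not positive, and
        -- the average is even at least 1/2.
        set η := Real.pi / 2 - θ with hη
        have hη0 : 0 ≤ η := by rw [hη]; linarith
        have hsη : Real.sin (2 * θ) = Real.sin (2 * η) := by
          rw [show 2 * θ = Real.pi - 2 * η by rw [hη]; ring, Real.sin_pi_sub]
        have hlin : 2 / Real.pi * (2 * η) ≤ Real.sin (2 * η) :=
          Real.mul_le_sin (by linarith) (by rw [hη]; linarith)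
        have hMη : 4 * M * η ≤ Real.pi := by
          have h1 : M * (2 / Real.pi * (2 * η)) ≤ 1 :=
            (mul_le_mul_of_nonneg_left hlin (by linarith)).trans (hsη ▸ hA.le)
          have h2 : M * (2 / Real.pi * (2 * η)) = (4 * M * η) / Real.pi := by ring
          rwa [h2, div_le_one hπ] at h1
        have h3 : Real.sin (4 * M * θ) = -Real.sin (4 * M * η) := by
          have : 4 * (M : ℝ) * θ = M * (2 * Real.pi) - 4 * M * η := by rw [hη]; ring
          rw [this, Real.sin_nat_mul_two_pi_sub]
        have h4 : 0 ≤ Real.sin (4 * M * η) :=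
          Real.sin_nonneg_of_nonneg_of_le_pi (by positivity) hMη
        have h2 : 4 * Real.sin (2 * θ) * (M / 4) ≤ 4 * Real.sin (2 * θ) * T := by
          rw [hid, h3]; nlinarith
        exact le_of_mul_le_mul_left h2 (by linarith)
      · apply hquarter
        have hθ : θ = Real.pi / 2 := by
          by_contra hne
          have : 0 < Real.sin (2 * θ) := Real.sin_pos_of_pos_of_lt_pi (by linarith)
            (by have := lt_of_le_of_ne hθ1 hne; linarith)
          linarith
        have h1 : ∀ j ∈ Finset.range M, Real.sin ((2 * (j : ℝ) + 1) * θ) ^ 2 = 1 := by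
          intro j _
          have : Real.cos ((2 * (j : ℝ) + 1) * θ) = 0 := by
            rw [Real.cos_eq_zero_iff]
            exact ⟨j, by rw [hθ]; push_cast; ring⟩
          have h2 := Real.sin_sq_add_cos_sq ((2 * (j : ℝ) + 1) * θ)
          rw [this] at h2
          linarith
        rw [hT, Finset.sum_congr rfl h1]
        simp
        linarith

/-! ### The quantum decoder -/

theorem quantumSolve_sound (e : Fin a ⊕ Fin k → ZMod 2)
    (h : (quantumSolve H₁ s w).res (some e) ≠ 0) : reducedMul H₁ e = s ∧ hammingNorm e = w := by
  unfold quantumSolve at h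
  rw [Timed.res_bind, ← PMF.mem_support_iff, PMF.mem_support_bind_iff] at h
  obtain ⟨j, -, h⟩ := h
  rw [Timed.res_bind, PMF.mem_support_bind_iff] at h
  obtain ⟨x, -, h⟩ := h
  rw [Timed.res_bind, PMF.mem_support_bind_iff] at h
  obtain ⟨o, ho, h⟩ := h
  cases o with
  | none => simp [Timed.res_pure] at h
  | some e' =>
    have h' := solveOn_sound H₁ s _ e' ho
    simp only [Timed.res_tick_bind] at h
    split_ifs at h with hw
    · have : e = e' := by simpa [Timed.res_pure] using h
      rw [this]; exact ⟨h', hw⟩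
    · simp [Timed.res_pure] at h

/-- The steps of the quantum decoder, for the number `M` of possible numbers of iterations. -/
def quantumSolveBound (a k M : ℕ) : ℕ :=
  (M + 1) + ((322 * M * (a + k + 1) ^ 4 + 2 * (a * k + 4 * a + 3 * k + 2)) +
    ((a + k + a * (a + 2 * (a + k + 1) + a * (a + k + 1))) + (a + k)))

theorem within_quantumSolve : (quantumSolve H₁ s w).Within
    (quantumSolveBound a k (⌈Real.pi / (4 * goodAmplitude a k w)⌉₊ + 1)) := by
  unfold quantumSolve quantumSolveBound
  refine ((Timed.within_draw _).mono ?_).bind fun j => ((Timed.within_runQuantum _ _).mono ?_).bind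
    fun x => (within_solveOn _ _ _).bind fun o => ?_
  · rw [Fintype.card_fin]
    exact Nat.add_le_add_right (Nat.log_le_self _ _) 1
  · rw [card_wire]
    refine Nat.add_le_add_right ((time_searchCircuit_le _ _ _ _).trans ?_) _
    have := j.2
    gcongr
    omega
  · cases o with
    | none => exact Timed.within_pure _ _
    | some e =>
      refine (Timed.within_tick _).bind (B' := 0) fun _ => ?_
      split_ifs <;> exact Timed.within_pure _ _

open Classical in
/-- The subsets from which the solution `e` is found. -/
def subsetsFor (e : Fin a ⊕ Fin k → ZMod 2) : Finset (Fin a ⊕ Fin k → Bool) :=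
  (subsets a k).filter fun I => SupportedOn I e ∧
    ∀ u, SupportedOn I u → reducedMul H₁ u = 0 → u = 0

theorem goodAmplitude_pos (hw : w ≤ a) : 0 < goodAmplitude a k w := by
  unfold goodAmplitude
  have h1 : (0 : ℝ) < a.choose w := by exact_mod_cast Nat.choose_pos hw
  have h2 : (0 : ℝ) < (a + k).choose w := by exact_mod_cast Nat.choose_pos (by omega)
  refine Real.sqrt_pos.2 (mul_pos (lt_max_of_lt_left one_pos) (div_pos h1 h2))

/-- After j iterations every good subset is measured with probability sin²((2j+1)θ)/G. Averaging
over j gives at least min(1, G/(N·g²))/(4G) = 1/(4·max(G, N·g²)), so a common bound B for G and N·g²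
is all that is needed. This is multiplied by the number of subsets from which `e` is reconstructed.
-/
theorem quantumSolve_success (hw : w ≤ a) (e : Fin a ⊕ Fin k → ZMod 2)
    (he : reducedMul H₁ e = s) (hew : hammingNorm e = w) (B : ℝ) (hB0 : 0 < B)
    (hB1 : ((goodSubsets H₁ s w).card : ℝ) ≤ B)
    (hB2 : ((a + k).choose a : ℝ) * goodAmplitude a k w ^ 2 ≤ B) :
    ENNReal.ofReal ((subsetsFor H₁ e).card / (4 * B)) ≤ (quantumSolve H₁ s w).res (some e) := by
  classical
  set P := subsetsFor H₁ e with hP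
  set g := goodAmplitude a k w with hg
  have hgpos : 0 < g := goodAmplitude_pos w hw
  set M := ⌈Real.pi / (4 * g)⌉₊ + 1 with hM
  set θ := searchAngle H₁ s w with hθ
  set N : ℝ := ((a + k).choose a : ℝ) with hN
  have hNpos : 0 < N := by
    rw [hN]; exact_mod_cast Nat.choose_pos (by omega)
  set G : ℝ := ((goodSubsets H₁ s w).card : ℝ) with hG
  have hsub : P ⊆ goodSubsets H₁ s w := by
    intro I hI
    obtain ⟨h1, h2, h3⟩ := Finset.mem_filter.1 hI
    exact (mem_goodSubsets _ _ _ _).2 ⟨(mem_subsets I).1 h1, h3, e, h2, he, hew⟩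
  rcases P.eq_empty_or_nonempty with hPe | hPne
  · rw [hPe]; simp
  have hGpos : 0 < G := by
    rw [hG]; exact_mod_cast (hPne.mono hsub).card_pos
  have hsin2 : Real.sin θ ^ 2 = G / N := sin_sq_searchAngle H₁ s w
  have hθ0 : 0 < θ := by
    rw [hθ]; unfold searchAngle
    exact Real.arcsin_pos.2 (Real.sqrt_pos.2 (div_pos hGpos hNpos))
  have hθ1 : θ ≤ Real.pi / 2 := Real.arcsin_le_pi_div_two _
  -- There are M = ⌈π/(4g)⌉ + 1 possible iteration numbers, starting with 0.
  have havg := average_sin_sq θ g hθ0 hθ1 hgpos M (by omega) (by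
    rw [hM]; push_cast
    exact (Nat.le_ceil _).trans (by linarith))
  -- probability of a fixed number of iterations and a fixed subset
  have hmeas : ∀ j : ℕ, ∀ I ∈ P,
      (runQuantum (loadInstance H₁ s) (searchCircuit a k w j)).res
        (setReg (loadInstance H₁ s) I (oneHot (a + 1) a)) =
      ENNReal.ofReal (Real.sin ((2 * j + 1) * θ) ^ 2 / G) := by
    intro j I hI
    rw [Timed.res_runQuantum]
    unfold QState.measure
    rw [PMF.ofFintype_apply, QState.run_val]
    obtain ⟨α, β, h1, h2, -⟩ := act_searchCircuit H₁ s w hw j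
    have hb : (QState.basis (loadInstance H₁ s)).1 = delta (loadInstance H₁ s) := by
      funext x
      simp [QState.basis, delta]
    rw [hb, h1, twoLevel_setReg _ _ _ _ _ _ (goodSubsets_subset H₁ s w (hsub hI)),
      if_pos (hsub hI)]
    congr 1
    rw [Complex.norm_real, Real.norm_eq_abs, sq_abs, eq_div_iff hGpos.ne']
    have h3 : G = N * Real.sin θ ^ 2 := by rw [hsin2]; field_simp
    have h4 := congrArg (· ^ 2) h2
    simp only [mul_pow] at h4
    rw [Real.sq_sqrt hNpos.le, ← pow_mul, mul_comm j 2, pow_mul] at h4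
    rw [h3]
    norm_num at h4
    linarith
  have hinner : ∀ j : ℕ, ENNReal.ofReal (P.card * (Real.sin ((2 * j + 1) * θ) ^ 2 / G)) ≤
      ((runQuantum (loadInstance H₁ s) (searchCircuit a k w j)).res.bind fun x =>
        ((solveOn H₁ s (fun c => x (Wire.sub c)) >>= fun o => (match o with
          | none => (pure none : Timed (Option (Fin a ⊕ Fin k → ZMod 2)))
          | some e => do
            tick (a + k)
            if hammingNorm e = w then pure (some e) else pure none)).res)) (some e) := by
    intro j
    rw [PMF.bind_apply]
    refine le_trans ?_ (ENNReal.sum_le_tsum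
      (P.image fun I => setReg (loadInstance H₁ s) I (oneHot (a + 1) a)))
    rw [Finset.sum_image (fun I _ J _ h => (setReg_injective h).1)]
    rw [Finset.sum_congr rfl (g := fun _ => ENNReal.ofReal (Real.sin ((2 * j + 1) * θ) ^ 2 / G)),
      Finset.sum_const, nsmul_eq_mul, ENNReal.ofReal_mul (by positivity), ENNReal.ofReal_natCast]
    intro I hI
    rw [hmeas j I hI]
    obtain ⟨h1, h2, h3⟩ := Finset.mem_filter.1 hI
    have h4 : (solveOn H₁ s I).res = PMF.pure (some e) :=
      solveOn_complete H₁ s I ((mem_subsets I).1 h1) h3 e h2 he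
    have h5 : (fun c => setReg (loadInstance H₁ s) I (oneHot (a + 1) a) (Wire.sub c)) = I := rfl
    rw [h5, Timed.res_bind, h4, PMF.pure_bind]
    simp only [Timed.res_tick_bind, hew, if_true, Timed.res_pure]
    simp
  have hq : (quantumSolve H₁ s w).res (some e) = ∑ j : Fin M, (M : ℝ≥0∞)⁻¹ *
      ((runQuantum (loadInstance H₁ s) (searchCircuit a k w j)).res.bind fun x =>
        ((solveOn H₁ s (fun c => x (Wire.sub c)) >>= fun o => (match o with
          | none => (pure none : Timed (Option (Fin a ⊕ Fin k → ZMod 2)))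
          | some e => do
            tick (a + k)
            if hammingNorm e = w then pure (some e) else pure none)).res)) (some e) := by
    unfold quantumSolve
    rw [Timed.res_bind, Timed.res_draw, PMF.bind_apply, tsum_fintype]
    refine Finset.sum_congr rfl fun j _ => ?_
    rw [PMF.uniformOfFintype_apply, Fintype.card_fin]
    exact congrArg _ (congrArg (fun p : PMF _ => p (some e)) (Timed.res_bind _ _))
  rw [hq]
  have hMpos : (0 : ℝ) < M := by rw [hM]; positivity
  have hstep : ∀ j : Fin M, ENNReal.ofReal ((M : ℝ)⁻¹ * (P.card *
      (Real.sin ((2 * ((j : ℕ) : ℝ) + 1) * θ) ^ 2 / G))) =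
      (M : ℝ≥0∞)⁻¹ * ENNReal.ofReal (P.card *
        (Real.sin ((2 * ((j : ℕ) : ℝ) + 1) * θ) ^ 2 / G)) := fun j => by
    rw [ENNReal.ofReal_mul (by positivity), ENNReal.ofReal_inv_of_pos hMpos, ENNReal.ofReal_natCast]
  refine le_trans ?_ (Finset.sum_le_sum fun j _ =>
    (hstep j).trans_le (mul_le_mul_right (hinner j) _))
  rw [← ENNReal.ofReal_sum_of_nonneg (fun j _ => by positivity)]
  refine ENNReal.ofReal_le_ofReal ?_
  rw [Fin.sum_univ_eq_sum_range
    (fun j : ℕ => (M : ℝ)⁻¹ * (P.card * (Real.sin ((2 * (j : ℝ) + 1) * θ) ^ 2 / G))) M,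
    ← Finset.mul_sum, ← Finset.mul_sum, ← Finset.sum_div]
  have hcard : (0 : ℝ) ≤ P.card := by positivity
  calc (P.card : ℝ) / (4 * B) = P.card * (1 / (4 * B)) := by ring
    _ ≤ P.card * ((M : ℝ)⁻¹ * ((M : ℝ) / 4 * min 1 (Real.sin θ ^ 2 / g ^ 2)) / G) := by
        refine mul_le_mul_of_nonneg_left ?_ hcard
        have e1 : (M : ℝ)⁻¹ * ((M : ℝ) / 4 * min 1 (Real.sin θ ^ 2 / g ^ 2)) / G =
            min 1 (Real.sin θ ^ 2 / g ^ 2) / (4 * G) := by field_simp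
        rw [e1, div_le_div_iff₀ (by positivity) (by positivity), one_mul]
        rcases min_cases (1 : ℝ) (Real.sin θ ^ 2 / g ^ 2) with ⟨h, -⟩ | ⟨h, -⟩
        · rw [h]; linarith
        · rw [h, hsin2]
          have : G / N / g ^ 2 * (4 * B) = 4 * G * (B / (N * g ^ 2)) := by field_simp
          rw [this]
          have h6 : 1 ≤ B / (N * g ^ 2) := by rw [one_le_div (by positivity)]; exact hB2
          nlinarith
    _ ≤ P.card * ((M : ℝ)⁻¹ * (∑ j ∈ Finset.range M, Real.sin ((2 * j + 1) * θ) ^ 2) / G) := by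
        gcongr
    _ = _ := by ring

end


/-! ### The reduced instance -/

/-- The columns after the permutation. -/
abbrev Position (a b k : ℕ) : Type := (Fin a ⊕ Fin b) ⊕ Fin k

section Reduction

variable {a b k : ℕ}

/-- The part of a vector in the reduced instance. -/
def reducedPart (u : Position a b k → ZMod 2) : Fin a ⊕ Fin k → ZMod 2 :=
  Sum.elim (fun i => u (.inl (.inl i))) (fun c => u (.inr c))

/-- The part of a vector at the omitted equations. -/
def omittedPart (u : Position a b k → ZMod 2) : Fin b → ZMod 2 := fun i => u (.inl (.inr i))

/-- The vector with given parts. -/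
def assemble (e : Fin a ⊕ Fin k → ZMod 2) (z : Fin b → ZMod 2) : Position a b k → ZMod 2 :=
  Sum.elim (Sum.elim (fun i => e (.inl i)) z) (fun c => e (.inr c))

theorem assemble_parts (u : Position a b k → ZMod 2) :
    assemble (reducedPart u) (omittedPart u) = u := by
  funext c
  rcases c with (i | i) | c <;> rfl

theorem reducedPart_assemble (e : Fin a ⊕ Fin k → ZMod 2) (z : Fin b → ZMod 2) :
    reducedPart (assemble e z) = e := by
  funext c
  rcases c with i | c <;> rfl

theorem hammingNorm_eq_sum {ι : Type} [Fintype ι] (u : ι → ZMod 2) :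
    hammingNorm u = ∑ c, if u c = 0 then 0 else 1 := by
  classical
  unfold hammingNorm
  rw [Finset.card_eq_sum_ones, Finset.sum_filter]
  exact Finset.sum_congr rfl fun c _ => by by_cases h : u c = 0 <;> simp [h]

theorem hammingNorm_parts (u : Position a b k → ZMod 2) :
    hammingNorm u = hammingNorm (reducedPart u) + hammingNorm (omittedPart u) := by
  rw [hammingNorm_eq_sum, hammingNorm_eq_sum, hammingNorm_eq_sum, Fintype.sum_sum_type,
    Fintype.sum_sum_type, Fintype.sum_sum_type]
  exact Nat.add_right_comm _ _ _

/-- A matrix together with the syndrome. -/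
def withSyndrome {ι κ : Type} (G : Matrix ι κ (ZMod 2)) (σ : ι → ZMod 2) :
    Matrix ι (κ ⊕ Unit) (ZMod 2) := Matrix.of fun i => Sum.elim (G i) fun _ => σ i

theorem withSyndrome_mulVec {ι κ : Type} [Fintype κ] (G : Matrix ι κ (ZMod 2)) (σ : ι → ZMod 2)
    (v : κ ⊕ Unit → ZMod 2) (i : ι) : (withSyndrome G σ).mulVec v i =
      G.mulVec (fun c => v (.inl c)) i + σ i * v (.inr ()) := by
  simp [withSyndrome, Matrix.mulVec, dotProduct]

/-- The columns in `J` are linearly independent. -/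
def Independent {ι κ : Type} [Fintype κ] (G : Matrix ι κ (ZMod 2)) (J : Finset κ) : Prop :=
  ∀ u : κ → ZMod 2, (∀ c ∉ J, u c = 0) → G.mulVec u = 0 → u = 0

variable (T : Matrix (Fin a ⊕ Fin b) (Position a b k ⊕ Unit) (ZMod 2))

/-- The reduced matrix. -/
def matrixOne : Matrix (Fin a) (Fin k) (ZMod 2) := Matrix.of fun i c => T (.inl i) (.inl (.inr c))

/-- The omitted rows. -/
def matrixTwo : Matrix (Fin b) (Fin k) (ZMod 2) := Matrix.of fun i c => T (.inr i) (.inl (.inr c))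

/-- The reduced syndrome. -/
def syndromeOne : Fin a → ZMod 2 := fun i => T (.inl i) (.inr ())

/-- The omitted part of the syndrome. -/
def syndromeTwo : Fin b → ZMod 2 := fun i => T (.inr i) (.inr ())

/-- The matrix `T` is a systematic form of `(G ∣ σ)`. -/
structure IsReduced (G : Matrix (Fin a ⊕ Fin b) (Position a b k) (ZMod 2))
    (σ : Fin a ⊕ Fin b → ZMod 2) : Prop where
  kernel : ∀ v, T.mulVec v = 0 ↔ (withSyndrome G σ).mulVec v = 0
  unit : ∀ i j, T j (.inl (.inl i)) = if j = i then 1 else 0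

variable {T} {G : Matrix (Fin a ⊕ Fin b) (Position a b k) (ZMod 2)} {σ : Fin a ⊕ Fin b → ZMod 2}

/-- The elimination preserves the kernel of the matrix with appended syndrome. Scaling the syndrome
by t covers both the inhomogeneous equation (t = 1) and the kernel (t = 0). -/
theorem IsReduced.mulVec_eq_iff (h : IsReduced T G σ) (u : Position a b k → ZMod 2) (t : ZMod 2) :
    G.mulVec u = (fun i => σ i * t) ↔
      ∀ j, u (.inl j) + ∑ c, T j (.inl (.inr c)) * u (.inr c) = T j (.inr ()) * t := by
  have h1 := h.kernel (Sum.elim u fun _ => t)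
  have h2 : ∀ j, T.mulVec (Sum.elim u fun _ => t) j =
      (u (.inl j) + ∑ c, T j (.inl (.inr c)) * u (.inr c)) + T j (.inr ()) * t := by
    intro j
    simp only [Matrix.mulVec, dotProduct]
    rw [Fintype.sum_sum_type, Fintype.sum_sum_type]
    simp [h.unit]
  have h3 : (withSyndrome G σ).mulVec (Sum.elim u fun _ => t) = 0 ↔
      G.mulVec u = fun i => σ i * t := by
    rw [funext_iff, funext_iff]
    refine forall_congr' fun i => ?_
    rw [withSyndrome_mulVec]
    exact ZMod.two_add_eq_zero_iff
  rw [← h3, ← h1, funext_iff]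
  refine forall_congr' fun j => ?_
  rw [h2]
  exact ZMod.two_add_eq_zero_iff

theorem IsReduced.mulVec_eq_syndrome (h : IsReduced T G σ) (u : Position a b k → ZMod 2) :
    G.mulVec u = σ ↔ reducedMul (matrixOne T) (reducedPart u) = syndromeOne T ∧
      omittedPart u = (matrixTwo T).mulVec (fun c => reducedPart u (.inr c)) + syndromeTwo T := by
  have h1 := h.mulVec_eq_iff u 1
  simp only [mul_one] at h1
  rw [h1, Sum.forall, funext_iff, funext_iff]
  refine and_congr Iff.rfl (forall_congr' fun i => ?_)
  simp only [omittedPart, matrixTwo, syndromeTwo, reducedPart, Pi.add_apply, Matrix.mulVec,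
    dotProduct, Matrix.of_apply, Sum.elim_inr]
  generalize u (.inl (.inr i)) = x
  generalize ∑ c, T (Sum.inr i) (Sum.inl (Sum.inr c)) * u (Sum.inr c) = y
  generalize T (Sum.inr i) (Sum.inr ()) = z
  revert x y z
  decide

theorem IsReduced.mulVec_eq_zero (h : IsReduced T G σ) (e : Fin a ⊕ Fin k → ZMod 2)
    (he : reducedMul (matrixOne T) e = 0) :
    G.mulVec (assemble e ((matrixTwo T).mulVec fun c => e (.inr c))) = 0 := by
  have h1 := h.mulVec_eq_iff (assemble e ((matrixTwo T).mulVec fun c => e (.inr c))) 0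
  simp only [mul_zero] at h1
  refine h1.2 ?_
  rintro (i | i)
  · exact congrFun he i
  · exact CharTwo.add_self_eq_zero _

theorem isReduced_of_gaussJordanResult
    (h : gaussJordanResult (fun i => Sum.inl (Sum.inl i)) (columns a b) (withSyndrome G σ) =
      some T) : IsReduced T G σ := by
  obtain ⟨h1, h2⟩ := gaussJordanResult_spec _ _ _ _ (fun i hi => absurd (mem_columns a b i) hi) h
  exact ⟨h1, h2⟩

theorem exists_gaussJordanResult (hG : Independent G (Finset.univ.map ⟨Sum.inl, Sum.inl_injective⟩)) :
    ∃ T, gaussJordanResult (fun i => Sum.inl (Sum.inl i)) (columns a b) (withSyndrome G σ) =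
      some T := by
  refine Option.ne_none_iff_exists'.1 (gaussJordanResult_ne_none _
    (Sum.inl_injective.comp Sum.inl_injective) _ _
    (fun i hi => absurd (mem_columns a b i) hi) fun v hv hv0 => ?_)
  have h0 : v (.inr ()) = 0 := hv _ (by simp)
  have h1 := hG (fun c => v (.inl c)) (fun c hc => hv _ (by
      rintro ⟨i, hi⟩
      have : Sum.inl i = c := by simpa using hi
      exact hc (by simp [← this]))) (by
    funext i
    have := congrFun hv0 i
    rwa [withSyndrome_mulVec, h0, mul_zero, add_zero] at this)
  funext c
  rcases c with c | ⟨⟩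
  · exact congrFun h1 c
  · exact h0

/-- The supersets of `X` with `t` elements. -/
theorem card_supersets {α : Type} [Fintype α] [DecidableEq α] (X : Finset α) (t : ℕ)
    (ht : X.card ≤ t) : (Finset.univ.filter fun A : Finset α => X ⊆ A ∧ A.card = t).card =
      (Fintype.card α - X.card).choose (t - X.card) := by
  rw [← Finset.card_compl, ← Finset.card_powersetCard]
  refine Finset.card_bij (fun A _ => A \ X) ?_ ?_ ?_
  · intro A hA
    obtain ⟨-, h1, h2⟩ := Finset.mem_filter.1 hA
    rw [Finset.mem_powersetCard, Finset.card_sdiff_of_subset h1, h2]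
    exact ⟨fun x hx => by simpa using (Finset.mem_sdiff.1 hx).2, rfl⟩
  · intro A hA B hB h
    obtain ⟨-, h1, -⟩ := Finset.mem_filter.1 hA
    obtain ⟨-, h2, -⟩ := Finset.mem_filter.1 hB
    rw [← Finset.sdiff_union_of_subset h1, ← Finset.sdiff_union_of_subset h2, h]
  · intro A hA
    obtain ⟨h1, h2⟩ := Finset.mem_powersetCard.1 hA
    have hd : Disjoint A X := by
      rw [Finset.disjoint_left]
      intro x hx
      simpa using h1 hx
    refine ⟨A ∪ X, ?_, ?_⟩
    · rw [Finset.mem_filter, Finset.card_union_of_disjoint hd, h2]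
      exact ⟨Finset.mem_univ _, Finset.subset_union_right, by omega⟩
    · rw [Finset.union_sdiff_right, Finset.sdiff_eq_self_of_disjoint hd]

/-- A good subset contains the support of a solution of weight w, and each such support has C(a+k-w,
a-w) supersets with a elements. -/
theorem card_goodSubsets_le (H₁ : Matrix (Fin a) (Fin k) (ZMod 2)) (s : Fin a → ZMod 2) (w : ℕ)
    (hw : w ≤ a) : (goodSubsets H₁ s w).card ≤
      (Finset.univ.filter fun e : Fin a ⊕ Fin k → ZMod 2 =>
        reducedMul H₁ e = s ∧ hammingNorm e = w).card * (a + k - w).choose (a - w) := by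
  classical
  set E := Finset.univ.filter fun e : Fin a ⊕ Fin k → ZMod 2 =>
    reducedMul H₁ e = s ∧ hammingNorm e = w with hE
  have hsub : goodSubsets H₁ s w ⊆ E.biUnion fun e =>
      (subsets a k).filter fun I => SupportedOn I e := by
    intro I hI
    obtain ⟨h1, -, u, h3, h4, h5⟩ := (mem_goodSubsets _ _ _ _).1 hI
    rw [Finset.mem_biUnion]
    exact ⟨u, Finset.mem_filter.2 ⟨Finset.mem_univ _, h4, h5⟩,
      Finset.mem_filter.2 ⟨(mem_subsets I).2 h1, h3⟩⟩
  refine (Finset.card_le_card hsub).trans (Finset.card_biUnion_le_card_mul _ _ _ fun e he => ?_)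
  have hew : (Finset.univ.filter fun c => e c ≠ 0).card = w := (Finset.mem_filter.1 he).2.2
  have hc := card_supersets (Finset.univ.filter fun c => e c ≠ 0) a (by rw [hew]; exact hw)
  rw [hew, Fintype.card_sum, Fintype.card_fin, Fintype.card_fin] at hc
  rw [← hc]
  refine Finset.card_le_card_of_injOn (boolEquivFinset _) ?_
    ((boolEquivFinset _).injective.injOn)
  intro I hI
  obtain ⟨h1, h2⟩ := Finset.mem_filter.1 hI
  rw [Finset.mem_coe, Finset.mem_filter]
  refine ⟨Finset.mem_univ _, fun c hc => ?_, (mem_subsets I).1 h1⟩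
  have hec : e c ≠ 0 := (Finset.mem_filter.1 hc).2
  refine Finset.mem_filter.2 ⟨Finset.mem_univ _, ?_⟩
  by_contra hI
  exact hec (h2 c (by simpa using hI))

/-- The omitted equations determine the omitted coordinates, so a reduced solution extends to a
unique full one. No weight is prescribed on the omitted part. -/
theorem card_reducedSolutions_le (h : IsReduced T G σ) (w : ℕ) :
    (Finset.univ.filter fun e : Fin a ⊕ Fin k → ZMod 2 =>
        reducedMul (matrixOne T) e = syndromeOne T ∧ hammingNorm e = w).card ≤
      (Finset.univ.filter fun v : Position a b k → ZMod 2 =>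
        G.mulVec v = σ ∧ hammingNorm (reducedPart v) = w).card := by
  classical
  refine Finset.card_le_card_of_injOn (fun e => assemble e
    ((matrixTwo T).mulVec (fun c => e (.inr c)) + syndromeTwo T)) ?_ ?_
  · intro e he
    obtain ⟨-, h1, h2⟩ := Finset.mem_filter.1 he
    rw [Finset.mem_coe, Finset.mem_filter, h.mulVec_eq_syndrome, reducedPart_assemble]
    exact ⟨Finset.mem_univ _, ⟨h1, rfl⟩, h2⟩
  · intro e _ e' _ hee
    have := congrArg reducedPart hee
    rwa [reducedPart_assemble, reducedPart_assemble] at this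

open Classical in
/-- The information sets that contain the omitted positions and the support of `u`. -/
def informationSets (G : Matrix (Fin a ⊕ Fin b) (Position a b k) (ZMod 2))
    (u : Position a b k → ZMod 2) : Finset (Finset (Position a b k)) :=
  Finset.univ.filter fun W => (∀ i, Sum.inl (Sum.inr i) ∈ W) ∧ W.card = a + b ∧
    (∀ c ∉ W, u c = 0) ∧ Independent G W

/-- Deleting the omitted positions from W leaves an a-set. It is independent for the reduced matrix,
since a reduced kernel vector extends to a kernel vector of the full matrix supported on W. -/
theorem card_informationSets_le (h : IsReduced T G σ) (u : Position a b k → ZMod 2) :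
    (informationSets G u).card ≤ (subsetsFor (matrixOne T) (reducedPart u)).card := by
  classical
  let emb : Fin a ⊕ Fin k → Position a b k := Sum.map Sum.inl id
  refine Finset.card_le_card_of_injOn (fun W c => decide (emb c ∈ W)) ?_ ?_
  · intro W hW
    obtain ⟨-, h1, h2, h3, h4⟩ := Finset.mem_filter.1 hW
    rw [Finset.mem_coe, subsetsFor, Finset.mem_filter, mem_subsets]
    refine ⟨?_, ?_, ?_⟩
    · have e1 : W.card = ∑ c, if c ∈ W then 1 else 0 := by simp
      have e2 : (Finset.univ.filter fun c => decide (emb c ∈ W) = true).card =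
          ∑ c, if emb c ∈ W then 1 else 0 := by
        rw [Finset.card_eq_sum_ones, Finset.sum_filter]
        simp
      rw [e2, Fintype.sum_sum_type]
      rw [Fintype.sum_sum_type, Fintype.sum_sum_type, h2,
        Finset.sum_congr rfl fun i _ => if_pos (h1 i)] at e1
      change (∑ i, if Sum.inl (Sum.inl i) ∈ W then 1 else 0) +
        (∑ c, if Sum.inr c ∈ W then 1 else 0) = a
      simp only [Finset.sum_const, Finset.card_univ, Fintype.card_fin, smul_eq_mul, mul_one] at e1
      omega
    · intro c hc
      have hc' : emb c ∉ W := by simpa using hc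
      have := h3 _ hc'
      rcases c with c | c <;> exact this
    · intro v hv hv0
      have := h4 _ (fun c hc => ?_) (h.mulVec_eq_zero v hv0)
      · rw [← reducedPart_assemble v ((matrixTwo T).mulVec fun c => v (.inr c)), this]
        funext c
        rcases c with c | c <;> rfl
      · rcases c with (i | i) | c
        · exact hv (.inl i) (decide_eq_false hc)
        · exact absurd (h1 i) hc
        · exact hv (.inr c) (decide_eq_false hc)
  · intro W hW W' hW' hWW
    have h1 := (Finset.mem_filter.1 hW).2.1
    have h2 := (Finset.mem_filter.1 hW').2.1
    ext c
    rcases c with (i | i) | c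
    · have := congrFun hWW (.inl i)
      exact decide_eq_decide.1 this
    · exact iff_of_true (h1 i) (h2 i)
    · have := congrFun hWW (.inr c)
      exact decide_eq_decide.1 this

/-- By C(a+k,a)·C(a,w) = C(a+k,w)·C(a+k-w,a-w), the number of subsets times g² is exactly the number
of good subsets that max(1,S) solutions can contribute at most. -/
theorem choose_mul_goodAmplitude_sq (a k w : ℕ) (hw : w ≤ a) :
    ((a + k).choose a : ℝ) * goodAmplitude a k w ^ 2 =
      max 1 (expectedSolutions a k w) * ((a + k - w).choose (a - w) : ℝ) := by
  have h1 : (0 : ℝ) < (a + k).choose w := by exact_mod_cast Nat.choose_pos (by omega)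
  have h0 : 0 ≤ max 1 (expectedSolutions a k w) := le_max_of_le_left zero_le_one
  unfold goodAmplitude
  rw [Real.sq_sqrt (by positivity)]
  have h2 : ((a + k).choose a : ℝ) * a.choose w = (a + k).choose w * (a + k - w).choose (a - w) := by
    exact_mod_cast Nat.choose_mul hw
  rw [mul_left_comm, ← mul_div_assoc, h2, mul_div_cancel_left₀ _ h1.ne']

/-! ### One attempt with the quantum decoder -/

/-- One run of the quantum decoder, and the test of the omitted equations. -/
def decodeAttempt {β : Type} (T : Matrix (Fin a ⊕ Fin b) (Position a b k ⊕ Unit) (ZMod 2))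
    (w p c : ℕ) (out : (Position a b k → ZMod 2) → β) : Timed (Option β) := do
  match ← quantumSolve (matrixOne T) (syndromeOne T) w with
  | none => pure none
  | some e₁ => do
    let e₂ : Fin b → ZMod 2 := (matrixTwo T).mulVec (fun c => e₁ (.inr c)) + syndromeTwo T
    tick c
    if hammingNorm e₂ = p then pure (some (out (assemble e₁ e₂))) else pure none

variable {β : Type} {w p c : ℕ} {out : (Position a b k → ZMod 2) → β}

theorem decodeAttempt_sound (h : IsReduced T G σ) (v : β)
    (hv : (decodeAttempt T w p c out).res (some v) ≠ 0) :
    ∃ u, v = out u ∧ G.mulVec u = σ ∧ hammingNorm u = w + p := by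
  unfold decodeAttempt at hv
  rw [Timed.res_bind, ← PMF.mem_support_iff, PMF.mem_support_bind_iff] at hv
  obtain ⟨o, ho, hv⟩ := hv
  cases o with
  | none => simp [Timed.res_pure] at hv
  | some e₁ =>
    obtain ⟨h1, h2⟩ := quantumSolve_sound _ _ _ _ ho
    simp only [Timed.res_tick_bind] at hv
    split_ifs at hv with hp
    · have hve : v = out (assemble e₁ ((matrixTwo T).mulVec (fun c => e₁ (.inr c)) +
        syndromeTwo T)) := by simpa [Timed.res_pure] using hv
      refine ⟨assemble e₁ ((matrixTwo T).mulVec (fun c => e₁ (.inr c)) + syndromeTwo T), hve,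
        (h.mulVec_eq_syndrome _).2 ?_, ?_⟩
      · rw [reducedPart_assemble]
        exact ⟨h1, rfl⟩
      · rw [hammingNorm_parts, reducedPart_assemble, h2]
        exact congrArg (w + ·) hp
    · simp [Timed.res_pure] at hv

/-- The bound on full solutions controls the good subsets, and Θ ≥ 1 lets the same number bound N·g²
as well; this is the B of `quantumSolve_success`. -/
theorem decodeAttempt_success (h : IsReduced T G σ) (hw : w ≤ a) (u : Position a b k → ZMod 2)
    (hu : G.mulVec u = σ) (huw : hammingNorm (reducedPart u) = w)
    (hup : hammingNorm (omittedPart u) = p) (Θ : ℝ) (hΘ : 1 ≤ Θ)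
    (hS : ((Finset.univ.filter fun v : Position a b k → ZMod 2 =>
        G.mulVec v = σ ∧ hammingNorm (reducedPart v) = w).card : ℝ) ≤
      Θ * max 1 (expectedSolutions a k w)) :
    ENNReal.ofReal ((informationSets G u).card /
      (4 * (Θ * (max 1 (expectedSolutions a k w) * (a + k - w).choose (a - w))))) ≤
      (decodeAttempt T w p c out).res (some (out u)) := by
  obtain ⟨h1, h2⟩ := (h.mulVec_eq_syndrome u).1 hu
  have hL : (0 : ℝ) < (a + k - w).choose (a - w) := by exact_mod_cast Nat.choose_pos (by omega)
  have hm : 0 < max 1 (expectedSolutions a k w) := lt_max_of_lt_left one_pos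
  have hB := quantumSolve_success (matrixOne T) (syndromeOne T) w hw (reducedPart u) h1 huw
    (Θ * (max 1 (expectedSolutions a k w) * (a + k - w).choose (a - w))) (by positivity) (by
      have e1 := card_goodSubsets_le (matrixOne T) (syndromeOne T) w hw
      have e2 := Nat.mul_le_mul_right ((a + k - w).choose (a - w)) (card_reducedSolutions_le h w)
      have e3 : ((goodSubsets (matrixOne T) (syndromeOne T) w).card : ℝ) ≤ _ :=
        Nat.cast_le.2 (e1.trans e2)
      refine e3.trans ?_
      rw [Nat.cast_mul, ← mul_assoc]
      exact mul_le_mul_of_nonneg_right hS hL.le) (by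
      rw [choose_mul_goodAmplitude_sq a k w hw]
      exact le_mul_of_one_le_left (by positivity) hΘ)
  refine le_trans (ENNReal.ofReal_le_ofReal ?_) (hB.trans ?_)
  · refine div_le_div_of_nonneg_right ?_ (by positivity)
    exact_mod_cast card_informationSets_le h u
  · unfold decodeAttempt
    rw [Timed.res_bind, PMF.bind_apply]
    refine le_trans ?_ (ENNReal.le_tsum (some (reducedPart u)))
    simp only [Timed.res_tick_bind]
    rw [← h2, if_pos hup, Timed.res_pure, assemble_parts]
    simp

theorem within_decodeAttempt : (decodeAttempt T w p c out).Within
    (quantumSolveBound a k (⌈Real.pi / (4 * goodAmplitude a k w)⌉₊ + 1) + c) := by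
  unfold decodeAttempt
  refine (within_quantumSolve _ _ _).bind fun o => ?_
  cases o with
  | none => exact Timed.within_pure _ _
  | some e =>
    refine (Timed.within_tick _).bind (B' := 0) fun _ => ?_
    split_ifs <;> exact Timed.within_pure _ _

end Reduction


/-! ### One round of the algorithm -/

theorem pmf_add_le_one {α : Type} (p : PMF α) {x y : α} (h : x ≠ y) : p x + p y ≤ 1 := by
  classical
  rw [← p.tsum_coe, ← Finset.sum_pair h]
  exact ENNReal.sum_le_tsum _

/-- The linearly independent sets of `t` columns that contain `X`. -/
def independentSupersets {m n : ℕ} (H : Matrix (Fin m) (Fin n) (ZMod 2)) (X : Finset (Fin n))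
    (t : ℕ) : Finset (Finset (Fin n)) :=
  open Classical in Finset.univ.filter fun W => X ⊆ W ∧ W.card = t ∧ Independent H W

theorem mem_independentSupersets {m n : ℕ} {H : Matrix (Fin m) (Fin n) (ZMod 2)}
    {X : Finset (Fin n)} {t : ℕ} {W : Finset (Fin n)} : W ∈ independentSupersets H X t ↔
      X ⊆ W ∧ W.card = t ∧ Independent H W := by
  simp [independentSupersets]

/-- The support of a vector. -/
def support {n : ℕ} (e : Fin n → ZMod 2) : Finset (Fin n) := Finset.univ.filter fun i => e i ≠ 0

theorem card_support {n : ℕ} (e : Fin n → ZMod 2) : (support e).card = hammingNorm e := rfl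

/-- The vectors with syndrome `s` that have weight `w` outside of `X`. -/
def partialSolutions {m n : ℕ} (H : Matrix (Fin m) (Fin n) (ZMod 2)) (s : Fin m → ZMod 2)
    (X : Finset (Fin n)) (w : ℕ) : Finset (Fin n → ZMod 2) :=
  Finset.univ.filter fun v => H.mulVec v = s ∧ (support v \ X).card = w

section Round

variable (n k b ω p : ℕ) (h : k + b ≤ n) (H : Matrix (Fin (n - k)) (Fin n) (ZMod 2))
  (s : Fin (n - k) → ZMod 2) (P : Equiv.Perm (Fin n))

/-- The columns at given positions. -/
def positionEquiv : Position (n - k - b) b k ≃ Fin n := (colBlocks n k b h).trans P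

/-- The permuted matrix. -/
def permuted : Matrix (Fin (n - k - b) ⊕ Fin b) (Position (n - k - b) b k) (ZMod 2) :=
  Matrix.of fun i c => H (rowBlocks n k b h i) (P (colBlocks n k b h c))

/-- The result of a round in terms of the permuted columns. -/
def unpermute (u : Position (n - k - b) b k → ZMod 2) : Fin n → ZMod 2 :=
  fun i => u ((positionEquiv n k b h P).symm i)

/-- A round of Punctured-Hybrid with the permutation `P`. -/
def roundWith : Timed (Option (Fin n → ZMod 2)) := do
  tick (n * n)
  match ← gaussJordan (fun i => Sum.inl (Sum.inl i)) (columns (n - k - b) b)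
      (withSyndrome (permuted n k b h H P) (fun i => s (rowBlocks n k b h i))) with
  | none => pure none
  | some T => do
    match ← repeatUntil (decodeAttempt T (ω - p) p (2 * n * n) (unpermute n k b h P))
      (n * ⌈expectedSolutions (n - k - b) k (ω - p)⌉₊) with
    | none => pure none
    | some e => do
      tick (2 * n * n)
      if H.mulVec e = s ∧ hammingNorm e = ω then pure (some e) else pure none

theorem puncturedHybridRound_eq : puncturedHybridRound n k b ω p h H s =
    draw (Equiv.Perm (Fin n)) >>= roundWith n k b ω p h H s := by
  unfold puncturedHybridRound
  refine congrArg (draw (Equiv.Perm (Fin n)) >>= ·) (funext fun P => ?_)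
  unfold roundWith
  refine congrArg (tick (n * n) >>= ·) (funext fun _ => ?_)
  refine congrArg (gaussJordan (fun i => Sum.inl (Sum.inl i)) (columns (n - k - b) b)
    (withSyndrome (permuted n k b h H P) (fun i => s (rowBlocks n k b h i))) >>= ·)
    (funext fun T => ?_)
  cases T with
  | none => rfl
  | some T =>
    refine congrArg₂ (fun att f => repeatUntil att
      (n * ⌈expectedSolutions (n - k - b) k (ω - p)⌉₊) >>= f) ?_ (funext fun o => ?_)
    · refine congrArg (quantumSolve (matrixOne T) (syndromeOne T) (ω - p) >>= ·)
        (funext fun o => ?_)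
      cases o <;> rfl
    · cases o <;> rfl

theorem mulVec_unpermute (u : Position (n - k - b) b k → ZMod 2)
    (i : Fin (n - k - b) ⊕ Fin b) : H.mulVec (unpermute n k b h P u) (rowBlocks n k b h i) =
      (permuted n k b h H P).mulVec u i := by
  simp only [Matrix.mulVec, dotProduct]
  rw [← (positionEquiv n k b h P).sum_comp]
  simp only [unpermute, Equiv.symm_apply_apply]
  rfl

theorem mulVec_unpermute_eq (u : Position (n - k - b) b k → ZMod 2) :
    H.mulVec (unpermute n k b h P u) = s ↔
      (permuted n k b h H P).mulVec u = fun i => s (rowBlocks n k b h i) := by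
  constructor
  · rintro rfl
    funext i
    rw [mulVec_unpermute]
  · intro hu
    funext i
    obtain ⟨j, rfl⟩ := (rowBlocks n k b h).surjective i
    rw [mulVec_unpermute, hu]

theorem hammingNorm_unpermute (u : Position (n - k - b) b k → ZMod 2) :
    hammingNorm (unpermute n k b h P u) = hammingNorm u := by
  rw [hammingNorm_eq_sum, hammingNorm_eq_sum, ← (positionEquiv n k b h P).sum_comp]
  simp only [unpermute, Equiv.symm_apply_apply]

theorem independent_permuted (J : Finset (Position (n - k - b) b k)) :
    Independent (permuted n k b h H P) J ↔
      Independent H (J.map (positionEquiv n k b h P).toEmbedding) := by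
  constructor
  · intro hJ u hu hu0
    have h1 : u = unpermute n k b h P (fun c => u (positionEquiv n k b h P c)) := by
      funext i; simp [unpermute]
    have h2 := hJ (fun c => u (positionEquiv n k b h P c))
      (fun c hc => hu _ (by simpa using hc)) (by
        rw [h1] at hu0
        exact (mulVec_unpermute_eq n k b h H 0 P _).1 hu0)
    rw [h1, h2]
    rfl
  · intro hJ u hu hu0
    have h2 := hJ (unpermute n k b h P u) (fun i hi => hu _ (fun hc => hi (by
      rw [Finset.mem_map_equiv]; exact hc))) ((mulVec_unpermute_eq n k b h H 0 P _).2 hu0)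
    funext c
    have := congrFun h2 (positionEquiv n k b h P c)
    simpa [unpermute] using this

/-- The columns of the omitted equations. -/
def omittedSet : Finset (Fin n) :=
  Finset.univ.map ((Function.Embedding.inr.trans Function.Embedding.inl).trans
    (positionEquiv n k b h P).toEmbedding)

/-- The pivot columns. -/
def pivotSet : Finset (Fin n) :=
  Finset.univ.map (Function.Embedding.inl.trans (positionEquiv n k b h P).toEmbedding)

theorem card_omittedSet : (omittedSet n k b h P).card = b := by simp [omittedSet]

theorem positionEquiv_mem_omittedSet (c : Position (n - k - b) b k) :
    positionEquiv n k b h P c ∈ omittedSet n k b h P ↔ ∃ i, c = .inl (.inr i) := by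
  simp [omittedSet, eq_comm]

theorem card_support_sdiff (u : Position (n - k - b) b k → ZMod 2) :
    (support (unpermute n k b h P u) \ omittedSet n k b h P).card = hammingNorm (reducedPart u) := by
  have h1 : (support (unpermute n k b h P u) \ omittedSet n k b h P).card =
      ∑ i, if unpermute n k b h P u i ≠ 0 ∧ i ∉ omittedSet n k b h P then 1 else 0 := by
    rw [← Finset.sum_filter, ← Finset.card_eq_sum_ones]
    congr 1
    ext i
    simp [support]
  rw [h1, hammingNorm_eq_sum, ← (positionEquiv n k b h P).sum_comp, Fintype.sum_sum_type,
    Fintype.sum_sum_type, Fintype.sum_sum_type]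
  simp only [positionEquiv_mem_omittedSet, unpermute, Equiv.symm_apply_apply]
  simp [reducedPart]
  rfl

theorem card_support_inter (u : Position (n - k - b) b k → ZMod 2) :
    (support (unpermute n k b h P u) ∩ omittedSet n k b h P).card = hammingNorm (omittedPart u) := by
  have h1 := Finset.card_sdiff_add_card_inter (support (unpermute n k b h P u))
    (omittedSet n k b h P)
  rw [card_support_sdiff, card_support, hammingNorm_unpermute, hammingNorm_parts] at h1
  omega

theorem card_independentSupersets_le (u : Position (n - k - b) b k → ZMod 2) :
    (independentSupersets H (omittedSet n k b h P ∪ support (unpermute n k b h P u))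
      (n - k - b + b)).card ≤ (informationSets (permuted n k b h H P) u).card := by
  classical
  refine Finset.card_le_card_of_injOn
    (fun W => W.map (positionEquiv n k b h P).symm.toEmbedding) ?_
    ((Finset.map_injective _).injOn)
  intro W hW
  obtain ⟨h1, h2, h3⟩ := mem_independentSupersets.1 hW
  rw [Finset.mem_coe, informationSets, Finset.mem_filter]
  refine ⟨Finset.mem_univ _, fun i => ?_, ?_, fun c hc => ?_, ?_⟩
  · rw [Finset.mem_map_equiv]
    exact h1 (Finset.mem_union_left _ ((positionEquiv_mem_omittedSet n k b h P _).2 ⟨i, rfl⟩))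
  · rw [Finset.card_map, h2]
  · by_contra hne
    refine hc ?_
    rw [Finset.mem_map_equiv]
    refine h1 (Finset.mem_union_right _ (Finset.mem_filter.2 ⟨Finset.mem_univ _, ?_⟩))
    simpa [unpermute] using hne
  · rw [independent_permuted]
    have : (W.map (positionEquiv n k b h P).symm.toEmbedding).map
        (positionEquiv n k b h P).toEmbedding = W := by ext i; simp
    rwa [this]

theorem card_partialSolutions_ge (w : ℕ) :
    (Finset.univ.filter fun v : Position (n - k - b) b k → ZMod 2 =>
      (permuted n k b h H P).mulVec v = (fun i => s (rowBlocks n k b h i)) ∧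
        hammingNorm (reducedPart v) = w).card ≤
      (partialSolutions H s (omittedSet n k b h P) w).card := by
  refine Finset.card_le_card_of_injOn (unpermute n k b h P) ?_ ?_
  · intro v hv
    obtain ⟨-, h1, h2⟩ := Finset.mem_filter.1 hv
    rw [Finset.mem_coe, partialSolutions, Finset.mem_filter, mulVec_unpermute_eq,
      card_support_sdiff]
    exact ⟨Finset.mem_univ _, h1, h2⟩
  · intro u _ v _ huv
    funext c
    have := congrFun huv (positionEquiv n k b h P c)
    simpa [unpermute] using this

theorem expectedSolutions_pos (a k w : ℕ) (hw : w ≤ a) : 0 < expectedSolutions a k w := by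
  unfold expectedSolutions
  have : (0 : ℝ) < (a + k).choose w := by exact_mod_cast Nat.choose_pos (by omega)
  positivity

/-- The chain is (1-q)^m ≤ exp(-mq) ≤ exp(-2y) ≤ 1/(1+2y) ≤ 1-y, where the last inequality uses y ≤
1/2. -/
theorem one_sub_pow_le (q y : ℝ) (m : ℕ) (hq1 : q ≤ 1) (hy0 : 0 ≤ y) (hy : y ≤ 1 / 2)
    (hm : 2 * y ≤ m * q) : (1 - q) ^ m ≤ 1 - y := by
  have h1 : (1 - q) ^ m ≤ Real.exp (-(2 * y)) := by
    calc (1 - q) ^ m ≤ Real.exp (-q) ^ m :=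
          pow_le_pow_left₀ (by linarith) (by linarith [Real.add_one_le_exp (-q)]) m
      _ = Real.exp (-(m * q)) := by rw [← Real.exp_nat_mul]; ring_nf
      _ ≤ _ := Real.exp_le_exp.2 (by linarith)
  have h2 : 1 + 2 * y ≤ Real.exp (2 * y) := by linarith [Real.add_one_le_exp (2 * y)]
  have h3 : Real.exp (-(2 * y)) * Real.exp (2 * y) = 1 := by rw [← Real.exp_add]; simp
  have h4 := Real.exp_pos (-(2 * y))
  nlinarith

/-- The probability that a round with permutation `P` fails. -/
theorem roundWith_none_le (hn : 1 ≤ n) (hp : p ≤ ω) (hw : ω - p ≤ n - k - b) (e : Fin n → ZMod 2)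
    (he : H.mulVec e = s) (heω : hammingNorm e = ω)
    (hpat : (support e ∩ omittedSet n k b h P).card = p)
    (hV : Independent H (pivotSet n k b h P)) (Θ : ℝ) (hΘ : 1 ≤ Θ)
    (hS : ((partialSolutions H s (omittedSet n k b h P) (ω - p)).card : ℝ) ≤
      Θ * max 1 (expectedSolutions (n - k - b) k (ω - p))) :
    (roundWith n k b ω p h H s P).res none ≤ 1 - ENNReal.ofReal
      ((independentSupersets H (omittedSet n k b h P ∪ support e) (n - k - b + b)).card /
        (8 * Θ * (n - k - b + k - (ω - p)).choose (n - k - b - (ω - p)))) := by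
  set a := n - k - b with ha
  set w := ω - p with hwdef
  set S := expectedSolutions a k w with hSdef
  set L : ℝ := ((a + k - w).choose (a - w) : ℝ) with hL
  obtain ⟨u, rfl⟩ : ∃ u, e = unpermute n k b h P u :=
    ⟨fun c => e (positionEquiv n k b h P c), by funext i; simp [unpermute]⟩
  have hLpos : 0 < L := by rw [hL]; exact_mod_cast Nat.choose_pos (by omega)
  have hmpos : 0 < max 1 S := lt_max_of_lt_left one_pos
  have hu := (mulVec_unpermute_eq n k b h H s P u).1 he
  have hup : hammingNorm (omittedPart u) = p := by
    rw [← card_support_inter n k b h P u, hpat]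
  have huw : hammingNorm (reducedPart u) = w := by
    have := hammingNorm_parts u
    rw [hammingNorm_unpermute] at heω
    omega
  have hind : Independent (permuted n k b h H P)
      (Finset.univ.map ⟨Sum.inl, Sum.inl_injective⟩) :=
    (independent_permuted n k b h H P _).2 (by rw [Finset.map_map]; exact hV)
  obtain ⟨T, hT⟩ := exists_gaussJordanResult (σ := fun i => s (rowBlocks n k b h i)) hind
  have hred := isReduced_of_gaussJordanResult hT
  have hatt := decodeAttempt_success (c := 2 * n * n) (out := unpermute n k b h P) hred hw u hu huw
    hup Θ hΘ ((Nat.cast_le.2 (card_partialSolutions_ge n k b h H s P w)).trans hS)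
  set N : ℝ := ((independentSupersets H (omittedSet n k b h P ∪ support (unpermute n k b h P u))
    (a + b)).card : ℝ) with hN
  set att := decodeAttempt T w p (2 * n * n) (unpermute n k b h P) with hattdef
  set m := n * ⌈S⌉₊ with hm
  -- Independent supersets are among all supersets with a + b elements; this bound puts the success
  -- probability below 1/2, as `one_sub_pow_le` requires.
  have hNle : N ≤ L := by
    rw [hN, hL]
    have h1 : (omittedSet n k b h P ∪ support (unpermute n k b h P u)).card = b + w := by
      have := Finset.card_union_add_card_inter (omittedSet n k b h P)
        (support (unpermute n k b h P u))
      rw [Finset.inter_comm, hpat, card_omittedSet, card_support, heω] at this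
      omega
    have h2 := card_supersets (omittedSet n k b h P ∪ support (unpermute n k b h P u)) (a + b)
      (by omega)
    rw [h1, Fintype.card_fin] at h2
    have h3 : n - (b + w) = a + k - w := by omega
    have h4 : a + b - (b + w) = a - w := by omega
    rw [h3, h4] at h2
    rw [← h2]
    refine Nat.cast_le.2 (Finset.card_le_card fun W hW => ?_)
    obtain ⟨h5, h6, -⟩ := mem_independentSupersets.1 hW
    exact Finset.mem_filter.2 ⟨Finset.mem_univ _, h5, h6⟩
  set q : ℝ := N / (4 * (Θ * (max 1 S * L))) with hq
  have hq0 : 0 ≤ q := by positivity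
  have hatt' : ENNReal.ofReal q ≤ att.res (some (unpermute n k b h P u)) := by
    refine le_trans (ENNReal.ofReal_le_ofReal ?_) hatt
    refine div_le_div_of_nonneg_right ?_ (by positivity)
    exact Nat.cast_le.2 (card_independentSupersets_le n k b h H P u)
  have hq1 : q ≤ 1 := by
    rw [← ENNReal.ofReal_le_one]
    exact hatt'.trans (PMF.coe_le_one _ _)
  have hnone : att.res none ≤ ENNReal.ofReal (1 - q) := by
    rw [ENNReal.ofReal_sub _ hq0, ENNReal.ofReal_one]
    refine ENNReal.le_sub_of_add_le_right ENNReal.ofReal_ne_top ?_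
    exact (add_le_add_right hatt' _).trans (pmf_add_le_one _ (by simp))
  -- Every vector that an attempt returns passes the final test, so the round fails exactly if all m
  -- attempts fail.
  have hround : (roundWith n k b ω p h H s P).res none = att.res none ^ m := by
    unfold roundWith
    rw [Timed.res_tick_bind, Timed.res_bind, res_gaussJordan, hT, PMF.pure_bind]
    change (repeatUntil att m >>= _).res none = _
    rw [Timed.res_bind, PMF.bind_apply, tsum_eq_single none, res_repeatUntil_none]
    · simp [Timed.res_pure]
    · intro o ho
      cases o with
      | none => exact absurd rfl ho
      | some v =>
        by_cases hv : (repeatUntil att m).res (some v) = 0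
        · rw [hv, zero_mul]
        · obtain ⟨u', rfl, h1, h2⟩ := decodeAttempt_sound hred v (res_repeatUntil_some _ _ _ hv)
          have h3 : H.mulVec (unpermute n k b h P u') = s ∧
              hammingNorm (unpermute n k b h P u') = ω := by
            rw [mulVec_unpermute_eq, hammingNorm_unpermute, h2]
            exact ⟨h1, by omega⟩
          simp only [Timed.res_tick_bind]
          rw [if_pos h3, Timed.res_pure]
          simp
  rw [hround]
  have hy : N / (8 * Θ * L) ≤ 1 / 2 := by
    rw [div_le_iff₀ (by positivity)]
    nlinarith
  rw [← ENNReal.ofReal_one, ← ENNReal.ofReal_sub _ (by positivity)]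
  refine (pow_le_pow_left' hnone m).trans ?_
  rw [← ENNReal.ofReal_pow (by linarith)]
  refine ENNReal.ofReal_le_ofReal (one_sub_pow_le q _ m hq1 (by positivity) hy ?_)
  -- Since S > 0, its ceiling is at least 1; hence the number of attempts dominates both 1 and S.
  have hmS : max 1 S ≤ m := by
    have hSpos : 0 < S := expectedSolutions_pos a k w hw
    have h1 : 1 ≤ ⌈S⌉₊ := Nat.one_le_iff_ne_zero.2 (Nat.ceil_pos.2 hSpos).ne'
    have h2 : ⌈S⌉₊ ≤ m := Nat.le_mul_of_pos_left _ hn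
    refine max_le ?_ ((Nat.le_ceil S).trans ?_)
    · exact_mod_cast h1.trans h2
    · exact_mod_cast h2
  calc 2 * (N / (8 * Θ * L)) = max 1 S * q := by rw [hq]; field_simp; ring
    _ ≤ m * q := mul_le_mul_of_nonneg_right hmS hq0

/-- Lower bounds for the success probability are averaged over the uniform permutation. -/
theorem res_round_none_le (y : Equiv.Perm (Fin n) → ℝ) (hy0 : ∀ P, 0 ≤ y P)
    (hy1 : ∀ P, y P ≤ 1)
    (hy : ∀ P, (roundWith n k b ω p h H s P).res none ≤ 1 - ENNReal.ofReal (y P)) :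
    (puncturedHybridRound n k b ω p h H s).res none ≤
      1 - ENNReal.ofReal ((∑ P, y P) / n.factorial) := by
  rw [puncturedHybridRound_eq, Timed.res_bind, Timed.res_draw, PMF.bind_apply, tsum_fintype]
  simp only [PMF.uniformOfFintype_apply, Fintype.card_perm, Fintype.card_fin]
  have hf : (0 : ℝ) < n.factorial := by exact_mod_cast n.factorial_pos
  refine ENNReal.le_sub_of_add_le_right ENNReal.ofReal_ne_top ?_
  rw [div_eq_inv_mul, ENNReal.ofReal_mul (by positivity), ENNReal.ofReal_inv_of_pos hf,
    ENNReal.ofReal_natCast, ENNReal.ofReal_sum_of_nonneg fun P _ => hy0 P, ← Finset.mul_sum,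
    ← mul_add, ← Finset.sum_add_distrib]
  have h1 : ∀ P ∈ (Finset.univ : Finset (Equiv.Perm (Fin n))),
      (roundWith n k b ω p h H s P).res none + ENNReal.ofReal (y P) ≤ 1 := by
    intro P _
    have hle : ENNReal.ofReal (y P) ≤ 1 := ENNReal.ofReal_le_one.2 (hy1 P)
    exact (add_le_add_left (hy P) _).trans_eq (tsub_add_cancel_of_le hle)
  refine (mul_le_mul_right (Finset.sum_le_sum h1) _).trans ?_
  rw [Finset.sum_const, Finset.card_univ, Fintype.card_perm, Fintype.card_fin, nsmul_eq_mul, mul_one,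
    ENNReal.inv_mul_cancel (by exact_mod_cast n.factorial_ne_zero) (ENNReal.natCast_ne_top _)]

theorem round_sound (e : Fin n → ZMod 2)
    (he : (puncturedHybridRound n k b ω p h H s).res (some e) ≠ 0) : e ∈ solutions H s ω := by
  rw [puncturedHybridRound_eq, Timed.res_bind, ← PMF.mem_support_iff,
    PMF.mem_support_bind_iff] at he
  obtain ⟨P, -, he⟩ := he
  unfold roundWith at he
  rw [Timed.res_tick_bind, Timed.res_bind, PMF.mem_support_bind_iff] at he
  obtain ⟨T, -, he⟩ := he
  cases T with
  | none => simp [Timed.res_pure] at he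
  | some T =>
    simp only [] at he
    rw [Timed.res_bind, PMF.mem_support_bind_iff] at he
    obtain ⟨o, -, he⟩ := he
    cases o with
    | none => simp [Timed.res_pure] at he
    | some v =>
      simp only [Timed.res_tick_bind] at he
      split_ifs at he with hv
      · have : e = v := by simpa [Timed.res_pure] using he
        rw [this]; exact hv
      · simp [Timed.res_pure] at he

/-- Upper bound for the number of steps of a round. -/
def roundBound : ℕ :=
  (Nat.log 2 n.factorial + 1) + (n * n +
    ((n - k - b + b) * ((n - k - b + b) + 2 * (n - k - b + b + k + 1) +
      (n - k - b + b) * (n - k - b + b + k + 1)) +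
    (n * ⌈expectedSolutions (n - k - b) k (ω - p)⌉₊ *
      (quantumSolveBound (n - k - b) k
        (⌈Real.pi / (4 * goodAmplitude (n - k - b) k (ω - p))⌉₊ + 1) + 2 * n * n) + 2 * n * n)))

theorem within_round : (puncturedHybridRound n k b ω p h H s).Within (roundBound n k b ω p) := by
  rw [puncturedHybridRound_eq]
  unfold roundBound roundWith
  refine ((Timed.within_draw _).mono ?_).bind fun P => (Timed.within_tick _).bind fun _ =>
    ((within_gaussJordan _ _ _).mono ?_).bind fun T => ?_
  · rw [Fintype.card_perm, Fintype.card_fin]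
  · simp [length_columns]
  · cases T with
    | none => exact Timed.within_pure _ _
    | some T =>
      refine (Timed.within_repeatUntil within_decodeAttempt _).bind fun o => ?_
      cases o with
      | none => exact Timed.within_pure _ _
      | some v =>
        refine (Timed.within_tick _).bind (B' := 0) fun _ => ?_
        split_ifs <;> exact Timed.within_pure _ _

theorem solves_and_time_le (q : ℝ) (hq : 0 < q) (hq1 : q ≤ 1)
    (h0 : (puncturedHybridRound n k b ω p h H s).res none ≤ 1 - ENNReal.ofReal q) :
    PuncturedHybridSolves n k b ω p h H s ∧
      puncturedHybridTime n k b ω p h H s ≤ ENNReal.ofReal (roundBound n k b ω p / q) := by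
  have hq' : 0 < ENNReal.ofReal q := ENNReal.ofReal_pos.2 hq
  refine ⟨loopProb_eq_one _ _ (round_sound n k b ω p h H s) (h0.trans_lt
    (ENNReal.sub_lt_self ENNReal.one_ne_top one_ne_zero hq'.ne')), ?_⟩
  refine (loopExpectedTime_le _ _ (within_round n k b ω p h H s)).trans ?_
  rw [div_eq_mul_inv, ENNReal.ofReal_mul (by positivity), ENNReal.ofReal_natCast,
    ENNReal.ofReal_inv_of_pos hq]
  gcongr
  refine ENNReal.le_sub_of_add_le_left (PMF.apply_ne_top _ _) ?_
  exact (add_le_add_left h0 _).trans_eq (tsub_add_cancel_of_le (ENNReal.ofReal_le_one.2 hq1))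

end Round


/-! ### Random permutations and random sets -/

theorem exists_sum_equiv {α β γ : Type} [Fintype α] [Fintype β] [Fintype γ] [DecidableEq γ]
    (A : Finset γ) (h1 : A.card = Fintype.card α) (h2 : Fintype.card α + Fintype.card β =
      Fintype.card γ) :
    ∃ e : α ⊕ β ≃ γ, (∀ x, e (.inl x) ∈ A) ∧ ∀ x, e (.inr x) ∉ A := by
  have h3 : Fintype.card α = Fintype.card {x // x ∈ A} := by rw [Fintype.card_coe, h1]
  have h4 : Fintype.card β = Fintype.card {x // x ∉ A} := by
    rw [Fintype.card_subtype_compl, Fintype.card_coe]; omega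
  refine ⟨((Fintype.equivOfCardEq h3).sumCongr (Fintype.equivOfCardEq h4)).trans
    (Equiv.sumCompl (· ∈ A)), fun x => ?_, fun x => ?_⟩
  · simp
  · exact (Fintype.equivOfCardEq h4 x).2

section Counting

variable (n k b : ℕ) (h : k + b ≤ n)

theorem exists_perm (X V : Finset (Fin n)) (hX : X.card = b) (hXV : X ⊆ V)
    (hV : V.card = n - k - b + b) :
    ∃ P, omittedSet n k b h P = X ∧ pivotSet n k b h P = V := by
  classical
  obtain ⟨e₀, h1, h2⟩ := exists_sum_equiv (α := Fin (n - k - b) ⊕ Fin b) (β := Fin k) V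
    (by simp [hV]) (by simp; omega)
  have hpre : ∀ x ∈ X, ∃ y, e₀ (.inl y) = x := by
    intro x hx
    rcases hy : e₀.symm x with y | y
    · exact ⟨y, by rw [← hy, Equiv.apply_symm_apply]⟩
    · exact absurd (hXV hx) (by rw [← e₀.apply_symm_apply x, hy]; exact h2 y)
  obtain ⟨e₁, h3, h4⟩ := exists_sum_equiv (α := Fin b) (β := Fin (n - k - b))
    (Finset.univ.filter fun y => e₀ (.inl y) ∈ X) (by
      refine Eq.trans ?_ (hX.trans (Fintype.card_fin b).symm)
      refine Finset.card_bij (fun y _ => e₀ (.inl y)) (fun y hy => (Finset.mem_filter.1 hy).2)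
        (fun y _ z _ hyz => by simpa using hyz) fun x hx => ?_
      obtain ⟨y, hy⟩ := hpre x hx
      exact ⟨y, Finset.mem_filter.2 ⟨Finset.mem_univ _, hy ▸ hx⟩, hy⟩) (by simp; omega)
  let Q : Position (n - k - b) b k ≃ Fin n :=
    (((Equiv.sumComm _ _).trans e₁).sumCongr (Equiv.refl _)).trans e₀
  have hQ : positionEquiv n k b h ((colBlocks n k b h).symm.trans Q) = Q := by
    ext c; simp [positionEquiv]
  refine ⟨(colBlocks n k b h).symm.trans Q, ?_, ?_⟩
  · refine Finset.eq_of_subset_of_card_le ?_ (by rw [card_omittedSet, hX])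
    intro x hx
    unfold omittedSet at hx
    rw [hQ] at hx
    obtain ⟨i, -, rfl⟩ := Finset.mem_map.1 hx
    exact (Finset.mem_filter.1 (h3 i)).2
  · refine Finset.eq_of_subset_of_card_le ?_ (by simp [pivotSet, hV])
    intro x hx
    unfold pivotSet at hx
    rw [hQ] at hx
    obtain ⟨i, -, rfl⟩ := Finset.mem_map.1 hx
    exact h1 _

/-- Starting from one suitable permutation, the three blocks of positions can be permuted internally
without changing the omitted and the pivot set. -/
theorem card_perm_ge (X V : Finset (Fin n)) (hX : X.card = b) (hXV : X ⊆ V)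
    (hV : V.card = n - k - b + b) :
    (n - k - b).factorial * b.factorial * k.factorial ≤
      (Finset.univ.filter fun P => omittedSet n k b h P = X ∧ pivotSet n k b h P = V).card := by
  classical
  obtain ⟨P₀, h1, h2⟩ := exists_perm n k b h X V hX hXV hV
  have hc : (n - k - b).factorial * b.factorial * k.factorial =
      (Finset.univ : Finset ((Equiv.Perm (Fin (n - k - b)) × Equiv.Perm (Fin b)) ×
        Equiv.Perm (Fin k))).card := by
    simp [Fintype.card_perm]
  rw [hc]
  let π : (Equiv.Perm (Fin (n - k - b)) × Equiv.Perm (Fin b)) × Equiv.Perm (Fin k) →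
      Equiv.Perm (Position (n - k - b) b k) := fun x => (x.1.1.sumCongr x.1.2).sumCongr x.2
  have hQ : ∀ x, positionEquiv n k b h ((colBlocks n k b h).symm.trans
      ((π x).trans (positionEquiv n k b h P₀))) = (π x).trans (positionEquiv n k b h P₀) := by
    intro x; ext c; simp [positionEquiv]
  refine Finset.card_le_card_of_injOn (fun x => (colBlocks n k b h).symm.trans
    ((π x).trans (positionEquiv n k b h P₀))) ?_ ?_
  · intro x _
    rw [Finset.mem_coe, Finset.mem_filter]
    refine ⟨Finset.mem_univ _, ?_, ?_⟩
    · rw [← h1]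
      refine Finset.eq_of_subset_of_card_le ?_ (by rw [card_omittedSet, card_omittedSet])
      intro y hy
      rw [omittedSet, hQ] at hy
      obtain ⟨i, -, rfl⟩ := Finset.mem_map.1 hy
      exact Finset.mem_map.2 ⟨x.1.2 i, Finset.mem_univ _, rfl⟩
    · rw [← h2]
      refine Finset.eq_of_subset_of_card_le ?_ (by simp [pivotSet])
      intro y hy
      rw [pivotSet, hQ] at hy
      obtain ⟨i, -, rfl⟩ := Finset.mem_map.1 hy
      exact Finset.mem_map.2 ⟨(x.1.1.sumCongr x.1.2) i, Finset.mem_univ _, rfl⟩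
  · intro x _ y _ hxy
    have h3 : π x = π y := by
      ext c
      have := congrArg (fun P => (positionEquiv n k b h P₀).symm (P (colBlocks n k b h c))) hxy
      simpa using this
    refine Prod.ext (Prod.ext ?_ ?_) ?_
    · refine Equiv.ext fun i => ?_
      have := congrArg (fun P => P (.inl (.inl i))) h3
      simpa [π] using this
    · refine Equiv.ext fun i => ?_
      have := congrArg (fun P => P (.inl (.inr i))) h3
      simpa [π] using this
    · refine Equiv.ext fun i => ?_
      have := congrArg (fun P => P (.inr i)) h3
      simpa [π] using this

/-- Grouping the permutations by their pair (X, V) turns an average over permutations into a sum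
over sets; pairs outside the range of summation are dropped because F is nonnegative. -/
theorem sum_perm_ge (F : Finset (Fin n) → Finset (Fin n) → ℝ) (hF : ∀ X V, 0 ≤ F X V)
    (A : Finset (Finset (Fin n))) (hA : ∀ X ∈ A, X.card = b) :
    ((n - k - b).factorial * b.factorial * k.factorial : ℝ) *
      ∑ X ∈ A, ∑ V : Finset (Fin n) with X ⊆ V ∧ V.card = n - k - b + b, F X V ≤
      ∑ P, F (omittedSet n k b h P) (pivotSet n k b h P) := by
  classical
  have h1 : ∑ P, F (omittedSet n k b h P) (pivotSet n k b h P) =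
      ∑ XV : Finset (Fin n) × Finset (Fin n), ∑ P : Equiv.Perm (Fin n) with
        (omittedSet n k b h P, pivotSet n k b h P) = XV, F XV.1 XV.2 := by
    rw [← Finset.sum_fiberwise_of_maps_to (t := Finset.univ)
      (g := fun P => (omittedSet n k b h P, pivotSet n k b h P)) (fun _ _ => Finset.mem_univ _)]
    refine Finset.sum_congr rfl fun XV _ => Finset.sum_congr rfl fun P hP => ?_
    rw [← (Finset.mem_filter.1 hP).2]
  rw [h1, Fintype.sum_prod_type, Finset.mul_sum]
  refine (Finset.sum_le_sum fun X hX => ?_).trans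
    (Finset.sum_le_sum_of_subset_of_nonneg (Finset.subset_univ A) fun X _ _ =>
      Finset.sum_nonneg fun V _ => Finset.sum_nonneg fun P _ => hF _ _)
  rw [Finset.mul_sum]
  refine (Finset.sum_le_sum fun V hV => ?_).trans
    (Finset.sum_le_sum_of_subset_of_nonneg (Finset.subset_univ _) fun V _ _ =>
      Finset.sum_nonneg fun P _ => hF _ _)
  obtain ⟨-, h2, h3⟩ := Finset.mem_filter.1 hV
  rw [Finset.sum_const, nsmul_eq_mul]
  refine mul_le_mul_of_nonneg_right ?_ (hF _ _)
  have := card_perm_ge n k b h X V (hA X hX) h2 h3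
  simp only [Prod.mk.injEq]
  exact_mod_cast this

end Counting

/-- The fraction of linearly independent sets among the sets of `t` columns that contain `X`. -/
def density {m n : ℕ} (H : Matrix (Fin m) (Fin n) (ZMod 2)) (X : Finset (Fin n)) (t : ℕ) : ℝ :=
  (independentSupersets H X t).card / (n - X.card).choose (t - X.card)

theorem density_nonneg {m n : ℕ} (H : Matrix (Fin m) (Fin n) (ZMod 2)) (X : Finset (Fin n))
    (t : ℕ) : 0 ≤ density H X t := by unfold density; positivity

theorem choose_supersets_pos {n : ℕ} (X : Finset (Fin n)) {t : ℕ} (ht : t ≤ n) :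
    (0 : ℝ) < (n - X.card).choose (t - X.card) := by
  exact_mod_cast Nat.choose_pos (by omega)

theorem density_le_one {m n : ℕ} (H : Matrix (Fin m) (Fin n) (ZMod 2)) (X : Finset (Fin n))
    (t : ℕ) (hX : X.card ≤ t) (ht : t ≤ n) : density H X t ≤ 1 := by
  unfold density
  rw [div_le_one (choose_supersets_pos X ht)]
  have h2 := card_supersets X t hX
  rw [Fintype.card_fin] at h2
  rw [← h2]
  refine Nat.cast_le.2 (Finset.card_le_card fun W hW => ?_)
  obtain ⟨h5, h6, -⟩ := mem_independentSupersets.1 hW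
  exact Finset.mem_filter.2 ⟨Finset.mem_univ _, h5, h6⟩

theorem card_union_support {n b p ω : ℕ} (X : Finset (Fin n)) (e : Fin n → ZMod 2)
    (hX : X.card = b) (he : hammingNorm e = ω) (hpat : (support e ∩ X).card = p) :
    (X ∪ support e).card = b + (ω - p) := by
  have h1 := Finset.card_union_add_card_inter X (support e)
  rw [Finset.inter_comm, hpat, hX, card_support, he] at h1
  have h2 : p ≤ ω := by
    rw [← he, ← card_support, ← hpat]
    exact Finset.card_le_card Finset.inter_subset_left
  omega

/-- The failure probability of a round in terms of sets of columns. -/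
theorem res_round_none_le_of_sets (n k b ω p : ℕ) (h : k + b ≤ n) (hn : 1 ≤ n) (hp : p ≤ ω)
    (hw : ω - p ≤ n - k - b)
    (H : Matrix (Fin (n - k)) (Fin n) (ZMod 2)) (e : Fin n → ZMod 2) (heω : hammingNorm e = ω)
    (Θ y₁ y₂ : ℝ) (hΘ : 1 ≤ Θ) (hy₁ : 0 ≤ y₁) (A : Finset (Finset (Fin n)))
    (hA : ∀ X ∈ A, X.card = b ∧ (support e ∩ X).card = p ∧
      ((partialSolutions H (H.mulVec e) X (ω - p)).card : ℝ) ≤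
        Θ * max 1 (expectedSolutions (n - k - b) k (ω - p)) ∧
      y₁ ≤ density H (X ∪ support e) (n - k) ∧ y₂ ≤ density H X (n - k)) :
    (puncturedHybridRound n k b ω p h H (H.mulVec e)).res none ≤
      1 - ENNReal.ofReal (A.card / n.choose b * (y₁ * y₂ / (8 * Θ))) := by
  classical
  -- A lower bound for the success probability of the round that depends on the permutation only
  -- through (X, V).
  set F : Finset (Fin n) → Finset (Fin n) → ℝ := fun X V =>
    if X ∈ A ∧ Independent H V then density H (X ∪ support e) (n - k) / (8 * Θ) else 0 with hF
  have hcard : ∀ X ∈ A, (X ∪ support e).card = b + (ω - p) := fun X hX =>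
    card_union_support X e (hA X hX).1 heω (hA X hX).2.1
  have hdle : ∀ X ∈ A, density H (X ∪ support e) (n - k) ≤ 1 := fun X hX =>
    density_le_one _ _ _ (by rw [hcard X hX]; omega) (by omega)
  have hF0 : ∀ X V, 0 ≤ F X V := by
    intro X V
    simp only [hF]
    split_ifs
    · exact div_nonneg (density_nonneg _ _ _) (by linarith)
    · exact le_rfl
  have hr : n - k - b + b = n - k := by omega
  refine (res_round_none_le n k b ω p h H (H.mulVec e)
    (fun P => F (omittedSet n k b h P) (pivotSet n k b h P)) (fun P => hF0 _ _) ?_ ?_).trans ?_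
  · intro P
    simp only [hF]
    split_ifs with hc
    · rw [div_le_one (by linarith)]
      linarith [hdle _ hc.1]
    · exact zero_le_one
  · intro P
    simp only [hF]
    split_ifs with hc
    · obtain ⟨h1, h2, h3, -, -⟩ := hA _ hc.1
      refine (roundWith_none_le n k b ω p h H (H.mulVec e) P hn hp hw e rfl heω h2 hc.2 Θ hΘ
        h3).trans (tsub_le_tsub_left (ENNReal.ofReal_le_ofReal (le_of_eq ?_)) _)
      unfold density
      rw [hcard _ hc.1, hr]
      have e1 : n - (b + (ω - p)) = n - k - b + k - (ω - p) := by omega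
      have e2 : n - k - (b + (ω - p)) = n - k - b - (ω - p) := by omega
      rw [e1, e2, div_div, mul_comm (8 * Θ)]
    · simp [PMF.coe_le_one]
  · refine tsub_le_tsub_left (ENNReal.ofReal_le_ofReal ?_) _
    have h1 := sum_perm_ge n k b h F hF0 A fun X hX => (hA X hX).1
    have h2 : ∀ X ∈ A, (n - b).choose (n - k - b) * (y₁ * y₂ / (8 * Θ)) ≤
        ∑ V : Finset (Fin n) with X ⊆ V ∧ V.card = n - k - b + b, F X V := by
      intro X hX
      obtain ⟨h3, -, -, h4, h5⟩ := hA X hX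
      have h6 : ∑ V : Finset (Fin n) with X ⊆ V ∧ V.card = n - k - b + b, F X V =
          (independentSupersets H X (n - k)).card *
            (density H (X ∪ support e) (n - k) / (8 * Θ)) := by
        rw [hr, ← nsmul_eq_mul, ← Finset.sum_const]
        simp only [hF]
        rw [← Finset.sum_filter]
        refine Finset.sum_congr ?_ fun _ _ => rfl
        ext V
        simp [mem_independentSupersets, hX, and_assoc]
      have hLpos := choose_supersets_pos X (t := n - k) (by omega)
      have h7 : ((independentSupersets H X (n - k)).card : ℝ) =
          density H X (n - k) * (n - b).choose (n - k - b) := by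
        unfold density
        rw [h3] at hLpos ⊢
        field_simp
      rw [h6, h7]
      have h8 : (0 : ℝ) ≤ (n - b).choose (n - k - b) := by positivity
      have h9 : y₁ * y₂ / (8 * Θ) ≤ density H X (n - k) *
          (density H (X ∪ support e) (n - k) / (8 * Θ)) := by
        rw [← mul_div_assoc]
        refine div_le_div_of_nonneg_right ?_ (by linarith)
        rw [mul_comm]
        refine (mul_le_mul_of_nonneg_right h5 hy₁).trans
          (mul_le_mul_of_nonneg_left h4 (density_nonneg _ _ _))
      calc _ ≤ (n - b).choose (n - k - b) * (density H X (n - k) *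
          (density H (X ∪ support e) (n - k) / (8 * Θ))) := mul_le_mul_of_nonneg_left h9 h8
        _ = _ := by ring
    have h3 := Finset.sum_le_sum h2
    rw [Finset.sum_const, nsmul_eq_mul] at h3
    -- The multinomial identity: n! is the number of pairs (X, V) times the number of permutations
    -- guaranteed for each pair, so dividing by n! yields an average over pairs.
    have hfac : (n.factorial : ℝ) = n.choose b * (n - b).choose (n - k - b) *
        ((n - k - b).factorial * b.factorial * k.factorial) := by
      have e1 := Nat.choose_mul_factorial_mul_factorial (n := n) (k := b) (by omega)
      have e2 := Nat.choose_mul_factorial_mul_factorial (n := n - b) (k := n - k - b) (by omega)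
      have e3 : n - b - (n - k - b) = k := by omega
      rw [e3] at e2
      rw [← e1, ← e2]
      push_cast
      ring
    have hpos : (0 : ℝ) < (n - k - b).factorial * b.factorial * k.factorial := by positivity
    have hc1 : (0 : ℝ) < n.choose b := by exact_mod_cast Nat.choose_pos (by omega)
    have hc2 : (0 : ℝ) < (n - b).choose (n - k - b) := by exact_mod_cast Nat.choose_pos (by omega)
    rw [le_div_iff₀ (by exact_mod_cast n.factorial_pos), hfac]
    refine le_trans (le_of_eq ?_) ((mul_le_mul_of_nonneg_left h3 hpos.le).trans h1)
    field_simp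


/-! ### Random matrices -/

/-- Markov's inequality for the uniform distribution. -/
theorem card_ge_mul_le {Ω : Type} [Fintype Ω] (f : Ω → ℝ) (hf : ∀ x, 0 ≤ f x) (B θ : ℝ)
    (hsum : ∑ x, f x ≤ B) (q : Ω → Prop) [DecidablePred q] (hq : ∀ x, q x → θ ≤ f x) :
    ((Finset.univ.filter q).card : ℝ) * θ ≤ B := by
  rw [← nsmul_eq_mul]
  refine (Finset.card_nsmul_le_sum _ f θ fun x hx => hq x (Finset.mem_filter.1 hx).2).trans
    (le_trans ?_ hsum)
  exact Finset.sum_le_sum_of_subset_of_nonneg (Finset.subset_univ _) fun x _ _ => hf x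

/-- Double counting of bad pairs. -/
theorem card_many_bad_mul_le {Ω ι : Type} [Fintype Ω] (A : Finset ι) (Bad : Ω → ι → Prop)
    [∀ x, DecidablePred (Bad x)] [∀ i, DecidablePred fun x => Bad x i] (c η : ℝ) (hc : 0 ≤ c)
    (hbad : ∀ i ∈ A, ((Finset.univ.filter fun x => Bad x i).card : ℝ) ≤ c * Fintype.card Ω) :
    ((Finset.univ.filter fun x => η * A.card < (A.filter (Bad x)).card).card : ℝ) * η ≤
      c * Fintype.card Ω := by
  classical
  rcases A.eq_empty_or_nonempty with rfl | hA
  · simp only [Finset.card_empty, Finset.filter_empty, Nat.cast_zero, mul_zero, lt_irrefl,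
      Finset.filter_false, zero_mul]
    positivity
  have hpos : (0 : ℝ) < A.card := by exact_mod_cast hA.card_pos
  have hsum : ∑ x, ((A.filter (Bad x)).card : ℝ) ≤ A.card * (c * Fintype.card Ω) := by
    have h1 : ∑ x, ((A.filter (Bad x)).card : ℝ) =
        ∑ i ∈ A, ((Finset.univ.filter fun x => Bad x i).card : ℝ) := by
      simp only [Finset.card_eq_sum_ones, Finset.sum_filter, Nat.cast_sum]
      exact Finset.sum_comm
    rw [h1, ← nsmul_eq_mul]
    exact Finset.sum_le_card_nsmul _ _ _ hbad
  have := card_ge_mul_le (fun x => ((A.filter (Bad x)).card : ℝ)) (fun x => by positivity) _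
    (η * A.card) hsum (fun x => η * A.card < (A.filter (Bad x)).card) (fun x hx => hx.le)
  refine le_of_mul_le_mul_left ?_ hpos
  linarith

section Matrices

variable {m n : ℕ}

/-- Adding u' - u to a column at which v is 1 maps one fibre injectively into the other. -/
theorem card_mulVec_le (v : Fin n → ZMod 2) (hv : v ≠ 0) (u u' : Fin m → ZMod 2) :
    (Finset.univ.filter fun H : Matrix (Fin m) (Fin n) (ZMod 2) => H.mulVec v = u).card ≤
      (Finset.univ.filter fun H : Matrix (Fin m) (Fin n) (ZMod 2) => H.mulVec v = u').card := by
  obtain ⟨c, hc⟩ := Function.ne_iff.1 hv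
  have hc1 : v c = 1 := by
    by_contra h
    exact hc (ZMod.two_eq_zero_of_ne_one h)
  refine Finset.card_le_card_of_injOn (fun H => H + Matrix.of fun i j =>
    if j = c then (u' - u) i else 0) ?_ (fun H _ H' _ hH => add_right_cancel hH)
  intro H hH
  have hH' := (Finset.mem_filter.1 hH).2
  refine Finset.mem_filter.2 ⟨Finset.mem_univ _, ?_⟩
  rw [Matrix.add_mulVec, hH']
  funext i
  simp [Matrix.mulVec, dotProduct, hc1]

/-- For fixed v ≠ 0, Hv is uniform for uniform H: all fibres have the same size. -/
theorem card_mulVec_eq (v : Fin n → ZMod 2) (hv : v ≠ 0) (u : Fin m → ZMod 2) :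
    (Finset.univ.filter fun H : Matrix (Fin m) (Fin n) (ZMod 2) => H.mulVec v = u).card * 2 ^ m =
      Fintype.card (Matrix (Fin m) (Fin n) (ZMod 2)) := by
  have h1 := Finset.card_eq_sum_card_fiberwise (s := Finset.univ) (t := Finset.univ)
    (f := fun H : Matrix (Fin m) (Fin n) (ZMod 2) => H.mulVec v) (fun _ _ => by simp)
  rw [← Finset.card_univ (α := Matrix (Fin m) (Fin n) (ZMod 2)), h1,
    Finset.sum_congr rfl fun u' _ => (card_mulVec_le v hv u' u).antisymm (card_mulVec_le v hv u u'),
    Finset.sum_const, Finset.card_univ, smul_eq_mul, mul_comm]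
  simp [ZMod.card]

theorem card_vecMul_eq (x : Fin m → ZMod 2) (hx : x ≠ 0) (y : Fin n → ZMod 2) :
    (Finset.univ.filter fun H : Matrix (Fin m) (Fin n) (ZMod 2) => Matrix.vecMul x H = y).card *
      2 ^ n = Fintype.card (Matrix (Fin m) (Fin n) (ZMod 2)) := by
  have h1 := card_mulVec_eq x hx y
  have h2 : Fintype.card (Matrix (Fin m) (Fin n) (ZMod 2)) =
      Fintype.card (Matrix (Fin n) (Fin m) (ZMod 2)) :=
    Fintype.card_congr (Matrix.transposeAddEquiv _ _ _).toEquiv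
  rw [h2, ← h1]
  congr 1
  refine Finset.card_bij (fun H _ => H.transpose) ?_ ?_ ?_
  · intro H hH
    simpa [Matrix.mulVec_transpose] using hH
  · intro H _ H' _ h
    exact Matrix.transpose_injective h
  · intro H hH
    refine ⟨H.transpose, ?_, Matrix.transpose_transpose H⟩
    simpa [Matrix.vecMul_transpose] using hH

theorem card_supported (T : Finset (Fin n)) :
    (Finset.univ.filter fun u : Fin n → ZMod 2 => ∀ c ∉ T, u c = 0).card = 2 ^ T.card := by
  have h1 : (Finset.univ.filter fun u : Fin n → ZMod 2 => ∀ c ∉ T, u c = 0) =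
      Fintype.piFinset fun c => if c ∈ T then Finset.univ else {0} := by
    ext u
    simp only [Finset.mem_filter, Finset.mem_univ, true_and, Fintype.mem_piFinset]
    refine forall_congr' fun c => ?_
    by_cases hc : c ∈ T <;> simp [hc]
  rw [h1, Fintype.card_piFinset]
  have h2 : ∀ c, (if c ∈ T then (Finset.univ : Finset (ZMod 2)) else {0}).card =
      if c ∈ T then 2 else 1 := by
    intro c
    split_ifs
    · rfl
    · rfl
  simp [h2]

-- Union bound over the nonzero vectors supported on T, each of which lies in the kernel with
-- probability 2^(-m).
open Classical in
theorem card_dependent_le (T : Finset (Fin n)) :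
    ((Finset.univ.filter fun H : Matrix (Fin m) (Fin n) (ZMod 2) => ¬ Independent H T).card : ℝ) *
      2 ^ m ≤ 2 ^ T.card * Fintype.card (Matrix (Fin m) (Fin n) (ZMod 2)) := by
  have hsub : (Finset.univ.filter fun H : Matrix (Fin m) (Fin n) (ZMod 2) => ¬ Independent H T) ⊆
      ((Finset.univ.filter fun u : Fin n → ZMod 2 => ∀ c ∉ T, u c = 0).erase 0).biUnion fun u =>
        Finset.univ.filter fun H => H.mulVec u = 0 := by
    intro H hH
    have := (Finset.mem_filter.1 hH).2
    unfold Independent at this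
    push Not at this
    obtain ⟨u, h1, h2, h3⟩ := this
    rw [Finset.mem_biUnion]
    exact ⟨u, Finset.mem_erase.2 ⟨h3, Finset.mem_filter.2 ⟨Finset.mem_univ _, h1⟩⟩,
      Finset.mem_filter.2 ⟨Finset.mem_univ _, h2⟩⟩
  have h1 : (Finset.univ.filter fun H : Matrix (Fin m) (Fin n) (ZMod 2) =>
      ¬ Independent H T).card * 2 ^ m ≤
        2 ^ T.card * Fintype.card (Matrix (Fin m) (Fin n) (ZMod 2)) := by
    refine (Nat.mul_le_mul_right _ ((Finset.card_le_card hsub).trans Finset.card_biUnion_le)).trans ?_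
    rw [Finset.sum_mul, Finset.sum_congr rfl fun u hu =>
      card_mulVec_eq (m := m) u (Finset.mem_erase.1 hu).1 0, Finset.sum_const, smul_eq_mul]
    refine Nat.mul_le_mul_right _ ?_
    rw [← card_supported T]
    exact Finset.card_erase_le
  exact_mod_cast h1

/-- The row space has minimum distance at least `d`, and the rows are linearly independent. -/
def DualDistance (H : Matrix (Fin m) (Fin n) (ZMod 2)) (d : ℕ) : Prop :=
  ∀ x : Fin m → ZMod 2, x ≠ 0 → d ≤ hammingNorm (Matrix.vecMul x H)

-- Union bound over nonzero row combinations x and light words y; each xH is uniform.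
open Classical in
theorem card_not_dualDistance_le (d : ℕ) :
    ((Finset.univ.filter fun H : Matrix (Fin m) (Fin n) (ZMod 2) => ¬ DualDistance H d).card : ℝ) *
      2 ^ n ≤ 2 ^ m * (Finset.univ.filter fun y : Fin n → ZMod 2 => hammingNorm y < d).card *
        Fintype.card (Matrix (Fin m) (Fin n) (ZMod 2)) := by
  set D := Finset.univ.filter fun y : Fin n → ZMod 2 => hammingNorm y < d with hD
  have hsub : (Finset.univ.filter fun H : Matrix (Fin m) (Fin n) (ZMod 2) => ¬ DualDistance H d) ⊆
      ((Finset.univ.erase (0 : Fin m → ZMod 2)) ×ˢ D).biUnion fun xy =>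
        Finset.univ.filter fun H => Matrix.vecMul xy.1 H = xy.2 := by
    intro H hH
    have := (Finset.mem_filter.1 hH).2
    unfold DualDistance at this
    push Not at this
    obtain ⟨x, h1, h2⟩ := this
    rw [Finset.mem_biUnion]
    exact ⟨(x, Matrix.vecMul x H), Finset.mem_product.2 ⟨Finset.mem_erase.2 ⟨h1, Finset.mem_univ _⟩,
      Finset.mem_filter.2 ⟨Finset.mem_univ _, h2⟩⟩, Finset.mem_filter.2 ⟨Finset.mem_univ _, rfl⟩⟩
  have h1 : (Finset.univ.filter fun H : Matrix (Fin m) (Fin n) (ZMod 2) =>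
      ¬ DualDistance H d).card * 2 ^ n ≤
        2 ^ m * D.card * Fintype.card (Matrix (Fin m) (Fin n) (ZMod 2)) := by
    refine (Nat.mul_le_mul_right _ ((Finset.card_le_card hsub).trans Finset.card_biUnion_le)).trans ?_
    rw [Finset.sum_mul, Finset.sum_congr rfl fun xy hxy =>
      card_vecMul_eq xy.1 (Finset.mem_erase.1 (Finset.mem_product.1 hxy).1).1 xy.2,
      Finset.sum_const, smul_eq_mul, Finset.card_product]
    refine Nat.mul_le_mul_right _ (Nat.mul_le_mul_right _ (Finset.card_erase_le.trans ?_))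
    simp [ZMod.card]
  exact_mod_cast h1

/-- Chernoff's method: the weight enumerator at l is (1+l)^n, and each light word contributes at
least l^d. -/
theorem card_light_le (d : ℕ) (l : ℝ) (hl0 : 0 < l) (hl1 : l ≤ 1) :
    ((Finset.univ.filter fun y : Fin n → ZMod 2 => hammingNorm y < d).card : ℝ) * l ^ d ≤
      (1 + l) ^ n := by
  have h1 : ∑ y : Fin n → ZMod 2, l ^ hammingNorm y = (1 + l) ^ n := by
    have h2 : ∀ y : Fin n → ZMod 2, l ^ hammingNorm y = ∏ i, if y i = 0 then 1 else l := by
      intro y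
      rw [hammingNorm_eq_sum, ← Finset.prod_pow_eq_pow_sum]
      refine Finset.prod_congr rfl fun i _ => ?_
      split_ifs <;> simp
    rw [Finset.sum_congr rfl fun y _ => h2 y,
      ← Fintype.prod_sum (fun (_ : Fin n) (x : ZMod 2) => if x = 0 then 1 else l)]
    have h3 : ∑ x : ZMod 2, (if x = 0 then 1 else l) = 1 + l := by
      rw [show (Finset.univ : Finset (ZMod 2)) = {0, 1} from rfl, Finset.sum_pair (by decide)]
      simp
    rw [h3]
    simp
  exact card_ge_mul_le (fun y : Fin n → ZMod 2 => l ^ hammingNorm y) (fun y => by positivity) _ _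
    h1.le _ fun y hy => pow_le_pow_of_le_one hl0.le hl1 hy.le

/-! ### Extension of independent sets of columns and their density. -/

/-- Pigeonhole: the 2^m row combinations restricted to fewer than m columns cannot all differ. -/
theorem exists_vecMul_eq_zero (H : Matrix (Fin m) (Fin n) (ZMod 2)) (T : Finset (Fin n))
    (hT : T.card < m) : ∃ x : Fin m → ZMod 2, x ≠ 0 ∧ ∀ c ∈ T, Matrix.vecMul x H c = 0 := by
  obtain ⟨x, x', hne, hxx⟩ := Fintype.exists_ne_map_eq_of_card_lt
    (fun (x : Fin m → ZMod 2) (c : T) => Matrix.vecMul x H c) (by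
      simp only [Fintype.card_pi, ZMod.card, Finset.prod_const, Finset.card_univ, Fintype.card_fin,
        Fintype.card_coe]
      exact Nat.pow_lt_pow_right (by norm_num) hT)
  refine ⟨x - x', sub_ne_zero.2 hne, fun c hc => ?_⟩
  rw [Matrix.sub_vecMul, Pi.sub_apply, sub_eq_zero]
  exact congrFun hxx ⟨c, hc⟩

/-- The combination x annihilates the columns in T but not column c. Pairing a relation with x
therefore kills its coefficient at c. -/
theorem independent_insert (H : Matrix (Fin m) (Fin n) (ZMod 2)) (T : Finset (Fin n))
    (hT : Independent H T) (x : Fin m → ZMod 2) (hx : ∀ c ∈ T, Matrix.vecMul x H c = 0)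
    (c : Fin n) (hc : Matrix.vecMul x H c ≠ 0) : Independent H (insert c T) := by
  intro u hu hu0
  have h1 : Matrix.vecMul x H ⬝ᵥ u = 0 := by
    rw [← Matrix.dotProduct_mulVec, hu0, dotProduct_zero]
  have h2 : Matrix.vecMul x H ⬝ᵥ u = Matrix.vecMul x H c * u c := by
    unfold dotProduct
    refine Finset.sum_eq_single c (fun c' _ hne => ?_) (by simp)
    by_cases h : c' ∈ T
    · rw [hx c' h, zero_mul]
    · rw [hu c' (by simp [h, hne]), mul_zero]
  rw [h2] at h1
  refine hT u (fun c' hc' => ?_) hu0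
  by_cases h : c' = c
  · rw [h]; exact (mul_eq_zero.1 h1).resolve_left hc
  · exact hu c' (by simp [h, hc'])

theorem Independent.mono {H : Matrix (Fin m) (Fin n) (ZMod 2)} {T T' : Finset (Fin n)}
    (h : Independent H T') (hT : T ⊆ T') : Independent H T :=
  fun u hu => h u fun c hc => hu c fun h' => hc (hT h')

/-- Double counting of pairs T ⊂ T'. A dual word vanishing on T has at least d nonzero positions,
each of which extends T; conversely T' arises from T only by removing an element outside X. -/
theorem card_independentSupersets_succ (H : Matrix (Fin m) (Fin n) (ZMod 2)) (d : ℕ)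
    (hd : DualDistance H d) (X : Finset (Fin n)) (t : ℕ) (htm : t < m) :
    (independentSupersets H X t).card * d ≤
      (independentSupersets H X (t + 1)).card * (t + 1 - X.card) := by
  classical
  refine Finset.card_mul_le_card_mul (fun T T' => T ⊆ T') ?_ ?_
  · intro T hT
    obtain ⟨h1, h2, h3⟩ := mem_independentSupersets.1 hT
    obtain ⟨x, hx, hxT⟩ := exists_vecMul_eq_zero H T (h2 ▸ htm)
    refine (hd x hx).trans (Finset.card_le_card_of_injOn (fun c => insert c T) ?_ ?_)
    · intro c hc
      have hc' : Matrix.vecMul x H c ≠ 0 := (Finset.mem_filter.1 hc).2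
      have hcT : c ∉ T := fun h => hc' (hxT c h)
      rw [Finset.mem_coe, Finset.mem_bipartiteAbove, mem_independentSupersets]
      exact ⟨⟨h1.trans (Finset.subset_insert _ _), by rw [Finset.card_insert_of_notMem hcT, h2],
        independent_insert H T h3 x hxT c hc'⟩, Finset.subset_insert _ _⟩
    · intro c hc c' hc' hcc
      have hcT : c ∉ T := fun h => (Finset.mem_filter.1 hc).2 (hxT c h)
      have : c ∈ insert c' T := by
        rw [← show insert c T = insert c' T from hcc]; exact Finset.mem_insert_self _ _
      exact (Finset.mem_insert.1 this).resolve_right hcT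
  · intro T' hT'
    obtain ⟨h1, h2, h3⟩ := mem_independentSupersets.1 hT'
    rw [← h2, ← Finset.card_sdiff_of_subset h1]
    refine (Finset.card_le_card (t := (T' \ X).image fun c => T'.erase c) ?_).trans
      Finset.card_image_le
    intro T hT
    obtain ⟨hT1, hT2⟩ := Finset.mem_bipartiteBelow _ |>.1 hT
    obtain ⟨h4, h5, -⟩ := mem_independentSupersets.1 hT1
    have h6 : (T' \ T).card = 1 := by rw [Finset.card_sdiff_of_subset hT2, h2, h5]; omega
    obtain ⟨c, hc⟩ := Finset.card_eq_one.1 h6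
    have hc' : c ∈ T' \ T := by rw [hc]; exact Finset.mem_singleton_self c
    obtain ⟨h7, h8⟩ := Finset.mem_sdiff.1 hc'
    refine Finset.mem_image.2 ⟨c, Finset.mem_sdiff.2 ⟨h7, fun h => h8 (h4 h)⟩, ?_⟩
    rw [Finset.erase_eq, ← hc, Finset.sdiff_sdiff_eq_self hT2]

/-- The ratio of the numbers of all (t+1)-sets and t-sets above X is (n-t)/(t+1-|X|). Comparing with
the double count leaves the factor d/(n-t) ≥ ε. -/
theorem density_succ (H : Matrix (Fin m) (Fin n) (ZMod 2)) (d : ℕ) (ε : ℝ) (hε : 0 ≤ ε)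
    (hεd : ε * n ≤ d) (hd : DualDistance H d) (X : Finset (Fin n)) (t : ℕ) (hX : X.card ≤ t)
    (htm : t < m) (hmn : m ≤ n) : ε * density H X t ≤ density H X (t + 1) := by
  have h1 : ((independentSupersets H X t).card : ℝ) * d ≤
      (independentSupersets H X (t + 1)).card * (t + 1 - X.card : ℕ) := by
    exact_mod_cast card_independentSupersets_succ H d hd X t htm
  have h2 : ((n - X.card).choose (t - X.card + 1) : ℝ) * (t + 1 - X.card : ℕ) =
      (n - X.card).choose (t - X.card) * (n - t : ℕ) := by
    have e1 := Nat.choose_succ_right_eq (n - X.card) (t - X.card)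
    have e2 : t - X.card + 1 = t + 1 - X.card := by omega
    have e3 : n - X.card - (t - X.card) = n - t := by omega
    rw [e3] at e1
    rw [← e2]
    exact_mod_cast e1
  unfold density
  have e2 : t + 1 - X.card = t - X.card + 1 := by omega
  have hp1 := choose_supersets_pos X (t := t) (by omega)
  have hp2 := choose_supersets_pos X (t := t + 1) (by omega)
  rw [e2] at h1 h2 hp2 ⊢
  have hp3 : (0 : ℝ) < (t - X.card + 1 : ℕ) := by positivity
  have hnt : ((n - t : ℕ) : ℝ) ≤ n := by exact_mod_cast Nat.sub_le _ _
  rw [← mul_div_assoc, div_le_div_iff₀ hp1 hp2]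
  refine le_of_mul_le_mul_right ?_ hp3
  calc ε * (independentSupersets H X t).card * (n - X.card).choose (t - X.card + 1) *
        (t - X.card + 1 : ℕ)
      = ε * (n - t : ℕ) * (independentSupersets H X t).card * (n - X.card).choose (t - X.card) := by
        linear_combination ε * (independentSupersets H X t).card * h2
    _ ≤ d * (independentSupersets H X t).card * (n - X.card).choose (t - X.card) := by
        gcongr
        exact (mul_le_mul_of_nonneg_left hnt hε).trans hεd
    _ ≤ _ := by nlinarith

theorem density_add (H : Matrix (Fin m) (Fin n) (ZMod 2)) (d : ℕ) (ε : ℝ) (hε : 0 ≤ ε)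
    (hεd : ε * n ≤ d) (hd : DualDistance H d) (X : Finset (Fin n)) (t s : ℕ) (hX : X.card ≤ t)
    (htm : t + s ≤ m) (hmn : m ≤ n) : ε ^ s * density H X t ≤ density H X (t + s) := by
  induction s with
  | zero => simp
  | succ s ih =>
    have := density_succ H d ε hε hεd hd X (t + s) (by omega) (by omega) hmn
    calc ε ^ (s + 1) * density H X t = ε * (ε ^ s * density H X t) := by ring
      _ ≤ ε * density H X (t + s) := mul_le_mul_of_nonneg_left (ih (by omega)) hε
      _ ≤ _ := this

/-- Interchange the sums over matrices and sets: each set of m - s columns is dependent for at most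
a fraction 2^(-s) of the matrices. -/
theorem sum_one_sub_density_le (X : Finset (Fin n)) (t s : ℕ) (hX : X.card ≤ t) (hts : t + s = m)
    (hmn : m ≤ n) : ∑ H : Matrix (Fin m) (Fin n) (ZMod 2), (1 - density H X t) ≤
      (1 / 2) ^ s * Fintype.card (Matrix (Fin m) (Fin n) (ZMod 2)) := by
  classical
  have hL := choose_supersets_pos X (t := t) (by omega)
  have hcard := card_supersets X t hX
  rw [Fintype.card_fin] at hcard
  set A := Finset.univ.filter fun T : Finset (Fin n) => X ⊆ T ∧ T.card = t with hA
  have h1 : ∀ H : Matrix (Fin m) (Fin n) (ZMod 2), 1 - density H X t =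
      (A.filter fun T => ¬ Independent H T).card / (n - X.card).choose (t - X.card) := by
    intro H
    have e1 : independentSupersets H X t = A.filter fun T => Independent H T := by
      ext T
      simp [hA, mem_independentSupersets, and_assoc]
    have e2 := Finset.card_filter_add_card_filter_not (s := A) (fun T => Independent H T)
    unfold density
    rw [eq_div_iff hL.ne', sub_mul, one_mul, div_mul_cancel₀ _ hL.ne', e1, ← hcard, ← e2]
    push_cast
    ring
  rw [Finset.sum_congr rfl fun H _ => h1 H, ← Finset.sum_div, div_le_iff₀ hL]
  have h2 : ∑ H : Matrix (Fin m) (Fin n) (ZMod 2),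
      ((A.filter fun T => ¬ Independent H T).card : ℝ) = ∑ T ∈ A, ((Finset.univ.filter
        fun H : Matrix (Fin m) (Fin n) (ZMod 2) => ¬ Independent H T).card : ℝ) := by
    simp only [Finset.card_eq_sum_ones, Finset.sum_filter, Nat.cast_sum]
    exact Finset.sum_comm
  rw [h2]
  refine le_trans (Finset.sum_le_card_nsmul A _ ((1 / 2 : ℝ) ^ s *
    Fintype.card (Matrix (Fin m) (Fin n) (ZMod 2))) ?_) (le_of_eq ?_)
  · intro T hT
    have h3 := card_dependent_le (m := m) T
    rw [(Finset.mem_filter.1 hT).2.2, ← hts, pow_add] at h3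
    rw [← hts, one_div, inv_pow, inv_mul_eq_div, le_div_iff₀ (by positivity)]
    refine le_of_mul_le_mul_left ?_ (by positivity : (0 : ℝ) < 2 ^ t)
    linarith
  · rw [nsmul_eq_mul, hcard]
    ring

theorem card_density_lt_half_le (X : Finset (Fin n)) (t s : ℕ) (hX : X.card ≤ t) (hts : t + s = m)
    (hmn : m ≤ n) :
    ((Finset.univ.filter fun H : Matrix (Fin m) (Fin n) (ZMod 2) => density H X t < 1 / 2).card :
      ℝ) ≤ 2 * (1 / 2) ^ s * Fintype.card (Matrix (Fin m) (Fin n) (ZMod 2)) := by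
  have := card_ge_mul_le (fun H : Matrix (Fin m) (Fin n) (ZMod 2) => 1 - density H X t)
    (fun H => sub_nonneg.2 (density_le_one H X t hX (by omega))) _ (1 / 2)
    (sum_one_sub_density_le X t s hX hts hmn) (fun H => density H X t < 1 / 2)
    (fun H hH => by linarith)
  linarith

theorem rank_eq_of_vecMul (H : Matrix (Fin m) (Fin n) (ZMod 2))
    (h : ∀ x : Fin m → ZMod 2, Matrix.vecMul x H = 0 → x = 0) : H.rank = m := by
  have hli : LinearIndependent (ZMod 2) H.row := by
    rw [← Matrix.vecMul_injective_iff]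
    intro x y hxy
    refine sub_eq_zero.1 (h (x - y) ?_)
    rw [Matrix.sub_vecMul]
    exact sub_eq_zero.2 hxy
  simpa using hli.rank_matrix

/-- Dual distance 1 already forces full rank, and the union bound with the zero word fails with
probability at most 2^(m-n) ≤ 1/2. A fraction of all matrices is thus a fraction of the full-rank
ones, up to a factor 2. -/
theorem card_full_rank_ge (hmn : m < n) :
    Fintype.card (Matrix (Fin m) (Fin n) (ZMod 2)) ≤
      2 * (Finset.univ.filter fun H : Matrix (Fin m) (Fin n) (ZMod 2) => H.rank = m).card := by
  classical
  have h1 := card_not_dualDistance_le (m := m) (n := n) 1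
  have h2 : (Finset.univ.filter fun y : Fin n → ZMod 2 => hammingNorm y < 1) = {0} := by
    ext y; simp
  rw [h2, Finset.card_singleton, Nat.cast_one, mul_one] at h1
  have h3 : (Finset.univ.filter fun H : Matrix (Fin m) (Fin n) (ZMod 2) => ¬ H.rank = m).card ≤
      (Finset.univ.filter fun H : Matrix (Fin m) (Fin n) (ZMod 2) => ¬ DualDistance H 1).card := by
    refine Finset.card_le_card fun H hH => ?_
    refine Finset.mem_filter.2 ⟨Finset.mem_univ _, fun hd => (Finset.mem_filter.1 hH).2 ?_⟩
    refine rank_eq_of_vecMul H fun x hx => ?_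
    by_contra hne
    have := hd x hne
    rw [hx, hammingNorm_zero] at this
    omega
  have h4 := Finset.card_filter_add_card_filter_not
    (s := (Finset.univ : Finset (Matrix (Fin m) (Fin n) (ZMod 2)))) (fun H => H.rank = m)
  rw [Finset.card_univ] at h4
  have h5 : (2 : ℝ) ^ m * 2 ≤ 2 ^ n := by
    rw [← pow_succ]
    exact pow_le_pow_right₀ (by norm_num) hmn
  set N : ℝ := (Fintype.card (Matrix (Fin m) (Fin n) (ZMod 2)) : ℝ) with hN
  have h6 : ((Finset.univ.filter fun H : Matrix (Fin m) (Fin n) (ZMod 2) =>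
      ¬ DualDistance H 1).card : ℝ) * 2 ≤ N := by
    have hp : (0 : ℝ) < 2 ^ m := by positivity
    refine le_of_mul_le_mul_left ?_ hp
    refine le_trans ?_ h1
    have : (0 : ℝ) ≤ (Finset.univ.filter fun H : Matrix (Fin m) (Fin n) (ZMod 2) =>
      ¬ DualDistance H 1).card := by positivity
    nlinarith
  have h7 : (Finset.univ.filter fun H : Matrix (Fin m) (Fin n) (ZMod 2) =>
      ¬ DualDistance H 1).card * 2 ≤ Fintype.card (Matrix (Fin m) (Fin n) (ZMod 2)) := by
    rw [hN] at h6
    exact_mod_cast h6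
  omega

end Matrices


/-! ### The success probability for most matrices -/

section Patterns

variable {n : ℕ}

/-- The sets of `b` columns that contain `p` elements of the support of `e`. -/
def patterns (e : Fin n → ZMod 2) (b p : ℕ) : Finset (Finset (Fin n)) :=
  Finset.univ.filter fun X => X.card = b ∧ (support e ∩ X).card = p

theorem card_pattern_subsets (A W : Finset (Fin n)) (hAW : A ⊆ W) (b p : ℕ) (hpb : p ≤ b) :
    (Finset.univ.filter fun X : Finset (Fin n) => X ⊆ W ∧ X.card = b ∧ (A ∩ X).card = p).card =
      A.card.choose p * (W.card - A.card).choose (b - p) := by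
  rw [← Finset.card_sdiff_of_subset hAW, ← Finset.card_powersetCard, ← Finset.card_powersetCard,
    ← Finset.card_product]
  refine Finset.card_bij' (fun X _ => (A ∩ X, X \ A)) (fun BC _ => BC.1 ∪ BC.2) ?_ ?_ ?_ ?_
  · intro X hX
    obtain ⟨-, h1, h2, h3⟩ := Finset.mem_filter.1 hX
    rw [Finset.mem_product, Finset.mem_powersetCard, Finset.mem_powersetCard]
    have h4 := Finset.card_sdiff_add_card_inter X A
    rw [Finset.inter_comm, h3, h2] at h4
    exact ⟨⟨Finset.inter_subset_left, h3⟩, Finset.sdiff_subset_sdiff h1 le_rfl, by simp only; omega⟩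
  · rintro ⟨B, C⟩ hBC
    rw [Finset.mem_product, Finset.mem_powersetCard, Finset.mem_powersetCard] at hBC
    obtain ⟨⟨h1, h2⟩, h3, h4⟩ := hBC
    simp only at h1 h2 h3 h4
    have hd : Disjoint A C := Finset.disjoint_left.2 fun x hx hx' =>
      (Finset.mem_sdiff.1 (h3 hx')).2 hx
    have hBCd : Disjoint B C := hd.mono_left h1
    refine Finset.mem_filter.2 ⟨Finset.mem_univ _, Finset.union_subset (h1.trans hAW)
      (h3.trans Finset.sdiff_subset), ?_, ?_⟩
    · rw [Finset.card_union_of_disjoint hBCd]; omega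
    · rw [Finset.inter_union_distrib_left, Finset.inter_eq_right.2 h1,
        Finset.disjoint_iff_inter_eq_empty.1 hd, Finset.union_empty, h2]
  · intro X _
    ext x
    by_cases hx : x ∈ A <;> simp [hx]
  · rintro ⟨B, C⟩ hBC
    rw [Finset.mem_product, Finset.mem_powersetCard, Finset.mem_powersetCard] at hBC
    obtain ⟨⟨h1, h2⟩, h3, h4⟩ := hBC
    simp only at h1 h3
    have hd : Disjoint A C := Finset.disjoint_left.2 fun x hx hx' =>
      (Finset.mem_sdiff.1 (h3 hx')).2 hx
    refine Prod.ext ?_ ?_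
    · simp only
      rw [Finset.inter_union_distrib_left, Finset.inter_eq_right.2 h1,
        Finset.disjoint_iff_inter_eq_empty.1 hd, Finset.union_empty]
    · simp only
      rw [Finset.union_sdiff_distrib, Finset.sdiff_eq_empty_iff_subset.2 h1, Finset.empty_union,
        Finset.sdiff_eq_self_of_disjoint hd.symm]

theorem card_patterns (e : Fin n → ZMod 2) (b p : ℕ) (hpb : p ≤ b) :
    (patterns e b p).card = (hammingNorm e).choose p * (n - hammingNorm e).choose (b - p) := by
  have h := card_pattern_subsets (support e) Finset.univ (Finset.subset_univ _) b p hpb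
  rw [Finset.card_univ, Fintype.card_fin, card_support] at h
  rw [← h, patterns]
  simp

/-- Every independent W above supp e contains the same number of patterns X. Hence the average of
the densities above X ∪ supp e is the density above supp e, with no randomness of the matrix
involved. -/
theorem sum_density_patterns {m : ℕ} (H : Matrix (Fin m) (Fin n) (ZMod 2)) (e : Fin n → ZMod 2)
    (b p ω : ℕ) (he : hammingNorm e = ω) (hp : p ≤ ω) (hpb : p ≤ b) (hw : b + (ω - p) ≤ m)
    (hmn : m ≤ n) : ∑ X ∈ patterns e b p, density H (X ∪ support e) m =
      (patterns e b p).card * density H (support e) m := by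
  classical
  have hcard : ∀ X ∈ patterns e b p, (X ∪ support e).card = b + (ω - p) := fun X hX =>
    card_union_support X e (Finset.mem_filter.1 hX).2.1 he (Finset.mem_filter.1 hX).2.2
  have h1 : ∑ X ∈ patterns e b p, (independentSupersets H (X ∪ support e) m).card =
      (independentSupersets H (support e) m).card * (ω.choose p * (m - ω).choose (b - p)) := by
    have e1 : ∀ X, independentSupersets H (X ∪ support e) m =
        (independentSupersets H (support e) m).filter fun W => X ⊆ W := by
      intro X
      ext W
      rw [Finset.mem_filter, mem_independentSupersets, mem_independentSupersets,
        Finset.union_subset_iff]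
      tauto
    simp only [e1, Finset.card_eq_sum_ones (Finset.filter _ _), Finset.sum_filter]
    rw [Finset.sum_comm, ← smul_eq_mul, ← Finset.sum_const]
    refine Finset.sum_congr rfl fun W hW => ?_
    obtain ⟨h2, h3, -⟩ := mem_independentSupersets.1 hW
    have h4 := card_pattern_subsets (support e) W h2 b p hpb
    rw [h3, card_support, he] at h4
    rw [← h4, ← Finset.sum_filter, ← Finset.card_eq_sum_ones, patterns, Finset.filter_filter]
    congr 1
    ext X
    simp only [Finset.mem_filter, Finset.mem_univ, true_and]
    tauto
  have h2 : ∑ X ∈ patterns e b p, density H (X ∪ support e) m =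
      (∑ X ∈ patterns e b p, (independentSupersets H (X ∪ support e) m).card : ℕ) /
        ((n - (b + (ω - p))).choose (m - (b + (ω - p))) : ℝ) := by
    rw [Nat.cast_sum, Finset.sum_div]
    refine Finset.sum_congr rfl fun X hX => ?_
    unfold density
    rw [hcard X hX]
  have hc1 : (0 : ℝ) < (n - (b + (ω - p))).choose (m - (b + (ω - p))) := by
    exact_mod_cast Nat.choose_pos (by omega)
  have hc2 := choose_supersets_pos (support e) hmn
  have h3 : ((n - ω).choose (m - ω) : ℝ) * (m - ω).choose (b - p) =
      (n - ω).choose (b - p) * (n - (b + (ω - p))).choose (m - (b + (ω - p))) := by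
    have e1 := Nat.choose_mul (n := n - ω) (k := m - ω) (s := b - p) (by omega)
    have e2 : n - ω - (b - p) = n - (b + (ω - p)) := by omega
    have e3 : m - ω - (b - p) = m - (b + (ω - p)) := by omega
    rw [e2, e3] at e1
    exact_mod_cast e1
  rw [card_support, he] at hc2
  rw [h2, h1, card_patterns e b p hpb, he]
  unfold density
  rw [card_support, he, div_eq_iff hc1.ne']
  push_cast
  field_simp
  linear_combination ((independentSupersets H (support e) m).card : ℝ) * (ω.choose p : ℝ) * h3

theorem support_injective : Function.Injective (support : (Fin n → ZMod 2) → Finset (Fin n)) := by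
  intro u v huv
  funext i
  have h1 : i ∈ support u ↔ i ∈ support v := by rw [huv]
  simp only [support, Finset.mem_filter, Finset.mem_univ, true_and] at h1
  revert h1
  generalize u i = x
  generalize v i = y
  revert x y
  decide

theorem card_partial_weight_le (X : Finset (Fin n)) (w : ℕ) :
    (Finset.univ.filter fun v : Fin n → ZMod 2 => (support v \ X).card = w).card ≤
      2 ^ X.card * (n - X.card).choose w := by
  have h1 : (X.powerset ×ˢ (Xᶜ).powersetCard w).card = 2 ^ X.card * (n - X.card).choose w := by
    rw [Finset.card_product, Finset.card_powerset, Finset.card_powersetCard, Finset.card_compl,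
      Fintype.card_fin]
  rw [← h1]
  refine Finset.card_le_card_of_injOn (fun v => (support v ∩ X, support v \ X)) ?_ ?_
  · intro v hv
    rw [Finset.mem_coe, Finset.mem_product, Finset.mem_powerset, Finset.mem_powersetCard]
    refine ⟨Finset.inter_subset_right, fun x hx => ?_, (Finset.mem_filter.1 hv).2⟩
    rw [Finset.mem_compl]
    exact (Finset.mem_sdiff.1 hx).2
  · intro u _ v _ huv
    obtain ⟨h1, h2⟩ := Prod.ext_iff.1 huv
    refine support_injective ?_
    rw [← Finset.sdiff_union_inter (support u) X, ← Finset.sdiff_union_inter (support v) X]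
    exact congrArg₂ _ h2 h1

/-- First moment: e itself always counts, and any other vector has the same syndrome with
probability 2^(-m). -/
theorem sum_card_partialSolutions_le {m : ℕ} (e : Fin n → ZMod 2) (X : Finset (Fin n)) (w : ℕ) :
    ∑ H : Matrix (Fin m) (Fin n) (ZMod 2),
      ((partialSolutions H (H.mulVec e) X w).card : ℝ) ≤
      (1 + 2 ^ X.card * (n - X.card).choose w / 2 ^ m) *
        Fintype.card (Matrix (Fin m) (Fin n) (ZMod 2)) := by
  classical
  set E := Finset.univ.filter fun v : Fin n → ZMod 2 => (support v \ X).card = w with hE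
  set N : ℝ := (Fintype.card (Matrix (Fin m) (Fin n) (ZMod 2)) : ℝ) with hN
  have h1 : ∑ H : Matrix (Fin m) (Fin n) (ZMod 2),
      ((partialSolutions H (H.mulVec e) X w).card : ℝ) =
      ∑ v ∈ E, ((Finset.univ.filter fun H : Matrix (Fin m) (Fin n) (ZMod 2) =>
        H.mulVec v = H.mulVec e).card : ℝ) := by
    have e1 : ∀ H : Matrix (Fin m) (Fin n) (ZMod 2), partialSolutions H (H.mulVec e) X w =
        E.filter fun v => H.mulVec v = H.mulVec e := by
      intro H
      ext v
      simp [partialSolutions, hE, and_comm]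
    simp only [e1, Finset.card_eq_sum_ones (Finset.filter _ _), Finset.sum_filter, Nat.cast_sum]
    exact Finset.sum_comm
  have h2 : ∀ v ∈ E, ((Finset.univ.filter fun H : Matrix (Fin m) (Fin n) (ZMod 2) =>
      H.mulVec v = H.mulVec e).card : ℝ) ≤ N / 2 ^ m + if v = e then N else 0 := by
    intro v _
    by_cases hv : v = e
    · subst hv
      simp [hN]
      positivity
    · rw [if_neg hv, add_zero, le_div_iff₀ (by positivity), hN,
        ← card_mulVec_eq (m := m) (v - e) (sub_ne_zero.2 hv) 0]
      push_cast
      refine mul_le_mul_of_nonneg_right (Nat.cast_le.2 (Finset.card_le_card fun H hH => ?_))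
        (by positivity)
      refine Finset.mem_filter.2 ⟨Finset.mem_univ _, ?_⟩
      rw [Matrix.mulVec_sub, (Finset.mem_filter.1 hH).2, sub_self]
  rw [h1]
  refine (Finset.sum_le_sum h2).trans ?_
  rw [Finset.sum_add_distrib, Finset.sum_const, nsmul_eq_mul]
  have h3 : (E.card : ℝ) ≤ 2 ^ X.card * (n - X.card).choose w := by
    exact_mod_cast card_partial_weight_le X w
  have h4 : ∑ v ∈ E, (if v = e then N else 0) ≤ N := by
    rw [Finset.sum_ite_eq']
    split_ifs
    · exact le_rfl
    · positivity
  have h5 : (E.card : ℝ) * (N / 2 ^ m) ≤ 2 ^ X.card * (n - X.card).choose w * (N / 2 ^ m) :=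
    mul_le_mul_of_nonneg_right h3 (by positivity)
  calc _ ≤ 2 ^ X.card * (n - X.card).choose w * (N / 2 ^ m) + N := add_le_add h5 h4
    _ = _ := by ring

/-- The expected number of partial solutions is at most 1 + S ≤ 2·max(1,S), because the b free
coordinates cancel b of the n-k equations; then Markov's inequality applies. -/
theorem card_many_partialSolutions_le (n k b : ℕ) (h : k + b ≤ n) (e : Fin n → ZMod 2)
    (X : Finset (Fin n)) (hX : X.card = b) (w : ℕ) (Θ : ℝ) (hΘ : 0 < Θ) :
    ((Finset.univ.filter fun H : Matrix (Fin (n - k)) (Fin n) (ZMod 2) =>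
      Θ * max 1 (expectedSolutions (n - k - b) k w) <
        (partialSolutions H (H.mulVec e) X w).card).card : ℝ) ≤
      2 / Θ * Fintype.card (Matrix (Fin (n - k)) (Fin n) (ZMod 2)) := by
  set S := expectedSolutions (n - k - b) k w with hS
  have h1 := card_ge_mul_le _ (fun H => by positivity) _ (Θ * max 1 S)
    (sum_card_partialSolutions_le (m := n - k) e X w)
    (fun H => Θ * max 1 S < (partialSolutions H (H.mulVec e) X w).card) (fun H hH => hH.le)
  have h2 : (2 : ℝ) ^ X.card * (n - X.card).choose w / 2 ^ (n - k) = S := by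
    rw [hS, expectedSolutions, hX]
    have e1 : n - k - b + k = n - b := by omega
    have e2 : n - k = (n - k - b) + b := by omega
    rw [e1, div_eq_div_iff (by positivity) (by positivity)]
    conv_rhs => rw [e2, pow_add]
    ring
  rw [h2] at h1
  have h3 : (1 : ℝ) ≤ max 1 S := le_max_left _ _
  have h4 : S ≤ max 1 S := le_max_right _ _
  set N : ℝ := (Fintype.card (Matrix (Fin (n - k)) (Fin n) (ZMod 2)) : ℝ) with hN
  have hN0 : 0 ≤ N := by positivity
  have h5 := h1.trans (mul_le_mul_of_nonneg_right (by linarith : 1 + S ≤ 2 * max 1 S) hN0)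
  rw [div_mul_eq_mul_div, le_div_iff₀ hΘ]
  refine le_of_mul_le_mul_right ?_ (by linarith : 0 < max 1 S)
  linarith

end Patterns

theorem one_le_density_self {m n : ℕ} {H : Matrix (Fin m) (Fin n) (ZMod 2)} {X : Finset (Fin n)}
    (hX : Independent H X) : 1 ≤ density H X X.card := by
  unfold density
  rw [Nat.sub_self, Nat.choose_zero_right, Nat.cast_one, div_one]
  exact_mod_cast Finset.card_pos.2 ⟨X, mem_independentSupersets.2 ⟨le_rfl, rfl, hX⟩⟩

theorem exists_independent_of_density_pos {m n : ℕ} {H : Matrix (Fin m) (Fin n) (ZMod 2)}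
    {X : Finset (Fin n)} {t : ℕ} (h : 0 < density H X t) : Independent H X := by
  have h1 : (independentSupersets H X t).Nonempty := by
    by_contra hne
    rw [Finset.not_nonempty_iff_eq_empty] at hne
    rw [density, hne] at h
    simp at h
  obtain ⟨W, hW⟩ := h1
  obtain ⟨h2, -, h3⟩ := mem_independentSupersets.1 hW
  exact h3.mono h2

open Classical in
/-- For most matrices, a round succeeds with almost the probability of the weight pattern. -/
theorem card_bad_matrices_le (n k b ω p : ℕ) (h : k + b ≤ n) (hn : 1 ≤ n) (hp : p ≤ ω)
    (hpb : p ≤ b) (hw : ω - p ≤ n - k - b) (e : Fin n → ZMod 2) (he : hammingNorm e = ω)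
    (d : ℕ) (ε : ℝ) (hε0 : 0 < ε) (hε1 : ε ≤ 1) (hεd : ε * n ≤ d) (s s' : ℕ)
    (hs : ω + s ≤ n - k) (Θ : ℝ) (hΘ : 1 ≤ Θ) (y : ℝ) (hy : y = ε ^ s / 2) :
    ((Finset.univ.filter fun H : Matrix (Fin (n - k)) (Fin n) (ZMod 2) =>
      ¬ (puncturedHybridRound n k b ω p h H (H.mulVec e)).res none ≤
        1 - ENNReal.ofReal (((ω.choose p * (n - ω).choose (b - p) : ℕ) : ℝ) / n.choose b *
          (y / 4) * (y / 2 * (ε ^ s' / 2) / (8 * Θ)))).card : ℝ) ≤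
      ((Finset.univ.filter fun H : Matrix (Fin (n - k)) (Fin n) (ZMod 2) =>
        ¬ DualDistance H d).card : ℝ) +
      (2 * (1 / 2) ^ s + 16 * (1 / 2) ^ s' / y + 16 / (Θ * y)) *
        Fintype.card (Matrix (Fin (n - k)) (Fin n) (ZMod 2)) := by
  set N : ℝ := (Fintype.card (Matrix (Fin (n - k)) (Fin n) (ZMod 2)) : ℝ) with hN
  have hy0 : 0 < y := by rw [hy]; positivity
  set pat := patterns e b p with hpat
  -- The condition on s' keeps n-k-s' at least |X| = b. If it fails, fewer than s' columns are
  -- missing and independence of X alone suffices.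
  set Bad₃ : Matrix (Fin (n - k)) (Fin n) (ZMod 2) → Finset (Fin n) → Prop := fun H X =>
    s' ≤ n - k - b ∧ density H X (n - k - s') < 1 / 2 with hBad₃
  set Bad₄ : Matrix (Fin (n - k)) (Fin n) (ZMod 2) → Finset (Fin n) → Prop := fun H X =>
    Θ * max 1 (expectedSolutions (n - k - b) k (ω - p)) <
      (partialSolutions H (H.mulVec e) X (ω - p)).card with hBad₄
  set E₁ := Finset.univ.filter fun H : Matrix (Fin (n - k)) (Fin n) (ZMod 2) => ¬ DualDistance H d
    with hE₁
  set E₂ := Finset.univ.filter fun H : Matrix (Fin (n - k)) (Fin n) (ZMod 2) =>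
    density H (support e) (n - k - s) < 1 / 2 with hE₂
  set E₃ := Finset.univ.filter fun H : Matrix (Fin (n - k)) (Fin n) (ZMod 2) =>
    y / 8 * pat.card < (pat.filter (Bad₃ H)).card with hE₃
  set E₄ := Finset.univ.filter fun H : Matrix (Fin (n - k)) (Fin n) (ZMod 2) =>
    y / 8 * pat.card < (pat.filter (Bad₄ H)).card with hE₄
  have c2 : (E₂.card : ℝ) ≤ 2 * (1 / 2) ^ s * N :=
    card_density_lt_half_le (support e) (n - k - s) s (by rw [card_support]; omega) (by omega)
      (by omega)
  have c3 : (E₃.card : ℝ) ≤ 16 * (1 / 2) ^ s' / y * N := by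
    have := card_many_bad_mul_le pat Bad₃ (2 * (1 / 2) ^ s') (y / 8) (by positivity) (by
      intro X hX
      obtain ⟨h1, -⟩ := (Finset.mem_filter.1 hX).2
      by_cases hs' : s' ≤ n - k - b
      · refine le_trans ?_ (card_density_lt_half_le X (n - k - s') s' (by omega) (by omega)
          (by omega))
        refine Nat.cast_le.2 (Finset.card_le_card fun H hH => ?_)
        exact Finset.mem_filter.2 ⟨Finset.mem_univ _, (Finset.mem_filter.1 hH).2.2⟩
      · have : (Finset.univ.filter fun H => Bad₃ H X) = ∅ :=
          Finset.filter_eq_empty_iff.2 fun H _ hH => hs' hH.1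
        rw [this, Finset.card_empty, Nat.cast_zero]
        positivity)
    rw [div_mul_eq_mul_div, le_div_iff₀ hy0]
    linarith
  have c4 : (E₄.card : ℝ) ≤ 16 / (Θ * y) * N := by
    have := card_many_bad_mul_le pat Bad₄ (2 / Θ) (y / 8) (by positivity) (by
      intro X hX
      convert card_many_partialSolutions_le n k b h e X (Finset.mem_filter.1 hX).2.1 (ω - p) Θ
        (by linarith))
    have e1 : 16 / (Θ * y) * N = 8 * (2 / Θ * N) / y := by field_simp; ring
    rw [e1, le_div_iff₀ hy0]
    linarith
  have hsub : (Finset.univ.filter fun H : Matrix (Fin (n - k)) (Fin n) (ZMod 2) =>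
      ¬ (puncturedHybridRound n k b ω p h H (H.mulVec e)).res none ≤
        1 - ENNReal.ofReal (((ω.choose p * (n - ω).choose (b - p) : ℕ) : ℝ) / n.choose b *
          (y / 4) * (y / 2 * (ε ^ s' / 2) / (8 * Θ)))) ⊆ E₁ ∪ (E₂ ∪ (E₃ ∪ E₄)) := by
    intro H hH
    by_contra hnot
    simp only [Finset.mem_union, not_or] at hnot
    obtain ⟨n1, n2, n3, n4⟩ := hnot
    have hd : DualDistance H d := by
      by_contra hd
      exact n1 (Finset.mem_filter.2 ⟨Finset.mem_univ _, hd⟩)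
    have g2 : 1 / 2 ≤ density H (support e) (n - k - s) := by
      by_contra hd
      exact n2 (Finset.mem_filter.2 ⟨Finset.mem_univ _, not_le.1 hd⟩)
    have g3 : ((pat.filter (Bad₃ H)).card : ℝ) ≤ y / 8 * pat.card := by
      by_contra hd
      exact n3 (Finset.mem_filter.2 ⟨Finset.mem_univ _, not_le.1 hd⟩)
    have g4 : ((pat.filter (Bad₄ H)).card : ℝ) ≤ y / 8 * pat.card := by
      by_contra hd
      exact n4 (Finset.mem_filter.2 ⟨Finset.mem_univ _, not_le.1 hd⟩)
    refine (Finset.mem_filter.1 hH).2 ?_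
    -- The density is at least 1/2 at size n-k-s, and the dual distance carries it over the last s
    -- columns at the cost ε^s.
    have hdens : y ≤ density H (support e) (n - k) := by
      have := density_add H d ε hε0.le hεd hd (support e) (n - k - s) s
        (by rw [card_support]; omega) (by omega) (by omega)
      rw [show n - k - s + s = n - k by omega] at this
      rw [hy]
      have hp := pow_pos hε0 s
      nlinarith
    set good := pat.filter fun X => y / 2 ≤ density H (X ∪ support e) (n - k) with hgood
    -- Densities are at most 1 and average at least y, so at least a fraction y/2 of the patterns
    -- have density at least y/2.
    have hgoodcard : y / 2 * pat.card ≤ good.card := by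
      have h1 := sum_density_patterns H e b p ω he hp hpb (by omega) (by omega)
      have h2 : ∀ X ∈ pat, density H (X ∪ support e) (n - k) ≤
          y / 2 + if y / 2 ≤ density H (X ∪ support e) (n - k) then 1 else 0 := by
        intro X hX
        obtain ⟨h3, h4⟩ := (Finset.mem_filter.1 hX).2
        split_ifs with hc
        · have := density_le_one H (X ∪ support e) (n - k)
            (by rw [card_union_support X e h3 he h4]; omega) (by omega)
          linarith
        · linarith
      have h3 := Finset.sum_le_sum h2
      rw [h1, Finset.sum_add_distrib, Finset.sum_const, nsmul_eq_mul, ← Finset.sum_filter,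
        Finset.sum_const, nsmul_eq_mul, mul_one] at h3
      have h4 : (pat.card : ℝ) * y ≤ pat.card * density H (support e) (n - k) :=
        mul_le_mul_of_nonneg_left hdens (by positivity)
      linarith
    set A := good \ (pat.filter (Bad₃ H) ∪ pat.filter (Bad₄ H)) with hA
    -- The two kinds of bad patterns take at most y/8 each from the fraction y/2.
    have hAcard : y / 4 * pat.card ≤ A.card := by
      have h1 : good.card ≤ A.card + ((pat.filter (Bad₃ H)).card + (pat.filter (Bad₄ H)).card) := by
        have := Finset.le_card_sdiff (pat.filter (Bad₃ H) ∪ pat.filter (Bad₄ H)) good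
        have h5 := Finset.card_union_le (pat.filter (Bad₃ H)) (pat.filter (Bad₄ H))
        rw [← hA] at this
        omega
      have h2 : (good.card : ℝ) ≤
          A.card + ((pat.filter (Bad₃ H)).card + (pat.filter (Bad₄ H)).card) := by
        exact_mod_cast h1
      linarith
    have hfin := res_round_none_le_of_sets n k b ω p h hn hp hw H e he Θ (y / 2) (ε ^ s' / 2) hΘ
      (by positivity) A (by
        intro X hX
        obtain ⟨h1, h2⟩ := Finset.mem_sdiff.1 hX
        obtain ⟨h3, h4⟩ := Finset.mem_filter.1 h1
        obtain ⟨h5, h6⟩ := (Finset.mem_filter.1 h3).2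
        have h7 : ¬ Bad₃ H X := fun hb =>
          h2 (Finset.mem_union_left _ (Finset.mem_filter.2 ⟨h3, hb⟩))
        have h8 : ¬ Bad₄ H X := fun hb =>
          h2 (Finset.mem_union_right _ (Finset.mem_filter.2 ⟨h3, hb⟩))
        refine ⟨h5, h6, not_lt.1 h8, h4, ?_⟩
        by_cases hs' : s' ≤ n - k - b
        · have h9 : 1 / 2 ≤ density H X (n - k - s') := by
            by_contra hlt
            exact h7 ⟨hs', not_le.1 hlt⟩
          have := density_add H d ε hε0.le hεd hd X (n - k - s') s' (by omega) (by omega) (by omega)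
          rw [show n - k - s' + s' = n - k by omega] at this
          have hp := pow_pos hε0 s'
          nlinarith
        -- Positive density above X ∪ supp e exhibits an independent superset of X. From X itself,
        -- of density 1 at size b, fewer than s' extensions lead to size n-k.
        · have h9 : Independent H X := (exists_independent_of_density_pos
            (lt_of_lt_of_le (by positivity) h4)).mono Finset.subset_union_left
          have h10 := one_le_density_self h9
          rw [h5] at h10
          have := density_add H d ε hε0.le hεd hd X b (n - k - b) (by omega) (by omega) (by omega)
          rw [show b + (n - k - b) = n - k by omega] at this
          have hp := pow_pos hε0 (n - k - b)
          have hp' := pow_pos hε0 s'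
          have hle : ε ^ s' ≤ ε ^ (n - k - b) := pow_le_pow_of_le_one hε0.le hε1 (by omega)
          nlinarith)
    refine hfin.trans (tsub_le_tsub_left (ENNReal.ofReal_le_ofReal ?_) _)
    refine mul_le_mul_of_nonneg_right ?_ (by positivity)
    rw [← he, ← card_patterns e b p hpb, div_mul_eq_mul_div, mul_comm]
    exact div_le_div_of_nonneg_right hAcard (by positivity)
  have hcard : ((Finset.univ.filter fun H : Matrix (Fin (n - k)) (Fin n) (ZMod 2) =>
      ¬ (puncturedHybridRound n k b ω p h H (H.mulVec e)).res none ≤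
        1 - ENNReal.ofReal (((ω.choose p * (n - ω).choose (b - p) : ℕ) : ℝ) / n.choose b *
          (y / 4) * (y / 2 * (ε ^ s' / 2) / (8 * Θ)))).card : ℝ) ≤
      E₁.card + (E₂.card + (E₃.card + E₄.card)) := by
    have h1 := Finset.card_le_card hsub
    have h2 := Finset.card_union_le E₁ (E₂ ∪ (E₃ ∪ E₄))
    have h3 := Finset.card_union_le E₂ (E₃ ∪ E₄)
    have h4 := Finset.card_union_le E₃ E₄
    exact_mod_cast h1.trans (h2.trans (by omega))
  refine hcard.trans ?_
  rw [add_mul, add_mul]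
  linarith


/-! ### Asymptotics of binomial coefficients -/

/-- A crude Stirling formula by induction, with logarithmic error. In terms of `negMulLog` it also
holds at m = 0. -/
theorem log_factorial_bounds (m : ℕ) : -Real.negMulLog m - m ≤ Real.log m.factorial ∧
    Real.log m.factorial ≤ -Real.negMulLog m - m + 1 + 2 * Real.log (m + 1) := by
  induction m with
  | zero => simp
  | succ m ih =>
    obtain ⟨h1, h2⟩ := ih
    have hf : Real.log ((m + 1).factorial : ℝ) = Real.log (m + 1) + Real.log m.factorial := by
      rw [Nat.factorial_succ, Nat.cast_mul, Real.log_mul (by positivity) (by positivity)]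
      push_cast; rfl
    rw [hf]
    unfold Real.negMulLog at h1 h2 ⊢
    push_cast
    have hm1 : (0 : ℝ) < (m : ℝ) + 1 := by positivity
    have h3 : 1 / ((m : ℝ) + 2) ≤ Real.log (m + 1 + 1) - Real.log (m + 1) := by
      rw [← Real.log_div (by positivity) (by positivity)]
      refine le_trans (le_of_eq ?_) (Real.one_sub_inv_le_log_of_pos (by positivity))
      field_simp; ring
    rcases Nat.eq_zero_or_pos m with rfl | hm
    · norm_num at *
      have := Real.log_two_gt_d9
      linarith
    have hmr : (0 : ℝ) < m := by exact_mod_cast hm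
    have h4 : Real.log (m + 1) - Real.log m ≤ 1 / m := by
      rw [← Real.log_div (by positivity) (by positivity)]
      refine (Real.log_le_sub_one_of_pos (by positivity)).trans (le_of_eq ?_)
      field_simp; ring
    have h5 : 1 / ((m : ℝ) + 1) ≤ Real.log (m + 1) - Real.log m := by
      rw [← Real.log_div (by positivity) (by positivity)]
      refine le_trans (le_of_eq ?_) (Real.one_sub_inv_le_log_of_pos (by positivity))
      field_simp; ring
    have h6 : m * (Real.log (m + 1) - Real.log m) ≤ 1 := by
      have := mul_le_mul_of_nonneg_left h4 hmr.le
      rwa [mul_one_div_cancel hmr.ne'] at this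
    have h7 : 1 - 1 / ((m : ℝ) + 1) ≤ m * (Real.log (m + 1) - Real.log m) := by
      have := mul_le_mul_of_nonneg_left h5 hmr.le
      refine le_trans (le_of_eq ?_) this
      field_simp; ring
    have h8 : 1 / ((m : ℝ) + 1) ≤ 2 * (1 / ((m : ℝ) + 2)) := by
      rw [← mul_div_assoc, mul_one, div_le_div_iff₀ hm1 (by positivity)]
      linarith
    constructor <;> linarith

/-- Bounded rounding errors in the argument cost only O(log X), uniformly down to 0, although x·log
x has an unbounded derivative there. -/
theorem abs_negMulLog_sub_le {X u v : ℝ} (hX : 1 ≤ X) (hu0 : 0 ≤ u) (hv0 : 0 ≤ v) (hu : u ≤ X)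
    (hv : v ≤ X) (D : ℝ) (huv : |u - v| ≤ D) :
    |Real.negMulLog u - Real.negMulLog v| ≤ (1 + D) * (1 + Real.log X) := by
  have hlX : 0 ≤ Real.log X := Real.log_nonneg hX
  wlog h : v ≤ u generalizing u v with H
  · rw [abs_sub_comm]
    exact H hv0 hu0 hv hu (by rwa [abs_sub_comm]) (le_of_not_ge h)
  have hd : 0 ≤ u - v := by linarith
  rw [abs_of_nonneg hd] at huv
  have hD : 0 ≤ D := by linarith
  rcases hv0.lt_or_eq with hvp | rfl
  · have hup : 0 < u := lt_of_lt_of_le hvp h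
    have hlog : Real.log u ≤ Real.log X := Real.log_le_log hup hu
    have h1 : v * (Real.log u - Real.log v) ≤ u - v := by
      rw [← Real.log_div hup.ne' hvp.ne']
      have := mul_le_mul_of_nonneg_left (Real.log_le_sub_one_of_pos (div_pos hup hvp)) hv0
      refine this.trans (le_of_eq ?_)
      field_simp
    have h2 : 0 ≤ v * (Real.log u - Real.log v) :=
      mul_nonneg hv0 (sub_nonneg.2 (Real.log_le_log hvp h))
    have h3 : (u - v) * Real.log u ≤ D * Real.log X :=
      (mul_le_mul_of_nonneg_left hlog hd).trans (mul_le_mul_of_nonneg_right huv hlX)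
    have h4 : -1 ≤ (u - v) * Real.log u := by
      have h5 : 1 - u⁻¹ ≤ Real.log u := Real.one_sub_inv_le_log_of_pos hup
      have h6 := mul_le_mul_of_nonneg_left h5 hd
      have h7 : (u - v) * u⁻¹ ≤ 1 := by
        rw [← div_eq_mul_inv, div_le_one hup]; linarith
      nlinarith
    unfold Real.negMulLog
    rw [abs_le]
    constructor <;> nlinarith [mul_nonneg hD hlX]
  · rw [Real.negMulLog_zero, sub_zero]
    rcases hu0.lt_or_eq with hup | rfl
    · have hlog : Real.log u ≤ Real.log X := Real.log_le_log hup hu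
      have h5 : 1 - u⁻¹ ≤ Real.log u := Real.one_sub_inv_le_log_of_pos hup
      have h6 := mul_le_mul_of_nonneg_left h5 hup.le
      rw [mul_sub, mul_inv_cancel₀ hup.ne'] at h6
      have h3 : u * Real.log u ≤ D * Real.log X :=
        (mul_le_mul_of_nonneg_left hlog hup.le).trans
          (mul_le_mul_of_nonneg_right (by linarith) hlX)
      unfold Real.negMulLog
      rw [abs_le]
      constructor <;> nlinarith [mul_nonneg hD hlX]
    · rw [Real.negMulLog_zero, abs_zero]; positivity

/-- The homogeneous form of the entropy. At x = 0 both sides vanish, in accordance with the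
convention 0·H(0/0) = 0. -/
theorem mul_binEntropy_div {x y : ℝ} (hy : 0 ≤ y) (hyx : y ≤ x) : x * Real.binEntropy (y / x) =
    Real.negMulLog y + Real.negMulLog (x - y) - Real.negMulLog x := by
  rcases (hy.trans hyx).lt_or_eq with hx | rfl
  · rw [Real.binEntropy_eq_negMulLog_add_negMulLog_one_sub]
    have key : ∀ z : ℝ, x * Real.negMulLog (z / x) = Real.negMulLog z + z * Real.log x := by
      intro z
      rcases eq_or_ne z 0 with rfl | hz
      · simp
      · unfold Real.negMulLog
        rw [Real.log_div hz hx.ne']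
        field_simp
        ring
    have e : 1 - y / x = (x - y) / x := by field_simp
    rw [mul_add, key, e, key]
    unfold Real.negMulLog
    ring
  · have : y = 0 := le_antisymm hyx hy
    simp [this]

/-- Stirling applied to three factorials, then the rounding errors. The tolerance 5 covers every
binomial that occurs, and the errors sum to at most 6 + 6 + 6 + 11 = 29 multiples of 1 + log n. -/
theorem log_choose_near {n x y : ℕ} (hn : 1 ≤ n) (hyx : y ≤ x) (hxn : x ≤ n) {ξ η : ℝ}
    (hη : 0 ≤ η) (hηξ : η ≤ ξ) (hξ : ξ ≤ 1) (hx : |(x : ℝ) - ξ * n| ≤ 5)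
    (hy : |(y : ℝ) - η * n| ≤ 5) :
    |Real.log (x.choose y) - n * (ξ * Real.binEntropy (η / ξ))| ≤ 35 * (1 + Real.log n) := by
  have hnr : (1 : ℝ) ≤ n := by exact_mod_cast hn
  have hn0 : (0 : ℝ) < n := by linarith
  have hL : 0 ≤ Real.log n := Real.log_nonneg hnr
  have hlog : ∀ z : ℕ, z ≤ n → Real.log ((z : ℝ) + 1) ≤ 1 + Real.log n := by
    intro z hz
    have hz' : (z : ℝ) ≤ n := by exact_mod_cast hz
    calc Real.log ((z : ℝ) + 1) ≤ Real.log (2 * n) := Real.log_le_log (by positivity) (by linarith)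
      _ = Real.log 2 + Real.log n := Real.log_mul (by norm_num) hn0.ne'
      _ ≤ _ := by linarith [Real.log_two_lt_d9]
  have hc : Real.log (x.choose y) = Real.log x.factorial - Real.log y.factorial -
      Real.log (x - y).factorial := by
    rw [Nat.choose_eq_factorial_div_factorial hyx, Nat.cast_div
      (Nat.factorial_mul_factorial_dvd_factorial hyx) (by positivity), Nat.cast_mul,
      Real.log_div (by positivity) (by positivity), Real.log_mul (by positivity) (by positivity)]
    ring
  have hs : ((x - y : ℕ) : ℝ) = x - y := by rw [Nat.cast_sub hyx]
  have hyx' : (y : ℝ) ≤ x := by exact_mod_cast hyx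
  have hxn' : (x : ℝ) ≤ n := by exact_mod_cast hxn
  obtain ⟨a1, a2⟩ := log_factorial_bounds x
  obtain ⟨b1, b2⟩ := log_factorial_bounds y
  obtain ⟨c1, c2⟩ := log_factorial_bounds (x - y)
  have l1 := hlog x hxn
  have l2 := hlog y (hyx.trans hxn)
  have l3 := hlog (x - y) ((Nat.sub_le _ _).trans hxn)
  have hξn : ξ * n ≤ n := mul_le_of_le_one_left hn0.le hξ
  have hηn : η * n ≤ ξ * n := mul_le_mul_of_nonneg_right hηξ hn0.le
  have hη0 : 0 ≤ η * n := by positivity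
  have d1 := abs_le.1 (abs_negMulLog_sub_le hnr (Nat.cast_nonneg x) (hη0.trans hηn) hxn' hξn 5 hx)
  have d2 := abs_le.1 (abs_negMulLog_sub_le hnr (Nat.cast_nonneg y) hη0 (hyx'.trans hxn')
    (hηn.trans hξn) 5 hy)
  have d3 := abs_le.1 (abs_negMulLog_sub_le hnr (Nat.cast_nonneg (x - y)) (sub_nonneg.2 hηn)
    (by rw [hs]; linarith [Nat.cast_nonneg (α := ℝ) y]) (by linarith) 10 (by
      rw [hs]
      have e : (x : ℝ) - y - (ξ * n - η * n) = (x - ξ * n) - (y - η * n) := by ring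
      rw [e]
      exact (abs_sub _ _).trans (by linarith)))
  have hF : n * (ξ * Real.binEntropy (η / ξ)) = Real.negMulLog (η * n) +
      Real.negMulLog (ξ * n - η * n) - Real.negMulLog (ξ * n) := by
    rw [← mul_binEntropy_div hη0 hηn, mul_div_mul_right _ _ hn0.ne']
    ring
  rw [hF, hc, abs_le]
  rw [hs] at c1 c2 d3 l3
  constructor <;> linarith [d1.1, d1.2, d2.1, d2.2, d3.1, d3.2]

/-! ### The exponents -/

theorem mul_entropy (x y : ℝ) : x * entropy (y / x) * Real.log 2 = x * Real.binEntropy (y / x) := by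
  unfold entropy
  have := Real.log_pos one_lt_two
  field_simp

theorem entropy_mul_log_two (x : ℝ) : entropy x * Real.log 2 = Real.binEntropy x := by
  unfold entropy
  have := Real.log_pos one_lt_two
  field_simp

/-- The exponent of the classical algorithm is positive. -/
theorem classical_exponent_pos {τ R : ℝ} (hR : 0 < R) (hτ : 0 < τ) (hτR : τ < 1 - R) :
    0 < entropy τ - (1 - R) * entropy (τ / (1 - R)) := by
  have h1R : 0 < 1 - R := by linarith
  have h := Real.strictConcave_binEntropy.2 (x := τ / (1 - R)) (y := 0)
    ⟨by positivity, (div_le_one h1R).2 hτR.le⟩ ⟨le_rfl, zero_le_one⟩ (by positivity) h1R hR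
    (by ring)
  simp only [smul_eq_mul, Real.binEntropy_zero, mul_zero, add_zero, mul_div_cancel₀ _ h1R.ne'] at h
  have hl := Real.log_pos one_lt_two
  unfold entropy
  rw [← mul_div_assoc, ← sub_div]
  exact div_pos (by linarith) hl

/-- The exponent of the success probability of a random permutation. -/
theorem pattern_exponent {τ β ρ : ℝ} (hρ0 : 0 ≤ ρ) (hρβ : ρ ≤ β) (hρτ : ρ ≤ τ)
    (h : τ - ρ ≤ 1 - β) (hτ : τ ≤ 1) (hβ : β ≤ 1) :
    1 * Real.binEntropy (β / 1) - τ * Real.binEntropy (ρ / τ) -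
        (1 - τ) * Real.binEntropy ((β - ρ) / (1 - τ)) =
      1 * Real.binEntropy (τ / 1) - β * Real.binEntropy (ρ / β) -
        (1 - β) * Real.binEntropy ((τ - ρ) / (1 - β)) := by
  rw [mul_binEntropy_div (by linarith) hβ, mul_binEntropy_div hρ0 hρτ,
    mul_binEntropy_div (by linarith) (by linarith), mul_binEntropy_div (by linarith) hτ,
    mul_binEntropy_div hρ0 hρβ, mul_binEntropy_div (by linarith) (by linarith)]
  have e : 1 - τ - (β - ρ) = 1 - β - (τ - ρ) := by ring
  rw [e]
  ring

/-- For S ≥ 1 the squared amplitude is C(a,w)/2^a, and otherwise C(a,w)/C(a+k,w). -/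
theorem goodAmplitude_le_one (a k w : ℕ) : goodAmplitude a k w ≤ 1 := by
  unfold goodAmplitude
  refine Real.sqrt_le_one.2 ?_
  rcases Nat.eq_zero_or_pos ((a + k).choose w) with h0 | h0
  · simp [h0]
  have h1 : (0 : ℝ) < (a + k).choose w := by exact_mod_cast h0
  have h2 : ((a.choose w : ℕ) : ℝ) ≤ (a + k).choose w := by
    exact_mod_cast Nat.choose_le_choose w (Nat.le_add_right a k)
  have h3 : ((a.choose w : ℕ) : ℝ) ≤ 2 ^ a := by exact_mod_cast Nat.choose_le_two_pow a w
  rcases max_cases 1 (expectedSolutions a k w) with ⟨h, -⟩ | ⟨h, -⟩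
  · rw [h, one_mul]
    exact (div_le_one h1).2 h2
  · rw [h, expectedSolutions, div_mul_div_comm, mul_comm, mul_div_mul_right _ _ h1.ne']
    exact (div_le_one (by positivity)).2 h3

/-- The time of a round, in terms of the logarithms of binomial coefficients. -/
theorem log_max_div_goodAmplitude (a k w : ℕ) (hw : w ≤ a) :
    Real.log (max 1 (expectedSolutions a k w) / goodAmplitude a k w) =
      (max 0 (Real.log ((a + k).choose w) - a * Real.log 2) + Real.log ((a + k).choose w) -
        Real.log (a.choose w)) / 2 := by
  have h1 : (0 : ℝ) < (a + k).choose w := by exact_mod_cast Nat.choose_pos (by omega)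
  have h2 : (0 : ℝ) < a.choose w := by exact_mod_cast Nat.choose_pos hw
  have hm : 0 < max 1 (expectedSolutions a k w) := lt_max_of_lt_left one_pos
  have hS : 0 < expectedSolutions a k w := expectedSolutions_pos a k w hw
  have hlm : Real.log (max 1 (expectedSolutions a k w)) =
      max 0 (Real.log ((a + k).choose w) - a * Real.log 2) := by
    have e : Real.log (expectedSolutions a k w) =
        Real.log ((a + k).choose w) - a * Real.log 2 := by
      unfold expectedSolutions
      rw [Real.log_div h1.ne' (by positivity), Real.log_pow]
    rw [← e]
    rcases le_total 1 (expectedSolutions a k w) with h | h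
    · rw [max_eq_right h, max_eq_right (Real.log_nonneg h)]
    · rw [max_eq_left h, Real.log_one, max_eq_left (Real.log_nonpos hS.le h)]
  rw [Real.log_div hm.ne' (goodAmplitude_pos w hw).ne', goodAmplitude, Real.log_sqrt
    (by positivity), Real.log_mul hm.ne' (by positivity), Real.log_div h2.ne' h1.ne', hlm]
  ring

theorem quantumSolveBound_le {n a k M : ℕ} (hn : 1 ≤ n) (hak : a + k ≤ n) (hM : 1 ≤ M) :
    quantumSolveBound a k M ≤ 6000 * (M * n ^ 4) := by
  have ha : a ≤ n := by omega
  have hk : k ≤ n := by omega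
  have h1 : n ≤ n ^ 4 := Nat.le_self_pow (by norm_num) n
  have h2 : n ^ 2 ≤ n ^ 4 := Nat.pow_le_pow_right hn (by norm_num)
  have h3 : n ^ 3 ≤ n ^ 4 := Nat.pow_le_pow_right hn (by norm_num)
  have h0 : 1 ≤ n ^ 4 := Nat.one_le_pow _ _ hn
  have hMn : n ^ 4 ≤ M * n ^ 4 := Nat.le_mul_of_pos_left _ hM
  have hMM : M ≤ M * n ^ 4 := Nat.le_mul_of_pos_right _ h0
  have e1 : 322 * M * (a + k + 1) ^ 4 ≤ 5152 * (M * n ^ 4) := by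
    calc 322 * M * (a + k + 1) ^ 4 ≤ 322 * M * (2 * n) ^ 4 := by gcongr; omega
      _ = _ := by ring
  have e2 : a * k ≤ n ^ 2 := by
    calc a * k ≤ n * n := Nat.mul_le_mul ha hk
      _ = _ := by ring
  have e3 : a * (a + 2 * (a + k + 1) + a * (a + k + 1)) ≤ 7 * n ^ 3 := by
    calc a * (a + 2 * (a + k + 1) + a * (a + k + 1)) ≤ n * (n + 2 * (2 * n) + n * (2 * n)) := by
          gcongr <;> omega
      _ = 5 * n ^ 2 + 2 * n ^ 3 := by ring
      _ ≤ _ := by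
          have : n ^ 2 ≤ n ^ 3 := Nat.pow_le_pow_right hn (by norm_num)
          omega
  unfold quantumSolveBound
  omega

/-- At most n⌈S⌉ runs with O(1/g) iterations of O(n⁴) gates each. As max(1,S) ≥ 1 and g ≤ 1,
rounding up costs only constants. -/
theorem roundBound_le {n k b ω p : ℕ} (h : k + b ≤ n) (hn : 1 ≤ n) (hw : ω - p ≤ n - k - b) :
    (roundBound n k b ω p : ℝ) ≤ 50000 * (n : ℝ) ^ 5 *
      (max 1 (expectedSolutions (n - k - b) k (ω - p)) /
        goodAmplitude (n - k - b) k (ω - p)) := by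
  set S := expectedSolutions (n - k - b) k (ω - p) with hS
  set g := goodAmplitude (n - k - b) k (ω - p) with hg
  have hg0 : 0 < g := goodAmplitude_pos (ω - p) hw
  have hg1 : g ≤ 1 := goodAmplitude_le_one _ _ _
  have hS0 : 0 < S := expectedSolutions_pos _ _ _ hw
  set M := ⌈Real.pi / (4 * g)⌉₊ + 1 with hM
  set c := ⌈S⌉₊ with hc
  have hM1 : 1 ≤ M := by omega
  have hc1 : 1 ≤ c := Nat.one_le_iff_ne_zero.2 (Nat.ceil_pos.2 hS0).ne'
  have hnat : roundBound n k b ω p ≤ 7000 * (n ^ 5 * (c * M)) := by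
    have hq := quantumSolveBound_le (a := n - k - b) (k := k) hn (by omega) hM1
    have hr : n - k - b + b ≤ n := by omega
    have h0 : 1 ≤ c * M := Nat.mul_pos hc1 hM1
    have h5 : n ^ 5 ≤ n ^ 5 * (c * M) := Nat.le_mul_of_pos_right _ h0
    have p1 : n ^ 2 ≤ n ^ 5 := Nat.pow_le_pow_right hn (by norm_num)
    have p2 : n ^ 3 ≤ n ^ 5 := Nat.pow_le_pow_right hn (by norm_num)
    have p0 : 1 ≤ n ^ 5 := Nat.one_le_pow _ _ hn
    have e1 : Nat.log 2 n.factorial ≤ n ^ 2 := by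
      calc Nat.log 2 n.factorial ≤ Nat.log 2 (2 ^ (n ^ 2)) := by
            refine Nat.log_mono_right ((Nat.factorial_le_pow n).trans ?_)
            rw [pow_two, pow_mul]
            exact Nat.pow_le_pow_left Nat.lt_two_pow_self.le n
        _ = n ^ 2 := Nat.log_pow (by norm_num) _
    have e2 : (n - k - b + b) * ((n - k - b + b) + 2 * (n - k - b + b + k + 1) +
        (n - k - b + b) * (n - k - b + b + k + 1)) ≤ 7 * n ^ 3 := by
      calc _ ≤ n * (n + 2 * (2 * n) + n * (2 * n)) := by gcongr <;> omega
        _ = 5 * n ^ 2 + 2 * n ^ 3 := by ring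
        _ ≤ _ := by
          have : n ^ 2 ≤ n ^ 3 := Nat.pow_le_pow_right hn (by norm_num)
          omega
    have e3 : n * c * (quantumSolveBound (n - k - b) k M + 2 * n * n) ≤
        6002 * (n ^ 5 * (c * M)) := by
      calc _ ≤ n * c * (6000 * (M * n ^ 4) + 2 * (M * n ^ 4)) := by
            refine Nat.mul_le_mul_left _ (Nat.add_le_add hq ?_)
            calc 2 * n * n = 2 * n ^ 2 := by ring
              _ ≤ 2 * (M * n ^ 4) := by
                have h2 : n ^ 2 ≤ n ^ 4 := Nat.pow_le_pow_right hn (by norm_num)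
                have h3 : n ^ 4 ≤ M * n ^ 4 := Nat.le_mul_of_pos_left _ hM1
                omega
        _ = _ := by ring
    have e4 : n * n = n ^ 2 := by ring
    have e5 : 2 * n * n = 2 * n ^ 2 := by ring
    unfold roundBound
    rw [← hS, ← hg, ← hM, ← hc]
    rw [e5] at e3 ⊢
    rw [e4]
    omega
  have hcr : (c : ℝ) ≤ 2 * max 1 S := by
    have := (Nat.ceil_lt_add_one hS0.le).le
    have h1 : (1 : ℝ) ≤ max 1 S := le_max_left _ _
    have h2 : S ≤ max 1 S := le_max_right _ _
    linarith
  have hMr : (M : ℝ) ≤ 3 / g := by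
    have h1 := (Nat.ceil_lt_add_one (a := Real.pi / (4 * g)) (by positivity)).le
    have h2 : Real.pi / (4 * g) ≤ 1 / g := by
      rw [div_le_div_iff₀ (by positivity) hg0]
      nlinarith [Real.pi_le_four]
    have h3 : 1 ≤ 1 / g := (one_le_div hg0).2 hg1
    rw [hM]
    push_cast
    have e : 3 / g = 1 / g + 1 / g + 1 / g := by ring
    linarith
  calc (roundBound n k b ω p : ℝ) ≤ 7000 * ((n : ℝ) ^ 5 * (c * M)) := by exact_mod_cast hnat
    _ ≤ 7000 * ((n : ℝ) ^ 5 * ((2 * max 1 S) * (3 / g))) := by gcongr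
    _ = 42000 * ((n : ℝ) ^ 5 * (max 1 S / g)) := by ring
    _ ≤ 50000 * ((n : ℝ) ^ 5 * (max 1 S / g)) := by
        refine mul_le_mul_of_nonneg_right (by norm_num) ?_
        have : 0 < max 1 S := lt_max_of_lt_left one_pos
        positivity
    _ = _ := by ring


/-! ### Admissible parameters -/

/-- The parameters of the algorithm for the given constants. -/
structure Admissible (τ R ρ δ : ℝ) (n k ω p b : ℕ) : Prop where
  kb : k + b ≤ n
  n_pos : 1 ≤ n
  k_near : |(k : ℝ) - R * n| ≤ 1
  ω_near : |(ω : ℝ) - τ * n| ≤ 1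
  p_near : |(p : ℝ) - ρ * n| ≤ 1
  b_eq : b = ⌈(1 - δ) * ((n : ℝ) - k)⌉₊
  p_le_ω : p ≤ ω
  p_le_b : p ≤ b
  w_le : ω - p ≤ n - k - b

section

variable {τ R ρ δ : ℝ} {n k ω p b : ℕ}

theorem Admissible.b_near (h : Admissible τ R ρ δ n k ω p b) (hδ0 : 0 ≤ δ) (hδ1 : δ ≤ 1) :
    |(b : ℝ) - (1 - δ) * (1 - R) * n| ≤ 2 := by
  have hk := abs_le.1 h.k_near
  have hkn : (k : ℝ) ≤ n := by exact_mod_cast (Nat.le_add_right k b).trans h.kb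
  have h0 : 0 ≤ (1 - δ) * ((n : ℝ) - k) := mul_nonneg (by linarith) (by linarith)
  have h1 := Nat.le_ceil ((1 - δ) * ((n : ℝ) - k))
  have h2 := Nat.ceil_lt_add_one h0
  rw [← h.b_eq] at h1 h2
  have h3 : (1 - δ) * ((n : ℝ) - k) = (1 - δ) * (1 - R) * n + (1 - δ) * (R * n - k) := by ring
  rw [abs_le]
  constructor <;> nlinarith

theorem Admissible.a_near (h : Admissible τ R ρ δ n k ω p b) (hδ0 : 0 ≤ δ) (hδ1 : δ ≤ 1) :
    |((n - k - b : ℕ) : ℝ) - (1 - (1 - δ) * (1 - R) - R) * n| ≤ 3 := by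
  have hb := abs_le.1 (h.b_near hδ0 hδ1)
  have hk := abs_le.1 h.k_near
  have hc : ((n - k - b : ℕ) : ℝ) = n - k - b := by
    have := h.kb
    rw [Nat.cast_sub (by omega), Nat.cast_sub (by omega)]
  rw [hc, abs_le]
  constructor <;> nlinarith

/-- If x < 0, then x·n falls below -K for large n. An inequality between limits that holds up to a
bounded error for one large n thus holds exactly. -/
theorem exists_forall_nonneg (x K : ℝ) : ∃ N : ℕ, ∀ n : ℕ, N ≤ n → -K ≤ x * n → 0 ≤ x := by
  obtain ⟨N, hN⟩ := exists_nat_gt (K / -x)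
  refine ⟨N, fun n hn hx => ?_⟩
  by_contra hneg
  push Not at hneg
  have h1 : (N : ℝ) ≤ n := by exact_mod_cast hn
  have h2 := hN.trans_le h1
  rw [div_lt_iff₀ (by linarith)] at h2
  linarith

/-- Nothing is assumed about ρ. The integer constraints imply the real ones up to rounding, so for
large n either the real ones hold or there are no admissible parameters. -/
theorem Admissible.exists_constraints (τ R ρ δ : ℝ) (hδ0 : 0 ≤ δ) (hδ1 : δ ≤ 1) :
    ∃ N : ℕ, ∀ n k ω p b : ℕ, N ≤ n → Admissible τ R ρ δ n k ω p b →
      0 ≤ ρ ∧ ρ ≤ (1 - δ) * (1 - R) ∧ ρ ≤ τ ∧ τ - ρ ≤ 1 - (1 - δ) * (1 - R) - R := by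
  obtain ⟨N₁, h₁⟩ := exists_forall_nonneg ρ 1
  obtain ⟨N₂, h₂⟩ := exists_forall_nonneg ((1 - δ) * (1 - R) - ρ) 3
  obtain ⟨N₃, h₃⟩ := exists_forall_nonneg (τ - ρ) 2
  obtain ⟨N₄, h₄⟩ := exists_forall_nonneg (1 - (1 - δ) * (1 - R) - R - (τ - ρ)) 5
  refine ⟨N₁ + N₂ + N₃ + N₄, fun n k ω p b hn h => ?_⟩
  have hp := abs_le.1 h.p_near
  have hω := abs_le.1 h.ω_near
  have hb := abs_le.1 (h.b_near hδ0 hδ1)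
  have ha := abs_le.1 (h.a_near hδ0 hδ1)
  have c1 : (p : ℝ) ≤ b := by exact_mod_cast h.p_le_b
  have c2 : (p : ℝ) ≤ ω := by exact_mod_cast h.p_le_ω
  have c3 : (ω : ℝ) - p ≤ (n - k - b : ℕ) := by
    rw [← Nat.cast_sub h.p_le_ω]; exact_mod_cast h.w_le
  have c0 : (0 : ℝ) ≤ p := Nat.cast_nonneg p
  refine ⟨h₁ n (by omega) (by linarith), ?_, ?_, ?_⟩
  · linarith [h₂ n (by omega) (by rw [sub_mul]; linarith)]
  · linarith [h₃ n (by omega) (by rw [sub_mul]; linarith)]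
  · linarith [h₄ n (by omega) (by rw [sub_mul, sub_mul τ]; linarith)]

set_option maxHeartbeats 400000 in
/-- The exponent of the running time with `c = 1/2` and the resulting bound. -/
theorem Admissible.exponent_le (h : Admissible τ R ρ δ n k ω p b) (hR : 0 < R) (hτ : 0 < τ)
    (hτR : τ < 1 - R) (hδ0 : 0 ≤ δ) (hδ1 : δ ≤ 1) (hρ0 : 0 ≤ ρ) (hρβ : ρ ≤ (1 - δ) * (1 - R))
    (hρτ : ρ ≤ τ) (hτρ : τ - ρ ≤ 1 - (1 - δ) * (1 - R) - R) (hωk : ω ≤ n - k) :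
    Real.log (max 1 (expectedSolutions (n - k - b) k (ω - p)) /
        goodAmplitude (n - k - b) k (ω - p)) +
      (Real.log (n.choose b) - Real.log (ω.choose p) - Real.log ((n - ω).choose (b - p))) ≤
      speedup (1 / 2) τ R ρ δ * Real.log (classicalTime n k ω) +
        (200 + 70 * |speedup (1 / 2) τ R ρ δ|) * (1 + Real.log n) := by
  set β := (1 - δ) * (1 - R) with hβ
  have hkb := h.kb
  have hpω := h.p_le_ω
  have hpb := h.p_le_b
  have hw := h.w_le
  have hn := h.n_pos
  have hnr : (1 : ℝ) ≤ n := by exact_mod_cast hn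
  have hL0 : 0 ≤ Real.log n := Real.log_nonneg hnr
  set L := 1 + Real.log n with hL
  clear_value L
  have hl2 := Real.log_pos one_lt_two
  have hl2' : Real.log 2 ≤ 1 := by linarith [Real.log_two_lt_d9]
  have hβ1 : β ≤ 1 - R := by rw [hβ]; nlinarith
  have hb := abs_le.1 (h.b_near hδ0 hδ1)
  have ha := abs_le.1 (h.a_near hδ0 hδ1)
  rw [← hβ] at hb ha
  have hk := abs_le.1 h.k_near
  have hω := abs_le.1 h.ω_near
  have hp := abs_le.1 h.p_near
  have cw : ((ω - p : ℕ) : ℝ) = ω - p := Nat.cast_sub hpω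
  have cbp : ((b - p : ℕ) : ℝ) = b - p := Nat.cast_sub hpb
  have cnω : ((n - ω : ℕ) : ℝ) = n - ω := Nat.cast_sub (by omega)
  have cnk : ((n - k : ℕ) : ℝ) = n - k := Nat.cast_sub (by omega)
  have cak : ((n - k - b + k : ℕ) : ℝ) = n - b := by
    rw [show n - k - b + k = n - b by omega, Nat.cast_sub (by omega)]
  have A1 := abs_le.1 (log_choose_near (x := n) (y := b) (ξ := 1) (η := β) hn (by omega) le_rfl
    (by linarith) (by linarith) le_rfl (by simp) (abs_le.2 ⟨by linarith, by linarith⟩))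
  have A2 := abs_le.1 (log_choose_near (x := ω) (y := p) (ξ := τ) (η := ρ) hn hpω (by omega)
    hρ0 hρτ (by linarith) (abs_le.2 ⟨by linarith, by linarith⟩)
    (abs_le.2 ⟨by linarith, by linarith⟩))
  have A3 := abs_le.1 (log_choose_near (x := n - ω) (y := b - p) (ξ := 1 - τ) (η := β - ρ) hn
    (by omega) (by omega) (by linarith) (by linarith) (by linarith)
    (by rw [cnω]; exact abs_le.2 ⟨by linarith, by linarith⟩)
    (by rw [cbp]; exact abs_le.2 ⟨by linarith, by linarith⟩))
  have A4 := abs_le.1 (log_choose_near (x := n - k - b + k) (y := ω - p) (ξ := 1 - β) (η := τ - ρ)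
    hn (by omega) (by omega) (by linarith) (by linarith) (by linarith)
    (by rw [cak]; exact abs_le.2 ⟨by linarith, by linarith⟩)
    (by rw [cw]; exact abs_le.2 ⟨by linarith, by linarith⟩))
  have A5 := abs_le.1 (log_choose_near (x := n - k - b) (y := ω - p) (ξ := 1 - β - R) (η := τ - ρ)
    hn (by omega) (by omega) (by linarith) (by linarith) (by linarith)
    (abs_le.2 ⟨by linarith, by linarith⟩)
    (by rw [cw]; exact abs_le.2 ⟨by linarith, by linarith⟩))
  have A6 := abs_le.1 (log_choose_near (x := n) (y := ω) (ξ := 1) (η := τ) hn (by omega) le_rfl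
    hτ.le (by linarith) le_rfl (by simp) (abs_le.2 ⟨by linarith, by linarith⟩))
  have A7 := abs_le.1 (log_choose_near (x := n - k) (y := ω) (ξ := 1 - R) (η := τ) hn hωk (by omega)
    hτ.le hτR.le (by linarith) (by rw [cnk]; exact abs_le.2 ⟨by linarith, by linarith⟩)
    (abs_le.2 ⟨by linarith, by linarith⟩))
  rw [← hL] at A1 A2 A3 A4 A5 A6 A7
  have hpat := pattern_exponent (τ := τ) (β := β) (ρ := ρ) hρ0 hρβ hρτ (by linarith) (by linarith)
    (by linarith)
  set B1 := (1 : ℝ) * Real.binEntropy (β / 1) with hB1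
  set B2 := τ * Real.binEntropy (ρ / τ) with hB2
  set B3 := (1 - τ) * Real.binEntropy ((β - ρ) / (1 - τ)) with hB3
  set B4 := (1 - β) * Real.binEntropy ((τ - ρ) / (1 - β)) with hB4
  set B5 := (1 - β - R) * Real.binEntropy ((τ - ρ) / (1 - β - R)) with hB5
  set B6 := (1 : ℝ) * Real.binEntropy (τ / 1) with hB6
  set B7 := (1 - R) * Real.binEntropy (τ / (1 - R)) with hB7
  set B8 := β * Real.binEntropy (ρ / β) with hB8
  have hσ : sigma τ R ρ β * Real.log 2 = B4 - (1 - β - R) * Real.log 2 := by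
    unfold sigma
    rw [sub_mul, mul_entropy]
  have hD := classical_exponent_pos hR hτ hτR
  set D := entropy τ - (1 - R) * entropy (τ / (1 - R)) with hDdef
  have hDlog : D * Real.log 2 = B6 - B7 := by
    rw [hDdef, sub_mul, mul_entropy, entropy_mul_log_two, hB6, one_mul, div_one]
  set t := speedup (1 / 2) τ R ρ δ with ht
  have htD : t * (D * Real.log 2) = B6 - B8 - B4 / 2 - B5 / 2 +
      1 / 2 * (max 0 (sigma τ R ρ β) * Real.log 2) := by
    have e1 : t * D = entropy τ - β * entropy (ρ / β) - (1 - β) / 2 * entropy ((τ - ρ) / (1 - β))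
        - (1 - β - R) / 2 * entropy ((τ - ρ) / (1 - β - R)) + 1 / 2 * max 0 (sigma τ R ρ β) :=
      div_mul_cancel₀ _ hD.ne'
    have e2 := mul_entropy β ρ
    have e3 := mul_entropy (1 - β) (τ - ρ)
    have e4 := mul_entropy (1 - β - R) (τ - ρ)
    have e5 := entropy_mul_log_two τ
    rw [← mul_assoc, e1, hB6, one_mul, div_one]
    linear_combination e5 - e2 - e3 / 2 - e4 / 2
  clear_value B1 B2 B3 B4 B5 B6 B7 B8 D
  -- The error is 35 from the binomial coefficient and 3 from rounding a, the latter multiplied by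
  -- log 2 ≤ 1.
  have hmax : max 0 (Real.log ((n - k - b + k).choose (ω - p)) - (n - k - b : ℕ) * Real.log 2) ≤
      n * (max 0 (sigma τ R ρ β) * Real.log 2) + 38 * L := by
    have h0 : 0 ≤ n * (max 0 (sigma τ R ρ β) * Real.log 2) := by
      have := le_max_left 0 (sigma τ R ρ β)
      positivity
    refine max_le (by linarith) ?_
    have h1 : n * (sigma τ R ρ β * Real.log 2) ≤ n * (max 0 (sigma τ R ρ β) * Real.log 2) := by
      have := le_max_right 0 (sigma τ R ρ β)
      gcongr
    rw [hσ] at h1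
    have h2 : ((1 - β - R) * n - 3) * Real.log 2 ≤ (n - k - b : ℕ) * Real.log 2 :=
      mul_le_mul_of_nonneg_right (by linarith) hl2.le
    linarith [A4.2]
  have hT : Real.log (classicalTime n k ω) =
      Real.log (n.choose ω) - Real.log ((n - k).choose ω) := by
    have h1 : (0 : ℝ) < n.choose ω := by exact_mod_cast Nat.choose_pos (by omega)
    have h2 : (0 : ℝ) < (n - k).choose ω := by exact_mod_cast Nat.choose_pos hωk
    rw [classicalTime, Real.log_div h1.ne' h2.ne']
  -- The exponent t has no known sign, so the error of the two binomials in T_C enters with |t|.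
  have htT : n * (t * (D * Real.log 2)) - 70 * |t| * L ≤ t * Real.log (classicalTime n k ω) := by
    have h1 : |Real.log (classicalTime n k ω) - n * (D * Real.log 2)| ≤ 70 * L := by
      rw [hT, hDlog, abs_le]
      constructor <;> linarith [A6.1, A6.2, A7.1, A7.2]
    have h2 : |t * (Real.log (classicalTime n k ω) - n * (D * Real.log 2))| ≤ |t| * (70 * L) := by
      rw [abs_mul]
      exact mul_le_mul_of_nonneg_left h1 (abs_nonneg t)
    have h3 := (abs_le.1 h2).1
    linarith
  rw [log_max_div_goodAmplitude _ _ _ hw]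
  have hnpat : n * (B1 - B2 - B3) = n * (B6 - B8 - B4) := by rw [hpat]
  rw [htD] at htT
  have hnn : 0 ≤ L := by linarith
  -- The errors are 3·35 for the pattern probability, 2·35/2 for the amplitude and 38/2 for the
  -- solutions, together at most 200.
  linarith [A1.2, A2.1, A3.1, A4.2, A5.1]

theorem one_le_classicalTime (hωk : ω ≤ n - k) : 1 ≤ classicalTime n k ω := by
  have h2 : (0 : ℝ) < (n - k).choose ω := by exact_mod_cast Nat.choose_pos hωk
  unfold classicalTime
  rw [one_le_div h2]
  exact_mod_cast Nat.choose_le_choose ω (Nat.sub_le n k)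

theorem speedup_half_le_one (hR : 0 < R) (hτ : 0 < τ) (hτR : τ < 1 - R) :
    speedup (1 / 2) τ R ρ δ ≤ speedup 1 τ R ρ δ := by
  have hD := classical_exponent_pos hR hτ hτR
  unfold speedup
  refine div_le_div_of_nonneg_right ?_ hD.le
  have := le_max_left 0 (sigma τ R ρ ((1 - δ) * (1 - R)))
  linarith

/-- The time of a round, divided by the probability of the weight pattern. -/
theorem Admissible.time_le (h : Admissible τ R ρ δ n k ω p b) (hR : 0 < R) (hτ : 0 < τ)
    (hτR : τ < 1 - R) (hδ0 : 0 ≤ δ) (hδ1 : δ ≤ 1) (hρ0 : 0 ≤ ρ) (hρβ : ρ ≤ (1 - δ) * (1 - R))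
    (hρτ : ρ ≤ τ) (hτρ : τ - ρ ≤ 1 - (1 - δ) * (1 - R) - R) (hωk : ω ≤ n - k) (K : ℕ)
    (hK : 200 + 70 * |speedup (1 / 2) τ R ρ δ| ≤ K) :
    (roundBound n k b ω p : ℝ) / (((ω.choose p * (n - ω).choose (b - p) : ℕ) : ℝ) / n.choose b) ≤
      50000 * Real.exp K * (n : ℝ) ^ (5 + K) *
        classicalTime n k ω ^ speedup (1 / 2) τ R ρ δ := by
  have hkb := h.kb
  have hpω := h.p_le_ω
  have hpb := h.p_le_b
  have hw := h.w_le
  have hnr : (1 : ℝ) ≤ n := by exact_mod_cast h.n_pos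
  have hn0 : (0 : ℝ) < n := by linarith
  have hL0 : 0 ≤ Real.log n := Real.log_nonneg hnr
  have hT := lt_of_lt_of_le one_pos (one_le_classicalTime (n := n) (k := k) hωk)
  have h1 : (0 : ℝ) < n.choose b := by exact_mod_cast Nat.choose_pos (by omega)
  have h2 : (0 : ℝ) < ω.choose p := by exact_mod_cast Nat.choose_pos hpω
  have h3 : (0 : ℝ) < (n - ω).choose (b - p) := by exact_mod_cast Nat.choose_pos (by omega)
  have hexp := h.exponent_le hR hτ hτR hδ0 hδ1 hρ0 hρβ hρτ hτρ hωk
  set X := max 1 (expectedSolutions (n - k - b) k (ω - p)) /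
    goodAmplitude (n - k - b) k (ω - p) with hX
  have hX0 : 0 < X := div_pos (lt_max_of_lt_left one_pos) (goodAmplitude_pos _ hw)
  set t := speedup (1 / 2) τ R ρ δ with ht
  have hmain : X * (n.choose b / (ω.choose p * (n - ω).choose (b - p))) ≤
      Real.exp K * (n : ℝ) ^ K * classicalTime n k ω ^ t := by
    rw [← Real.log_le_log_iff (by positivity) (by positivity), Real.log_mul hX0.ne' (by positivity),
      Real.log_div h1.ne' (by positivity), Real.log_mul h2.ne' h3.ne',
      Real.log_mul (by positivity) (by positivity), Real.log_mul (by positivity) (by positivity),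
      Real.log_exp, Real.log_pow, Real.log_rpow hT]
    have := mul_le_mul_of_nonneg_right hK (by linarith : 0 ≤ 1 + Real.log n)
    linarith
  calc (roundBound n k b ω p : ℝ) / (((ω.choose p * (n - ω).choose (b - p) : ℕ) : ℝ) / n.choose b)
      = roundBound n k b ω p * (n.choose b / (ω.choose p * (n - ω).choose (b - p))) := by
        push_cast; field_simp
    _ ≤ (50000 * (n : ℝ) ^ 5 * X) * (n.choose b / (ω.choose p * (n - ω).choose (b - p))) :=
        mul_le_mul_of_nonneg_right (roundBound_le hkb h.n_pos hw) (by positivity)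
    _ = 50000 * (n : ℝ) ^ 5 * (X * (n.choose b / (ω.choose p * (n - ω).choose (b - p)))) := by ring
    _ ≤ 50000 * (n : ℝ) ^ 5 * (Real.exp K * (n : ℝ) ^ K * classicalTime n k ω ^ t) := by gcongr
    _ = _ := by rw [pow_add]; ring

end

/-! ### Codes with small dual distance are rare -/

/-- With l = R/4, the number of light words is at most exp(Rn/4 + dΛ), and ε is so small that dΛ ≤
Rn/4 + Λ. Since log 2 > 1/2 + 1/10, the factor 2^(-k) wins by exp(-Rn/10), and exp(-x) ≤ 1/x gives
the bound C/n. Taking ε as a power of 1/2 makes ε^s a power of 2^s later. -/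
theorem exists_dualDistance_bound {R : ℝ} (hR : 0 < R) (hR1 : R < 1) : ∃ (C : ℝ) (e₀ : ℕ), 0 ≤ C ∧
    ∀ n k : ℕ, 1 ≤ n → |(k : ℝ) - R * n| ≤ 1 →
      ((Finset.univ.filter fun y : Fin n → ZMod 2 =>
        hammingNorm y < ⌈(1 / 2 : ℝ) ^ e₀ * n⌉₊).card : ℝ) * (1 / 2) ^ k ≤ C / n := by
  set l := R / 4 with hl
  have hl0 : 0 < l := by positivity
  have hl1 : l ≤ 1 := by linarith
  set Λ := -Real.log l with hΛ
  have hΛ0 : 0 ≤ Λ := by rw [hΛ]; linarith [Real.log_nonpos hl0.le hl1]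
  obtain ⟨e₀, he₀⟩ := exists_pow_lt_of_lt_one (show 0 < R / (4 * (Λ + 1)) by positivity)
    (show (1 / 2 : ℝ) < 1 by norm_num)
  refine ⟨Real.exp (1 + Λ) / (R / 10), e₀, by positivity, fun n k hn hk => ?_⟩
  have hn0 : (0 : ℝ) < n := by exact_mod_cast hn
  set ε := (1 / 2 : ℝ) ^ e₀ with hε
  have hε0 : 0 < ε := by positivity
  set d := ⌈ε * n⌉₊ with hd
  have hdle : (d : ℝ) ≤ ε * n + 1 := (Nat.ceil_lt_add_one (by positivity)).le
  have hV := card_light_le (n := n) d l hl0 hl1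
  set V : ℝ := ((Finset.univ.filter fun y : Fin n → ZMod 2 => hammingNorm y < d).card : ℝ) with hVdef
  have hεΛ : ε * Λ ≤ R / 4 := by
    rw [lt_div_iff₀ (by positivity)] at he₀
    nlinarith
  have h1 : (1 + l) ^ n ≤ Real.exp (l * n) := by
    calc (1 + l) ^ n ≤ Real.exp l ^ n := by
          gcongr
          linarith [Real.add_one_le_exp l]
      _ = _ := by rw [← Real.exp_nat_mul]; ring_nf
  have h2 : l ^ d = Real.exp (-(d * Λ)) := by
    rw [hΛ, ← Real.exp_log (pow_pos hl0 d), Real.log_pow]; ring_nf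
  have h3 : (1 / 2 : ℝ) ^ k = Real.exp (-(k * Real.log 2)) := by
    rw [← Real.exp_log (show (0 : ℝ) < (1 / 2) ^ k by positivity), Real.log_pow, one_div,
      Real.log_inv]; ring_nf
  have h4 : V ≤ Real.exp (l * n + d * Λ) := by
    rw [h2] at hV
    rw [Real.exp_add]
    have h5 : Real.exp (-(d * Λ)) * Real.exp (d * Λ) = 1 := by rw [← Real.exp_add]; simp
    calc V = V * Real.exp (-(d * Λ)) * Real.exp (d * Λ) := by rw [mul_assoc, h5, mul_one]
      _ ≤ _ := mul_le_mul_of_nonneg_right (hV.trans h1) (Real.exp_pos _).le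
  have h6 : V * (1 / 2) ^ k ≤ Real.exp (1 + Λ) * Real.exp (-(R / 10 * n)) := by
    rw [h3, ← Real.exp_add]
    refine (mul_le_mul_of_nonneg_right h4 (Real.exp_pos _).le).trans ?_
    rw [← Real.exp_add]
    refine Real.exp_le_exp.2 ?_
    have hk' := (abs_le.1 hk).1
    have e1 : d * Λ ≤ R / 4 * n + Λ := by
      have := mul_le_mul_of_nonneg_right hdle hΛ0
      nlinarith
    have e2 : (R * n - 1) * Real.log 2 ≤ k * Real.log 2 :=
      mul_le_mul_of_nonneg_right (by linarith) (Real.log_pos one_lt_two).le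
    have e3 := Real.log_two_gt_d9
    have e4 := Real.log_two_lt_d9
    have e5 : 0 < R * n := by positivity
    rw [hl]
    nlinarith
  refine h6.trans ?_
  rw [div_div, Real.exp_neg, ← div_eq_mul_inv]
  refine div_le_div_of_nonneg_left (Real.exp_pos _).le (by positivity) ?_
  linarith [Real.add_one_le_exp (R / 10 * n)]


/-! ### The main theorem -/

section

variable {τ R ρ δ : ℝ} {n k ω p b : ℕ}

/-- One term of Vandermonde's identity. -/
theorem pattern_mul_le (hω : ω ≤ n) (hpb : p ≤ b) :
    ω.choose p * (n - ω).choose (b - p) ≤ n.choose b := by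
  conv_rhs => rw [← Nat.add_sub_cancel' hω, Nat.add_choose_eq]
  exact Finset.single_le_sum (f := fun ij : ℕ × ℕ => ω.choose ij.1 * (n - ω).choose ij.2)
    (fun _ _ => Nat.zero_le _) (a := (p, b - p)) (by simp; omega)

open Classical in
/-- Outside a small fraction of the full-rank matrices, a round succeeds with a probability that is
polynomially close to the probability of the weight pattern. -/
theorem exists_round_bound (hR : 0 < R) (hR1 : R < 1) : ∃ (C : ℝ) (D : ℕ), 0 ≤ C ∧
    ∀ (n k ω p b : ℕ) (h : k + b ≤ n), 1 ≤ n → |(k : ℝ) - R * n| ≤ 1 → p ≤ ω → p ≤ b →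
      ω - p ≤ n - k - b → 1 ≤ k → ω + (Nat.log 2 n + 1) ≤ n - k →
      ∃ c : ℝ, 0 < c ∧ c ≤ 1 ∧ 1 / c ≤ C * (n : ℝ) ^ D ∧
        ∀ e : Fin n → ZMod 2, hammingNorm e = ω →
          ((Finset.univ.filter fun H : Matrix (Fin (n - k)) (Fin n) (ZMod 2) =>
            ¬ (puncturedHybridRound n k b ω p h H (H.mulVec e)).res none ≤
              1 - ENNReal.ofReal (((ω.choose p * (n - ω).choose (b - p) : ℕ) : ℝ) / n.choose b *
                c)).card : ℝ) ≤
          C / n * (Finset.univ.filter fun H : Matrix (Fin (n - k)) (Fin n) (ZMod 2) =>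
            H.rank = n - k).card := by
  obtain ⟨C₁, e₀, hC₁, hdual⟩ := exists_dualDistance_bound hR hR1
  -- The exponent of u = 2^s in 1/c: three factors y, each of order u^(-e₀), and the factor ε^(s') =
  -- u^(-e₀(e₀+1)).
  set E := 3 * e₀ + e₀ * (e₀ + 1) with hE
  refine ⟨2 * (C₁ + 50) + 1024 * 2 ^ E, E + 1, by positivity, ?_⟩
  intro n k ω p b h hn hk hp hpb hw hk1 hωs
  -- With this s, n ≤ 2^s ≤ 2n, so losses exponential in s are polynomial in n.
  set s := Nat.log 2 n + 1 with hs
  set u : ℝ := 2 ^ s with hu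
  have hu0 : 0 < u := by positivity
  have hn0 : (0 : ℝ) < n := by exact_mod_cast hn
  have hnr : (1 : ℝ) ≤ n := by exact_mod_cast hn
  have hnu : (n : ℝ) ≤ u := by
    rw [hu]
    exact_mod_cast (Nat.lt_pow_succ_log_self one_lt_two n).le
  have hun : u ≤ 2 * n := by
    rw [hu, hs, pow_succ, mul_comm]
    have : ((2 ^ Nat.log 2 n : ℕ) : ℝ) ≤ n := Nat.cast_le.2 (Nat.pow_log_le_self 2 (by omega))
    push_cast at this
    linarith
  have hhalf : ∀ i : ℕ, (1 / 2 : ℝ) ^ (i * s) = 1 / u ^ i := fun i => by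
    rw [hu, ← pow_mul, one_div_pow, mul_comm]
  set ε : ℝ := (1 / 2) ^ e₀ with hε
  have hε0 : 0 < ε := by positivity
  have hε1 : ε ≤ 1 := pow_le_one₀ (by norm_num) (by norm_num)
  have hεs : ε ^ s = 1 / u ^ e₀ := by rw [hε, ← pow_mul, hhalf]
  have hεs' : ε ^ ((e₀ + 1) * s) = 1 / u ^ (e₀ * (e₀ + 1)) := by
    rw [hε, ← pow_mul, ← mul_assoc, hhalf]
  set y : ℝ := ε ^ s / 2 with hy
  have hy' : y = 1 / (2 * u ^ e₀) := by rw [hy, hεs]; field_simp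
  have hy0 : 0 < y := by positivity
  have hy1 : y ≤ 1 := by
    rw [hy]
    linarith [pow_le_one₀ hε0.le hε1 (n := s)]
  -- Θ = n/y and s' = (e₀+1)s are chosen so that 16/(Θy) and 16·2^(-s')/y are both O(1/n) in spite
  -- of the division by y.
  have hΘ : 1 ≤ n / y := by
    rw [one_le_div hy0]; linarith
  set c := y / 4 * (y / 2 * (ε ^ ((e₀ + 1) * s) / 2) / (8 * (n / y))) with hc
  have hcinv : 1 / c = 1024 * n * u ^ E := by
    rw [hc, hεs', hy', hE, pow_add, mul_comm 3, pow_mul u e₀ 3]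
    field_simp
    norm_num
  have hc0 : 0 < c := by positivity
  have huE : 1 ≤ u ^ E := one_le_pow₀ (hnr.trans hnu)
  have hpow : u ^ E ≤ 2 ^ E * (n : ℝ) ^ E := by
    rw [← mul_pow]
    exact pow_le_pow_left₀ hu0.le hun E
  refine ⟨c, hc0, ?_, ?_, fun e he => ?_⟩
  · have h1 : 1 ≤ 1 / c := by
      rw [hcinv]
      nlinarith
    rwa [le_div_iff₀ hc0, one_mul] at h1
  · rw [hcinv, pow_succ]
    calc 1024 * n * u ^ E ≤ 1024 * n * (2 ^ E * (n : ℝ) ^ E) := by gcongr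
      _ = 1024 * 2 ^ E * ((n : ℝ) ^ E * n) := by ring
      _ ≤ _ := by
        gcongr
        linarith
  · set N : ℝ := (Fintype.card (Matrix (Fin (n - k)) (Fin n) (ZMod 2)) : ℝ) with hN
    have hN0 : 0 ≤ N := Nat.cast_nonneg _
    have hmain := card_bad_matrices_le n k b ω p h hn hp hpb hw e he ⌈ε * n⌉₊ ε hε0 hε1
      (Nat.le_ceil _) s ((e₀ + 1) * s) hωs (n / y) hΘ y hy
    rw [mul_assoc, ← hc] at hmain
    have hd : ((Finset.univ.filter fun H : Matrix (Fin (n - k)) (Fin n) (ZMod 2) =>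
        ¬ DualDistance H ⌈ε * n⌉₊).card : ℝ) ≤ C₁ / n * N := by
      have h1 := card_not_dualDistance_le (m := n - k) (n := n) ⌈ε * n⌉₊
      have h2 := hdual n k hn hk
      set V : ℝ := ((Finset.univ.filter fun y : Fin n → ZMod 2 =>
        hammingNorm y < ⌈ε * n⌉₊).card : ℝ) with hV
      have h3 : (2 : ℝ) ^ n = 2 ^ (n - k) * 2 ^ k := by
        rw [← pow_add]; congr 1; omega
      have h4 : V ≤ C₁ / n * 2 ^ k := by
        rw [one_div_pow, ← div_eq_mul_one_div, div_le_iff₀ (by positivity)] at h2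
        exact h2
      rw [← mul_le_mul_iff_left₀ (show (0 : ℝ) < 2 ^ n by positivity)]
      refine h1.trans ?_
      rw [h3]
      calc 2 ^ (n - k) * V * N ≤ 2 ^ (n - k) * (C₁ / n * 2 ^ k) * N := by gcongr
        _ = _ := by ring
    have hfrac : 2 * (1 / 2 : ℝ) ^ s + 16 * (1 / 2) ^ ((e₀ + 1) * s) / y + 16 / (n / y * y) ≤
        50 / n := by
      have h1 := hhalf 1
      rw [one_mul, pow_one] at h1
      have h2 : 16 * (1 / u ^ (e₀ + 1)) / (1 / (2 * u ^ e₀)) = 32 * (1 / u) := by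
        rw [pow_succ]; field_simp; norm_num
      rw [h1, hhalf, div_mul_cancel₀ _ hy0.ne', hy', h2]
      have h3 : 1 / u ≤ 1 / n := one_div_le_one_div_of_le hn0 hnu
      have h4 : (50 : ℝ) / n = 2 * (1 / n) + 32 * (1 / n) + 16 / n := by ring
      rw [h4]
      linarith
    have hfull : N ≤ 2 * ((Finset.univ.filter fun H : Matrix (Fin (n - k)) (Fin n) (ZMod 2) =>
        H.rank = n - k).card : ℝ) := by
      have := card_full_rank_ge (m := n - k) (n := n) (by omega)
      rw [hN]
      exact_mod_cast this
    set F : ℝ := ((Finset.univ.filter fun H : Matrix (Fin (n - k)) (Fin n) (ZMod 2) =>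
        H.rank = n - k).card : ℝ) with hF
    refine hmain.trans ?_
    calc _ ≤ C₁ / n * N + 50 / n * N := by gcongr
      _ = (C₁ + 50) / n * N := by ring
      _ ≤ (C₁ + 50) / n * (2 * F) := by gcongr
      _ = 2 * (C₁ + 50) / n * F := by ring
      _ ≤ _ := by
        gcongr
        linarith [show (0 : ℝ) < 1024 * 2 ^ E by positivity]

/-- Since τ < 1 - R is strict, the gap between ω and n - k is linear and has room for the log n
columns of the bridging step. -/
theorem exists_log_le (x : ℝ) (hx : 0 < x) : ∃ N : ℕ, ∀ n : ℕ, N ≤ n →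
    (Nat.log 2 n : ℝ) + 3 ≤ x * n := by
  have h1 : Filter.Tendsto (fun n : ℕ => Real.log n / n) Filter.atTop (nhds 0) := by
    have := (Real.isLittleO_log_id_atTop.comp_tendsto tendsto_natCast_atTop_atTop).tendsto_div_nhds_zero
    simpa using this
  have h2 := h1.eventually (gt_mem_nhds (show 0 < x * Real.log 2 / 2 by
    have := Real.log_pos one_lt_two; positivity))
  obtain ⟨N₁, hN₁⟩ := Filter.eventually_atTop.1 h2
  obtain ⟨N₂, hN₂⟩ := exists_nat_gt (6 / x)
  refine ⟨max N₁ N₂ + 1, fun n hn => ?_⟩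
  have hn1 := hN₁ n (by omega)
  have hn2 : (N₂ : ℝ) ≤ n := Nat.cast_le.2 (by omega)
  have hn0 : (0 : ℝ) < n := Nat.cast_pos.2 (by omega)
  have hl2 := Real.log_pos one_lt_two
  rw [div_lt_iff₀ hn0] at hn1
  have h3 := hN₂.trans_le hn2
  rw [div_lt_iff₀ hx] at h3
  have h4 : (Nat.log 2 n : ℝ) * Real.log 2 ≤ Real.log n := by
    rw [← Real.log_pow]
    refine Real.log_le_log (by positivity) ?_
    exact_mod_cast Nat.pow_log_le_self 2 (by omega)
  have h5 : (Nat.log 2 n : ℝ) * Real.log 2 ≤ x * n / 2 * Real.log 2 := by linarith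
  have h6 := le_of_mul_le_mul_right h5 hl2
  linarith

theorem Admissible.matrixQubits_le (h : Admissible τ R ρ δ n k ω p b) (hR : 0 < R)
    (hk : (k : ℝ) = R * n) :
    (matrixQubits (n - k - b) k : ℝ) ≤ δ * (1 - R) * R * n ^ 2 := by
  have h1 := Nat.le_ceil ((1 - δ) * ((n : ℝ) - k))
  rw [← h.b_eq] at h1
  have hc : ((n - k - b : ℕ) : ℝ) = n - k - b := by
    have := h.kb
    rw [Nat.cast_sub (by omega), Nat.cast_sub (by omega)]
  rw [matrixQubits_eq, Nat.cast_mul, hc]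
  have h2 : (n : ℝ) - k - b ≤ δ * (1 - R) * n := by
    rw [hk] at h1 ⊢
    linarith
  rw [hk] at h2 ⊢
  have h3 : 0 ≤ R * (n : ℝ) := by positivity
  nlinarith [mul_le_mul_of_nonneg_right h2 h3]

theorem Admissible.matrixQubits_near (h : Admissible τ R ρ δ n k ω p b) (hR : 0 < R) (hR1 : R < 1)
    (hδ0 : 0 ≤ δ) (hδ1 : δ ≤ 1) :
    |(matrixQubits (n - k - b) k : ℝ) - δ * (1 - R) * R * n ^ 2| ≤ 4 * (n : ℝ) := by
  have ha := h.a_near hδ0 hδ1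
  have hk := h.k_near
  have hkn : (k : ℝ) ≤ n := Nat.cast_le.2 ((Nat.le_add_right k b).trans h.kb)
  have hk0 : (0 : ℝ) ≤ k := Nat.cast_nonneg k
  have hn0 : (0 : ℝ) ≤ n := Nat.cast_nonneg n
  rw [matrixQubits_eq, Nat.cast_mul]
  set a : ℝ := ((n - k - b : ℕ) : ℝ) with hadef
  have h0 : 0 ≤ δ * (1 - R) := mul_nonneg hδ0 (by linarith)
  have h1 : δ * (1 - R) ≤ 1 := mul_le_one₀ hδ1 (by linarith) (by linarith)
  -- The product of two rounded quantities is split so that each rounding error is multiplied by at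
  -- most n.
  have h2 : a * k - δ * (1 - R) * R * n ^ 2 =
      (a - (1 - (1 - δ) * (1 - R) - R) * n) * k + δ * (1 - R) * n * (k - R * n) := by ring
  rw [h2]
  refine (abs_add_le _ _).trans ?_
  rw [abs_mul, abs_mul, abs_of_nonneg hk0, abs_of_nonneg (mul_nonneg h0 hn0)]
  have h3 := mul_le_mul ha hkn hk0 (by norm_num : (0 : ℝ) ≤ 3)
  have h4 := mul_le_mul (mul_le_mul_of_nonneg_right h1 hn0) hk (abs_nonneg _) (by linarith)
  linarith

theorem Admissible.qubits_le (h : Admissible τ R ρ δ n k ω p b) (w j : ℕ) :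
    ((searchCircuit (n - k - b) k w j).qubits : ℝ) ≤ matrixQubits (n - k - b) k + 16 * n := by
  have h1 := qubits_searchCircuit_le (n - k - b) k w j
  have h2 := h.kb
  have h3 := h.n_pos
  exact_mod_cast h1.trans (by omega :
    matrixQubits (n - k - b) k + (6 * (n - k - b) + 5 * k + 5) ≤ matrixQubits (n - k - b) k + 16 * n)

/-- For all large `n`, the algorithm solves all but a small fraction of the instances in time. -/
theorem exists_time_bound (hR : 0 < R) (hτ : 0 < τ) (hτR : τ < 1 - R) (hδ0 : 0 ≤ δ)
    (hδ1 : δ ≤ 1) : ∃ (C : ℝ) (D N : ℕ), 0 ≤ C ∧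
    ∀ (n k ω p b : ℕ) (h : Admissible τ R ρ δ n k ω p b), N ≤ n →
      ∀ e : Fin n → ZMod 2, hammingNorm e = ω →
        (Set.ncard {H : Matrix (Fin (n - k)) (Fin n) (ZMod 2) |
          ¬ (PuncturedHybridSolves n k b ω p h.kb H (H.mulVec e) ∧
            puncturedHybridTime n k b ω p h.kb H (H.mulVec e) ≤
              ENNReal.ofReal (C * (n : ℝ) ^ D *
                classicalTime n k ω ^ speedup 1 τ R ρ δ) ∧
            puncturedHybridTime n k b ω p h.kb H (H.mulVec e) ≤
              ENNReal.ofReal (C * (n : ℝ) ^ D *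
                classicalTime n k ω ^ speedup (1 / 2) τ R ρ δ))} : ℝ) ≤
          C / n * Set.ncard {H : Matrix (Fin (n - k)) (Fin n) (ZMod 2) | H.rank = n - k} := by
  classical
  obtain ⟨C₁, D₁, hC₁, hround⟩ := exists_round_bound hR (by linarith : R < 1)
  obtain ⟨N₁, hN₁⟩ := Admissible.exists_constraints τ R ρ δ hδ0 hδ1
  obtain ⟨N₂, hN₂⟩ := exists_log_le (1 - R - τ) (by linarith)
  obtain ⟨N₃, hN₃⟩ := exists_nat_gt (1 / R)
  obtain ⟨K, hK⟩ := exists_nat_ge (200 + 70 * |speedup (1 / 2) τ R ρ δ|)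
  -- The first summand serves the exceptional fraction, the second the running time.
  refine ⟨C₁ + 50000 * Real.exp K * C₁, 5 + K + D₁, max N₁ (max N₂ N₃), by positivity, ?_⟩
  intro n k ω p b h hn e he
  have hkb := h.kb
  have hnr : (1 : ℝ) ≤ n := Nat.one_le_cast.2 h.n_pos
  have hk' := abs_le.1 h.k_near
  have hω' := abs_le.1 h.ω_near
  obtain ⟨hρ0, hρβ, hρτ, hτρ⟩ := hN₁ n k ω p b (by omega) h
  have hk1 : 1 ≤ k := by
    have h1 : (N₃ : ℝ) ≤ n := Nat.cast_le.2 (by omega)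
    have h2 := hN₃.trans_le h1
    rw [div_lt_iff₀ hR] at h2
    have h3 : (0 : ℝ) < k := by linarith
    exact Nat.cast_pos.1 h3
  have hωs : ω + (Nat.log 2 n + 1) ≤ n - k := by
    have h1 := hN₂ n (by omega)
    have h2 : ((ω + (Nat.log 2 n + 1) + k : ℕ) : ℝ) ≤ n := by
      push_cast
      linarith
    have h3 := Nat.cast_le.1 h2
    omega
  have hωk : ω ≤ n - k := by omega
  obtain ⟨c, hc0, hc1, hcinv, hbad⟩ := hround n k ω p b hkb h.n_pos h.k_near h.p_le_ω h.p_le_b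
    h.w_le hk1 hωs
  have hT := one_le_classicalTime hωk
  have hpat0 : (0 : ℝ) < ((ω.choose p * (n - ω).choose (b - p) : ℕ) : ℝ) := by
    have hw := h.w_le
    have hp := h.p_le_ω
    exact Nat.cast_pos.2 (Nat.mul_pos (Nat.choose_pos hp) (Nat.choose_pos (by omega)))
  have hnb : (0 : ℝ) < n.choose b := Nat.cast_pos.2 (Nat.choose_pos (by omega))
  have htime := h.time_le hR hτ hτR hδ0 hδ1 hρ0 hρβ hρτ hτρ hωk K hK
  set q₀ : ℝ := ((ω.choose p * (n - ω).choose (b - p) : ℕ) : ℝ) / n.choose b with hq₀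
  have hq₀0 : 0 < q₀ := div_pos hpat0 hnb
  have hq₀1 : q₀ ≤ 1 := by
    rw [hq₀, div_le_one hnb]
    exact Nat.cast_le.2 (pattern_mul_le (by omega) h.p_le_b)
  set t := speedup (1 / 2) τ R ρ δ with ht
  set C := C₁ + 50000 * Real.exp K * C₁ with hC
  have hTt : 0 < classicalTime n k ω ^ t := Real.rpow_pos_of_pos (by linarith) _
  have hbound : roundBound n k b ω p / (q₀ * c) ≤
      C * (n : ℝ) ^ (5 + K + D₁) * classicalTime n k ω ^ t := by
    calc roundBound n k b ω p / (q₀ * c) = roundBound n k b ω p / q₀ * (1 / c) := by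
          rw [div_mul_div_comm, mul_one]
      _ ≤ (50000 * Real.exp K * (n : ℝ) ^ (5 + K) * classicalTime n k ω ^ t) *
          (C₁ * (n : ℝ) ^ D₁) := mul_le_mul htime hcinv (by positivity) (by positivity)
      _ = 50000 * Real.exp K * C₁ * (n : ℝ) ^ (5 + K + D₁) * classicalTime n k ω ^ t := by
          rw [pow_add _ (5 + K)]; ring
      _ ≤ _ := by
          gcongr
          rw [hC]; linarith
  have hCn : 0 ≤ C := by positivity
  have hbound1 : C * (n : ℝ) ^ (5 + K + D₁) * classicalTime n k ω ^ t ≤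
      C * (n : ℝ) ^ (5 + K + D₁) * classicalTime n k ω ^ speedup 1 τ R ρ δ :=
    mul_le_mul_of_nonneg_left (Real.rpow_le_rpow_of_exponent_le hT
      (speedup_half_le_one hR hτ hτR)) (by positivity)
  have hsub : {H : Matrix (Fin (n - k)) (Fin n) (ZMod 2) |
      ¬ (PuncturedHybridSolves n k b ω p h.kb H (H.mulVec e) ∧
        puncturedHybridTime n k b ω p h.kb H (H.mulVec e) ≤
          ENNReal.ofReal (C * (n : ℝ) ^ (5 + K + D₁) *
            classicalTime n k ω ^ speedup 1 τ R ρ δ) ∧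
        puncturedHybridTime n k b ω p h.kb H (H.mulVec e) ≤
          ENNReal.ofReal (C * (n : ℝ) ^ (5 + K + D₁) * classicalTime n k ω ^ t))} ⊆
      ((Finset.univ.filter fun H : Matrix (Fin (n - k)) (Fin n) (ZMod 2) =>
        ¬ (puncturedHybridRound n k b ω p h.kb H (H.mulVec e)).res none ≤
          1 - ENNReal.ofReal (q₀ * c) : Finset _) : Set _) := by
    intro H hH
    rw [Finset.coe_filter]
    refine ⟨Finset.mem_univ _, fun hgood => hH ?_⟩
    obtain ⟨h1, h2⟩ := solves_and_time_le n k b ω p h.kb H (H.mulVec e) (q₀ * c)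
      (mul_pos hq₀0 hc0) (mul_le_one₀ hq₀1 hc0.le hc1) hgood
    exact ⟨h1, h2.trans (ENNReal.ofReal_le_ofReal (hbound.trans hbound1)),
      h2.trans (ENNReal.ofReal_le_ofReal hbound)⟩
  have hcard := Set.ncard_le_ncard hsub (Finset.finite_toSet _)
  rw [Set.ncard_coe_finset] at hcard
  have hfull : (Set.ncard {H : Matrix (Fin (n - k)) (Fin n) (ZMod 2) | H.rank = n - k} : ℝ) =
      (Finset.univ.filter fun H : Matrix (Fin (n - k)) (Fin n) (ZMod 2) => H.rank = n - k).card := by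
    rw [← Set.ncard_coe_finset, Finset.coe_filter]
    simp
  rw [hfull]
  refine ((Nat.cast_le (α := ℝ)).2 hcard).trans ((hbad e he).trans ?_)
  gcongr
  rw [hC]
  linarith [show (0 : ℝ) ≤ 50000 * Real.exp K * C₁ by positivity]

end

end PuncturedISD

end

theorem mainTheorem5 (τ R ρ δ : ℝ) (hR : 0 < R) (hτ : 0 < τ) (hτR : τ < 1 - R)
    (hδ0 : 0 ≤ δ) (hδ1 : δ ≤ 1) :
    ∃ (C : ℝ) (d : ℕ), ∀ (n k ω p b : ℕ) (hkb : k + b ≤ n), 1 ≤ n →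
      |(k : ℝ) - R * n| ≤ 1 → |(ω : ℝ) - τ * n| ≤ 1 → |(p : ℝ) - ρ * n| ≤ 1 →
      b = ⌈(1 - δ) * ((n : ℝ) - k)⌉₊ →
      p ≤ ω → p ≤ b → ω - p ≤ n - k - b →
      ((k : ℝ) = R * n →
        (PuncturedISD.matrixQubits (n - k - b) k : ℝ) ≤ δ * (1 - R) * R * n ^ 2) ∧
      |(PuncturedISD.matrixQubits (n - k - b) k : ℝ) - δ * (1 - R) * R * n ^ 2| ≤ C * n ∧
      (∀ j : ℕ, ((PuncturedISD.searchCircuit (n - k - b) k (ω - p) j).qubits : ℝ) ≤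
        PuncturedISD.matrixQubits (n - k - b) k + C * n) ∧
      ∀ e : Fin n → ZMod 2, hammingNorm e = ω →
        (Set.ncard {H : Matrix (Fin (n - k)) (Fin n) (ZMod 2) | H.rank = n - k ∧
          ¬ (PuncturedISD.PuncturedHybridSolves n k b ω p hkb H (H.mulVec e) ∧
            PuncturedISD.puncturedHybridTime n k b ω p hkb H (H.mulVec e) ≤
              ENNReal.ofReal (C * (n : ℝ) ^ d *
                PuncturedISD.classicalTime n k ω ^ PuncturedISD.speedup 1 τ R ρ δ) ∧
            PuncturedISD.puncturedHybridTime n k b ω p hkb H (H.mulVec e) ≤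
              ENNReal.ofReal (C * (n : ℝ) ^ d *
                PuncturedISD.classicalTime n k ω ^ PuncturedISD.speedup (1 / 2) τ R ρ δ))} : ℝ) ≤
          C / n * Set.ncard {H : Matrix (Fin (n - k)) (Fin n) (ZMod 2) | H.rank = n - k} := by
  obtain ⟨C, D, N, hC, hmain⟩ :=
    PuncturedISD.exists_time_bound (ρ := ρ) hR hτ hτR hδ0 hδ1
  -- The constant covers the error 4n of the matrix size, the 16n other qubits, and all n < N.
  refine ⟨C + 16 + N, D, fun n k ω p b hkb hn hk hω hp hb hpω hpb hw => ?_⟩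
  have h : PuncturedISD.Admissible τ R ρ δ n k ω p b := ⟨hkb, hn, hk, hω, hp, hb, hpω, hpb, hw⟩
  have hn0 : (0 : ℝ) < n := Nat.cast_pos.2 hn
  have hN0 : (0 : ℝ) ≤ N := Nat.cast_nonneg N
  refine ⟨h.matrixQubits_le hR, (h.matrixQubits_near hR (by linarith) hδ0 hδ1).trans ?_,
    fun j => (h.qubits_le (ω - p) j).trans ?_, fun e he => ?_⟩
  · gcongr
    linarith
  · gcongr
    linarith
  rcases le_or_gt N n with hNn | hNn
  · refine le_trans ?_ ((hmain n k ω p b h hNn e he).trans ?_)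
    · have hmono : ∀ x : ℝ, ENNReal.ofReal (C * (n : ℝ) ^ D * PuncturedISD.classicalTime n k ω ^ x) ≤
          ENNReal.ofReal ((C + 16 + N) * (n : ℝ) ^ D * PuncturedISD.classicalTime n k ω ^ x) := by
        intro x
        have hT : 0 ≤ PuncturedISD.classicalTime n k ω ^ x :=
          Real.rpow_nonneg (by unfold PuncturedISD.classicalTime; positivity) _
        refine ENNReal.ofReal_le_ofReal ?_
        gcongr
        linarith
      exact Nat.cast_le.2 (Set.ncard_le_ncard (fun H hH hgood => hH.2
        ⟨hgood.1, hgood.2.1.trans (hmono _), hgood.2.2.trans (hmono _)⟩) (Set.toFinite _))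
    · gcongr
      linarith
  -- For n < N the permitted fraction C/n is at least 1, and the bound holds trivially.
  · have h1 : 1 ≤ (C + 16 + N) / n := by
      rw [one_le_div hn0]
      have : (n : ℝ) ≤ N := Nat.cast_le.2 hNn.le
      linarith
    refine le_trans (Nat.cast_le.2 (Set.ncard_le_ncard (fun H hH => hH.1) (Set.toFinite _))) ?_
    exact le_mul_of_one_le_left (Nat.cast_nonneg _) h1
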